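/- **Setting.** Let $M\neq 0$ be an even integer, $N\ge 1$, $\zeta_N$ a primitive $N$-th root of unity, $A=\mathbb Z[1/M,\zeta_N]$, $K=\mathbb Q(\zeta_N)$, and let $\mathcal V$ be a (possibly infinite) set of primes not dividing $MN$. For $n\ge 0$ let $x=(x_{ij})$ be an $n\times n$ matrix of indeterminates, $B=A[x,\det(x)^{-1}]$, $G=GL_n=\mathrm{Spec}\,B$, and $E=K(x)$ the fraction field of $B$. For a matrix $z$ write $z^{(p)}=(z_{ij}^p)$, $z^t$ for the transpose, and let $\hat{\ }$ denote $p$-adic completion. *Connections.* A $p$-derivation on a ring $R$ is a map $\delta_p:R\to R$ such that $\phi_p(b)=b^p+p\,\delta_p(b)$ is a ring homomorphism. An adelic connection on $GL_n$ is a family $(\delta_p)_{p\in\mathcal V}$ of $p$-derivations on the rings $\hat B$. For $q\in GL_n(A)$ with $q^t=\pm q$, the Chern connection attached to $q$ is the unique adelic connection whose $\phi_p$ satisfy, for all $p\in\mathcal V$, with $\Phi=\phi_p(x)$, $$\Phi^t\phi_p(q)\Phi=(x^tqx)^{(p)},\qquad x^{(p)t}\phi_p(q)\Phi=\Phi^t\phi_p(q)x^{(p)}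 .$$ *Correspondences.* An affine correspondence on an affine scheme $X$ is a triple $\Gamma=(Y,\pi,\varphi)$ with $Y$ affine and $\pi,\varphi:Y\to X$ morphisms; the corresponding ring maps are denoted by the same letters. Its transpose is $\Gamma^t=(Y,\varphi,\pi)$; $\Gamma'\circ\Gamma$ is given by $Y\times_{\varphi,X,\pi'}Y'$ with maps $\pi$ and $\varphi'$ composed with the projections; the direct sum $\oplus$ is given by disjoint union; the base change $\Gamma\otimes X'$ is the pullback of $Y\to X\times X$ along $X'\times X'\to X\times X$. $\Gamma_1,\Gamma_2$ commute if $\Gamma_1\circ\Gamma_2\simeq\Gamma_2\circ\Gamma_1$; they partially commute if $\Gamma_2\circ\Gamma_1\circ(\Gamma_1\circ\Gamma_2)^t\simeq\Gamma'\oplus\Gamma''$ with $\Gamma'$ strictly symmetric (both of its maps are equal) and left totally dominant (its left map has dense image, and the image of each connected component is dense in the corresponding connected component); over a field this last condition means that $\Gamma'$ is non-empty. $\mathcal C_0(E)$ is the class of correspondences $(\mathrm{Spec}\,F,\pi,\varphi)$ on $E$ with $F$ reduced and nonzero, and finite over $E$ via $\pi$ and via $\varphi$; the degrees of $\pi$ and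 of $\varphi$ are the left and right degrees, and $\Gamma$ is irreducible if $F$ is a field. A correspondence $\Gamma'=(Y',\pi',\varphi')$ on $G$ with $Y'$ affine algebraizes $\phi_p$ if $\pi'$ is étale, $\hat\pi':\hat Y'\to\hat G$ is an isomorphism, and $\hat\varphi'=\phi_p\circ\hat\pi'$. A correspondence structure for $(\delta_p)$ is a family $(\Gamma_p)_{p\in\mathcal V}$ in $\mathcal C_0(E)$ such that each $\Gamma_p$ is isomorphic to $\Gamma'\otimes E$ for some such $\Gamma'$. *Curvature.* For $\Gamma$ in $\mathcal C_0(E)$ put $\Gamma^*=\mathrm{tr}_\pi\circ\varphi\in\mathrm{End}_{\rm gr}(E)$. Let $\mathbb U$ be an algebraically closed field into which $E$ embeds and $\mathrm{Cyc}(E)$ the free abelian group on the embeddings $E\to\mathbb U$; let $\Gamma_*[\sigma]=\sum_{\rho:F\to\mathbb U,\ \rho\circ\pi=\sigma}[\rho\circ\varphi]$. Let $\Gamma_{\bar p}=(\mathrm{Spec}\,E,\mathrm{id},\varphi_{\bar p})$, with $\varphi_{\bar p}(x)=x^{(p)}$ and $\varphi_{\bar p}(\zeta_N)=\zeta_N^p$.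 The curvature is $\varphi^*_{pp'}=\frac1{pp'}[\Gamma_{p'}^*,\Gamma_p^*]$. The $(1,1)$-curvature is $\varphi^*_{p\bar p'}=\frac1{pp'}[\Gamma_{\bar p'}^*,\Gamma_p^*]$ for $p\ne p'$ and $\varphi^*_{p\bar p}=\frac1p[\Gamma_{\bar p}^*,\Gamma_p^*]$; $\varphi_{p\bar p'*}\in\mathbb Q\otimes\mathrm{End}(\mathrm{Cyc}(E))$ is defined in the same way from $\Gamma_{\bar p'*}$ and $\Gamma_{p*}$. Let $\iota$ be the $K$-automorphism of $E$ with $\iota(x)=-x$, and $E^\pm=\{z:\iota(z)=\pm z\}$. $\Gamma$ is partially induced from $E^+$ if $\Gamma^*(E^+)\subset E^+$ and $\Gamma^*(E^-)=0$, and induced from $E^+$ if moreover $\varphi(E^+)\subset\pi(E^+)$. *The correspondences.* For $b$ an $n\times n$ matrix over a ring in which $2$ is invertible let $\mathrm{jor}(b)$ be the determinant of $z\mapsto(zb+bz)/2$ on $n\times n$ matrices. Let $y$ be another $n\times n$ matrix of indeterminates, let $\phi_p:A\to A$ denote the ring endomorphism with $\phi_p(\zeta_N)=\zeta_N^p$,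 and put $$g_p(x)=\det(x)\det(x^{(p)})\det((x^tqx)^{(p)}),\qquad f_p(x)=(x^{(p)t}\phi_p(q)x^{(p)})^{-1}(x^tqx)^{(p)},$$ $$C_p=A[x,g_p(x)^{-1},y,\det(y+1)^{-1},\mathrm{jor}(y)^{-1}]/(y^2-f_p(x)).$$ Let $\Gamma_{p/G}=(\mathrm{Spec}\,C_p,\pi,\varphi)$, where $\pi$ is the $A$-algebra map with $\pi(x)=x$ and $\varphi$ is the ring map with $\varphi(\zeta_N)=\zeta_N^p$, $\varphi(x)=x^{(p)}y$, and let $\Gamma_p=\Gamma_{p/G}\otimes E$. **Theorem 5.2.** (1) For every $n$ and every $q\in GL_n(A)$ with $q^t=\pm q$, the Chern connection on $GL_n$ attached to $q$ exists, is unique, and admits a correspondence structure; indeed each $\Gamma_{p/G}$ algebraizes $\phi_p$, and $(\Gamma_p)_{p\in\mathcal V}$ is a correspondence structure for it. (2) Let $n=2$ and $q=\begin{pmatrix}0&1\\-1&0\end{pmatrix}$. For all $p\in\mathcal V$, $\Gamma_p$ is irreducible, is induced from $E^+$, and has left degree $2$ and right degree $2p^4$. For all $p,p'\in\mathcal V$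 one has $\varphi^*_{pp'}=0$, $\varphi^*_{p\bar p'}\ne0$ and $\varphi_{p\bar p'*}\neq0$, and $\Gamma_p$ and $\Gamma_{p'}$ partially commute; if $p\ne p'$ they do not commute. (3) Let $n=2r$ and $q=\begin{pmatrix}0&1_r\\1_r&0\end{pmatrix}$. For all $p\in\mathcal V$, $\Gamma_p$ has left degree $2^n$. If $n=2$, then for all $p,p'\in\mathcal V$, $\Gamma_p$ is irreducible, is partially induced from $E^+$ and is not induced from $E^+$, and $\varphi^*_{p\bar p'}\ne0$ and $\varphi_{p\bar p'*}\neq0$. -/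

import Mathlib

universe u v

namespace ArithChern

open scoped Matrix

noncomputable section

/-! ## Correspondences on affine schemes

An affine correspondence `(Y, π, φ)` on `X = Spec R`, with `Y = Spec C`, is given by the ring `C`
and the two comorphisms `π, φ : R → C`.  Over a field, every correspondence with `π` finite is
of this form. -/

/-- The pushout ring `S ⊗[R] T` along two ring homomorphisms, i.e. the ring of the fibre product
of `Spec S` and `Spec T` over `Spec R`. -/
def Pushout {R S T : Type u} [CommRing R] [CommRing S] [CommRing T]
    (f : R →+* S) (g : R →+* T) : Type u :=
  @TensorProduct R _ S T _ _ f.toAlgebra.toModule g.toAlgebra.toModule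

namespace Pushout

variable {R S T : Type u} [CommRing R] [CommRing S] [CommRing T] (f : R →+* S) (g : R →+* T)

instance : CommRing (Pushout f g) :=
  @Algebra.TensorProduct.instCommRing (R := R) (A := S) (B := T) _ _ f.toAlgebra _ g.toAlgebra

/-- The homomorphism `s ↦ s ⊗ 1`. -/
def inl : S →+* Pushout f g :=
  @Algebra.TensorProduct.includeLeftRingHom R S T _ _ f.toAlgebra _ g.toAlgebra

/-- The homomorphism `t ↦ 1 ⊗ t`. -/
def inr : T →+* Pushout f g :=
  @AlgHom.toRingHom R T (@TensorProduct R _ S T _ _ f.toAlgebra.toModule g.toAlgebra.toModule)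
    _ _ _ g.toAlgebra _ (@Algebra.TensorProduct.includeRight R S T _ _ f.toAlgebra _ g.toAlgebra)

end Pushout

/-- An affine correspondence on `Spec R`: `Y = Spec carrier`, `left` is the comorphism of `π` and
`right` is the comorphism of `φ`. -/
structure Correspondence (R : Type u) [CommRing R] where
  carrier : Type u
  [commRing : CommRing carrier]
  left : R →+* carrier
  right : R →+* carrier

namespace Correspondence

attribute [instance] Correspondence.commRing

variable {R : Type u} [CommRing R]

/-- Isomorphism of correspondences. -/
def Iso (Γ Γ' : Correspondence R) : Prop :=
  ∃ e : Γ.carrier ≃+* Γ'.carrier,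
    (e : Γ.carrier →+* Γ'.carrier).comp Γ.left = Γ'.left ∧
      (e : Γ.carrier →+* Γ'.carrier).comp Γ.right = Γ'.right

/-- The transpose `(Y, φ, π)`. -/
def transpose (Γ : Correspondence R) : Correspondence R where
  carrier := Γ.carrier
  left := Γ.right
  right := Γ.left

/-- The composition `Γ' ∘ Γ`, whose scheme is the fibre product of `φ : Y → X` and
`π' : Y' → X`. -/
def comp (Γ' Γ : Correspondence R) : Correspondence R where
  carrier := Pushout Γ.right Γ'.left
  left := (Pushout.inl Γ.right Γ'.left).comp Γ.left
  right := (Pushout.inr Γ.right Γ'.left).comp Γ'.right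

/-- The direct sum, given by the disjoint union of the schemes. -/
def directSum (Γ Γ' : Correspondence R) : Correspondence R where
  carrier := Γ.carrier × Γ'.carrier
  left := Γ.left.prod Γ'.left
  right := Γ.right.prod Γ'.right

/-- A strictly symmetric correspondence: `π = φ`. -/
def IsStrictlySymmetric (Γ : Correspondence R) : Prop :=
  Γ.left = Γ.right

/-- The morphism of spectra given by `f` is totally dominant: its image is dense, and the image of
every connected component is dense in the corresponding connected component of the target. -/
def TotallyDominant {S : Type u} [CommRing S] (f : R →+* S) : Prop :=
  DenseRange (PrimeSpectrum.comap f) ∧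
    ∀ y : PrimeSpectrum S, connectedComponent (PrimeSpectrum.comap f y) ⊆
      closure (PrimeSpectrum.comap f '' connectedComponent y)

/-- `Γ` is compatible with `Γ'`: `Γ' ∘ Γᵗ` has a direct summand that is strictly symmetric and left
totally dominant. -/
def CompatibleWith (Γ Γ' : Correspondence R) : Prop :=
  ∃ Γ₁ Γ₂ : Correspondence R, (Γ'.comp Γ.transpose).Iso (Γ₁.directSum Γ₂) ∧
    Γ₁.IsStrictlySymmetric ∧ TotallyDominant Γ₁.left

/-- `Γ₁` and `Γ₂` partially commute. -/
def PartiallyCommute (Γ₁ Γ₂ : Correspondence R) : Prop :=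
  (Γ₁.comp Γ₂).CompatibleWith (Γ₂.comp Γ₁)

/-- `Γ₁` and `Γ₂` commute. -/
def Commutes (Γ₁ Γ₂ : Correspondence R) : Prop :=
  (Γ₁.comp Γ₂).Iso (Γ₂.comp Γ₁)

/-- The base change of a correspondence along `Spec R' → Spec R`: the pullback of
`(π, φ) : Y → X × X` along `X' × X' → X × X`; on rings it is `(R' ⊗ C) ⊗ R'`, where the first
tensor product is formed with `π` and the second with `φ`. -/
def baseChange {R' : Type u} [CommRing R'] (e : R →+* R') (Γ : Correspondence R) :
    Correspondence R' where
  carrier := Pushout ((Pushout.inr e Γ.left).comp Γ.right) e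
  left := (Pushout.inl ((Pushout.inr e Γ.left).comp Γ.right) e).comp (Pushout.inl e Γ.left)
  right := Pushout.inr ((Pushout.inr e Γ.left).comp Γ.right) e

/-! ## Correspondences on a field -/

section Field

variable {E : Type u} [Field E]

/-- The non-empty, reduced, left and right finite correspondences on a field. -/
structure IsFiniteReduced (Γ : Correspondence E) : Prop where
  nonempty : Nontrivial Γ.carrier
  reduced : IsReduced Γ.carrier
  left_finite : Γ.left.Finite
  right_finite : Γ.right.Finite

/-- `Y` is the spectrum of a field. -/
def IsIrreducible (Γ : Correspondence E) : Prop :=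
  IsField Γ.carrier

/-- The degree of `π`. -/
def leftDegree (Γ : Correspondence E) : ℕ :=
  letI := Γ.left.toAlgebra
  Module.finrank E Γ.carrier

/-- The degree of `φ`. -/
def rightDegree (Γ : Correspondence E) : ℕ :=
  letI := Γ.right.toAlgebra
  Module.finrank E Γ.carrier

/-- The action `Γ^* = tr_π ∘ φ` on the additive group of `E`. -/
def upperStar (Γ : Correspondence E) : AddMonoid.End E :=
  letI := Γ.left.toAlgebra
  (Algebra.trace E Γ.carrier).toAddMonoidHom.comp Γ.right.toAddMonoidHom

/-- The free abelian group on the set of embeddings of `E` into `U`. -/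
abbrev Cyc (E : Type u) [Field E] (U : Type v) [Field U] : Type (max u v) :=
  (E →+* U) →₀ ℤ

/-- The action `Γ_*` on cycles: `[σ]` is sent to the sum of the `[ρ ∘ φ]` over the (finitely many,
as `π` is finite) homomorphisms `ρ : F → U` such that `ρ ∘ π = σ`. -/
def lowerStar (U : Type v) [Field U] (Γ : Correspondence E) : Module.End ℤ (Cyc E U) :=
  Finsupp.lift (Cyc E U) ℤ (E →+* U) fun σ =>
    ∑ᶠ ρ : {ρ : Γ.carrier →+* U // ρ.comp Γ.left = σ},
      Finsupp.single (ρ.1.comp Γ.right) (1 : ℤ)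

/-- `Γ` is partially induced from the fixed field `E⁺` of an involution `ι` of `E`:
`Γ^*` maps `E⁺` into `E⁺` and vanishes on `E⁻`. -/
def IsPartiallyInduced (ι : E →+* E) (Γ : Correspondence E) : Prop :=
  (∀ z, ι z = z → ι (Γ.upperStar z) = Γ.upperStar z) ∧ ∀ z, ι z = -z → Γ.upperStar z = 0

/-- `Γ` is induced from `E⁺`: moreover `φ(E⁺) ⊆ π(E⁺)`. -/
def IsInduced (ι : E →+* E) (Γ : Correspondence E) : Prop :=
  Γ.IsPartiallyInduced ι ∧ ∀ z, ι z = z → ∃ w, ι w = w ∧ Γ.right z = Γ.left w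

end Field

end Correspondence

/-! ## Completions, `p`-derivations, and compatibility with lifts of Frobenius -/

/-- The `p`-adic completion of a ring. -/
abbrev PadicCompletion (p : ℕ) (R : Type u) [CommRing R] : Type u :=
  AdicCompletion (Ideal.span {(p : R)}) R

/-- The canonical homomorphism from a ring to its `p`-adic completion. -/
abbrev toPadicCompletion (p : ℕ) (R : Type u) [CommRing R] : R →+* PadicCompletion p R :=
  algebraMap R (PadicCompletion p R)

theorem span_pow_le_comap (p : ℕ) {R S : Type u} [CommRing R] [CommRing S] (f : R →+* S) (k : ℕ) :
    Ideal.span {(p : R)} ^ k ≤ (Ideal.span {(p : S)} ^ k).comap f := by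
  rw [← Ideal.map_le_iff_le_comap, Ideal.map_pow, Ideal.map_span]
  simp

/-- The homomorphism induced by `f` on `p`-adic completions. -/
def PadicCompletion.map (p : ℕ) {R S : Type u} [CommRing R] [CommRing S] (f : R →+* S) :
    PadicCompletion p R →+* PadicCompletion p S :=
  AdicCompletion.liftRingHom (Ideal.span {(p : S)})
    (fun k => (Ideal.quotientMap (Ideal.span {(p : S)} ^ k) f (span_pow_le_comap p f k)).comp
      (AdicCompletion.evalₐ (Ideal.span {(p : R)}) k).toRingHom)
    (by
      intro m k hle
      ext x
      obtain ⟨a, rfl⟩ := AdicCompletion.mk_surjective _ _ x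
      have h1 := a.property hle
      have h2 : (Ideal.Quotient.mk (Ideal.span {(p : R)} ^ m)) (a.val k) =
          (Ideal.Quotient.mk (Ideal.span {(p : R)} ^ m)) (a.val m) := by
        rw [Ideal.Quotient.eq]
        have h3 := (SModEq.sub_mem.mp h1.symm)
        simpa using h3
      have h4 := congrArg
        (Ideal.quotientMap (Ideal.span {(p : S)} ^ m) f (span_pow_le_comap p f m)) h2
      simpa using h4)

/-- A `p`-derivation `δ` on `R`, together with the ring homomorphism
`b ↦ b ^ p + p * δ b` attached to it. -/
@[ext]
structure PDerivation (p : ℕ) (R : Type u) [CommRing R] where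
  delta : R → R
  /-- The attached lift of Frobenius. -/
  frob : R →+* R
  frob_apply : ∀ b, frob b = b ^ p + (p : R) * delta b

/-- The correspondence `Γ = (Spec C, π, φ)` on `Spec B` satisfies: `π` is étale, `π` is an
isomorphism on `p`-adic completions, and on `p`-adic completions `φ` is the composition of `π`
with the lift of Frobenius `Φ`. -/
structure Correspondence.Algebraizes {B : Type u} [CommRing B] (p : ℕ)
    (Φ : PadicCompletion p B →+* PadicCompletion p B) (Γ : Correspondence B) : Prop where
  etale : Γ.left.Etale
  bijective : Function.Bijective (PadicCompletion.map p Γ.left)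
  right_eq : PadicCompletion.map p Γ.right = (PadicCompletion.map p Γ.left).comp Φ

/-- A lift of Frobenius `Φ` on the `p`-adic completion of `B` and a correspondence `Γ` on `E` are
compatible. Here `e : B → E` is the map from `B` to its fraction field. -/
def Correspondence.CompatibleWithFrobenius {B E : Type u} [CommRing B] [Field E] (e : B →+* E)
    (p : ℕ) (Φ : PadicCompletion p B →+* PadicCompletion p B) (Γ : Correspondence E) : Prop :=
  ∃ Γ' : Correspondence B, Γ.Iso (Γ'.baseChange e) ∧ Γ'.Algebraizes p Φ

/-! ## The group scheme `GL_n` -/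

/-- Raising all the entries of a matrix to the power `p`. -/
def entryPow {n : ℕ} {R : Type u} [CommRing R] (p : ℕ) (X : Matrix (Fin n) (Fin n) R) :
    Matrix (Fin n) (Fin n) R :=
  X.map (· ^ p)

/-- `ℋ_q(X) = Xᵗ q X`. -/
def Hform {n : ℕ} {R : Type u} [CommRing R] (q X : Matrix (Fin n) (Fin n) R) :
    Matrix (Fin n) (Fin n) R :=
  Xᵀ * q * X

/-- `ℬ_q(X, Y) = Xᵗ q Y`. -/
def Bform {n : ℕ} {R : Type u} [CommRing R] (q X Y : Matrix (Fin n) (Fin n) R) :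
    Matrix (Fin n) (Fin n) R :=
  Xᵀ * q * Y

/-- The coordinate ring `A[x, det(x)⁻¹]` of `GL_n` over `A`. -/
abbrev CoordGL (n : ℕ) (A : Type u) [CommRing A] : Type u :=
  Localization.Away (Matrix.mvPolynomialX (Fin n) (Fin n) A).det

/-- The generic matrix `x` over the coordinate ring of `GL_n`. -/
def genMatrix (n : ℕ) (A : Type u) [CommRing A] : Matrix (Fin n) (Fin n) (CoordGL n A) :=
  (Matrix.mvPolynomialX (Fin n) (Fin n) A).map (algebraMap _ _)

theorem eval_det_mvPolynomialX {n : ℕ} {A S : Type u} [CommRing A] [CommRing S] (s : A →+* S)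
    (X : Matrix (Fin n) (Fin n) S) :
    MvPolynomial.eval₂Hom s (fun ij : Fin n × Fin n => X ij.1 ij.2)
      (Matrix.mvPolynomialX (Fin n) (Fin n) A).det = X.det := by
  rw [RingHom.map_det]
  congr 1
  ext i j
  simp

/-- The homomorphism `A[x, det(x)⁻¹] → S` given by a homomorphism `s : A → S` and `x ↦ X`. -/
def CoordGL.lift {n : ℕ} {A S : Type u} [CommRing A] [CommRing S] (s : A →+* S)
    (X : Matrix (Fin n) (Fin n) S) (hX : IsUnit X.det) : CoordGL n A →+* S :=
  IsLocalization.Away.lift (S := CoordGL n A) (Matrix.mvPolynomialX (Fin n) (Fin n) A).det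
    (g := MvPolynomial.eval₂Hom s (fun ij : Fin n × Fin n => X ij.1 ij.2))
    (by rw [eval_det_mvPolynomialX]; exact hX)

/-- The matrix with entries in `A`, viewed over the `p`-adic completion of the coordinate ring. -/
def constHat {n : ℕ} {A : Type u} [CommRing A] (p : ℕ) (q : Matrix (Fin n) (Fin n) A) :
    Matrix (Fin n) (Fin n) (PadicCompletion p (CoordGL n A)) :=
  q.map ((toPadicCompletion p (CoordGL n A)).comp (algebraMap A (CoordGL n A)))

/-- The generic matrix, viewed over the `p`-adic completion of the coordinate ring. -/
def genHat (n : ℕ) (A : Type u) [CommRing A] (p : ℕ) :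
    Matrix (Fin n) (Fin n) (PadicCompletion p (CoordGL n A)) :=
  (genMatrix n A).map (toPadicCompletion p (CoordGL n A))

/-- An adelic connection on `GL_n` over `A`, indexed by the set of primes `V`. -/
abbrev AdelicConnection (n : ℕ) (A : Type u) [CommRing A] (V : Set ℕ) : Type u :=
  ∀ p : V, PDerivation (p : ℕ) (PadicCompletion (p : ℕ) (CoordGL n A))

/-- The two diagrams defining the Chern connection attached to `q`.  With
`φ₀(x) = x^{(p)}`, they are written as the equality of the two pullbacks of the coordinate
matrix along the two ways around the square:
`ℋ_q ∘ φ = φ₀ ∘ ℋ_q` on `Ĝ`, and `ℬ_q ∘ (φ₀ × φ) = ℬ_q ∘ (φ × φ₀)`.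
All lifts of Frobenius act on the constants, so that `q` becomes `φ(q)`. -/
structure IsChernConnection {n : ℕ} {A : Type u} [CommRing A] {V : Set ℕ}
    (q : Matrix (Fin n) (Fin n) A) (δ : AdelicConnection n A V) : Prop where
  hform : ∀ p : V,
    Hform ((constHat (p : ℕ) q).map (δ p).frob) ((genHat n A p).map (δ p).frob) =
      entryPow (p : ℕ) (Hform (constHat (p : ℕ) q) (genHat n A p))
  bform : ∀ p : V,
    Bform ((constHat (p : ℕ) q).map (δ p).frob) (entryPow (p : ℕ) (genHat n A p))
        ((genHat n A p).map (δ p).frob) =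
      Bform ((constHat (p : ℕ) q).map (δ p).frob) ((genHat n A p).map (δ p).frob)
        (entryPow (p : ℕ) (genHat n A p))

/-- `jor(b)`: the determinant of the Jordan multiplication `z ↦ (z b + b z) / 2`, over a ring in
which `2` is invertible. -/
def jor {n : ℕ} {R : Type u} [CommRing R] (b : Matrix (Fin n) (Fin n) R) : R :=
  LinearMap.det (Ring.inverse (2 : R) • (LinearMap.mulRight R b + LinearMap.mulLeft R b))

/-! ## The explicit correspondence

In this section `A` is a ring with an endomorphism `s` (which will be the lift of Frobenius). -/

section Model

variable {n : ℕ} {A : Type u} [CommRing A] (s : A →+* A) (p : ℕ) (q : Matrix (Fin n) (Fin n) A)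

/-- The polynomial ring `A[x, y]`. -/
abbrev PolyXY (n : ℕ) (A : Type u) [CommRing A] : Type u :=
  MvPolynomial ((Fin n × Fin n) ⊕ (Fin n × Fin n)) A

/-- The matrix `x` over `A[x, y]`. -/
def polyX (n : ℕ) (A : Type u) [CommRing A] : Matrix (Fin n) (Fin n) (PolyXY n A) :=
  Matrix.of fun i j => MvPolynomial.X (Sum.inl (i, j))

/-- The matrix `y` over `A[x, y]`. -/
def polyY (n : ℕ) (A : Type u) [CommRing A] : Matrix (Fin n) (Fin n) (PolyXY n A) :=
  Matrix.of fun i j => MvPolynomial.X (Sum.inr (i, j))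

/-- `g_p(x) = det(x) det(x^{(p)}) det((xᵗ q x)^{(p)})`. -/
def gPoly : PolyXY n A :=
  (polyX n A).det * (entryPow p (polyX n A)).det *
    (entryPow p (Hform (q.map MvPolynomial.C) (polyX n A))).det

/-- `g_p(x) det(y + 1) jor(y)`. -/
def modelDenom : PolyXY n A :=
  gPoly p q * (polyY n A + 1).det * jor (polyY n A)

/-- `A[x, g_p(x)⁻¹, y, det(y + 1)⁻¹, jor(y)⁻¹]`. -/
abbrev ModelLoc : Type u :=
  Localization.Away (modelDenom p q)

/-- The matrix `x` over the localized ring. -/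
def locX : Matrix (Fin n) (Fin n) (ModelLoc p q) := (polyX n A).map (algebraMap _ _)

/-- The matrix `y` over the localized ring. -/
def locY : Matrix (Fin n) (Fin n) (ModelLoc p q) := (polyY n A).map (algebraMap _ _)

/-- `f_p(x) = (x^{(p)t} s(q) x^{(p)})⁻¹ (xᵗ q x)^{(p)}`. -/
def fMatrix : Matrix (Fin n) (Fin n) (ModelLoc p q) :=
  (Hform (q.map ((algebraMap A (ModelLoc p q)).comp s)) (entryPow p (locX p q)))⁻¹ *
    entryPow p (Hform (q.map (algebraMap A (ModelLoc p q))) (locX p q))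

/-- The ideal generated by the entries of `y² - f_p(x)`. -/
def modelIdeal : Ideal (ModelLoc p q) :=
  Ideal.span (Set.range fun ij : Fin n × Fin n =>
    (locY p q * locY p q - fMatrix s p q) ij.1 ij.2)

/-- `C_p = A[x, g_p(x)⁻¹, y, det(y + 1)⁻¹, jor(y)⁻¹] / (y² - f_p(x))`. -/
abbrev ModelRing : Type u :=
  ModelLoc p q ⧸ modelIdeal s p q

/-- The matrix `x` over `C_p`. -/
def modelX : Matrix (Fin n) (Fin n) (ModelRing s p q) :=
  (locX p q).map (Ideal.Quotient.mk (modelIdeal s p q))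

/-- The matrix `y` over `C_p`. -/
def modelY : Matrix (Fin n) (Fin n) (ModelRing s p q) :=
  (locY p q).map (Ideal.Quotient.mk (modelIdeal s p q))

/-- The structure homomorphism `A → C_p`. -/
def modelConst : A →+* ModelRing s p q :=
  (Ideal.Quotient.mk (modelIdeal s p q)).comp (algebraMap A (ModelLoc p q))

theorem isUnit_model_of_dvd {d : PolyXY n A} (h : d ∣ modelDenom p q) :
    IsUnit (algebraMap (PolyXY n A) (ModelLoc p q) d) :=
  isUnit_of_dvd_unit (map_dvd _ h)
    (IsLocalization.Away.algebraMap_isUnit (S := ModelLoc p q) (modelDenom p q))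

theorem det_map_ringHom {R S : Type u} [CommRing R] [CommRing S] (f : R →+* S)
    (X : Matrix (Fin n) (Fin n) R) : (X.map f).det = f X.det :=
  (RingHom.map_det f X).symm

theorem entryPow_map {R S : Type u} [CommRing R] [CommRing S] (f : R →+* S)
    (X : Matrix (Fin n) (Fin n) R) : entryPow p (X.map f) = (entryPow p X).map f := by
  ext i j
  simp [entryPow]

theorem Hform_map {R S : Type u} [CommRing R] [CommRing S] (f : R →+* S)
    (Q X : Matrix (Fin n) (Fin n) R) : Hform (Q.map f) (X.map f) = (Hform Q X).map f := by
  simp [Hform, Matrix.map_mul, Matrix.transpose_map]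

theorem isUnit_det_locX : IsUnit (locX p q).det := by
  rw [locX, det_map_ringHom]
  refine isUnit_model_of_dvd p q ?_
  rw [modelDenom, gPoly]
  exact (((Dvd.intro _ rfl).mul_right _).mul_right _).mul_right _

theorem isUnit_det_entryPow_locX : IsUnit (entryPow p (locX p q)).det := by
  rw [locX, entryPow_map, det_map_ringHom]
  refine isUnit_model_of_dvd p q ?_
  rw [modelDenom, gPoly]
  exact (((Dvd.intro_left _ rfl).mul_right _).mul_right _).mul_right _

theorem isUnit_det_fMatrix (hq : IsUnit q.det) : IsUnit (fMatrix s p q).det := by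
  have h1 : IsUnit (Hform (q.map ((algebraMap A (ModelLoc p q)).comp s))
      (entryPow p (locX p q))).det := by
    rw [Hform, Matrix.det_mul, Matrix.det_mul, Matrix.det_transpose, det_map_ringHom]
    exact ((isUnit_det_entryPow_locX p q).mul (hq.map _)).mul (isUnit_det_entryPow_locX p q)
  have h2 : IsUnit (entryPow p (Hform (q.map (algebraMap A (ModelLoc p q))) (locX p q))).det := by
    have h3 : q.map (algebraMap A (ModelLoc p q)) =
        (q.map (MvPolynomial.C : A →+* PolyXY n A)).map (algebraMap _ (ModelLoc p q)) := by
      rw [Matrix.map_map]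
      ext i j
      simp only [Matrix.map_apply, Function.comp_apply]
      rw [IsScalarTower.algebraMap_apply A (PolyXY n A) (ModelLoc p q)]
      rfl
    rw [h3, locX, Hform_map, entryPow_map, det_map_ringHom]
    refine isUnit_model_of_dvd p q ?_
    rw [modelDenom, gPoly]
    exact ((Dvd.intro_left _ rfl).mul_right _).mul_right _
  rw [fMatrix, Matrix.det_mul]
  exact (Matrix.isUnit_nonsing_inv_det _ h1).mul h2

theorem isUnit_det_modelX : IsUnit (modelX s p q).det := by
  rw [modelX, det_map_ringHom]
  exact (isUnit_det_locX p q).map _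

theorem isUnit_det_modelXY (hq : IsUnit q.det) :
    IsUnit (entryPow p (modelX s p q) * modelY s p q).det := by
  have h1 : modelY s p q * modelY s p q =
      (fMatrix s p q).map (Ideal.Quotient.mk (modelIdeal s p q)) := by
    rw [modelY, ← Matrix.map_mul]
    ext i j
    simp only [Matrix.map_apply]
    rw [Ideal.Quotient.eq]
    exact Ideal.subset_span ⟨(i, j), rfl⟩
  have h2 : IsUnit (modelY s p q).det := by
    have h3 := congrArg Matrix.det h1
    rw [Matrix.det_mul, det_map_ringHom] at h3
    exact isUnit_of_mul_isUnit_left (h3 ▸ (isUnit_det_fMatrix s p q hq).map _)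
  rw [Matrix.det_mul, modelX, entryPow_map, det_map_ringHom]
  exact ((isUnit_det_entryPow_locX p q).map _).mul h2

/-- The correspondence `(Spec C_p, π, φ)` on `GL_n`, with `π(x) = x` and `φ(x) = x^{(p)} y`;
on constants `π` is the structure homomorphism and `φ` is its composition with `s`. -/
def chernModel (q : Matrix.GeneralLinearGroup (Fin n) A) : Correspondence (CoordGL n A) where
  carrier := ModelRing s p q.val
  left := CoordGL.lift (modelConst s p q.val) (modelX s p q.val) (isUnit_det_modelX s p q.val)
  right := CoordGL.lift ((modelConst s p q.val).comp s)
    (entryPow p (modelX s p q.val) * modelY s p q.val)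
    (isUnit_det_modelXY s p q.val ((Matrix.isUnit_iff_isUnit_det _).mp q.isUnit))

end Model

/-! ## The arithmetic set-up

`K` is the cyclotomic field `ℚ(ζ_N)`. -/

section Arithmetic

variable (M : ℤ) (N : ℕ) [NeZero N] (K : Type u) [Field K] [CharZero K]
  [IsCyclotomicExtension {N} ℚ K]

/-- A primitive `N`-th root of unity `ζ_N` in `K`. -/
def zetaN : K := IsCyclotomicExtension.zeta N ℚ K

/-- The ring `A = ℤ[1/M, ζ_N]`. -/
def cycRing : Subalgebra ℤ K :=
  Algebra.adjoin ℤ {(M : K)⁻¹, zetaN N K}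

/-- The automorphism of `K` sending `ζ_N` to `ζ_N ^ p`, for `p` prime to `N` (and, by convention,
the identity for other `p`). -/
def frobK (p : ℕ) : K →+* K :=
  if h : p.Coprime N then
    ((IsCyclotomicExtension.fromZetaAut (K := ℚ) (L := K)
      ((IsCyclotomicExtension.zeta_spec N ℚ K).pow_of_coprime p h)
      (Polynomial.cyclotomic.irreducible_rat (NeZero.pos N)) : K ≃ₐ[ℚ] K) : K →+* K)
  else RingHom.id _

theorem frobK_zetaN (p : ℕ) (h : p.Coprime N) : frobK N K p (zetaN N K) = zetaN N K ^ p := by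
  rw [frobK, dif_pos h]
  exact IsCyclotomicExtension.fromZetaAut_spec _ _

theorem frobK_mem (p : ℕ) (a : K) (ha : a ∈ cycRing M N K) :
    frobK N K p a ∈ cycRing M N K := by
  by_cases h : p.Coprime N
  · refine Algebra.adjoin_induction (p := fun a _ => frobK N K p a ∈ cycRing M N K)
      ?_ ?_ ?_ ?_ ha
    · rintro x (rfl | rfl)
      · rw [map_inv₀, map_intCast]
        exact Algebra.subset_adjoin (by simp)
      · rw [frobK_zetaN N K p h]
        exact pow_mem (Algebra.subset_adjoin (by simp)) p
    · intro r
      simp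
    · intro x y _ _ hx hy
      rw [map_add]
      exact add_mem hx hy
    · intro x y _ _ hx hy
      rw [map_mul]
      exact mul_mem hx hy
  · rw [frobK, dif_neg h]
    exact ha

/-- The lift of Frobenius on `A`, with `ζ_N ↦ ζ_N ^ p`. -/
def frobA (p : ℕ) : cycRing M N K →+* cycRing M N K :=
  ((frobK N K p).comp (cycRing M N K).val.toRingHom).codRestrict (cycRing M N K)
    (fun a => frobK_mem M N K p a a.2)

end Arithmetic

section FunctionField

variable (n : ℕ) (K : Type u) [Field K]

/-- The field `E = K(x)`, the fraction field of `GL_n`. -/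
abbrev FieldE : Type u := FractionRing (MvPolynomial (Fin n × Fin n) K)

/-- The generic matrix `x` over `E`. -/
def matE : Matrix (Fin n) (Fin n) (FieldE n K) :=
  (Matrix.mvPolynomialX (Fin n) (Fin n) K).map (algebraMap _ _)

theorem isUnit_det_matE : IsUnit (matE n K).det := by
  have h : (matE n K).det = algebraMap _ (FieldE n K)
      (Matrix.mvPolynomialX (Fin n) (Fin n) K).det := by
    rw [RingHom.map_det]
    rfl
  rw [h, isUnit_iff_ne_zero]
  exact (map_ne_zero_iff _ (IsFractionRing.injective _ _)).mpr
    (Matrix.det_mvPolynomialX_ne_zero _ _)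

/-- The `K`-automorphism of `K[x]` with `x ↦ -x`. -/
def iotaPoly : MvPolynomial (Fin n × Fin n) K ≃ₐ[K] MvPolynomial (Fin n × Fin n) K :=
  AlgEquiv.ofAlgHom (MvPolynomial.aeval fun ij => -MvPolynomial.X ij)
    (MvPolynomial.aeval fun ij => -MvPolynomial.X ij) (by ext; simp) (by ext; simp)

/-- The `K`-automorphism `ι` of `E` with `ι(x) = -x`. -/
def iota : FieldE n K →+* FieldE n K :=
  IsFractionRing.map (j := (iotaPoly n K : MvPolynomial (Fin n × Fin n) K →+*
    MvPolynomial (Fin n × Fin n) K)) (iotaPoly n K).injective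

end FunctionField

section Correspondences

variable (n : ℕ) (M : ℤ) (N : ℕ) [NeZero N] (K : Type u) [Field K] [CharZero K]
  [IsCyclotomicExtension {N} ℚ K]

/-- The inclusion of the coordinate ring of `GL_n` in its fraction field `E`. -/
def toE : CoordGL n (cycRing M N K) →+* FieldE n K :=
  CoordGL.lift ((algebraMap K (FieldE n K)).comp (cycRing M N K).val.toRingHom)
    (matE n K) (isUnit_det_matE n K)

/-- The endomorphism of `K[x]` acting as `ζ_N ↦ ζ_N ^ p` on `K` and sending `x` to `x^{(p)}`. -/
def frobPoly (p : ℕ) : MvPolynomial (Fin n × Fin n) K →+* MvPolynomial (Fin n × Fin n) K :=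
  (MvPolynomial.expand p).toRingHom.comp (MvPolynomial.map (frobK N K p))

theorem frobPoly_injective (p : ℕ) (hp : p.Prime) : Function.Injective (frobPoly n N K p) :=
  (MvPolynomial.expand_injective hp.pos).comp
    (MvPolynomial.map_injective _ (frobK N K p).injective)

/-- The endomorphism of `E` acting as `ζ_N ↦ ζ_N ^ p` on `K` and sending `x` to `x^{(p)}`. -/
def frobE (p : ℕ) (hp : p.Prime) : FieldE n K →+* FieldE n K :=
  IsFractionRing.map (frobPoly_injective n N K p hp)

/-- The canonical correspondence `Γ_{p̄} = (Spec E, id, x ↦ x^{(p)})` attached to `δ₀`. -/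
def canonicalCorrespondence (p : ℕ) (hp : p.Prime) : Correspondence (FieldE n K) where
  carrier := FieldE n K
  left := RingHom.id _
  right := frobE n N K p hp

variable {n K}

/-- The explicit correspondence `Γ_{p/G}` on `GL_n` over `A` attached to `q`. -/
def chernModelA (q : Matrix.GeneralLinearGroup (Fin n) (cycRing M N K)) (p : ℕ) :
    Correspondence (CoordGL n (cycRing M N K)) :=
  chernModel (frobA M N K p) p q

/-- The correspondence `Γ_p = Γ_{p/G} ⊗ E` on `E` attached to `q`. -/
def chernCorrespondence (q : Matrix.GeneralLinearGroup (Fin n) (cycRing M N K)) (p : ℕ) :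
    Correspondence (FieldE n K) :=
  (chernModelA M N q p).baseChange (toE n M N K)

variable {M N}

/-- A correspondence structure for the adelic connection `δ` on `GL_n` over `A`. -/
def IsCorrespondenceStructure {V : Set ℕ} (δ : AdelicConnection n (cycRing M N K) V)
    (Γ : V → Correspondence (FieldE n K)) : Prop :=
  ∀ p : V, (Γ p).IsFiniteReduced ∧
    (Γ p).CompatibleWithFrobenius (toE n M N K) (p : ℕ) (δ p).frob

end Correspondences

/-- The `2r × 2r` block matrix with rows `(0, 1)` and `(ε, 0)`: for `ε = 1` and `ε = -1` it is the
split symmetric and the split antisymmetric matrix. -/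
def splitMatrix {A : Type u} [CommRing A] (r : ℕ) (ε : A) : Matrix (Fin (2 * r)) (Fin (2 * r)) A :=
  Matrix.reindex (finSumFinEquiv.trans (finCongr (two_mul r).symm))
    (finSumFinEquiv.trans (finCongr (two_mul r).symm))
    (Matrix.fromBlocks (0 : Matrix (Fin r) (Fin r) A) 1 (ε • 1) 0)

/-! ## Curvature -/

section Curvature

variable {E : Type u} [Field E] [CharZero E]

/-- `(1 / (p p')) [Γ'^*, Γ^*]`, the upper star curvature for the indices `p, p'`. -/
def upperCurvature (p p' : ℕ) (Γ Γ' : Correspondence E) : AddMonoid.End E :=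
  (1 / ((p : ℚ) * p')) • ⁅Γ'.upperStar, Γ.upperStar⁆

/-- The upper star `(1,1)`-curvature for the indices `p, p̄'`: `Γ = Γ_p` and `Γ' = Γ_{p̄'}`. -/
def upperCurvature11 (p p' : ℕ) (Γ Γ' : Correspondence E) : AddMonoid.End E :=
  (if p = p' then 1 / (p : ℚ) else 1 / ((p : ℚ) * p')) • ⁅Γ'.upperStar, Γ.upperStar⁆

open scoped TensorProduct in
/-- The lower star `(1,1)`-curvature for the indices `p, p̄'`.  Because of the denominators it is
an element of the endomorphism ring of the group of cycles tensored with `ℚ`. -/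
def lowerCurvature11 (U : Type v) [Field U] (p p' : ℕ) (Γ Γ' : Correspondence E) :
    ℚ ⊗[ℤ] Module.End ℤ (Correspondence.Cyc E U) :=
  (if p = p' then 1 / (p : ℚ) else 1 / ((p : ℚ) * p')) ⊗ₜ[ℤ] ⁅Γ'.lowerStar U, Γ.lowerStar U⁆

end Curvature

end

end ArithChern

open ArithChern

open scoped Matrix

/-! Write the image of `x` under a lift of Frobenius as `x^{(p)} Y`, and put `H = x^{(p)t} φ(q)
x^{(p)}`, `F = (xᵗ q x)^{(p)}`. The second Chern equation says `H Y = Yᵗ H`, and this turns the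
first into `H Y² = F`. Modulo `p` the matrices `H` and `F` agree, so `H⁻¹F` is congruent to `1` and
has exactly one square root congruent to `1` over a `p`-adically complete ring in which `2` is a
unit (`IsPComplete.exists_sqrt`, `IsPComplete.matrix_ext`). Conversely `H⁻¹ Yᵗ H` is another such
root, so the second equation holds automatically (`mul_eq_transpose_mul`). The action on constants
is forced, because roots of unity of order prime to `p` are determined by their residues
(`frob_const_unique`).

The model ring represents square roots `Y` of `H⁻¹F` with `jor Y` and `det (Y + 1)` invertible. The
first condition says that the derivative of squaring is invertible at `Y`, whence the étale property
(`modelLeft_etale`). The second excludes every root modulo `p` other than `Y = 1`, so the left map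
becomes an isomorphism after completion (`IsSection.comp_eq`).

Over `E` the base change must be shown nonzero, reduced and finite on both sides. It is nonzero
because the section over the completion survives inverting all `b` and all `Φ(b')` with `b, b' ≠ 0`
(`mul_frob_ne_zero`). An unramified algebra essentially of finite type over a field is finite and
reduced, which handles the left side; the right side follows by comparing transcendence degrees
(`finite_of_twisted`).

Irreducibility and left degrees come from one counting principle (`isField_of_card_algHom_le`): if
every residue field has degree at least `d` and there are at most `d` geometric points, the algebra
is a field of degree `d`.

For the antisymmetric form in dimension two, `Xᵗ q X = det X · q`, so `Y` is a scalar `v` with `v² =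
det(x)^p / det(x^{(p)})`, which is not a square in `E`. Composing for `p` and `p'` gives `x ↦ c ·
x^{(pp')}` with `c²` symmetric in `p, p'`; the two orders therefore agree up to sign, that is, up to
`ι`. Since both actions kill `E⁻` and are induced from `E⁺`, the curvature vanishes, and the locus
where the signs agree is cut out by an idempotent, giving partial commutation. Full commutation
would impose a relation among the square classes of `det(x^{(m)})`, `m = 1, p, p', pp'`;
specializing these to `t^m - 1` rules it out. The right degree is found by rescaling the left
embedding until `φ` becomes a Frobenius up to an automorphism (`alternating_rightDegree`).

For the split symmetric form, the eigenvalues of a denominator-free multiple of `H⁻¹F` are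
specialized to elements whose nonempty subproducts are never squares. Then the trace of a square
root has `2^n` conjugates while there are at most `2^n` roots (`matrix_root_specialization`). For `n
= 2` the trace of `Y` thus has degree at least four over `E`. It satisfies no quadratic relation,
which excludes being induced and also shows that `det (1 - Y)` is nonzero, so that `y ↦ -y` is
available.

The `(1,1)`-curvatures are detected on one element `z` with `φ(z) = π(w)` on which the coordinate
Frobenius is raising to the power `p'`, whereas it is not so on `w`. -/

namespace ArithChern

/-! ## `p`-adically complete rings -/

/-- A ring is `p`-adically complete and separated. -/
structure IsPComplete (p : ℕ) (T : Type u) [CommRing T] : Prop where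
  separated : ∀ z : T, (∀ k : ℕ, (p : T) ^ k ∣ z) → z = 0
  complete : ∀ a : ℕ → T, (∀ k, (p : T) ^ k ∣ a (k + 1) - a k) →
    ∃ z, ∀ k, (p : T) ^ k ∣ z - a k

namespace IsPComplete

variable {p : ℕ} {T : Type u} [CommRing T]

/-- The inverse is the limit of the geometric series in `-pw`. -/
theorem isUnit_one_add (h : IsPComplete p T) (w : T) : IsUnit (1 + p * w) := by
  obtain ⟨z, hz⟩ := h.complete (fun k => ∑ i ∈ Finset.range k, (-(p * w)) ^ i) (fun k => by
    rw [Finset.sum_range_succ, add_sub_cancel_left]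
    exact ⟨(-w) ^ k, by rw [← mul_pow]; ring⟩)
  refine IsUnit.of_mul_eq_one z (sub_eq_zero.mp (h.separated _ fun k => ?_))
  obtain ⟨c, hc⟩ := hz k
  have h1 : z = p ^ k * c + ∑ i ∈ Finset.range k, (-(p * w)) ^ i := by rw [← hc]; ring
  have h2 := mul_neg_geom_sum (-(p * w)) k
  refine ⟨(1 + p * w) * c - (-w) ^ k, ?_⟩
  have h3 : (1 + p * w) * ∑ i ∈ Finset.range k, (-(p * w)) ^ i = 1 - (-(p * w)) ^ k := by
    rw [← h2]; ring
  rw [h1, mul_add, h3]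
  have h4 : (-(p * w)) ^ k = (p : T) ^ k * (-w) ^ k := by rw [← mul_pow]; ring
  rw [h4]; ring

theorem isUnit_of_mul (h : IsPComplete p T) {a b w : T} (hab : a * b = 1 + p * w) : IsUnit a :=
  isUnit_of_mul_isUnit_left (hab ▸ h.isUnit_one_add w)

theorem isUnit_of_quotient (h : IsPComplete p T) {a : T}
    (ha : IsUnit (Ideal.Quotient.mk (Ideal.span {(p : T)}) a)) : IsUnit a := by
  obtain ⟨b, hb⟩ := ha.exists_right_inv
  obtain ⟨b, rfl⟩ := Ideal.Quotient.mk_surjective b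
  rw [← map_mul, ← map_one (Ideal.Quotient.mk _), Ideal.Quotient.eq,
    Ideal.mem_span_singleton] at hb
  obtain ⟨w, hw⟩ := hb
  exact h.isUnit_of_mul (b := b) (w := w) (by rw [← hw]; ring)

variable {n : ℕ}

/-- The difference `D = Y - Y'` satisfies `Y D + D Y' = 0` without any commutation assumption. As
`Y` and `Y'` are `1` modulo `p`, this gives `2D = -p(aD + Db)`, so divisibility of `D` by `p^k`
improves to `p^(k+1)` and separatedness finishes. -/
theorem matrix_ext (h : IsPComplete p T) (hh : IsUnit (2 : T))
    {Y Y' a b : Matrix (Fin n) (Fin n) T} (hY : Y = 1 + (p : T) • a) (hY' : Y' = 1 + (p : T) • b)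
    (hsq : Y * Y = Y' * Y') : Y = Y' := by
  obtain ⟨h2, hh2⟩ := hh.exists_left_inv
  have key : ∀ k : ℕ, ∃ E : Matrix (Fin n) (Fin n) T, Y - Y' = (p : T) ^ k • E := by
    intro k
    induction k with
    | zero => exact ⟨Y - Y', by simp⟩
    | succ k ih =>
      obtain ⟨E, hE⟩ := ih
      refine ⟨-h2 • (a * E + E * b), ?_⟩
      have h1 : Y * (Y - Y') + (Y - Y') * Y' = 0 := by
        rw [mul_sub, sub_mul, hsq]; abel
      have h3 : (2 : T) • (Y - Y') = -((p : T) • (a * (Y - Y') + (Y - Y') * b)) := by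
        rw [eq_neg_iff_add_eq_zero, ← h1]
        have e1 : Y * (Y - Y') = (Y - Y') + (p : T) • (a * (Y - Y')) := by
          nth_rewrite 1 [hY]
          rw [add_mul, one_mul, Matrix.smul_mul]
        have e2 : (Y - Y') * Y' = (Y - Y') + (p : T) • ((Y - Y') * b) := by
          nth_rewrite 2 [hY']
          rw [mul_add, mul_one, Matrix.mul_smul]
        rw [e1, e2, two_smul, smul_add]
        abel
      have h4 : Y - Y' = h2 • (2 : T) • (Y - Y') := by rw [smul_smul, hh2, one_smul]
      rw [h4, h3, hE]
      simp only [Matrix.smul_mul, Matrix.mul_smul, smul_add, smul_smul, smul_neg, neg_smul, pow_succ]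
      rw [neg_add]
      congr 3 <;> ring
  ext i j
  refine sub_eq_zero.mp (h.separated _ fun k => ?_)
  obtain ⟨E, hE⟩ := key k
  exact ⟨E i j, by rw [← Matrix.sub_apply, hE]; rfl⟩

/-- The iteration `Y ↦ Y - (Y² - f) / 2` converging to the square root of `f`. -/
noncomputable def sqrtSeq (h2 : T) (f : Matrix (Fin n) (Fin n) T) : ℕ → Matrix (Fin n) (Fin n) T
  | 0 => 1
  | k + 1 => sqrtSeq h2 f k - h2 • (sqrtSeq h2 f k * sqrtSeq h2 f k - f)

/-- This is Newton's iteration with the derivative `2Y` replaced by `2`, legitimate because `Y ≡ 1`.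
The new error is `(1 - Y)D + D²/4` with `D = Y² - f`, which gains a factor `p` at each step.
Commutation with `f` is carried along so that the square expands as in a commutative ring. -/
theorem sqrtSeq_spec {h2 : T} (hh2 : h2 * 2 = 1) {f g : Matrix (Fin n) (Fin n) T}
    (hf : f = 1 + (p : T) • g) (k : ℕ) :
    Commute (sqrtSeq h2 f k) f ∧ (∃ a, sqrtSeq h2 f k = 1 + (p : T) • a) ∧
      ∃ E, sqrtSeq h2 f k * sqrtSeq h2 f k - f = (p : T) ^ (k + 1) • E := by
  induction k with
  | zero =>
    refine ⟨Commute.one_left _, ⟨0, by simp [sqrtSeq]⟩, ⟨-g, ?_⟩⟩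
    simp [sqrtSeq, hf]
  | succ k ih =>
    obtain ⟨hc, ⟨a, ha⟩, ⟨E, hE⟩⟩ := ih
    set Y := sqrtSeq h2 f k with hY
    have hs : sqrtSeq h2 f (k + 1) = Y - h2 • (Y * Y - f) := rfl
    have hcD : Commute Y (Y * Y - f) := ((Commute.refl Y).mul_right (Commute.refl Y)).sub_right hc
    refine ⟨?_, ⟨a - (h2 * (p : T) ^ k) • E, ?_⟩, ⟨-(a * E) + (h2 * h2 * (p : T) ^ k) • (E * E), ?_⟩⟩
    · rw [hs]
      exact hc.sub_left (((hc.mul_left hc).sub_left (Commute.refl f)).smul_left _)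
    · rw [hs, hE, ha]
      rw [smul_sub, smul_smul, smul_smul, pow_succ, add_sub_assoc]
      congr 3
      ring
    · rw [hs]
      have e1 : (Y - h2 • (Y * Y - f)) * (Y - h2 • (Y * Y - f)) - f =
          (Y * Y - f) - (h2 * 2) • (Y * (Y * Y - f)) + (h2 * h2) • ((Y * Y - f) * (Y * Y - f)) := by
        rw [sub_mul, mul_sub, mul_sub]
        simp only [Matrix.smul_mul, Matrix.mul_smul]
        rw [← hcD.eq, mul_two, add_smul, smul_smul]
        abel
      rw [e1, hh2, one_smul]
      have e2 : (Y * Y - f) - Y * (Y * Y - f) = -((p : T) • (a * (Y * Y - f))) := by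
        have e3 : Y * (Y * Y - f) = (Y * Y - f) + (p : T) • (a * (Y * Y - f)) := by
          nth_rewrite 1 [ha]
          rw [add_mul, one_mul, Matrix.smul_mul]
        rw [e3]
        abel
      rw [e2, hE]
      simp only [Matrix.smul_mul, Matrix.mul_smul, smul_smul, smul_add, smul_neg]
      congr 2 <;> ring_nf

theorem exists_sqrt (h : IsPComplete p T) (hh : IsUnit (2 : T)) {f g : Matrix (Fin n) (Fin n) T}
    (hf : f = 1 + (p : T) • g) :
    ∃ Y a : Matrix (Fin n) (Fin n) T, Y = 1 + (p : T) • a ∧ Y * Y = f := by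
  obtain ⟨h2, hh2⟩ := hh.exists_left_inv
  have H := sqrtSeq_spec (p := p) hh2 hf
  have hlim : ∀ i j, ∃ z, ∀ k, (p : T) ^ k ∣ z - sqrtSeq h2 f k i j := fun i j =>
    h.complete _ fun k => by
      obtain ⟨E, hE⟩ := (H k).2.2
      refine ⟨-(h2 * p * E i j), ?_⟩
      have : sqrtSeq h2 f (k + 1) = sqrtSeq h2 f k - h2 • ((p : T) ^ (k + 1) • E) := by
        rw [← hE]; rfl
      rw [this]
      simp [pow_succ]
      ring
  choose Z hZ using hlim
  have hZ' : ∀ k, ∃ W : Matrix (Fin n) (Fin n) T,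
      (Matrix.of Z) = sqrtSeq h2 f k + (p : T) ^ k • W := by
    intro k
    choose W hW using fun i j => hZ i j k
    refine ⟨Matrix.of W, ?_⟩
    ext i j
    simp only [Matrix.of_apply, Matrix.add_apply, Matrix.smul_apply, smul_eq_mul]
    rw [← hW]; ring
  -- Approximation to first order already shows that the limit is `1` modulo `p`.
  obtain ⟨W, hW⟩ := hZ' 1
  obtain ⟨a, ha⟩ := (H 1).2.1
  refine ⟨Matrix.of Z, a + W, ?_, ?_⟩
  · rw [hW, ha, pow_one, smul_add, add_assoc]
  · ext i j
    refine sub_eq_zero.mp (h.separated _ fun k => ?_)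
    obtain ⟨W, hW⟩ := hZ' k
    obtain ⟨E, hE⟩ := (H k).2.2
    refine ⟨(sqrtSeq h2 f k * W + W * sqrtSeq h2 f k + (p : T) ^ k • (W * W) + (p : T) • E) i j, ?_⟩
    rw [← Matrix.sub_apply, ← smul_eq_mul ((p : T) ^ k), ← Matrix.smul_apply]
    refine congrFun (congrFun ?_ i) j
    rw [hW]
    generalize sqrtSeq h2 f k = Y at hE
    have : f = Y * Y - (p : T) ^ (k + 1) • E := by rw [← hE]; abel
    rw [this]
    simp only [add_mul, mul_add, Matrix.smul_mul, Matrix.mul_smul, smul_add, smul_smul, pow_succ]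
    abel

end IsPComplete

/-! ## The `p`-adic completion -/

section Completion

variable (p : ℕ) (R : Type u) [CommRing R]

theorem span_natCast_fg : (Ideal.span {(p : R)}).FG := ⟨{(p : R)}, by simp⟩

variable {R p} in
theorem mem_pow_span {k : ℕ} {b : R} : b ∈ Ideal.span {(p : R)} ^ k ↔ (p : R) ^ k ∣ b := by
  rw [Ideal.span_singleton_pow, Ideal.mem_span_singleton]

variable {R p} in
-- Since the ideal `(p)` is finitely generated, the kernel of the projection to level `k` is
-- generated by `p^k`. All later work in the completion uses divisibility only.
theorem pow_dvd_iff_evalₐ {k : ℕ} {z : PadicCompletion p R} :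
    (p : PadicCompletion p R) ^ k ∣ z ↔ AdicCompletion.evalₐ (Ideal.span {(p : R)}) k z = 0 := by
  have h1 : z ∈ Ideal.span {(p : R)} ^ k • (⊤ : Submodule R (PadicCompletion p R)) ↔
      (p : PadicCompletion p R) ^ k ∣ z := by
    rw [Ideal.span_singleton_pow, Submodule.ideal_span_singleton_smul,
      Submodule.mem_smul_pointwise_iff_exists]
    constructor
    · rintro ⟨w, -, rfl⟩
      exact ⟨w, by rw [Algebra.smul_def]; simp⟩
    · rintro ⟨w, rfl⟩
      exact ⟨w, trivial, by rw [Algebra.smul_def]; simp⟩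
  rw [← h1, AdicCompletion.pow_smul_top_eq_ker_eval (span_natCast_fg p R), LinearMap.mem_ker]
  rw [← AdicCompletion.factor_eval_eq_evalₐ _ _ (le_of_eq (Ideal.mul_top _))]
  constructor
  · intro h; rw [h, map_zero]
  · intro h
    rw [← AdicCompletion.factor_evalₐ_eq_eval _ _ (le_of_eq (Ideal.mul_top _).symm)]
    rw [← AdicCompletion.factor_eval_eq_evalₐ _ _ (le_of_eq (Ideal.mul_top _)), h, map_zero]

variable {p R}

theorem PadicCompletion.exists_sub_dvd (z : PadicCompletion p R) (k : ℕ) :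
    ∃ b : R, (p : PadicCompletion p R) ^ k ∣ z - toPadicCompletion p R b := by
  obtain ⟨b, hb⟩ := Ideal.Quotient.mk_surjective (AdicCompletion.evalₐ (Ideal.span {(p : R)}) k z)
  refine ⟨b, pow_dvd_iff_evalₐ.mpr ?_⟩
  rw [map_sub, ← hb]
  simp

theorem PadicCompletion.pow_dvd_of_iff {k : ℕ} {b : R} :
    (p : PadicCompletion p R) ^ k ∣ toPadicCompletion p R b ↔ (p : R) ^ k ∣ b := by
  rw [pow_dvd_iff_evalₐ, ← mem_pow_span, ← Ideal.Quotient.eq_zero_iff_mem]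
  simp

variable (p R) in
theorem PadicCompletion.isPComplete : IsPComplete p (PadicCompletion p R) where
  separated z hz := by
    refine AdicCompletion.ext_evalₐ fun k => ?_
    rw [map_zero, ← pow_dvd_iff_evalₐ]
    exact hz k
  complete a ha := by
    choose b hb using fun k => PadicCompletion.exists_sub_dvd (a k) k
    have hc : ∀ k, b k ≡ b (k + 1)
        [SMOD Ideal.span {(p : R)} ^ k • (⊤ : Submodule R R)] := by
      intro k
      rw [SModEq.comm, SModEq.sub_mem, smul_eq_mul, Ideal.mul_top, mem_pow_span,
        ← PadicCompletion.pow_dvd_of_iff, map_sub]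
      have h1 := (pow_dvd_pow (p : PadicCompletion p R) k.le_succ).trans (hb (k + 1))
      have h2 := ((ha k).sub h1).add (hb k)
      convert h2 using 1
      ring
    refine ⟨AdicCompletion.mk _ _ (AdicCompletion.AdicCauchySequence.mk _ _ b hc), fun k => ?_⟩
    have h1 : (p : PadicCompletion p R) ^ k ∣ AdicCompletion.mk _ _
        (AdicCompletion.AdicCauchySequence.mk _ _ b hc) - toPadicCompletion p R (b k) := by
      rw [pow_dvd_iff_evalₐ, map_sub, AdicCompletion.evalₐ_mk]
      simp
    convert h1.sub (hb k) using 1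
    ring


/-- Modulo `p^k` every element comes from the uncompleted ring, so the two maps differ by multiples
of every power of `p`. -/
theorem PadicCompletion.ringHom_ext {S : Type v} [CommRing S]
    (hS : ∀ z : S, (∀ k : ℕ, (p : S) ^ k ∣ z) → z = 0) {f g : PadicCompletion p R →+* S}
    (h : f.comp (toPadicCompletion p R) = g.comp (toPadicCompletion p R)) : f = g := by
  ext z
  refine sub_eq_zero.mp (hS _ fun k => ?_)
  obtain ⟨b, c, hc⟩ := PadicCompletion.exists_sub_dvd z k
  have h1 : z = (p : PadicCompletion p R) ^ k * c + toPadicCompletion p R b := by rw [← hc]; ring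
  have h2 := RingHom.congr_fun h b
  simp only [RingHom.comp_apply] at h2
  refine ⟨f c - g c, ?_⟩
  rw [h1]
  simp only [map_add, map_mul, map_pow, map_natCast, h2]
  ring

/-- Approximate `z` by `b` modulo `p^k`: then `p^(k+1)` divides `p b`, and cancelling `p` in `R`
shows that `p^k` divides `b`, hence `z`. It is needed to recover `δ` from its lift of Frobenius. -/
theorem PadicCompletion.mul_left_cancel (hp : ∀ b : R, (p : R) * b = 0 → b = 0)
    {z : PadicCompletion p R} (hz : (p : PadicCompletion p R) * z = 0) : z = 0 := by
  refine (PadicCompletion.isPComplete p R).separated _ fun k => ?_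
  obtain ⟨b, c, hc⟩ := PadicCompletion.exists_sub_dvd z k
  have h1 : toPadicCompletion p R b = z - (p : PadicCompletion p R) ^ k * c := by rw [← hc]; ring
  have h2 : (p : PadicCompletion p R) ^ (k + 1) ∣ toPadicCompletion p R (p * b) := by
    refine ⟨-c, ?_⟩
    rw [map_mul, map_natCast, h1, mul_sub, hz]; ring
  rw [PadicCompletion.pow_dvd_of_iff] at h2
  obtain ⟨d, hd⟩ := h2
  have h3 : b = (p : R) ^ k * d := by
    refine sub_eq_zero.mp (hp _ ?_)
    rw [mul_sub, hd]; ring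
  have h4 : z = toPadicCompletion p R b + (p : PadicCompletion p R) ^ k * c := by rw [h1]; ring
  rw [h4, h3, map_mul, map_pow, map_natCast, ← mul_add]
  exact dvd_mul_right _ _

theorem PadicCompletion.map_of {S : Type u} [CommRing S] (f : R →+* S) (b : R) :
    PadicCompletion.map p f (toPadicCompletion p R b) = toPadicCompletion p S (f b) := by
  refine AdicCompletion.ext_evalₐ fun k => ?_
  have h : ∀ z : PadicCompletion p R, AdicCompletion.evalₐ (Ideal.span {(p : S)}) k
      (PadicCompletion.map p f z) =
        Ideal.quotientMap (Ideal.span {(p : S)} ^ k) f (span_pow_le_comap p f k)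
          (AdicCompletion.evalₐ (Ideal.span {(p : R)}) k z) := by
    intro z
    apply AdicCompletion.evalₐ_liftRingHom
    intro m k hle
    ext x
    obtain ⟨a, rfl⟩ := AdicCompletion.mk_surjective _ _ x
    have h1 : (Ideal.Quotient.mk (Ideal.span {(p : R)} ^ m)) (a.val k) =
        (Ideal.Quotient.mk (Ideal.span {(p : R)} ^ m)) (a.val m) := by
      rw [Ideal.Quotient.eq]
      simpa using SModEq.sub_mem.mp (a.property hle).symm
    simpa using congrArg
      (Ideal.quotientMap (Ideal.span {(p : S)} ^ m) f (span_pow_le_comap p f m)) h1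
  rw [h]
  simp

theorem PadicCompletion.map_comp_to {S : Type u} [CommRing S] (f : R →+* S) :
    (PadicCompletion.map p f).comp (toPadicCompletion p R) = (toPadicCompletion p S).comp f :=
  RingHom.ext fun b => PadicCompletion.map_of f b

end Completion

end ArithChern

namespace ArithChern

variable {n : ℕ}

/-! ## Maps of matrices and the Jordan multiplication -/

section Maps

variable {R S : Type*} [CommRing R] [CommRing S]

theorem inv_map_of_isUnit {A : Matrix (Fin n) (Fin n) R} (hA : IsUnit A.det) (f : R →+* S) :
    A⁻¹.map f = (A.map f)⁻¹ := by
  refine (Matrix.inv_eq_right_inv ?_).symm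
  rw [← Matrix.map_mul, Matrix.mul_nonsing_inv _ hA, Matrix.map_one _ f.map_zero f.map_one]

theorem entryPow_map' (p : ℕ) (f : R →+* S) (X : Matrix (Fin n) (Fin n) R) :
    (entryPow p X).map f = entryPow p (X.map f) := by
  ext i j
  simp [entryPow]

theorem Hform_map' (f : R →+* S) (Q X : Matrix (Fin n) (Fin n) R) :
    (Hform Q X).map f = Hform (Q.map f) (X.map f) := by
  simp [Hform, Matrix.map_mul, Matrix.transpose_map]

theorem det_map' (f : R →+* S) (X : Matrix (Fin n) (Fin n) R) : (X.map f).det = f X.det :=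
  (RingHom.map_det f X).symm

theorem isUnit_two_of_map (h2 : IsUnit (2 : R)) (f : R →+* S) : IsUnit (2 : S) := by
  have := h2.map f
  rwa [map_ofNat] at this

theorem map_inverse_two (h2 : IsUnit (2 : R)) (f : R →+* S) :
    f (Ring.inverse 2) = Ring.inverse 2 := by
  have h3 : IsUnit (2 : S) := isUnit_two_of_map h2 f
  refine h3.mul_left_cancel ?_
  rw [Ring.mul_inverse_cancel _ h3]
  have := congrArg f (Ring.mul_inverse_cancel _ h2)
  rwa [map_mul, map_ofNat, map_one] at this

/-- An explicit matrix for Jordan multiplication in the standard basis, from which compatibility of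
`jor` with ring homomorphisms is visible. -/
theorem jor_eq_det (b : Matrix (Fin n) (Fin n) R) :
    jor b = (Matrix.of fun (kl ij : Fin n × Fin n) => Ring.inverse (2 : R) *
      ((if kl.1 = ij.1 then b ij.2 kl.2 else 0) + (if kl.2 = ij.2 then b kl.1 ij.1 else 0))).det := by
  rw [jor, ← LinearMap.det_toMatrix (Matrix.stdBasis R (Fin n) (Fin n))]
  congr 1
  ext ⟨k, l⟩ ⟨i, j⟩
  rw [LinearMap.toMatrix_apply]
  have h : ∀ z : Matrix (Fin n) (Fin n) R,
      (Matrix.stdBasis R (Fin n) (Fin n)).repr z (k, l) = z k l := by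
    intro z
    simp [Matrix.stdBasis, Pi.basis_repr]
  rw [h, Matrix.stdBasis_eq_single]
  simp [Matrix.mul_apply, Matrix.single_apply, ite_and, eq_comm, mul_add]

theorem map_jor (h2 : IsUnit (2 : R)) (f : R →+* S) (b : Matrix (Fin n) (Fin n) R) :
    f (jor b) = jor (b.map f) := by
  rw [jor_eq_det, jor_eq_det, RingHom.map_det]
  congr 1
  ext ⟨k, l⟩ ⟨i, j⟩
  simp [map_inverse_two h2, apply_ite f]

theorem jor_one (h2 : IsUnit (2 : R)) : jor (1 : Matrix (Fin n) (Fin n) R) = 1 := by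
  have : (Ring.inverse (2 : R) • (LinearMap.mulRight R (1 : Matrix (Fin n) (Fin n) R) +
      LinearMap.mulLeft R 1)) = LinearMap.id := by
    ext z : 1
    simp only [LinearMap.smul_apply, LinearMap.add_apply, LinearMap.mulRight_apply, mul_one,
      LinearMap.mulLeft_apply, one_mul, LinearMap.id_apply]
    rw [← two_smul R z, smul_smul, Ring.inverse_mul_cancel _ h2, one_smul]
  rw [jor, this, LinearMap.det_id]

/-- The map `z ↦ z y + y z` is the derivative of squaring at `y`. Its bijectivity is what makes the
scheme of square roots étale. -/
theorem bijective_of_isUnit_jor (h2 : IsUnit (2 : R)) {y : Matrix (Fin n) (Fin n) R}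
    (hy : IsUnit (jor y)) :
    Function.Bijective (fun z : Matrix (Fin n) (Fin n) R => z * y + y * z) := by
  have h1 := (LinearMap.isUnit_iff_isUnit_det _).mpr hy
  have h3 := (Module.End.isUnit_iff _).mp h1
  have h4 : Function.Bijective (fun z : Matrix (Fin n) (Fin n) R => (2 : R) • z) :=
    (h2.unit • (LinearEquiv.refl R (Matrix (Fin n) (Fin n) R))).bijective
  have h5 := h4.comp h3
  convert h5 using 1
  ext z : 1
  simp only [Function.comp_apply, LinearMap.smul_apply, LinearMap.add_apply,
    LinearMap.mulRight_apply, LinearMap.mulLeft_apply, smul_smul]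
  rw [Ring.mul_inverse_cancel _ h2, one_smul]

end Maps

/-! ## The universal properties of `CoordGL` and of `ModelRing` -/

section CoordGL

variable {A : Type u} {S : Type u} [CommRing A] [CommRing S]

theorem CoordGL.lift_const (s : A →+* S) (X : Matrix (Fin n) (Fin n) S) (hX : IsUnit X.det) :
    (CoordGL.lift s X hX).comp (algebraMap A (CoordGL n A)) = s := by
  ext a
  rw [RingHom.comp_apply, IsScalarTower.algebraMap_apply A (MvPolynomial (Fin n × Fin n) A)
    (CoordGL n A), CoordGL.lift, IsLocalization.Away.lift_eq]
  simp

theorem CoordGL.lift_gen (s : A →+* S) (X : Matrix (Fin n) (Fin n) S) (hX : IsUnit X.det) :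
    (genMatrix n A).map (CoordGL.lift s X hX) = X := by
  ext i j
  rw [genMatrix, Matrix.map_map, Matrix.map_apply, Function.comp_apply, CoordGL.lift,
    IsLocalization.Away.lift_eq]
  simp

theorem CoordGL.ringHom_ext {T : Type v} [CommRing T] {f g : CoordGL n A →+* T}
    (h1 : f.comp (algebraMap A (CoordGL n A)) = g.comp (algebraMap A (CoordGL n A)))
    (h2 : (genMatrix n A).map f = (genMatrix n A).map g) : f = g := by
  refine IsLocalization.ringHom_ext
    (Submonoid.powers (Matrix.mvPolynomialX (Fin n) (Fin n) A).det) ?_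
  refine MvPolynomial.ringHom_ext ?_ ?_
  · intro a
    have := RingHom.congr_fun h1 a
    simpa [IsScalarTower.algebraMap_apply A (MvPolynomial (Fin n × Fin n) A) (CoordGL n A)]
      using this
  · rintro ⟨i, j⟩
    have := congrFun (congrFun h2 i) j
    simpa [genMatrix] using this

theorem isUnit_det_genMatrix : IsUnit (genMatrix n A).det := by
  rw [genMatrix, det_map']
  exact IsLocalization.Away.algebraMap_isUnit _

end CoordGL

section ModelRing

variable {A : Type u} [CommRing A] (s : A →+* A) (p : ℕ) (q : Matrix (Fin n) (Fin n) A)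

/-- `X` and `Y` satisfy the relations of the model over the `A`-algebra `T`. -/
structure ModelRel {T : Type*} [CommRing T] (a : A →+* T) (X Y : Matrix (Fin n) (Fin n) T) :
    Prop where
  det_X : IsUnit X.det
  det_Xp : IsUnit (entryPow p X).det
  det_F : IsUnit (entryPow p (Hform (q.map a) X)).det
  det_Y : IsUnit (Y + 1).det
  jor_Y : IsUnit (jor Y)
  rel : Hform (q.map (a.comp s)) (entryPow p X) * (Y * Y) = entryPow p (Hform (q.map a) X)

theorem isUnit_model_of_dvd' {d : PolyXY n A} (h : d ∣ modelDenom p q) :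
    IsUnit (algebraMap (PolyXY n A) (ModelRing s p q) d) := by
  rw [IsScalarTower.algebraMap_apply (PolyXY n A) (ModelLoc p q) (ModelRing s p q)]
  exact (isUnit_model_of_dvd p q h).map _

theorem modelX_eq : modelX s p q = (polyX n A).map (algebraMap (PolyXY n A) (ModelRing s p q)) := by
  ext i j; rfl

theorem modelY_eq : modelY s p q = (polyY n A).map (algebraMap (PolyXY n A) (ModelRing s p q)) := by
  ext i j; rfl

theorem modelConst_eq : modelConst s p q =
    (algebraMap (PolyXY n A) (ModelRing s p q)).comp MvPolynomial.C := by
  ext a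
  rw [modelConst, RingHom.comp_apply,
    IsScalarTower.algebraMap_apply A (PolyXY n A) (ModelLoc p q)]
  rfl

theorem Hform_const_eq :
    Hform (q.map (modelConst s p q)) (modelX s p q) =
      (Hform (q.map MvPolynomial.C) (polyX n A)).map
        (algebraMap (PolyXY n A) (ModelRing s p q)) := by
  rw [Hform_map', modelX_eq, modelConst_eq]
  congr 1

theorem modelRel (hq : IsUnit q.det) (h2 : IsUnit (2 : A)) :
    ModelRel s p q (modelConst s p q) (modelX s p q) (modelY s p q) where
  det_X := isUnit_det_modelX s p q
  det_Xp := by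
    rw [modelX_eq, ← entryPow_map', det_map']
    refine isUnit_model_of_dvd' s p q ?_
    rw [modelDenom, gPoly]
    exact ((Dvd.intro_left _ rfl).mul_right _).mul_right _ |>.mul_right _
  det_F := by
    rw [Hform_const_eq, ← entryPow_map', det_map']
    refine isUnit_model_of_dvd' s p q ?_
    rw [modelDenom, gPoly]
    exact ((Dvd.intro_left _ rfl).mul_right _).mul_right _
  det_Y := by
    have : modelY s p q + 1 = (polyY n A + 1).map
        (algebraMap (PolyXY n A) (ModelRing s p q)) := by
      rw [modelY_eq, Matrix.map_add _ (map_add _), Matrix.map_one _ (map_zero _) (map_one _)]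
    rw [this, det_map']
    refine isUnit_model_of_dvd' s p q ?_
    rw [modelDenom]
    exact (Dvd.intro_left _ rfl).mul_right _
  jor_Y := by
    rw [modelY_eq, ← map_jor (isUnit_two_of_map h2 (MvPolynomial.C : A →+* PolyXY n A))]
    refine isUnit_model_of_dvd' s p q ?_
    rw [modelDenom]
    exact Dvd.intro_left _ rfl
  rel := by
    have h1 : modelY s p q * modelY s p q =
        (fMatrix s p q).map (Ideal.Quotient.mk (modelIdeal s p q)) := by
      rw [modelY, ← Matrix.map_mul]
      ext i j
      simp only [Matrix.map_apply]
      rw [Ideal.Quotient.eq]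
      exact Ideal.subset_span ⟨(i, j), rfl⟩
    have h3 : IsUnit (Hform (q.map ((algebraMap A (ModelLoc p q)).comp s))
        (entryPow p (locX p q))).det := by
      rw [Hform, Matrix.det_mul, Matrix.det_mul, Matrix.det_transpose, det_map_ringHom]
      exact ((isUnit_det_entryPow_locX p q).mul (hq.map _)).mul (isUnit_det_entryPow_locX p q)
    have h4 := Matrix.mul_nonsing_inv_cancel_left
      (B := entryPow p (Hform (q.map (algebraMap A (ModelLoc p q))) (locX p q))) _ h3
    have h5 := congrArg (fun Z : Matrix (Fin n) (Fin n) (ModelLoc p q) =>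
      Z.map (Ideal.Quotient.mk (modelIdeal s p q))) h4
    simp only [Matrix.map_mul] at h5
    rw [h1, fMatrix, Matrix.map_mul]
    rw [entryPow_map', Hform_map', Hform_map', entryPow_map', Matrix.map_map, Matrix.map_map] at h5
    rw [entryPow_map', Hform_map', Matrix.map_map]
    exact h5

variable {s p q}

theorem modelRing_hom_ext {T : Type v} [CommRing T] {f g : ModelRing s p q →+* T}
    (h1 : f.comp (modelConst s p q) = g.comp (modelConst s p q))
    (h2 : (modelX s p q).map f = (modelX s p q).map g)
    (h3 : (modelY s p q).map f = (modelY s p q).map g) : f = g := by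
  refine Ideal.Quotient.ringHom_ext ?_
  refine IsLocalization.ringHom_ext (Submonoid.powers (modelDenom p q)) ?_
  refine MvPolynomial.ringHom_ext ?_ ?_
  · intro a
    rw [modelConst_eq] at h1
    exact RingHom.congr_fun h1 a
  · rintro (⟨i, j⟩ | ⟨i, j⟩)
    · rw [modelX_eq] at h2
      have := congrFun (congrFun h2 i) j
      simpa [polyX] using this
    · rw [modelY_eq] at h3
      have := congrFun (congrFun h3 i) j
      simpa [polyY] using this

/-- Together with `modelRing_hom_ext` this is the universal property of the model: its points are
the pairs `(X, Y)` satisfying `ModelRel`. The relation is kept in the form `H Y² = F`, free of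
inverse matrices, so that it transports along ring maps. -/
theorem ModelRel.exists_hom (h2 : IsUnit (2 : A)) (hq : IsUnit q.det) {T : Type v} [CommRing T]
    {a : A →+* T}
    {X Y : Matrix (Fin n) (Fin n) T} (h : ModelRel s p q a X Y) :
    ∃ g : ModelRing s p q →+* T, g.comp (modelConst s p q) = a ∧
      (modelX s p q).map g = X ∧ (modelY s p q).map g = Y := by
  let e : PolyXY n A →+* T := MvPolynomial.eval₂Hom a
    (Sum.elim (fun ij => X ij.1 ij.2) (fun ij => Y ij.1 ij.2))
  have heC : e.comp MvPolynomial.C = a := by ext; simp [e]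
  have heX : (polyX n A).map e = X := by ext; simp [e, polyX]
  have heY : (polyY n A).map e = Y := by ext; simp [e, polyY]
  have hX2 : IsUnit (2 : PolyXY n A) := isUnit_two_of_map h2 (MvPolynomial.C : A →+* PolyXY n A)
  have hu : IsUnit (e (modelDenom p q)) := by
    rw [modelDenom, gPoly]
    simp only [map_mul]
    rw [map_jor hX2, ← det_map', ← det_map', ← det_map', ← det_map',
      Matrix.map_add _ (map_add e), Matrix.map_one _ (map_zero e) (map_one e), entryPow_map',
      entryPow_map', Hform_map', heX, heY, Matrix.map_map, ← RingHom.coe_comp, heC]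
    exact (((h.det_X.mul h.det_Xp).mul h.det_F).mul h.det_Y).mul h.jor_Y
  let g₀ : ModelLoc p q →+* T := IsLocalization.Away.lift (modelDenom p q) hu
  have hg₀ : ∀ z, g₀ (algebraMap _ _ z) = e z := fun z => IsLocalization.Away.lift_eq _ hu z
  have hgX : (locX p q).map g₀ = X := by
    rw [← heX, locX, Matrix.map_map]; ext; simp [hg₀]
  have hgY : (locY p q).map g₀ = Y := by
    rw [← heY, locY, Matrix.map_map]; ext; simp [hg₀]
  have hgC : g₀.comp (algebraMap A (ModelLoc p q)) = a := by
    rw [← heC]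
    ext z
    rw [RingHom.comp_apply, IsScalarTower.algebraMap_apply A (PolyXY n A) (ModelLoc p q), hg₀]
    rfl
  have h3 : IsUnit (Hform (q.map ((algebraMap A (ModelLoc p q)).comp s))
      (entryPow p (locX p q))).det := by
    rw [Hform, Matrix.det_mul, Matrix.det_mul, Matrix.det_transpose, det_map_ringHom]
    exact ((isUnit_det_entryPow_locX p q).mul (hq.map _)).mul (isUnit_det_entryPow_locX p q)
  have hgf : (fMatrix s p q).map g₀ = Y * Y := by
    rw [fMatrix, Matrix.map_mul, inv_map_of_isUnit h3, Hform_map', entryPow_map', entryPow_map',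
      Hform_map', hgX, Matrix.map_map, Matrix.map_map, ← RingHom.coe_comp, ← RingHom.coe_comp,
      ← RingHom.comp_assoc, hgC, ← h.rel, Matrix.nonsing_inv_mul_cancel_left]
    rw [Hform, Matrix.det_mul, Matrix.det_mul, Matrix.det_transpose, det_map']
    exact (h.det_Xp.mul (hq.map _)).mul h.det_Xp
  have hker : ∀ z ∈ modelIdeal s p q, g₀ z = 0 := by
    intro z hz
    have : modelIdeal s p q ≤ RingHom.ker g₀ := by
      rw [modelIdeal, Ideal.span_le]
      rintro _ ⟨⟨i, j⟩, rfl⟩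
      have h4 : (locY p q * locY p q - fMatrix s p q).map g₀ = 0 := by
        rw [Matrix.map_sub _ (map_sub g₀), Matrix.map_mul, hgY, hgf, sub_self]
      exact congrFun (congrFun h4 i) j
    exact this hz
  refine ⟨Ideal.Quotient.lift _ g₀ hker, ?_, ?_, ?_⟩
  · rw [← hgC]; ext z; rfl
  · rw [← hgX]; ext i j; rfl
  · rw [← hgY]; ext i j; rfl

theorem ModelRel.map (h2 : IsUnit (2 : A)) {T : Type*} [CommRing T] {S : Type*} [CommRing S]
    {a : A →+* T} {X Y : Matrix (Fin n) (Fin n) T} (h : ModelRel s p q a X Y) (f : T →+* S) :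
    ModelRel s p q (f.comp a) (X.map f) (Y.map f) where
  det_X := by rw [det_map']; exact h.det_X.map f
  det_Xp := by rw [← entryPow_map', det_map']; exact h.det_Xp.map f
  det_F := by
    have := h.det_F.map f
    rwa [← det_map', entryPow_map', Hform_map', Matrix.map_map, ← RingHom.coe_comp] at this
  det_Y := by
    have := h.det_Y.map f
    rwa [← det_map', Matrix.map_add _ (map_add f), Matrix.map_one _ (map_zero f) (map_one f)]
      at this
  jor_Y := by
    rw [← map_jor (isUnit_two_of_map h2 a)]
    exact h.jor_Y.map f
  rel := by
    have := congrArg (fun Z : Matrix (Fin n) (Fin n) T => Z.map f) h.rel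
    simp only [Matrix.map_mul] at this
    rwa [entryPow_map', Hform_map', Hform_map', entryPow_map', Matrix.map_map, Matrix.map_map,
      ← RingHom.coe_comp, ← RingHom.coe_comp, ← RingHom.comp_assoc] at this

end ModelRing

end ArithChern

namespace ArithChern

variable {n : ℕ}

/-! ## The left map of the model is étale -/

section Etale

variable {A : Type u} [CommRing A]

/-- For `z = Y' - Y` the quadratic term vanishes because `I² = 0`, so equality of squares becomes
`zY + Yz = 0`, and Jordan multiplication by `Y` is injective. -/
theorem mul_add_mul_injective {R : Type*} [CommRing R] (h2 : IsUnit (2 : R))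
    {Y Y' : Matrix (Fin n) (Fin n) R} {I : Ideal R} (hI : I ^ 2 = ⊥)
    (hY : IsUnit (jor Y)) (hsq : Y * Y = Y' * Y') (h : ∀ i j, Y' i j - Y i j ∈ I) : Y' = Y := by
  set z := Y' - Y with hz
  have hY' : Y' = Y + z := by rw [hz]; abel
  have hzz : z * z = 0 := by
    ext i j
    rw [Matrix.mul_apply, Matrix.zero_apply]
    refine Finset.sum_eq_zero fun k _ => ?_
    have : z i k * z k j ∈ I ^ 2 := by
      rw [pow_two]; exact Ideal.mul_mem_mul (h i k) (h k j)
    rwa [hI, Ideal.mem_bot] at this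
  have h1 : z * Y + Y * z = 0 := by
    rw [hY', add_mul, mul_add, mul_add, hzz, add_zero] at hsq
    have h5 : Y * Y + (Y * z + z * Y) = Y * Y + 0 := by rw [add_zero, ← add_assoc]; exact hsq.symm
    rw [add_comm]; exact add_left_cancel h5
  have h3 := (bijective_of_isUnit_jor h2 hY).1 (a₁ := z) (a₂ := 0) (by simp [h1])
  rw [hY', h3, add_zero]

/-- One Newton step is exact because `I² = 0`: the correction `z` solves `zY + Yz = H⁻¹F - Y²`. Its
entries lie in `I` since modulo `I` the right side is zero and Jordan multiplication remains
injective. -/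
theorem exists_sqrt_lift {R : Type*} [CommRing R] (h2 : IsUnit (2 : R)) {I : Ideal R}
    (hI : I ^ 2 = ⊥) {H F Y : Matrix (Fin n) (Fin n) R} (hH : IsUnit H.det) (hY : IsUnit (jor Y))
    (h : ∀ i j, (H * (Y * Y) - F) i j ∈ I) :
    ∃ Y' : Matrix (Fin n) (Fin n) R, (∀ i j, Y' i j - Y i j ∈ I) ∧ H * (Y' * Y') = F := by
  obtain ⟨z, hz⟩ := (bijective_of_isUnit_jor h2 hY).2 (H⁻¹ * F - Y * Y)
  simp only at hz
  have hmap : z.map (Ideal.Quotient.mk I) = 0 := by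
    have hYq : IsUnit (jor (Y.map (Ideal.Quotient.mk I))) := by
      rw [← map_jor h2]; exact hY.map _
    refine (bijective_of_isUnit_jor (isUnit_two_of_map h2 (Ideal.Quotient.mk I)) hYq).1 ?_
    simp only [zero_mul, mul_zero, add_zero]
    have h3 := congrArg (fun Z : Matrix (Fin n) (Fin n) R => Z.map (Ideal.Quotient.mk I)) hz
    simp only [Matrix.map_add _ (map_add (Ideal.Quotient.mk I)), Matrix.map_mul] at h3
    rw [h3]
    have h4 : H⁻¹ * F - Y * Y = -(H⁻¹ * (H * (Y * Y) - F)) := by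
      rw [mul_sub, Matrix.nonsing_inv_mul_cancel_left _ _ hH]; abel
    rw [h4]
    ext i j
    simp only [Matrix.map_apply, Matrix.zero_apply, Matrix.neg_apply]
    rw [Ideal.Quotient.eq_zero_iff_mem, Matrix.mul_apply]
    exact I.neg_mem (I.sum_mem fun k _ => I.mul_mem_left _ (h k j))
  have hzI : ∀ i j, z i j ∈ I := fun i j => Ideal.Quotient.eq_zero_iff_mem.mp
    (congrFun (congrFun hmap i) j)
  have hzz : z * z = 0 := by
    ext i j
    rw [Matrix.mul_apply, Matrix.zero_apply]
    refine Finset.sum_eq_zero fun k _ => ?_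
    have : z i k * z k j ∈ I ^ 2 := by
      rw [pow_two]; exact Ideal.mul_mem_mul (hzI i k) (hzI k j)
    rwa [hI, Ideal.mem_bot] at this
  refine ⟨Y + z, fun i j => by simpa using hzI i j, ?_⟩
  have h5 : (Y + z) * (Y + z) = H⁻¹ * F := by
    rw [add_mul, mul_add, mul_add, hzz, add_zero, add_assoc, add_comm (Y * z), hz]; abel
  rw [h5, Matrix.mul_nonsing_inv_cancel_left _ _ hH]

theorem isUnit_of_quotient_sq {R : Type*} [CommRing R] {I : Ideal R} (hI : I ^ 2 = ⊥) {a : R}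
    (ha : IsUnit (Ideal.Quotient.mk I a)) : IsUnit a := by
  exact (IsNilpotent.isUnit_quotient_mk_iff ⟨2, hI⟩).mp ha

variable (s : A →+* A) (p : ℕ) (q : Matrix.GeneralLinearGroup (Fin n) A)

theorem isUnit_det_q : IsUnit q.val.det := (Matrix.isUnit_iff_isUnit_det _).mp q.isUnit

/-- The comorphism `x ↦ x` of the left projection of the model. -/
noncomputable def modelLeft : CoordGL n A →+* ModelRing s p q.val :=
  CoordGL.lift (modelConst s p q.val) (modelX s p q.val) (isUnit_det_modelX s p q.val)

/-- The comorphism `x ↦ x^{(p)} y` of the right projection of the model. -/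
noncomputable def modelRight : CoordGL n A →+* ModelRing s p q.val :=
  CoordGL.lift ((modelConst s p q.val).comp s) (entryPow p (modelX s p q.val) * modelY s p q.val)
    (isUnit_det_modelXY s p q.val (isUnit_det_q q))

theorem modelLeft_const :
    (modelLeft s p q).comp (algebraMap A (CoordGL n A)) = modelConst s p q.val :=
  CoordGL.lift_const _ _ (isUnit_det_modelX s p q.val)

theorem modelLeft_gen : (genMatrix n A).map (modelLeft s p q) = modelX s p q.val :=
  CoordGL.lift_gen _ _ (isUnit_det_modelX s p q.val)

theorem modelRight_const :
    (modelRight s p q).comp (algebraMap A (CoordGL n A)) = (modelConst s p q.val).comp s :=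
  CoordGL.lift_const _ _ (isUnit_det_modelXY s p q.val (isUnit_det_q q))

theorem modelRight_gen : (genMatrix n A).map (modelRight s p q) =
    entryPow p (modelX s p q.val) * modelY s p q.val :=
  CoordGL.lift_gen _ _ (isUnit_det_modelXY s p q.val (isUnit_det_q q))

theorem modelRing_finitePresentation : Algebra.FinitePresentation A (ModelRing s p q.val) := by
  have h1 : Algebra.FinitePresentation A (ModelLoc p q.val) :=
    have := IsLocalization.Away.finitePresentation (R := PolyXY n A) (S := ModelLoc p q.val)
      (modelDenom p q.val)
    Algebra.FinitePresentation.trans A (PolyXY n A) _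
  refine Algebra.FinitePresentation.quotient ?_
  rw [modelIdeal]
  exact Submodule.fg_span (Set.finite_range _)

/-- The infinitesimal criterion: over a thickening by a square-zero ideal, `x` is prescribed and
only `y` has to be lifted, which is a question about square roots of matrices. -/
theorem modelLeft_etale (h2 : IsUnit (2 : A)) : (modelLeft s p q).Etale := by
  have hq := isUnit_det_q q
  let : Algebra (CoordGL n A) (ModelRing s p q.val) := (modelLeft s p q).toAlgebra
  have hM := modelRel s p q.val hq h2
  have hC := modelLeft_const s p q
  have hX := modelLeft_gen s p q
  have : IsScalarTower A (CoordGL n A) (ModelRing s p q.val) := by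
    refine IsScalarTower.of_algebraMap_eq fun a => ?_
    refine Eq.trans ?_ (RingHom.congr_fun hC a).symm
    rw [modelConst_eq, RingHom.comp_apply,
      IsScalarTower.algebraMap_apply A (PolyXY n A) (ModelRing s p q.val)]
    rfl
  have : Algebra.FinitePresentation A (ModelRing s p q.val) := modelRing_finitePresentation s p q
  have hfp : Algebra.FinitePresentation (CoordGL n A) (ModelRing s p q.val) := by
    have : Algebra.FiniteType A (CoordGL n A) :=
      have := IsLocalization.Away.finitePresentation (R := MvPolynomial (Fin n × Fin n) A)
        (S := CoordGL n A) (Matrix.mvPolynomialX (Fin n) (Fin n) A).det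
      Algebra.FiniteType.trans (S := MvPolynomial (Fin n × Fin n) A) inferInstance inferInstance
    exact Algebra.FinitePresentation.of_restrict_scalars_finitePresentation A _ _
  have hfe : Algebra.FormallyEtale (CoordGL n A) (ModelRing s p q.val) := by
    refine Algebra.FormallyEtale.iff_comp_bijective.mpr ?_
    intro S _ _ I hI
    have h2S : IsUnit (2 : S) := isUnit_two_of_map h2
      ((algebraMap (CoordGL n A) S).comp (algebraMap A (CoordGL n A)))
    have hconst : ∀ {S' : Type u} [CommRing S'] [Algebra (CoordGL n A) S']
        (f : ModelRing s p q.val →ₐ[CoordGL n A] S'),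
        (f : ModelRing s p q.val →+* S').comp (modelConst s p q.val) =
          (algebraMap (CoordGL n A) S').comp (algebraMap A (CoordGL n A)) := by
      intro S' _ _ f
      rw [← hC, ← RingHom.comp_assoc]
      congr 1
      exact f.comp_algebraMap
    have hgen : ∀ {S' : Type u} [CommRing S'] [Algebra (CoordGL n A) S']
        (f : ModelRing s p q.val →ₐ[CoordGL n A] S'),
        (modelX s p q.val).map (f : ModelRing s p q.val →+* S') =
          (genMatrix n A).map (algebraMap (CoordGL n A) S') := by
      intro S' _ _ f
      rw [← hX, Matrix.map_map]
      congr 1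
      ext z
      exact f.commutes z
    constructor
    -- Uniqueness of the lift: two choices of `y` agree modulo `I` and have the same square.
    · intro f g hfg
      have hYeq : (modelY s p q.val).map (g : ModelRing s p q.val →+* S) =
          (modelY s p q.val).map (f : ModelRing s p q.val →+* S) := by
        have hf := hM.map h2 (f : ModelRing s p q.val →+* S)
        have hg := hM.map h2 (g : ModelRing s p q.val →+* S)
        refine mul_add_mul_injective h2S hI hf.jor_Y ?_ ?_
        · have e1 := hf.rel
          have e2 := hg.rel
          rw [hconst, hgen] at e1 e2
          rw [← e2] at e1
          have hu : IsUnit (Hform (q.val.map (((algebraMap (CoordGL n A) S).comp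
              (algebraMap A (CoordGL n A))).comp s))
              (entryPow p ((genMatrix n A).map (algebraMap (CoordGL n A) S)))).det := by
            have := hf.det_Xp
            rw [hgen] at this
            rw [Hform, Matrix.det_mul, Matrix.det_mul, Matrix.det_transpose, det_map']
            exact (this.mul (hq.map _)).mul this
          have e3 := congrArg (fun Z => (Hform (q.val.map (((algebraMap (CoordGL n A) S).comp
              (algebraMap A (CoordGL n A))).comp s))
              (entryPow p ((genMatrix n A).map (algebraMap (CoordGL n A) S))))⁻¹ * Z) e1
          simp only [Matrix.nonsing_inv_mul_cancel_left _ _ hu] at e3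
          exact e3
        · intro i j
          rw [← Ideal.Quotient.eq]
          exact (DFunLike.congr_fun hfg (modelY s p q.val i j)).symm
      refine AlgHom.coe_ringHom_injective (modelRing_hom_ext ?_ ?_ hYeq.symm)
      · rw [hconst, hconst]
      · rw [hgen, hgen]
    -- Existence of the lift: lift `y` entrywise at random and correct it to an exact root. The
    -- remaining conditions ask for units, and units lift modulo a nilpotent ideal.
    · intro g
      have hg := hM.map h2 (g : ModelRing s p q.val →+* S ⧸ I)
      have hgc := hconst g
      have hgX := hgen g
      rw [hgc, hgX] at hg
      have hmk : algebraMap (CoordGL n A) (S ⧸ I) =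
          (Ideal.Quotient.mk I).comp (algebraMap (CoordGL n A) S) := rfl
      set a : A →+* S := (algebraMap (CoordGL n A) S).comp (algebraMap A (CoordGL n A)) with ha
      set X : Matrix (Fin n) (Fin n) S := (genMatrix n A).map (algebraMap (CoordGL n A) S) with hXd
      have hXq : (genMatrix n A).map (algebraMap (CoordGL n A) (S ⧸ I)) =
          X.map (Ideal.Quotient.mk I) := by
        rw [hmk, hXd, Matrix.map_map]; rfl
      have haq : (algebraMap (CoordGL n A) (S ⧸ I)).comp (algebraMap A (CoordGL n A)) =
          (Ideal.Quotient.mk I).comp a := by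
        rw [hmk, ha, RingHom.comp_assoc]
      rw [haq, hXq] at hg
      have hu := @isUnit_of_quotient_sq S _ I hI
      obtain ⟨Y₀, hY₀⟩ : ∃ Y₀ : Matrix (Fin n) (Fin n) S,
          Y₀.map (Ideal.Quotient.mk I) = (modelY s p q.val).map (g : ModelRing s p q.val →+* S ⧸ I) :=
        ⟨Matrix.of fun i j => (Ideal.Quotient.mk_surjective (g (modelY s p q.val i j))).choose, by
          ext i j; exact (Ideal.Quotient.mk_surjective (g (modelY s p q.val i j))).choose_spec⟩
      rw [← hY₀] at hg
      have uX : IsUnit X.det := by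
        refine hu ?_; rw [← det_map']; exact hg.det_X
      have uXp : IsUnit (entryPow p X).det := by
        refine hu ?_; rw [← det_map', entryPow_map']; exact hg.det_Xp
      have uF : IsUnit (entryPow p (Hform (q.val.map a) X)).det := by
        refine hu ?_
        rw [← det_map', entryPow_map', Hform_map', Matrix.map_map, ← RingHom.coe_comp]
        exact hg.det_F
      have uj : IsUnit (jor Y₀) := by
        refine hu ?_; rw [map_jor h2S]; exact hg.jor_Y
      have uH : IsUnit (Hform (q.val.map (a.comp s)) (entryPow p X)).det := by
        rw [Hform, Matrix.det_mul, Matrix.det_mul, Matrix.det_transpose, det_map']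
        exact (uXp.mul (hq.map _)).mul uXp
      obtain ⟨Y, hYI, hY⟩ := exists_sqrt_lift h2S hI uH uj
        (F := entryPow p (Hform (q.val.map a) X)) (by
          intro i j
          rw [← Ideal.Quotient.eq_zero_iff_mem]
          have := hg.rel
          have e1 : Hform (q.val.map (((Ideal.Quotient.mk I).comp a).comp s))
              (entryPow p (X.map (Ideal.Quotient.mk I))) =
              (Hform (q.val.map (a.comp s)) (entryPow p X)).map (Ideal.Quotient.mk I) := by
            rw [Hform_map', entryPow_map', Matrix.map_map]; rfl
          have e2 : entryPow p (Hform (q.val.map ((Ideal.Quotient.mk I).comp a))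
              (X.map (Ideal.Quotient.mk I))) =
              (entryPow p (Hform (q.val.map a) X)).map (Ideal.Quotient.mk I) := by
            rw [entryPow_map', Hform_map', Matrix.map_map]; rfl
          rw [e1, e2, ← Matrix.map_mul, ← Matrix.map_mul] at this
          have h6 := congrFun (congrFun this i) j
          rw [Matrix.map_apply, Matrix.map_apply] at h6
          rw [Matrix.sub_apply, map_sub, h6, sub_self])
      have hYm : Y.map (Ideal.Quotient.mk I) = Y₀.map (Ideal.Quotient.mk I) := by
        ext i j
        exact Ideal.Quotient.eq.mpr (hYI i j)
      have hR : ModelRel s p q.val a X Y :=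
        { det_X := uX
          det_Xp := uXp
          det_F := uF
          det_Y := by
            refine hu ?_
            rw [← det_map', Matrix.map_add _ (map_add _), Matrix.map_one _ (map_zero _) (map_one _),
              hYm]
            exact hg.det_Y
          jor_Y := by
            refine hu ?_
            rw [map_jor h2S, hYm]; exact hg.jor_Y
          rel := hY }
      obtain ⟨f, hfc, hfX, hfY⟩ := hR.exists_hom h2 hq
      have hfB : ∀ z, f (algebraMap (CoordGL n A) (ModelRing s p q.val) z) =
          algebraMap (CoordGL n A) S z := by
        intro z
        refine RingHom.congr_fun (f := f.comp (modelLeft s p q))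
          (CoordGL.ringHom_ext ?_ ?_) z
        · rw [RingHom.comp_assoc, hC, hfc]
        · rw [RingHom.coe_comp, ← Matrix.map_map, hX, hfX]
      refine ⟨{ f with commutes' := hfB }, ?_⟩
      refine AlgHom.coe_ringHom_injective (modelRing_hom_ext ?_ ?_ ?_)
      · rw [hconst, hconst]
      · rw [hgen, hgen]
      · rw [← hY₀, ← hYm, ← hfY, Matrix.map_map]
        rfl
  exact ⟨hfe, hfp⟩

end Etale

end ArithChern

namespace ArithChern

variable {n : ℕ}

/-! ## The Frobenius endomorphism in characteristic `p` -/

section Frobenius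

/-- The Frobenius endomorphism of a ring in which the prime `p` vanishes. -/
def frobeniusOf {p : ℕ} (hp : p.Prime) {R : Type*} [CommRing R] (h0 : (p : R) = 0) : R →+* R where
  toFun x := x ^ p
  map_one' := one_pow p
  map_mul' x y := mul_pow x y p
  map_zero' := zero_pow hp.ne_zero
  map_add' x y := by
    obtain ⟨r, hr⟩ := exists_add_pow_prime_eq hp x y
    rw [hr, h0]; ring

theorem entryPow_eq_map {p : ℕ} (hp : p.Prime) {R : Type*} [CommRing R] (h0 : (p : R) = 0)
    (X : Matrix (Fin n) (Fin n) R) : entryPow p X = X.map (frobeniusOf hp h0) := rfl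

theorem entryPow_Hform_of_char {p : ℕ} (hp : p.Prime) {R : Type*} [CommRing R] (h0 : (p : R) = 0)
    (Q X : Matrix (Fin n) (Fin n) R) :
    entryPow p (Hform Q X) = Hform (entryPow p Q) (entryPow p X) := by
  rw [entryPow_eq_map hp h0, entryPow_eq_map hp h0, entryPow_eq_map hp h0, Hform_map']

theorem det_entryPow_of_char {p : ℕ} (hp : p.Prime) {R : Type*} [CommRing R] (h0 : (p : R) = 0)
    (X : Matrix (Fin n) (Fin n) R) : (entryPow p X).det = X.det ^ p := by
  rw [entryPow_eq_map hp h0, det_map']; rfl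

theorem natCast_quotient_eq_zero (p : ℕ) (T : Type*) [CommRing T] :
    (p : T ⧸ Ideal.span {(p : T)}) = 0 := by
  have := Ideal.Quotient.eq_zero_iff_mem.mpr (Ideal.mem_span_singleton_self (p : T))
  simpa using this

theorem map_mk_eq_iff {p : ℕ} {T : Type*} [CommRing T] {X Y : Matrix (Fin n) (Fin n) T} :
    X.map (Ideal.Quotient.mk (Ideal.span {(p : T)})) =
      Y.map (Ideal.Quotient.mk (Ideal.span {(p : T)})) ↔ ∃ Z, X = Y + (p : T) • Z := by
  constructor
  · intro h
    have : ∀ i j, ∃ z, X i j - Y i j = p * z := fun i j => by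
      have := congrFun (congrFun h i) j
      rw [Matrix.map_apply, Matrix.map_apply, Ideal.Quotient.eq, Ideal.mem_span_singleton] at this
      exact this
    choose Z hZ using this
    refine ⟨Matrix.of Z, ?_⟩
    ext i j
    simp [← hZ]
  · rintro ⟨Z, rfl⟩
    ext i j
    simp [natCast_quotient_eq_zero]

theorem transpose_entryPow (p : ℕ) {R : Type*} [CommRing R] (X : Matrix (Fin n) (Fin n) R) :
    (entryPow p X)ᵀ = entryPow p Xᵀ := rfl

theorem entryPow_neg {p : ℕ} (hp : Odd p) {R : Type*} [CommRing R] (X : Matrix (Fin n) (Fin n) R) :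
    entryPow p (-X) = -entryPow p X := by
  ext i j; simp [entryPow, hp.neg_pow]

theorem transpose_Hform {R : Type*} [CommRing R] (Q X : Matrix (Fin n) (Fin n) R) :
    (Hform Q X)ᵀ = Hform Qᵀ X := by
  simp [Hform, Matrix.transpose_mul, Matrix.mul_assoc]

theorem Hform_neg {R : Type*} [CommRing R] (Q X : Matrix (Fin n) (Fin n) R) :
    Hform (-Q) X = -Hform Q X := by
  simp [Hform]

/-- Oddness of `p` is what makes raising entries to the `p`-th power respect antisymmetry, so `H`
and `F` have the same symmetry type. -/
theorem transpose_Hform_entryPow {p : ℕ} (hp : Odd p) {R : Type*} [CommRing R]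
    {Q Q' X X' : Matrix (Fin n) (Fin n) R}
    (h : (Qᵀ = Q ∧ Q'ᵀ = Q') ∨ (Qᵀ = -Q ∧ Q'ᵀ = -Q')) :
    ((Hform Q X)ᵀ = Hform Q X ∧ (entryPow p (Hform Q' X'))ᵀ = entryPow p (Hform Q' X')) ∨
    ((Hform Q X)ᵀ = -Hform Q X ∧ (entryPow p (Hform Q' X'))ᵀ = -entryPow p (Hform Q' X')) := by
  rcases h with ⟨h1, h2⟩ | ⟨h1, h2⟩
  · left
    rw [transpose_Hform, h1, transpose_entryPow, transpose_Hform, h2]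
    exact ⟨rfl, rfl⟩
  · right
    rw [transpose_Hform, h1, transpose_entryPow, transpose_Hform, h2, Hform_neg, Hform_neg,
      entryPow_neg hp]
    exact ⟨rfl, rfl⟩

/-- Transpose the relation; in the antisymmetric case the two signs cancel. -/
theorem transpose_mul_of_sq {R : Type*} [CommRing R] {H F Y : Matrix (Fin n) (Fin n) R}
    (h : (Hᵀ = H ∧ Fᵀ = F) ∨ (Hᵀ = -H ∧ Fᵀ = -F)) (hr : H * (Y * Y) = F) :
    Yᵀ * Yᵀ * H = F := by
  have h1 := congrArg Matrix.transpose hr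
  rw [Matrix.transpose_mul, Matrix.transpose_mul] at h1
  rcases h with ⟨h2, h3⟩ | ⟨h2, h3⟩
  · rwa [h2, h3] at h1
  · rw [h2, h3, mul_neg, neg_inj] at h1
    exact h1

end Frobenius

/-! ## The square root over the completion, and the lift of Frobenius -/

section Chern

variable {A : Type u} [CommRing A]

/-- Modulo `p` the entrywise power is a ring homomorphism and `q^{(p)} = s(q)`, so `F = H` and `H⁻¹F
≡ 1` has a root `Y ≡ 1`. The unit conditions may be tested modulo `p`, where `Y + 1 = 2` and `jor 1
= 1`. -/
theorem IsPComplete.exists_modelRel {s : A →+* A} {p : ℕ} (hp : p.Prime)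
    (hs : ∀ c, (p : A) ∣ s c - c ^ p) (h2 : IsUnit (2 : A)) {q : Matrix (Fin n) (Fin n) A}
    (hq : IsUnit q.det) {T : Type v} [CommRing T] (hT : IsPComplete p T) (a : A →+* T)
    {X : Matrix (Fin n) (Fin n) T} (hX : IsUnit X.det) :
    ∃ Y b, Y = 1 + (p : T) • b ∧ ModelRel s p q a X Y := by
  set π := Ideal.Quotient.mk (Ideal.span {(p : T)}) with hπ
  have h0 := natCast_quotient_eq_zero p T
  have h2T := isUnit_two_of_map h2 a
  have hXp : IsUnit (entryPow p X).det := by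
    refine hT.isUnit_of_quotient ?_
    rw [← det_map', entryPow_map', det_entryPow_of_char hp h0, det_map']
    exact (hX.map _).pow p
  set H := Hform (q.map (a.comp s)) (entryPow p X) with hH
  set F := entryPow p (Hform (q.map a) X) with hF
  have hHu : IsUnit H.det := by
    rw [hH, Hform, Matrix.det_mul, Matrix.det_mul, Matrix.det_transpose, det_map']
    exact (hXp.mul (hq.map _)).mul hXp
  have hsq : entryPow p ((q.map a).map π) = (q.map (a.comp s)).map π := by
    ext i j
    obtain ⟨c, hc⟩ := hs (q i j)
    have : s (q i j) = q i j ^ p + p * c := by rw [← hc]; ring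
    simp [entryPow, this, h0]
  have hFH : F.map π = H.map π := by
    rw [hF, hH, entryPow_map', Hform_map', entryPow_Hform_of_char hp h0, Hform_map', hsq,
      entryPow_map']
  obtain ⟨G, hG⟩ := map_mk_eq_iff.mp hFH
  have hf : H⁻¹ * F = 1 + (p : T) • (H⁻¹ * G) := by
    rw [hG, mul_add, Matrix.nonsing_inv_mul _ hHu, Matrix.mul_smul]
  obtain ⟨Y, b, hYb, hYY⟩ := hT.exists_sqrt h2T hf
  have hYπ : Y.map π = 1 := by
    have := map_mk_eq_iff.mpr ⟨b, hYb⟩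
    rw [this, Matrix.map_one _ (map_zero _) (map_one _)]
  refine ⟨Y, b, hYb, ⟨hX, hXp, ?_, ?_, ?_, ?_⟩⟩
  · refine hT.isUnit_of_quotient ?_
    rw [← det_map']
    change IsUnit (F.map π).det
    rw [hFH, det_map']
    exact hHu.map _
  · refine hT.isUnit_of_quotient ?_
    rw [← det_map', Matrix.map_add _ (map_add _), Matrix.map_one _ (map_zero _) (map_one _), hYπ,
      show (1 + 1 : Matrix (Fin n) (Fin n) (T ⧸ Ideal.span {(p : T)})) = (2 : T ⧸ Ideal.span {(p : T)}) • 1 by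
        rw [two_smul], Matrix.det_smul, Matrix.det_one, mul_one]
    exact (isUnit_two_of_map h2T π).pow _
  · refine hT.isUnit_of_quotient ?_
    rw [map_jor h2T, hYπ, jor_one (isUnit_two_of_map h2T π)]
    exact isUnit_one
  · rw [hYY, Matrix.mul_nonsing_inv_cancel_left _ _ hHu]

/-- Modulo `p` the relation reads `Y² = 1`, that is `(Y + 1)(Y - 1) = 0`. Invertibility of `det (Y +
1)` selects the root `1`; this is why that determinant is inverted in the model. -/
theorem ModelRel.eq_one_add {s : A →+* A} {p : ℕ} (hp : p.Prime)
    (hs : ∀ c, (p : A) ∣ s c - c ^ p) {q : Matrix (Fin n) (Fin n) A}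
    (hq : IsUnit q.det) {T : Type v} [CommRing T] {a : A →+* T}
    {X Y : Matrix (Fin n) (Fin n) T} (h : ModelRel s p q a X Y) :
    ∃ b, Y = 1 + (p : T) • b := by
  rw [← map_mk_eq_iff]
  set π := Ideal.Quotient.mk (Ideal.span {(p : T)}) with hπ
  have h0 := natCast_quotient_eq_zero p T
  have hsq : entryPow p ((q.map a).map π) = (q.map (a.comp s)).map π := by
    ext i j
    obtain ⟨c, hc⟩ := hs (q i j)
    have : s (q i j) = q i j ^ p + p * c := by rw [← hc]; ring
    simp [entryPow, this, h0]
  have hHu : IsUnit (Hform (q.map (a.comp s)) (entryPow p X)).det := by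
    rw [Hform, Matrix.det_mul, Matrix.det_mul, Matrix.det_transpose, det_map']
    exact (h.det_Xp.mul (hq.map _)).mul h.det_Xp
  have h1 := congrArg (fun Z : Matrix (Fin n) (Fin n) T => Z.map π) h.rel
  simp only [Matrix.map_mul] at h1
  rw [entryPow_map', Hform_map', Hform_map', entryPow_Hform_of_char hp h0, hsq, entryPow_map'] at h1
  set H := Hform ((q.map (a.comp s)).map π) (entryPow p (X.map π)) with hH
  have hHu' : IsUnit H.det := by
    rw [hH, ← entryPow_map', ← Hform_map', det_map']
    exact hHu.map _
  have h3 : Y.map π * Y.map π = 1 := by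
    have h4 := congrArg (fun Z => H⁻¹ * Z) h1
    simp only [Matrix.nonsing_inv_mul_cancel_left _ _ hHu', Matrix.nonsing_inv_mul _ hHu'] at h4
    exact h4
  have h5 : (Y.map π + 1) * (Y.map π - 1) = 0 := by
    rw [add_mul, mul_sub, h3]; simp
  have h6 : IsUnit (Y.map π + 1).det := by
    have := h.det_Y.map π
    rwa [← det_map', Matrix.map_add _ (map_add π), Matrix.map_one _ (map_zero π) (map_one π)] at this
  have h7 := congrArg (fun Z => (Y.map π + 1)⁻¹ * Z) h5
  simp only [Matrix.nonsing_inv_mul_cancel_left _ _ h6, mul_zero] at h7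
  rw [sub_eq_zero.mp h7, Matrix.map_one _ (map_zero _) (map_one _)]

theorem ModelRel.unique {s : A →+* A} {p : ℕ} (hp : p.Prime)
    (hs : ∀ c, (p : A) ∣ s c - c ^ p) (h2 : IsUnit (2 : A)) {q : Matrix (Fin n) (Fin n) A}
    (hq : IsUnit q.det) {T : Type v} [CommRing T] (hT : IsPComplete p T) {a : A →+* T}
    {X Y Y' : Matrix (Fin n) (Fin n) T} (h : ModelRel s p q a X Y) (h' : ModelRel s p q a X Y') :
    Y = Y' := by
  obtain ⟨b, hb⟩ := h.eq_one_add hp hs hq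
  obtain ⟨b', hb'⟩ := h'.eq_one_add hp hs hq
  refine hT.matrix_ext (isUnit_two_of_map h2 a) hb hb' ?_
  have hHu : IsUnit (Hform (q.map (a.comp s)) (entryPow p X)).det := by
    rw [Hform, Matrix.det_mul, Matrix.det_mul, Matrix.det_transpose, det_map']
    exact (h.det_Xp.mul (hq.map _)).mul h.det_Xp
  have h3 := h.rel.trans h'.rel.symm
  have h4 := congrArg (fun Z => (Hform (q.map (a.comp s)) (entryPow p X))⁻¹ * Z) h3
  simpa only [Matrix.nonsing_inv_mul_cancel_left _ _ hHu] using h4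

variable {s : A →+* A} {p : ℕ} {q : Matrix.GeneralLinearGroup (Fin n) A}

variable (A p) in
/-- The structure homomorphism of the completed coordinate ring. -/
noncomputable abbrev constHom (n : ℕ) : A →+* PadicCompletion p (CoordGL n A) :=
  (toPadicCompletion p (CoordGL n A)).comp (algebraMap A (CoordGL n A))

theorem isUnit_det_genHat : IsUnit (genHat n A p).det := by
  rw [genHat, det_map']
  exact isUnit_det_genMatrix.map _

/-- The section `C_p → Ĝ` of the model over the completion. -/
structure IsSection (s : A →+* A) (p : ℕ) (q : Matrix.GeneralLinearGroup (Fin n) A)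
    (Y : Matrix (Fin n) (Fin n) (PadicCompletion p (CoordGL n A)))
    (ψ : ModelRing s p q.val →+* PadicCompletion p (CoordGL n A)) : Prop where
  rel : ModelRel s p q.val (constHom A p n) (genHat n A p) Y
  left : ψ.comp (modelLeft s p q) = toPadicCompletion p (CoordGL n A)
  map_Y : (modelY s p q.val).map ψ = Y

theorem exists_isSection (hp : p.Prime) (hs : ∀ c, (p : A) ∣ s c - c ^ p) (h2 : IsUnit (2 : A))
    (q : Matrix.GeneralLinearGroup (Fin n) A) : ∃ Y ψ, IsSection s p q Y ψ := by
  obtain ⟨Y, -, -, hY⟩ := IsPComplete.exists_modelRel hp hs h2 (isUnit_det_q q)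
    (PadicCompletion.isPComplete p (CoordGL n A)) (constHom A p n) isUnit_det_genHat
  obtain ⟨ψ, h1, h3, h4⟩ := hY.exists_hom h2 (isUnit_det_q q)
  refine ⟨Y, ψ, hY, CoordGL.ringHom_ext ?_ ?_, h4⟩
  · rw [RingHom.comp_assoc, modelLeft_const, h1]
  · rw [RingHom.coe_comp, ← Matrix.map_map, modelLeft_gen, h3]; rfl

/-- Both maps give points of the model over a complete ring with the same `x`, and the matrix `Y` of
such a point is unique. -/
theorem IsSection.comp_eq (hp : p.Prime) (hs : ∀ c, (p : A) ∣ s c - c ^ p) (h2 : IsUnit (2 : A))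
    {Y : Matrix (Fin n) (Fin n) (PadicCompletion p (CoordGL n A))}
    {ψ : ModelRing s p q.val →+* PadicCompletion p (CoordGL n A)} (h : IsSection s p q Y ψ) :
    (PadicCompletion.map p (modelLeft s p q)).comp ψ =
      toPadicCompletion p (ModelRing s p q.val) := by
  have hM := (modelRel s p q.val (isUnit_det_q q) h2)
  have e1 : ((PadicCompletion.map p (modelLeft s p q)).comp ψ).comp (modelLeft s p q) =
      (toPadicCompletion p (ModelRing s p q.val)).comp (modelLeft s p q) := by
    rw [RingHom.comp_assoc, h.left, PadicCompletion.map_comp_to]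
  have e2 : ((PadicCompletion.map p (modelLeft s p q)).comp ψ).comp (modelConst s p q.val) =
      (toPadicCompletion p (ModelRing s p q.val)).comp (modelConst s p q.val) := by
    rw [← modelLeft_const, ← RingHom.comp_assoc, e1, RingHom.comp_assoc]
  have e3 : (modelX s p q.val).map ((PadicCompletion.map p (modelLeft s p q)).comp ψ) =
      (modelX s p q.val).map (toPadicCompletion p (ModelRing s p q.val)) := by
    rw [← modelLeft_gen, Matrix.map_map, Matrix.map_map, ← RingHom.coe_comp, e1]
    rfl
  refine modelRing_hom_ext e2 e3 ?_
  have r1 := hM.map h2 ((PadicCompletion.map p (modelLeft s p q)).comp ψ)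
  have r2 := hM.map h2 (toPadicCompletion p (ModelRing s p q.val))
  rw [e2, e3] at r1
  exact r1.unique hp hs h2 (isUnit_det_q q) (PadicCompletion.isPComplete p _) r2

/-- The section takes values in the completion, so it need not be completed itself: approximations
in `S` are pushed through `ψ`, and `p`-adic limits do the rest. -/
theorem PadicCompletion.map_bijective_of_section {R S : Type u} [CommRing R] [CommRing S]
    {f : R →+* S} {ψ : S →+* PadicCompletion p R} (h1 : ψ.comp f = toPadicCompletion p R)
    (h2 : (PadicCompletion.map p f).comp ψ = toPadicCompletion p S) :
    Function.Bijective (PadicCompletion.map p f) := by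
  -- Divisibility is reflected: after approximating `z` by `b`, `p^k` divides `f b` already in `S`,
  -- and applying `ψ` brings this back to `b`.
  have key : ∀ (k : ℕ) z, (p : PadicCompletion p S) ^ k ∣ PadicCompletion.map p f z →
      (p : PadicCompletion p R) ^ k ∣ z := by
    intro k z hz
    obtain ⟨b, c, hc⟩ := PadicCompletion.exists_sub_dvd z k
    have h3 : z = (p : PadicCompletion p R) ^ k * c + toPadicCompletion p R b := by rw [← hc]; ring
    rw [h3, map_add, map_mul, map_pow, map_natCast, PadicCompletion.map_of,
      dvd_add_right (dvd_mul_right _ _), PadicCompletion.pow_dvd_of_iff] at hz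
    have h4 := map_dvd ψ hz
    rw [map_pow, map_natCast, ← RingHom.comp_apply, h1] at h4
    rw [h3]
    exact dvd_add (dvd_mul_right _ _) h4
  constructor
  · rw [injective_iff_map_eq_zero]
    intro z hz
    exact (PadicCompletion.isPComplete p R).separated z fun k => key k z (hz ▸ dvd_zero _)
  · intro w
    choose c hc using fun k => PadicCompletion.exists_sub_dvd w k
    have h5 : ∀ k, PadicCompletion.map p f (ψ (c k)) = toPadicCompletion p S (c k) := fun k =>
      RingHom.congr_fun h2 (c k)
    obtain ⟨z, hz⟩ := (PadicCompletion.isPComplete p R).complete (fun k => ψ (c k)) (fun k => by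
      refine key _ _ ?_
      rw [map_sub, h5, h5]
      have e1 := ((pow_dvd_pow (p : PadicCompletion p S) k.le_succ).trans (hc (k + 1)))
      have e2 := (hc k).sub e1
      convert e2 using 1
      ring)
    refine ⟨z, sub_eq_zero.mp ((PadicCompletion.isPComplete p S).separated _ fun k => ?_)⟩
    have e1 := map_dvd (PadicCompletion.map p f) (hz k)
    rw [map_sub, h5, map_pow, map_natCast] at e1
    have e2 := e1.sub (hc k)
    convert e2 using 1
    ring

/-- The properties characterizing the lift of Frobenius attached to a section of the model. -/
theorem IsSection.exists_frob (hp : p.Prime) (hs : ∀ c, (p : A) ∣ s c - c ^ p)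
    (h2 : IsUnit (2 : A))
    {Y : Matrix (Fin n) (Fin n) (PadicCompletion p (CoordGL n A))}
    {ψ : ModelRing s p q.val →+* PadicCompletion p (CoordGL n A)} (h : IsSection s p q Y ψ) :
    ∃ Φ : PadicCompletion p (CoordGL n A) →+* PadicCompletion p (CoordGL n A),
      (chernModel s p q).Algebraizes p Φ ∧
      Φ.comp (toPadicCompletion p (CoordGL n A)) = ψ.comp (modelRight s p q) ∧
      Φ.comp (constHom A p n) = (constHom A p n).comp s ∧
      (genHat n A p).map Φ = entryPow p (genHat n A p) * Y ∧
      ∀ z, (p : PadicCompletion p (CoordGL n A)) ∣ Φ z - z ^ p := by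
  have hcomp := h.comp_eq hp hs h2
  have hbij := PadicCompletion.map_bijective_of_section h.left hcomp
  -- The lift of Frobenius is read off from the correspondence: the right map followed by the
  -- inverse of the left map, on completions.
  let e := RingEquiv.ofBijective _ hbij
  let Φ : PadicCompletion p (CoordGL n A) →+* PadicCompletion p (CoordGL n A) :=
    (e.symm : _ →+* _).comp (PadicCompletion.map p (modelRight s p q))
  have hΦ : ∀ z, PadicCompletion.map p (modelLeft s p q) (Φ z) =
      PadicCompletion.map p (modelRight s p q) z := fun z => e.apply_symm_apply _
  have hΦto : Φ.comp (toPadicCompletion p (CoordGL n A)) = ψ.comp (modelRight s p q) := by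
    refine RingHom.ext fun b => hbij.1 ?_
    rw [RingHom.comp_apply, hΦ, PadicCompletion.map_of]
    exact (RingHom.congr_fun hcomp (modelRight s p q b)).symm
  have hψc : ψ.comp (modelConst s p q.val) = constHom A p n := by
    rw [← modelLeft_const, ← RingHom.comp_assoc, h.left]
  have hψX : (modelX s p q.val).map ψ = genHat n A p := by
    rw [← modelLeft_gen, Matrix.map_map, ← RingHom.coe_comp, h.left]; rfl
  have hΦc : Φ.comp (constHom A p n) = (constHom A p n).comp s := by
    rw [← RingHom.comp_assoc, hΦto, RingHom.comp_assoc, modelRight_const, ← RingHom.comp_assoc, hψc]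
  have hΦX : (genHat n A p).map Φ = entryPow p (genHat n A p) * Y := by
    rw [genHat, Matrix.map_map, ← RingHom.coe_comp, hΦto, RingHom.coe_comp, ← Matrix.map_map,
      modelRight_gen, Matrix.map_mul, h.map_Y, entryPow_map', hψX]; rfl
  refine ⟨Φ, ⟨modelLeft_etale s p q h2, hbij, RingHom.ext fun z => (hΦ z).symm⟩, hΦto, hΦc, hΦX, ?_⟩
  have h0 := natCast_quotient_eq_zero p (PadicCompletion p (CoordGL n A))
  set π := Ideal.Quotient.mk (Ideal.span {(p : PadicCompletion p (CoordGL n A))}) with hπ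
  obtain ⟨b, hb⟩ := h.rel.eq_one_add hp hs (isUnit_det_q q)
  have hYπ : Y.map π = 1 := by
    have := map_mk_eq_iff.mpr ⟨b, hb⟩
    rw [this, Matrix.map_one _ (map_zero _) (map_one _)]
  -- Being a Frobenius modulo `p` is an equality of ring homomorphisms, so it suffices to check
  -- constants and the entries of `x`, where `Y ≡ 1` gives `x ↦ x^{(p)}`.
  have hfrob : (π.comp Φ).comp (toPadicCompletion p (CoordGL n A)) =
      ((frobeniusOf hp h0).comp π).comp (toPadicCompletion p (CoordGL n A)) := by
    refine CoordGL.ringHom_ext ?_ ?_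
    · have e0 : ((π.comp Φ).comp (toPadicCompletion p (CoordGL n A))).comp (algebraMap A _) =
          π.comp (Φ.comp (constHom A p n)) := rfl
      rw [e0, hΦc]
      ext c
      obtain ⟨d, hd⟩ := hs c
      have : s c = c ^ p + p * d := by rw [← hd]; ring
      simp [this, frobeniusOf, h0]
    · have e1 : (genMatrix n A).map ((π.comp Φ).comp (toPadicCompletion p (CoordGL n A))) =
          ((genHat n A p).map Φ).map π := by
        rw [genHat, Matrix.map_map, Matrix.map_map]; rfl
      rw [e1, hΦX, Matrix.map_mul, hYπ, mul_one, entryPow_map', entryPow_eq_map hp h0, genHat,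
        Matrix.map_map, Matrix.map_map]
      rfl
  intro z
  obtain ⟨b, c, hc⟩ := PadicCompletion.exists_sub_dvd z 1
  have h3 : z = (p : PadicCompletion p (CoordGL n A)) * c + toPadicCompletion p _ b := by
    rw [pow_one] at hc; rw [← hc]; ring
  rw [← Ideal.mem_span_singleton, ← Ideal.Quotient.eq]
  have h4 := RingHom.congr_fun hfrob b
  have h5 : π z = π (toPadicCompletion p _ b) := by
    rw [h3, map_add, map_mul, map_natCast, h0, zero_mul, zero_add]
  have h6 : π (Φ z) = π (Φ (toPadicCompletion p _ b)) := by
    rw [h3, map_add, map_mul, map_natCast, map_add, map_mul, map_natCast, h0, zero_mul, zero_add]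
  change π (Φ z) = π (z ^ p)
  rw [h6, map_pow, h5]
  exact h4

/-- Because `H` and `F` have the same symmetry type, `H⁻¹ Yᵗ H` is also a square root of `H⁻¹F`
congruent to `1`; uniqueness of such roots identifies it with `Y`. -/
theorem mul_eq_transpose_mul (hp : p.Prime) (hp2 : Odd p) (hs : ∀ c, (p : A) ∣ s c - c ^ p)
    (h2 : IsUnit (2 : A)) (hqs : q.valᵀ = q.val ∨ q.valᵀ = -q.val)
    {Y : Matrix (Fin n) (Fin n) (PadicCompletion p (CoordGL n A))}
    (h : ModelRel s p q.val (constHom A p n) (genHat n A p) Y) :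
    Hform (q.val.map ((constHom A p n).comp s)) (entryPow p (genHat n A p)) * Y =
      Yᵀ * Hform (q.val.map ((constHom A p n).comp s)) (entryPow p (genHat n A p)) := by
  have hrel := h.rel
  have hsym := transpose_Hform_entryPow hp2 (Q := q.val.map ((constHom A p n).comp s))
    (Q' := q.val.map (constHom A p n)) (X := entryPow p (genHat n A p)) (X' := genHat n A p) (by
      rw [← Matrix.transpose_map, ← Matrix.transpose_map]
      rcases hqs with hq | hq
      · left; rw [hq]; exact ⟨rfl, rfl⟩
      · right
        rw [hq, Matrix.map_neg _ (map_neg _), Matrix.map_neg _ (map_neg _)]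
        exact ⟨rfl, rfl⟩)
  have hHu : IsUnit (Hform (q.val.map ((constHom A p n).comp s))
      (entryPow p (genHat n A p))).det := by
    rw [Hform, Matrix.det_mul, Matrix.det_mul, Matrix.det_transpose, det_map']
    exact (h.det_Xp.mul ((isUnit_det_q q).map _)).mul h.det_Xp
  obtain ⟨b, hb⟩ := h.eq_one_add hp hs (isUnit_det_q q)
  set H := Hform (q.val.map ((constHom A p n).comp s)) (entryPow p (genHat n A p)) with hH
  have htr := transpose_mul_of_sq hsym hrel
  have hY' : H⁻¹ * Yᵀ * H = 1 + (p : PadicCompletion p (CoordGL n A)) • (H⁻¹ * bᵀ * H) := by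
    rw [hb, Matrix.transpose_add, Matrix.transpose_one, Matrix.transpose_smul, mul_add, add_mul,
      mul_one, Matrix.nonsing_inv_mul _ hHu, Matrix.mul_smul, Matrix.smul_mul]
  have hYY : Y = H⁻¹ * Yᵀ * H := by
    refine (PadicCompletion.isPComplete p _).matrix_ext
      (isUnit_two_of_map h2 (constHom A p n)) hb hY' ?_
    have e1 : H⁻¹ * Yᵀ * H * (H⁻¹ * Yᵀ * H) = H⁻¹ * (Yᵀ * Yᵀ * H) := by
      simp only [Matrix.mul_assoc, Matrix.mul_nonsing_inv_cancel_left _ _ hHu]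
    rw [e1, htr, ← hrel, Matrix.nonsing_inv_mul_cancel_left _ _ hHu]
  nth_rewrite 1 [hYY]
  rw [Matrix.mul_assoc, Matrix.mul_nonsing_inv_cancel_left _ _ hHu]

/-- A lift of Frobenius satisfying the two Chern equations is the one attached to the section. -/
theorem IsSection.frob_unique (hp : p.Prime) (hs : ∀ c, (p : A) ∣ s c - c ^ p)
    (h2 : IsUnit (2 : A))
    {Y : Matrix (Fin n) (Fin n) (PadicCompletion p (CoordGL n A))}
    {ψ : ModelRing s p q.val →+* PadicCompletion p (CoordGL n A)} (h : IsSection s p q Y ψ)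
    {Φ : PadicCompletion p (CoordGL n A) →+* PadicCompletion p (CoordGL n A)}
    (hc : Φ.comp (constHom A p n) = (constHom A p n).comp s)
    (hfr : ∀ z, (p : PadicCompletion p (CoordGL n A)) ∣ Φ z - z ^ p)
    (hH : Hform ((constHat p q.val).map Φ) ((genHat n A p).map Φ) =
      entryPow p (Hform (constHat p q.val) (genHat n A p)))
    (hB : Bform ((constHat p q.val).map Φ) (entryPow p (genHat n A p)) ((genHat n A p).map Φ) =
      Bform ((constHat p q.val).map Φ) ((genHat n A p).map Φ) (entryPow p (genHat n A p))) :
    (genHat n A p).map Φ = entryPow p (genHat n A p) * Y := by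
  set X := genHat n A p
  set Z := X.map Φ with hZ
  have hu := h.rel.det_Xp
  have hcq : (constHat p q.val).map Φ = q.val.map ((constHom A p n).comp s) := by
    rw [← hc, constHat, Matrix.map_map]; rfl
  rw [hcq] at hH hB
  obtain ⟨W, hW⟩ : ∃ W, Z = entryPow p X + (p : PadicCompletion p (CoordGL n A)) • W := by
    choose W hW using fun i j => hfr (X i j)
    refine ⟨Matrix.of W, ?_⟩
    refine Matrix.ext fun i j => ?_
    rw [Matrix.add_apply, Matrix.smul_apply, Matrix.of_apply, smul_eq_mul, ← hW]
    simp [hZ, entryPow]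
  -- Since the map lifts Frobenius, `Z ≡ x^{(p)}`, hence `Y' ≡ 1`: exactly the normalization that
  -- determines a square root.
  set Y' := (entryPow p X)⁻¹ * Z with hY'
  have hZY : Z = entryPow p X * Y' := by
    rw [hY', Matrix.mul_nonsing_inv_cancel_left _ _ hu]
  have hY1 : Y' = 1 + (p : PadicCompletion p (CoordGL n A)) • ((entryPow p X)⁻¹ * W) := by
    rw [hY', hW, mul_add, Matrix.nonsing_inv_mul _ hu, Matrix.mul_smul]
  obtain ⟨b, hb⟩ := h.rel.eq_one_add hp hs (isUnit_det_q q)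
  set Q := q.val.map ((constHom A p n).comp s) with hQ
  have hHu : IsUnit (Hform Q (entryPow p X)).det := by
    rw [Hform, Matrix.det_mul, Matrix.det_mul, Matrix.det_transpose, hQ, det_map']
    exact (hu.mul ((isUnit_det_q q).map _)).mul hu
  have e1 : Hform Q (entryPow p X) * Y' = Y'ᵀ * Hform Q (entryPow p X) := by
    rw [Bform, Bform, hZY, Matrix.transpose_mul] at hB
    simp only [Hform, Matrix.mul_assoc] at hB ⊢
    exact hB
  have e2 : Y'ᵀ * Hform Q (entryPow p X) * Y' = entryPow p (Hform (constHat p q.val) X) := by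
    rw [← hH, hZY]
    clear_value Y'
    rw [Hform, Hform, Matrix.transpose_mul]
    simp only [Matrix.mul_assoc]
  -- The second Chern equation moves `Y'ᵗ` across `H`, and the first becomes `H Y'² = F`.
  rw [← e1, Matrix.mul_assoc] at e2
  rw [hZY]
  congr 1
  refine (PadicCompletion.isPComplete p _).matrix_ext
      (isUnit_two_of_map h2 (constHom A p n)) hY1 hb ?_
  have e3 := e2.trans h.rel.rel.symm
  have h4 := congrArg (fun Z => (Hform Q (entryPow p X))⁻¹ * Z) e3
  rw [Matrix.nonsing_inv_mul_cancel_left _ _ hHu, Matrix.nonsing_inv_mul_cancel_left _ _ hHu] at h4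
  exact h4

end Chern

end ArithChern

namespace ArithChern

variable {n : ℕ}

/-! ## The coordinate ring over a domain -/

section Domain

variable {A : Type u} [CommRing A] [IsDomain A]

theorem powers_det_le_nonZeroDivisors :
    Submonoid.powers (Matrix.mvPolynomialX (Fin n) (Fin n) A).det ≤
      nonZeroDivisors (MvPolynomial (Fin n × Fin n) A) :=
  powers_le_nonZeroDivisors_of_noZeroDivisors (Matrix.det_mvPolynomialX_ne_zero _ _)

theorem algebraMap_coordGL_injective :
    Function.Injective (algebraMap (MvPolynomial (Fin n × Fin n) A) (CoordGL n A)) :=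
  IsLocalization.injective _ powers_det_le_nonZeroDivisors

instance charZero_coordGL [CharZero A] : CharZero (CoordGL n A) :=
  charZero_of_injective_algebraMap (R := MvPolynomial (Fin n × Fin n) A)
    algebraMap_coordGL_injective

end Domain

/-! ## The ring `ℤ[1/M, ζ_N]` -/

section Arithmetic

variable {M : ℤ} {N : ℕ} [NeZero N] {K : Type u} [Field K] [CharZero K]
  [IsCyclotomicExtension {N} ℚ K]

variable (M N K) in
/-- The root of unity `ζ_N` as an element of `ℤ[1/M, ζ_N]`. -/
noncomputable def zetaA : cycRing M N K := ⟨zetaN N K, Algebra.subset_adjoin (by simp)⟩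

variable (M N K) in
/-- The element `1 / M` of `ℤ[1/M, ζ_N]`. -/
noncomputable def invMA : cycRing M N K := ⟨(M : K)⁻¹, Algebra.subset_adjoin (by simp)⟩

theorem zetaN_primitive : IsPrimitiveRoot (zetaN N K) N := IsCyclotomicExtension.zeta_spec N ℚ K

theorem zetaA_pow : zetaA M N K ^ N = 1 := by
  ext; exact (zetaN_primitive (N := N) (K := K)).pow_eq_one

theorem intCast_mul_invMA (hM0 : M ≠ 0) : (M : cycRing M N K) * invMA M N K = 1 := by
  ext
  simp only [invMA, MulMemClass.coe_mul, OneMemClass.coe_one]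
  have : ((M : cycRing M N K) : K) = (M : K) := by simp
  rw [this]
  exact mul_inv_cancel₀ (by exact_mod_cast hM0)

theorem isUnit_intCast_cycRing (hM0 : M ≠ 0) : IsUnit (M : cycRing M N K) :=
  IsUnit.of_mul_eq_one _ (intCast_mul_invMA hM0)

theorem isUnit_two_cycRing (hM : Even M) (hM0 : M ≠ 0) : IsUnit (2 : cycRing M N K) := by
  obtain ⟨k, hk⟩ := hM
  refine isUnit_of_dvd_unit ⟨(k : cycRing M N K), ?_⟩ (isUnit_intCast_cycRing (N := N) (K := K) hM0)
  rw [hk]; push_cast; ring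

theorem cycRing_hom_ext (hM0 : M ≠ 0) {T : Type v} [CommRing T] {f g : cycRing M N K →+* T}
    (h : f (zetaA M N K) = g (zetaA M N K)) : f = g := by
  have hinv : f (invMA M N K) = g (invMA M N K) := by
    have h1 := congrArg f (intCast_mul_invMA (N := N) (K := K) hM0)
    have h2 := congrArg g (intCast_mul_invMA (N := N) (K := K) hM0)
    rw [map_mul, map_intCast, map_one] at h1 h2
    have hu : IsUnit (M : T) := IsUnit.of_mul_eq_one _ h1
    exact hu.mul_left_cancel (h1.trans h2.symm)
  refine RingHom.ext fun a => ?_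
  obtain ⟨a, ha⟩ := a
  induction ha using Algebra.adjoin_induction with
  | mem x hx =>
    rcases hx with rfl | rfl
    · exact hinv
    · exact h
  | algebraMap r =>
    change f (algebraMap ℤ (cycRing M N K) r) = g (algebraMap ℤ (cycRing M N K) r)
    simp
  | add x y hx hy h1 h2 =>
    have : (⟨x + y, add_mem hx hy⟩ : cycRing M N K) = ⟨x, hx⟩ + ⟨y, hy⟩ := rfl
    rw [this, map_add, map_add, h1, h2]
  | mul x y hx hy h1 h2 =>
    have : (⟨x * y, mul_mem hx hy⟩ : cycRing M N K) = ⟨x, hx⟩ * ⟨y, hy⟩ := rfl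
    rw [this, map_mul, map_mul, h1, h2]

theorem frobA_zetaA {p : ℕ} (hpN : p.Coprime N) :
    frobA M N K p (zetaA M N K) = zetaA M N K ^ p := by
  ext
  exact frobK_zetaN N K p hpN

/-- Modulo `p` both sides are ring homomorphisms, and they agree on `ζ_N`, which together with `1/M`
generates the ring. -/
theorem frobA_congr (hM0 : M ≠ 0) {p : ℕ} (hp : p.Prime) (hpN : p.Coprime N) (c : cycRing M N K) :
    (p : cycRing M N K) ∣ frobA M N K p c - c ^ p := by
  have h0 := natCast_quotient_eq_zero p (cycRing M N K)
  have h : (Ideal.Quotient.mk (Ideal.span {(p : cycRing M N K)})).comp (frobA M N K p) =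
      (frobeniusOf hp h0).comp (Ideal.Quotient.mk (Ideal.span {(p : cycRing M N K)})) := by
    refine cycRing_hom_ext hM0 ?_
    rw [RingHom.comp_apply, frobA_zetaA hpN, map_pow]
    rfl
  rw [← Ideal.mem_span_singleton, ← Ideal.Quotient.eq]
  exact (RingHom.congr_fun h c).trans (map_pow _ _ _).symm

/-- Factor `a^N - b^N` as `(a - b)` times a sum. Modulo `p` the sum is `N b^(N-1)`, a unit because
`p` is prime to `N`, so `a - b = 0`. -/
theorem rootOfUnity_ext {p : ℕ} (hpN : p.Coprime N) {T : Type v} [CommRing T]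
    (hT : IsPComplete p T) {a b : T} (ha : a ^ N = 1) (hb : b ^ N = 1) (hab : (p : T) ∣ a - b) :
    a = b := by
  have h0 := natCast_quotient_eq_zero p T
  have h1 := (Commute.all a b).mul_geom_sum₂ N
  rw [ha, hb, sub_self] at h1
  have hN : IsUnit (N : T) := by
    have h2 : (p : ℤ) * p.gcdA N + N * p.gcdB N = 1 := by
      rw [← Nat.gcd_eq_gcd_ab, hpN]; rfl
    have h3 : (N : T) * (p.gcdB N : T) = 1 + p * (-(p.gcdA N : T)) := by
      have := congrArg (Int.cast : ℤ → T) h2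
      push_cast at this
      linear_combination this
    exact hT.isUnit_of_mul h3
  have hbu : IsUnit b := IsUnit.of_mul_eq_one _
    (by rw [← pow_succ', Nat.sub_add_cancel (NeZero.pos N), hb] : b * b ^ (N - 1) = 1)
  have hu : IsUnit (∑ i ∈ Finset.range N, a ^ i * b ^ (N - 1 - i)) := by
    refine hT.isUnit_of_quotient ?_
    have hab' : Ideal.Quotient.mk (Ideal.span {(p : T)}) a =
        Ideal.Quotient.mk (Ideal.span {(p : T)}) b := by
      rwa [Ideal.Quotient.eq, Ideal.mem_span_singleton]
    have h4 : Ideal.Quotient.mk (Ideal.span {(p : T)})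
        (∑ i ∈ Finset.range N, a ^ i * b ^ (N - 1 - i)) =
        Ideal.Quotient.mk (Ideal.span {(p : T)}) (N * b ^ (N - 1)) := by
      simp only [map_sum, map_mul, map_pow, hab', map_natCast]
      rw [Finset.sum_congr rfl (fun i hi => by
        rw [← pow_add, Nat.add_sub_cancel' (by have := Finset.mem_range.mp hi; omega)])]
      simp
    rw [h4]
    exact (hN.mul (hbu.pow _)).map _
  refine sub_eq_zero.mp (hu.mul_left_cancel ?_)
  rw [mul_zero, mul_comm, h1]

/-- The definition of the Chern connection does not prescribe the action on constants. It is
automatic: the image of `ζ_N` is an `N`-th root of unity congruent to `ζ_N^p`. -/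
theorem frob_const_unique (hM0 : M ≠ 0) {p : ℕ} (hpN : p.Coprime N) {T : Type v}
    [CommRing T] (hT : IsPComplete p T) (a : cycRing M N K →+* T) {Φ : T →+* T}
    (hΦ : ∀ z, (p : T) ∣ Φ z - z ^ p) : Φ.comp a = a.comp (frobA M N K p) := by
  refine cycRing_hom_ext hM0 (rootOfUnity_ext hpN hT (N := N) ?_ ?_ ?_)
  · rw [← map_pow, zetaA_pow, map_one]
  · rw [← map_pow, zetaA_pow, map_one]
  · rw [RingHom.comp_apply, RingHom.comp_apply, frobA_zetaA hpN, map_pow]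
    exact hΦ _

/-- For each prime there is exactly one lift of Frobenius satisfying the two Chern equations. -/
theorem exists_unique_chern (hM : Even M) (hM0 : M ≠ 0) {p : ℕ} (hp : p.Prime) (hp2 : Odd p)
    (hpN : p.Coprime N) (q : Matrix.GeneralLinearGroup (Fin n) (cycRing M N K))
    (hq : q.valᵀ = q.val ∨ q.valᵀ = -q.val) :
    ∃ δ : PDerivation p (PadicCompletion p (CoordGL n (cycRing M N K))),
      (Hform ((constHat p q.val).map δ.frob) ((genHat n _ p).map δ.frob) =
        entryPow p (Hform (constHat p q.val) (genHat n _ p))) ∧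
      (Bform ((constHat p q.val).map δ.frob) (entryPow p (genHat n _ p)) ((genHat n _ p).map δ.frob)
        = Bform ((constHat p q.val).map δ.frob) ((genHat n _ p).map δ.frob)
          (entryPow p (genHat n _ p))) ∧
      (chernModelA M N q p).Algebraizes p δ.frob ∧
      ∀ δ' : PDerivation p (PadicCompletion p (CoordGL n (cycRing M N K))),
        (Hform ((constHat p q.val).map δ'.frob) ((genHat n _ p).map δ'.frob) =
          entryPow p (Hform (constHat p q.val) (genHat n _ p))) →
        (Bform ((constHat p q.val).map δ'.frob) (entryPow p (genHat n _ p))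
            ((genHat n _ p).map δ'.frob)
          = Bform ((constHat p q.val).map δ'.frob) ((genHat n _ p).map δ'.frob)
            (entryPow p (genHat n _ p))) → δ' = δ := by
  have h2 := isUnit_two_cycRing (N := N) (K := K) hM hM0
  have hs := frobA_congr (K := K) hM0 hp hpN
  obtain ⟨Y, ψ, hψ⟩ := exists_isSection (s := frobA M N K p) hp hs h2 q
  obtain ⟨Φ, hΦa, -, hΦc, hΦX, hΦf⟩ := hψ.exists_frob hp hs h2
  choose d hd using hΦf
  have hcq : (constHat p q.val).map Φ =
      q.val.map ((constHom (cycRing M N K) p n).comp (frobA M N K p)) := by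
    rw [← hΦc, constHat, Matrix.map_map]; rfl
  have hsym := mul_eq_transpose_mul hp hp2 hs h2 hq hψ.rel
  refine ⟨⟨d, Φ, fun b => by rw [← hd]; ring⟩, ?_, ?_, hΦa, ?_⟩
  · change Hform ((constHat p q.val).map Φ) ((genHat n _ p).map Φ) = _
    rw [hcq, hΦX, Hform, Matrix.transpose_mul]
    rw [Hform] at hsym
    have e : Yᵀ * (entryPow p (genHat n (cycRing M N K) p))ᵀ *
        q.val.map ((constHom (cycRing M N K) p n).comp (frobA M N K p)) *
          (entryPow p (genHat n (cycRing M N K) p) * Y) =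
        (Yᵀ * ((entryPow p (genHat n (cycRing M N K) p))ᵀ *
          q.val.map ((constHom (cycRing M N K) p n).comp (frobA M N K p)) *
          entryPow p (genHat n (cycRing M N K) p))) * Y := by
      simp only [Matrix.mul_assoc]
    rw [e, ← hsym, Matrix.mul_assoc, ← Hform, hψ.rel.rel]
    rfl
  · change Bform ((constHat p q.val).map Φ) _ ((genHat n _ p).map Φ) =
      Bform ((constHat p q.val).map Φ) ((genHat n _ p).map Φ) _
    rw [hcq, hΦX, Bform, Bform, Matrix.transpose_mul]
    rw [Hform] at hsym
    simp only [Matrix.mul_assoc] at hsym ⊢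
    exact hsym
  · intro δ' h1 h3
    have hT := PadicCompletion.isPComplete p (CoordGL n (cycRing M N K))
    have hf' : ∀ z, (p : PadicCompletion p (CoordGL n (cycRing M N K))) ∣ δ'.frob z - z ^ p :=
      fun z => ⟨δ'.delta z, by rw [δ'.frob_apply]; ring⟩
    have hc' := frob_const_unique hM0 hpN hT (constHom (cycRing M N K) p n) hf'
    have hX' := hψ.frob_unique hp hs h2 hc' hf' h1 h3
    have hfrob : δ'.frob = Φ := by
      refine PadicCompletion.ringHom_ext hT.separated (CoordGL.ringHom_ext ?_ ?_)
      · exact hc'.trans hΦc.symm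
      · have := hX'.trans hΦX.symm
        rw [genHat, Matrix.map_map, Matrix.map_map] at this
        exact this
    refine PDerivation.ext (funext fun b => ?_) hfrob
    -- A lift of Frobenius determines its `p`-derivation only because the completion has no
    -- `p`-torsion, inherited from the coordinate ring, a domain of characteristic zero.
    refine sub_eq_zero.mp (PadicCompletion.mul_left_cancel (p := p) (fun b hb => ?_) ?_)
    · exact (mul_eq_zero.mp hb).resolve_left (Nat.cast_ne_zero.mpr hp.ne_zero)
    · have e1 := δ'.frob_apply b
      rw [hfrob] at e1
      rw [mul_sub, ← hd b, e1]; ring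

theorem exists_int_mul_mem_cycRing (k : K) :
    ∃ m : ℤ, m ≠ 0 ∧ (m : K) * k ∈ cycRing M N K := by
  have hk : k ∈ Algebra.adjoin ℚ ({b : K | ∃ n ∈ ({N} : Set ℕ), n ≠ 0 ∧ b ^ n = 1}) :=
    IsCyclotomicExtension.adjoin_roots k
  induction hk using Algebra.adjoin_induction with
  | mem x hx =>
    obtain ⟨m, rfl, -, hm⟩ := hx
    obtain ⟨i, -, hi⟩ := (zetaN_primitive (N := m) (K := K)).eq_pow_of_pow_eq_one hm
    refine ⟨1, one_ne_zero, ?_⟩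
    rw [← hi, Int.cast_one, one_mul]
    exact pow_mem (zetaA M m K).2 i
  | algebraMap r =>
    refine ⟨r.den, by exact_mod_cast r.den_ne_zero, ?_⟩
    have : ((r.den : ℤ) : K) * algebraMap ℚ K r = algebraMap ℤ K r.num := by
      have h := congrArg (Rat.cast : ℚ → K) r.den_mul_eq_num
      rw [Rat.cast_mul] at h
      simpa using h
    rw [this]
    exact Subalgebra.algebraMap_mem _ _
  | add x y hx hy h1 h2 =>
    obtain ⟨a, ha, ha'⟩ := h1
    obtain ⟨b, hb, hb'⟩ := h2
    refine ⟨a * b, mul_ne_zero ha hb, ?_⟩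
    have : ((a * b : ℤ) : K) * (x + y) = b * (a * x) + a * (b * y) := by push_cast; ring
    rw [this]
    exact add_mem (mul_mem (intCast_mem _ b) ha') (mul_mem (intCast_mem _ a) hb')
  | mul x y hx hy h1 h2 =>
    obtain ⟨a, ha, ha'⟩ := h1
    obtain ⟨b, hb, hb'⟩ := h2
    refine ⟨a * b, mul_ne_zero ha hb, ?_⟩
    have : ((a * b : ℤ) : K) * (x * y) = (a * x) * (b * y) := by push_cast; ring
    rw [this]
    exact mul_mem ha' hb'

end Arithmetic

end ArithChern

namespace ArithChern

variable {n : ℕ}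

/-! ## Universal properties of pushouts -/

namespace Pushout

variable {R S T : Type u} [CommRing R] [CommRing S] [CommRing T] (f : R →+* S) (g : R →+* T)

theorem inl_comp : (inl f g).comp f = (inr f g).comp g := by
  let := f.toAlgebra
  let := g.toAlgebra
  ext r
  change (f r) ⊗ₜ[R] (1 : T) = (1 : S) ⊗ₜ[R] g r
  have := TensorProduct.smul_tmul (R := R) r (1 : S) (1 : T)
  rw [Algebra.smul_def, Algebra.smul_def, mul_one, mul_one] at this
  exact this

theorem ringHom_ext {W : Type v} [CommRing W] {a b : Pushout f g →+* W}
    (h1 : a.comp (inl f g) = b.comp (inl f g)) (h2 : a.comp (inr f g) = b.comp (inr f g)) :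
    a = b := by
  let := f.toAlgebra
  let := g.toAlgebra
  ext z
  induction z using TensorProduct.induction_on with
  | zero => exact (map_zero a).trans (map_zero b).symm
  | tmul s t =>
    have e : s ⊗ₜ[R] t = inl f g s * inr f g t := by
      change s ⊗ₜ[R] t = (s ⊗ₜ[R] (1 : T)) * ((1 : S) ⊗ₜ[R] t)
      rw [Algebra.TensorProduct.tmul_mul_tmul, mul_one, one_mul]
    have h3 := RingHom.congr_fun h1 s
    have h4 := RingHom.congr_fun h2 t
    simp only [RingHom.comp_apply] at h3 h4
    exact ((congrArg a e).trans (map_mul a _ _)).trans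
      ((congrArg₂ (· * ·) h3 h4).trans ((congrArg b e).trans (map_mul b _ _)).symm)
  | add x y hx hy => exact (map_add a x y).trans ((congrArg₂ (· + ·) hx hy).trans (map_add b x y).symm)

theorem exists_lift {W : Type v} [CommRing W] (a : S →+* W) (b : T →+* W)
    (h : a.comp f = b.comp g) :
    ∃ c : Pushout f g →+* W, c.comp (inl f g) = a ∧ c.comp (inr f g) = b := by
  let := f.toAlgebra
  let := g.toAlgebra
  let := (a.comp f).toAlgebra
  let a' : S →ₐ[R] W := { a with commutes' := fun r => rfl }
  let b' : T →ₐ[R] W := { b with commutes' := fun r => (RingHom.congr_fun h r).symm }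
  have hc : ∀ x y, Commute (a' x) (b' y) := fun _ _ => Commute.all _ _
  refine ⟨(Algebra.TensorProduct.lift a' b' hc).toRingHom, ?_, ?_⟩
  · ext s
    change Algebra.TensorProduct.lift a' b' hc (s ⊗ₜ[R] (1 : T)) = _
    simp [a']
  · ext t
    change Algebra.TensorProduct.lift a' b' hc ((1 : S) ⊗ₜ[R] t) = _
    simp [b']

theorem inl_essFiniteType (h : g.EssFiniteType) : (inl f g).EssFiniteType := by
  let := f.toAlgebra
  let := g.toAlgebra
  have : Algebra.EssFiniteType R T := h
  exact RingHom.essFiniteType_algebraMap.mpr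
    (inferInstance : Algebra.EssFiniteType S (TensorProduct R S T))

end Pushout

theorem _root_.RingHom.EssFiniteType.comp' {R S T : Type*} [CommRing R] [CommRing S] [CommRing T]
    {g : S →+* T} {f : R →+* S} (hg : g.EssFiniteType) (hf : f.EssFiniteType) :
    (g.comp f).EssFiniteType := by
  let := f.toAlgebra
  let := g.toAlgebra
  let := (g.comp f).toAlgebra
  have : IsScalarTower R S T := .of_algebraMap_eq fun _ => rfl
  have : Algebra.EssFiniteType R S := hf
  have : Algebra.EssFiniteType S T := hg
  exact Algebra.EssFiniteType.comp R S T

/-! ## The function field -/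

section FunctionField

variable {M : ℤ} {N : ℕ} [NeZero N] {K : Type u} [Field K] [CharZero K]
  [IsCyclotomicExtension {N} ℚ K]

theorem toE_const : (toE n M N K).comp (algebraMap _ _) =
    (algebraMap K (FieldE n K)).comp (cycRing M N K).val.toRingHom :=
  CoordGL.lift_const _ _ (isUnit_det_matE n K)

theorem toE_gen : (genMatrix n (cycRing M N K)).map (toE n M N K) = matE n K :=
  CoordGL.lift_gen _ _ (isUnit_det_matE n K)

theorem toE_algebraMap (f : MvPolynomial (Fin n × Fin n) (cycRing M N K)) :
    toE n M N K (algebraMap _ _ f) =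
      algebraMap _ (FieldE n K) (MvPolynomial.map (cycRing M N K).val.toRingHom f) := by
  have : (toE n M N K).comp (algebraMap (MvPolynomial (Fin n × Fin n) (cycRing M N K)) _) =
      (algebraMap _ (FieldE n K)).comp (MvPolynomial.map (cycRing M N K).val.toRingHom) := by
    refine MvPolynomial.ringHom_ext (fun a => ?_) fun ij => ?_
    · have := RingHom.congr_fun (toE_const (n := n) (M := M) (N := N) (K := K)) a
      rw [RingHom.comp_apply, IsScalarTower.algebraMap_apply _ (MvPolynomial (Fin n × Fin n)
        (cycRing M N K)) (CoordGL n (cycRing M N K))] at this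
      rw [RingHom.comp_apply, RingHom.comp_apply, MvPolynomial.map_C]
      exact this.trans rfl
    · have := congrFun₂ (toE_gen (n := n) (M := M) (N := N) (K := K)) ij.1 ij.2
      simpa [genMatrix, matE] using this
  exact RingHom.congr_fun this f

theorem toE_injective : Function.Injective (toE n M N K) := by
  rw [injective_iff_map_eq_zero]
  intro b hb
  obtain ⟨⟨f, d⟩, hf⟩ := IsLocalization.surj
    (Submonoid.powers (Matrix.mvPolynomialX (Fin n) (Fin n) (cycRing M N K)).det) b
  have h1 := congrArg (toE n M N K) hf
  rw [map_mul, hb, zero_mul, toE_algebraMap] at h1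
  have h2 : f = 0 := by
    refine (MvPolynomial.map_injective (cycRing M N K).val.toRingHom Subtype.val_injective) ?_
    rw [map_zero]
    exact (IsFractionRing.injective (MvPolynomial (Fin n × Fin n) K) (FieldE n K))
      (h1.symm.trans (map_zero _).symm)
  simp only [h2, map_zero] at hf
  exact (IsLocalization.map_units (M := Submonoid.powers (Matrix.mvPolynomialX (Fin n) (Fin n)
    (cycRing M N K)).det) (CoordGL n (cycRing M N K)) d).mul_left_eq_zero.mp hf

theorem exists_int_mul_mem_range (f : MvPolynomial (Fin n × Fin n) K) :
    ∃ m : ℤ, m ≠ 0 ∧ ∃ g : MvPolynomial (Fin n × Fin n) (cycRing M N K),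
      MvPolynomial.map (cycRing M N K).val.toRingHom g = (m : MvPolynomial (Fin n × Fin n) K) * f := by
  induction f using MvPolynomial.induction_on with
  | C a =>
    obtain ⟨m, hm, ha⟩ := exists_int_mul_mem_cycRing (M := M) (N := N) a
    refine ⟨m, hm, MvPolynomial.C ⟨_, ha⟩, ?_⟩
    rw [MvPolynomial.map_C]
    change MvPolynomial.C ((m : K) * a) = _
    rw [map_mul, map_intCast]
  | add f g hf hg =>
    obtain ⟨m, hm, a, ha⟩ := hf
    obtain ⟨k, hk, b, hb⟩ := hg
    refine ⟨m * k, mul_ne_zero hm hk, k * a + m * b, ?_⟩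
    rw [map_add, map_mul, map_mul, ha, hb, map_intCast, map_intCast]
    push_cast; ring
  | mul_X f ij hf =>
    obtain ⟨m, hm, a, ha⟩ := hf
    refine ⟨m, hm, a * MvPolynomial.X ij, ?_⟩
    rw [map_mul, ha, MvPolynomial.map_X, mul_assoc]

variable (M N) in
theorem exists_toE_mul_eq (e : FieldE n K) :
    ∃ a b : CoordGL n (cycRing M N K), b ≠ 0 ∧ toE n M N K a = e * toE n M N K b := by
  obtain ⟨f, g, hg, rfl⟩ := IsFractionRing.div_surjective (A := MvPolynomial (Fin n × Fin n) K) e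
  obtain ⟨m, hm, a, ha⟩ := exists_int_mul_mem_range (M := M) (N := N) f
  obtain ⟨k, hk, b, hb⟩ := exists_int_mul_mem_range (M := M) (N := N) g
  have hg0 : algebraMap _ (FieldE n K) g ≠ 0 :=
    (map_ne_zero_iff _ (IsFractionRing.injective _ _)).mpr (nonZeroDivisors.ne_zero hg)
  have hkE : (k : FieldE n K) ≠ 0 := Int.cast_ne_zero.mpr hk
  have hmE : (m : FieldE n K) ≠ 0 := Int.cast_ne_zero.mpr hm
  refine ⟨k * algebraMap _ _ a, m * algebraMap _ _ b, fun h => ?_, ?_⟩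
  · have := congrArg (toE n M N K) h
    rw [map_mul, toE_algebraMap, hb, map_mul, map_zero, map_intCast, map_intCast] at this
    exact mul_ne_zero hmE (mul_ne_zero hkE hg0) this
  · rw [map_mul, map_mul, toE_algebraMap, toE_algebraMap, ha, hb, map_mul, map_mul]
    simp only [map_intCast]
    field_simp

theorem toE_ringHom_ext {T : Type v} [CommRing T] {f g : FieldE n K →+* T}
    (h : f.comp (toE n M N K) = g.comp (toE n M N K)) : f = g := by
  ext e
  obtain ⟨a, b, hb, hab⟩ := exists_toE_mul_eq M N e
  have hu : IsUnit (toE n M N K b) :=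
    isUnit_iff_ne_zero.mpr ((map_ne_zero_iff _ toE_injective).mpr hb)
  have h1 := RingHom.congr_fun h a
  have h2 := RingHom.congr_fun h b
  simp only [RingHom.comp_apply] at h1 h2
  rw [hab, map_mul, map_mul, ← h2] at h1
  exact (hu.map f).mul_right_cancel h1

theorem fieldE_ringHom_ext {T : Type v} [CommRing T] {f g : FieldE n K →+* T}
    (h1 : f.comp (algebraMap K _) = g.comp (algebraMap K _))
    (h2 : (matE n K).map f = (matE n K).map g) : f = g := by
  refine IsLocalization.ringHom_ext (nonZeroDivisors (MvPolynomial (Fin n × Fin n) K)) ?_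
  refine MvPolynomial.ringHom_ext (fun a => ?_) fun ij => ?_
  · have := RingHom.congr_fun h1 a
    rw [RingHom.comp_apply, RingHom.comp_apply, IsScalarTower.algebraMap_apply K
      (MvPolynomial (Fin n × Fin n) K) (FieldE n K)] at this
    exact this
  · exact congrFun₂ h2 ij.1 ij.2

theorem isFractionRing_toE :
    @IsFractionRing (CoordGL n (cycRing M N K)) _ (FieldE n K) _ (toE n M N K).toAlgebra := by
  let := (toE n M N K).toAlgebra
  have : FaithfulSMul (CoordGL n (cycRing M N K)) (FieldE n K) :=
    (faithfulSMul_iff_algebraMap_injective _ _).mpr toE_injective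
  refine IsFractionRing.of_field _ _ fun e => ?_
  obtain ⟨a, b, hb, hab⟩ := exists_toE_mul_eq M N e
  refine ⟨a, b, ?_⟩
  have : toE n M N K b ≠ 0 := (map_ne_zero_iff _ toE_injective).mpr hb
  change e = toE n M N K a / toE n M N K b
  rw [hab, mul_div_cancel_right₀ _ this]

theorem exists_lift_toE {T : Type v} [CommRing T] (f : CoordGL n (cycRing M N K) →+* T)
    (hf : ∀ b ≠ 0, IsUnit (f b)) : ∃ g : FieldE n K →+* T, g.comp (toE n M N K) = f := by
  let := (toE n M N K).toAlgebra
  have := isFractionRing_toE (n := n) (M := M) (N := N) (K := K)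
  refine ⟨IsLocalization.lift (M := nonZeroDivisors (CoordGL n (cycRing M N K))) (g := f)
    (fun y => hf _ (nonZeroDivisors.ne_zero y.2)), ?_⟩
  exact IsLocalization.lift_comp _

theorem toE_essFiniteType : (toE n M N K).EssFiniteType := by
  let := (toE n M N K).toAlgebra
  have := isFractionRing_toE (n := n) (M := M) (N := N) (K := K)
  exact Algebra.EssFiniteType.of_isLocalization _ (nonZeroDivisors (CoordGL n (cycRing M N K)))

end FunctionField

/-! ## The ring of the correspondence `Γ_p` -/

section ChernRing

variable {M : ℤ} {N : ℕ} [NeZero N] {K : Type u} [Field K] [CharZero K]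
  [IsCyclotomicExtension {N} ℚ K] (q : Matrix.GeneralLinearGroup (Fin n) (cycRing M N K)) (p : ℕ)

/-- The ring of functions of the correspondence `Γ_p`. -/
abbrev ChernRing : Type u := (chernCorrespondence M N q p).carrier

/-- The comorphism of the left projection of `Γ_p`. -/
noncomputable def chernL : FieldE n K →+* ChernRing q p := (chernCorrespondence M N q p).left

/-- The comorphism of the right projection of `Γ_p`. -/
noncomputable def chernR : FieldE n K →+* ChernRing q p := (chernCorrespondence M N q p).right

/-- The homomorphism from the ring of the model `Γ_{p/G}` to the ring of `Γ_p`. -/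
noncomputable def chernMid : ModelRing (frobA M N K p) p q.val →+* ChernRing q p :=
  (Pushout.inl ((Pushout.inr (toE n M N K) (chernModelA M N q p).left).comp
    (chernModelA M N q p).right) (toE n M N K)).comp
      (Pushout.inr (toE n M N K) (chernModelA M N q p).left)

/-- The matrix `y` over the ring of `Γ_p`. -/
noncomputable def chernY : Matrix (Fin n) (Fin n) (ChernRing q p) :=
  (modelY (frobA M N K p) p q.val).map (chernMid q p)

theorem chernL_comp_toE :
    (chernL q p).comp (toE n M N K) = (chernMid q p).comp (modelLeft (frobA M N K p) p q) := by
  have := Pushout.inl_comp (toE n M N K) (chernModelA M N q p).left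
  exact congrArg (RingHom.comp (Pushout.inl ((Pushout.inr (toE n M N K)
    (chernModelA M N q p).left).comp (chernModelA M N q p).right) (toE n M N K))) this

theorem chernMid_comp_right :
    (chernMid q p).comp (modelRight (frobA M N K p) p q) = (chernR q p).comp (toE n M N K) :=
  Pushout.inl_comp ((Pushout.inr (toE n M N K) (chernModelA M N q p).left).comp
    (chernModelA M N q p).right) (toE n M N K)

theorem chernRing_exists_lift' {T : Type v} [CommRing T] (l r : FieldE n K →+* T)
    (m : ModelRing (frobA M N K p) p q.val →+* T)
    (h1 : l.comp (toE n M N K) = m.comp (modelLeft (frobA M N K p) p q))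
    (h2 : m.comp (modelRight (frobA M N K p) p q) = r.comp (toE n M N K)) :
    ∃ g : ChernRing q p →+* T, g.comp (chernL q p) = l ∧ g.comp (chernR q p) = r ∧
      g.comp (chernMid q p) = m := by
  obtain ⟨c, hc1, hc2⟩ := Pushout.exists_lift (toE n M N K) (chernModelA M N q p).left l m h1
  obtain ⟨g, hg1, hg2⟩ := Pushout.exists_lift ((Pushout.inr (toE n M N K)
    (chernModelA M N q p).left).comp (chernModelA M N q p).right) (toE n M N K) c r (by
      rw [← RingHom.comp_assoc, hc2]; exact h2)
  refine ⟨g, ?_, hg2, ?_⟩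
  · rw [← hc1, ← hg1]; rfl
  · rw [← hc2, ← hg1]; rfl

theorem ringHom_ext_cycRing {T : Type v} [CommRing T] [CharZero T] [IsDomain T] {f g : K →+* T}
    (h : f.comp (cycRing M N K).val.toRingHom = g.comp (cycRing M N K).val.toRingHom) : f = g := by
  ext k
  obtain ⟨m, hm, hk⟩ := exists_int_mul_mem_cycRing (M := M) (N := N) k
  have := RingHom.congr_fun h ⟨_, hk⟩
  change f ((m : K) * k) = g ((m : K) * k) at this
  rw [map_mul, map_mul, map_intCast, map_intCast] at this
  exact mul_left_cancel₀ (Int.cast_ne_zero.mpr hm) this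

theorem chernL_mid_const : (chernMid q p).comp (modelConst (frobA M N K p) p q.val) =
    ((chernL q p).comp (algebraMap K (FieldE n K))).comp (cycRing M N K).val.toRingHom := by
  rw [← modelLeft_const, ← RingHom.comp_assoc, ← chernL_comp_toE, RingHom.comp_assoc, toE_const,
    RingHom.comp_assoc]

theorem chernMid_modelX :
    (modelX (frobA M N K p) p q.val).map (chernMid q p) = (matE n K).map (chernL q p) := by
  rw [← modelLeft_gen, ← toE_gen (M := M) (N := N), Matrix.map_map, Matrix.map_map, ← RingHom.coe_comp,
    ← RingHom.coe_comp, chernL_comp_toE]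

/-- The two sides agree on `ℤ[1/M, ζ_N]`, and each element of `K` has a nonzero integer multiple
there. That integer is a unit of `E`, so it cancels although the target is not yet known to be a
domain. -/
theorem chernR_const :
    ((chernR q p).comp (algebraMap K (FieldE n K))) =
      ((chernL q p).comp (algebraMap K (FieldE n K))).comp (frobK N K p) := by
  have h : ((chernR q p).comp (algebraMap K (FieldE n K))).comp (cycRing M N K).val.toRingHom =
      (((chernL q p).comp (algebraMap K (FieldE n K))).comp (frobK N K p)).comp
        (cycRing M N K).val.toRingHom := by
    rw [RingHom.comp_assoc, ← toE_const, ← RingHom.comp_assoc, ← chernMid_comp_right,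
      RingHom.comp_assoc, modelRight_const, ← RingHom.comp_assoc, chernL_mid_const]
    rfl
  ext k
  obtain ⟨m, hm, hk⟩ := exists_int_mul_mem_cycRing (M := M) (N := N) k
  have := RingHom.congr_fun h ⟨_, hk⟩
  have hu : IsUnit (chernL q p (m : FieldE n K)) := by
    refine IsUnit.map _ (isUnit_iff_ne_zero.mpr (Int.cast_ne_zero.mpr hm))
  change chernR q p (algebraMap K _ ((m : K) * k)) =
    chernL q p (algebraMap K _ (frobK N K p ((m : K) * k))) at this
  simp only [map_mul, map_intCast] at this hu
  exact hu.mul_left_cancel this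

theorem chernR_matE : (matE n K).map (chernR q p) =
    entryPow p ((matE n K).map (chernL q p)) * chernY q p := by
  rw [← chernMid_modelX, ← toE_gen (M := M) (N := N), Matrix.map_map, ← RingHom.coe_comp,
    ← chernMid_comp_right, RingHom.coe_comp, ← Matrix.map_map, modelRight_gen, Matrix.map_mul,
    entryPow_map', chernY]

variable (hM : Even M) (hM0 : M ≠ 0)

include hM hM0 in
theorem chernRel : ModelRel (frobA M N K p) p q.val
    (((chernL q p).comp (algebraMap K (FieldE n K))).comp (cycRing M N K).val.toRingHom)
    ((matE n K).map (chernL q p)) (chernY q p) := by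
  have h2 := isUnit_two_cycRing (N := N) (K := K) hM hM0
  have := (modelRel (frobA M N K p) p q.val (isUnit_det_q q) h2).map h2 (chernMid q p)
  rwa [chernL_mid_const, chernMid_modelX] at this

/-- The right copy of `E` adds no freedom: its generators are expressed through `x` and `y`, and it
is otherwise obtained by inverting elements. -/
theorem chernRing_ext {T : Type v} [CommRing T] {f g : ChernRing q p →+* T}
    (h1 : f.comp (chernL q p) = g.comp (chernL q p))
    (h2 : (chernY q p).map f = (chernY q p).map g) : f = g := by
  have hm : f.comp (chernMid q p) = g.comp (chernMid q p) := by
    refine modelRing_hom_ext ?_ ?_ ?_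
    · rw [RingHom.comp_assoc, RingHom.comp_assoc, chernL_mid_const, ← RingHom.comp_assoc,
        ← RingHom.comp_assoc, ← RingHom.comp_assoc, ← RingHom.comp_assoc, h1]
    · rw [RingHom.coe_comp, RingHom.coe_comp, ← Matrix.map_map, ← Matrix.map_map, chernMid_modelX,
        Matrix.map_map, Matrix.map_map, ← RingHom.coe_comp, ← RingHom.coe_comp, h1]
    · rw [RingHom.coe_comp, RingHom.coe_comp, ← Matrix.map_map, ← Matrix.map_map]
      exact h2
  have hr : f.comp (chernR q p) = g.comp (chernR q p) := by
    refine toE_ringHom_ext (M := M) (N := N) ?_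
    rw [RingHom.comp_assoc, RingHom.comp_assoc, ← chernMid_comp_right, ← RingHom.comp_assoc, hm,
      RingHom.comp_assoc]
  refine Pushout.ringHom_ext _ _ (Pushout.ringHom_ext _ _ ?_ ?_) ?_
  · exact h1
  · exact hm
  · exact hr

include hM hM0 in
-- The map `r` must be supplied as a homomorphism from the whole of `E`: base change on the right
-- inverts all nonzero functions of `x^{(p)} y`, and this is a condition on the point.
theorem chernRing_exists_lift {T : Type v} [CommRing T] (l r : FieldE n K →+* T)
    (Y : Matrix (Fin n) (Fin n) T)
    (hY : ModelRel (frobA M N K p) p q.val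
      ((l.comp (algebraMap K (FieldE n K))).comp (cycRing M N K).val.toRingHom)
      ((matE n K).map l) Y)
    (h1 : r.comp (algebraMap K (FieldE n K)) = (l.comp (algebraMap K (FieldE n K))).comp (frobK N K p))
    (h2 : (matE n K).map r = entryPow p ((matE n K).map l) * Y) :
    ∃ g : ChernRing q p →+* T, g.comp (chernL q p) = l ∧ g.comp (chernR q p) = r ∧
      (chernY q p).map g = Y := by
  have h2' := isUnit_two_cycRing (N := N) (K := K) hM hM0
  obtain ⟨m, hm1, hm2, hm3⟩ := hY.exists_hom h2' (isUnit_det_q q)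
  have e1 : l.comp (toE n M N K) = m.comp (modelLeft (frobA M N K p) p q) := by
    refine CoordGL.ringHom_ext ?_ ?_
    · rw [RingHom.comp_assoc, RingHom.comp_assoc, modelLeft_const, toE_const, hm1,
        RingHom.comp_assoc]
    · rw [RingHom.coe_comp, RingHom.coe_comp, ← Matrix.map_map, ← Matrix.map_map, modelLeft_gen,
        toE_gen, hm2]
  have e2 : m.comp (modelRight (frobA M N K p) p q) = r.comp (toE n M N K) := by
    refine CoordGL.ringHom_ext ?_ ?_
    · rw [RingHom.comp_assoc, RingHom.comp_assoc, modelRight_const, toE_const,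
        ← RingHom.comp_assoc, hm1, ← RingHom.comp_assoc, h1]
      rfl
    · rw [RingHom.coe_comp, RingHom.coe_comp, ← Matrix.map_map, ← Matrix.map_map, modelRight_gen,
        toE_gen, h2, Matrix.map_mul, entryPow_map', hm2, hm3]
  obtain ⟨g, hg1, hg2, hg3⟩ := chernRing_exists_lift' q p l r m e1 e2
  refine ⟨g, hg1, hg2, ?_⟩
  rw [chernY, Matrix.map_map, ← RingHom.coe_comp, hg3, hm3]

end ChernRing

end ArithChern

namespace ArithChern

variable {n : ℕ}

section

variable {M : ℤ} {N : ℕ} [NeZero N] {K : Type u} [Field K] [CharZero K]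
  [IsCyclotomicExtension {N} ℚ K]

/-! ## Divisibility by `p` -/

theorem exists_pow_mul_isIntegral (hM0 : M ≠ 0) {a : K} (ha : a ∈ cycRing M N K) :
    ∃ i : ℕ, IsIntegral ℤ ((M : K) ^ i * a) := by
  have hMK : (M : K) ≠ 0 := Int.cast_ne_zero.mpr hM0
  have hMi : IsIntegral ℤ (M : K) := by simpa using isIntegral_algebraMap (R := ℤ) (A := K) (x := M)
  induction ha using Algebra.adjoin_induction with
  | mem x hx =>
    rcases hx with rfl | rfl
    · exact ⟨1, by rw [pow_one, mul_inv_cancel₀ hMK]; exact isIntegral_one⟩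
    · refine ⟨0, ?_⟩
      rw [pow_zero, one_mul]
      exact zetaN_primitive.isIntegral (NeZero.pos N)
  | algebraMap r => exact ⟨0, by rw [pow_zero, one_mul]; exact isIntegral_algebraMap⟩
  | add x y hx hy h1 h2 =>
    obtain ⟨i, hi⟩ := h1
    obtain ⟨j, hj⟩ := h2
    refine ⟨i + j, ?_⟩
    have : (M : K) ^ (i + j) * (x + y) = (M : K) ^ j * (M ^ i * x) + M ^ i * (M ^ j * y) := by ring
    rw [this]
    exact ((hMi.pow j).mul hi).add ((hMi.pow i).mul hj)
  | mul x y hx hy h1 h2 =>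
    obtain ⟨i, hi⟩ := h1
    obtain ⟨j, hj⟩ := h2
    refine ⟨i + j, ?_⟩
    have : (M : K) ^ (i + j) * (x * y) = (M ^ i * x) * (M ^ j * y) := by ring
    rw [this]
    exact hi.mul hj

/-- If `c = p a`, some `M^i c / p` is a rational algebraic integer, hence an integer, and `p` does
not divide `M`. -/
theorem int_dvd_of_dvd_cycRing (hM0 : M ≠ 0) {p : ℕ} (hp : p.Prime) (hpM : ¬ (p : ℤ) ∣ M) {c : ℤ}
    (h : (p : cycRing M N K) ∣ (c : cycRing M N K)) : (p : ℤ) ∣ c := by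
  obtain ⟨a, ha⟩ := h
  obtain ⟨i, hi⟩ := exists_pow_mul_isIntegral (N := N) hM0 a.2
  have hpQ : (p : ℚ) ≠ 0 := Nat.cast_ne_zero.mpr hp.ne_zero
  have hpK : (p : K) ≠ 0 := Nat.cast_ne_zero.mpr hp.ne_zero
  have ha' : (c : K) = p * (a : K) := by
    have := congrArg (fun z : cycRing M N K => (z : K)) ha
    simpa using this
  have h1 : (M : K) ^ i * a = algebraMap ℚ K ((M ^ i * c : ℤ) / p) := by
    rw [map_div₀, map_intCast, map_natCast, eq_div_iff hpK]
    push_cast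
    rw [ha']; ring
  rw [h1, isIntegral_algebraMap_iff (algebraMap ℚ K).injective,
    IsIntegrallyClosed.isIntegral_iff] at hi
  obtain ⟨z, hz⟩ := hi
  have h2 : (p : ℤ) ∣ M ^ i * c := by
    refine ⟨z, ?_⟩
    rw [eq_div_iff hpQ] at hz
    have : ((M ^ i * c : ℤ) : ℚ) = ((p * z : ℤ) : ℚ) := by
      rw [← hz]; push_cast; simp [mul_comm]
    exact_mod_cast this
  have hpp := Nat.prime_iff_prime_int.mp hp
  exact (hpp.dvd_or_dvd h2).resolve_left (fun h3 => hpM (hpp.dvd_of_dvd_pow h3))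

variable (n M N K) in
/-- The homomorphism from the integral polynomial ring to the coordinate ring of `GL_n`. -/
noncomputable def polyToCoord : MvPolynomial (Fin n × Fin n) ℤ →+* CoordGL n (cycRing M N K) :=
  (algebraMap (MvPolynomial (Fin n × Fin n) (cycRing M N K)) _).comp
    (MvPolynomial.map (Int.castRingHom (cycRing M N K)))

theorem prime_natCast_mvPolynomial {σ : Type*} {p : ℕ} (hp : p.Prime) :
    Prime ((p : ℕ) : MvPolynomial σ ℤ) := by
  have := (MvPolynomial.prime_C_iff (σ := σ) (r := (p : ℤ))).mpr (Nat.prime_iff_prime_int.mp hp)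
  simpa using this

/-- Descent to `ℤ[x]` is made because `p` is prime there, whereas it may split in `ℤ[1/M, ζ_N]`. A
power of `det x` appears as denominator and is removed since `p` does not divide it. -/
theorem dvd_of_dvd_polyToCoord (hM0 : M ≠ 0) {p : ℕ} (hp : p.Prime) (hpM : ¬ (p : ℤ) ∣ M)
    {d : MvPolynomial (Fin n × Fin n) ℤ}
    (h : (p : CoordGL n (cycRing M N K)) ∣ polyToCoord n M N K d) :
    (p : MvPolynomial (Fin n × Fin n) ℤ) ∣ d := by
  set D : MvPolynomial (Fin n × Fin n) ℤ := (Matrix.mvPolynomialX (Fin n) (Fin n) ℤ).det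
  have hD : MvPolynomial.map (Int.castRingHom (cycRing M N K)) D =
      (Matrix.mvPolynomialX (Fin n) (Fin n) (cycRing M N K)).det := by
    rw [RingHom.map_det]
    congr 1
    ext i j
    simp [Matrix.mvPolynomialX]
  obtain ⟨b, hb⟩ := h
  obtain ⟨⟨f, ⟨_, k, rfl⟩⟩, hf⟩ := IsLocalization.surj
    (Submonoid.powers (Matrix.mvPolynomialX (Fin n) (Fin n) (cycRing M N K)).det) b
  have h1 : MvPolynomial.map (Int.castRingHom (cycRing M N K)) (D ^ k * d) = p * f := by
    refine algebraMap_coordGL_injective ?_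
    rw [map_mul, map_mul (algebraMap _ (CoordGL n (cycRing M N K))) (p : MvPolynomial _ _) f, map_pow,
      hD, map_natCast, ← hf, ← mul_assoc, ← hb]
    rw [map_mul]
    exact mul_comm (G := CoordGL n (cycRing M N K)) _ _
  have h2 : (p : MvPolynomial (Fin n × Fin n) ℤ) ∣ D ^ k * d := by
    have : ((p : ℤ) : MvPolynomial (Fin n × Fin n) ℤ) = MvPolynomial.C (p : ℤ) := by simp
    have e : (p : MvPolynomial (Fin n × Fin n) ℤ) = MvPolynomial.C (p : ℤ) := by simp
    rw [e, MvPolynomial.C_dvd_iff_dvd_coeff]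
    intro m
    refine int_dvd_of_dvd_cycRing (N := N) (K := K) hM0 hp hpM ⟨f.coeff m, ?_⟩
    have := congrArg (MvPolynomial.coeff m) h1
    rw [MvPolynomial.coeff_map] at this
    have e2 : ((p : ℕ) : MvPolynomial (Fin n × Fin n) (cycRing M N K)) =
      MvPolynomial.C (p : cycRing M N K) := by simp
    rwa [e2, MvPolynomial.coeff_C_mul] at this
  have hpp := prime_natCast_mvPolynomial (σ := Fin n × Fin n) hp
  refine (hpp.dvd_or_dvd h2).resolve_left fun h3 => ?_
  have h4 := hpp.dvd_of_dvd_pow h3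
  -- Evaluating at the identity matrix shows that the generic determinant is not divisible by `p`.
  have h5 := map_dvd (MvPolynomial.eval₂Hom (RingHom.id ℤ)
    (fun ij : Fin n × Fin n => (1 : Matrix (Fin n) (Fin n) ℤ) ij.1 ij.2)) h4
  rw [eval_det_mvPolynomialX, Matrix.det_one, map_natCast] at h5
  exact (Nat.prime_iff_prime_int.mp hp).not_isUnit (isUnit_of_dvd_one h5)

instance isAlgebraic_int_cycRing : Algebra.IsAlgebraic ℤ (cycRing M N K) := by
  refine ⟨fun a => ?_⟩
  have := IsCyclotomicExtension.finite {N} ℚ K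
  have h1 : IsAlgebraic ℚ (a : K) := Algebra.IsAlgebraic.isAlgebraic _
  have h2 : IsAlgebraic ℤ (a : K) := (IsFractionRing.isAlgebraic_iff ℤ ℚ K).mpr h1
  exact (isAlgebraic_algebraMap_iff (R := ℤ) (S := cycRing M N K) (A := K)
    Subtype.val_injective).mp h2

/-- The coefficient ring is algebraic over `ℤ`, so a nonzero polynomial divides a nonzero integral
one, as an element divides its norm. -/
theorem exists_dvd_polyToCoord {b : CoordGL n (cycRing M N K)} (hb : b ≠ 0) :
    ∃ d : MvPolynomial (Fin n × Fin n) ℤ, d ≠ 0 ∧ b ∣ polyToCoord n M N K d := by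
  obtain ⟨⟨f, s⟩, hf⟩ := IsLocalization.surj
    (Submonoid.powers (Matrix.mvPolynomialX (Fin n) (Fin n) (cycRing M N K)).det) b
  have hs := IsLocalization.map_units (CoordGL n (cycRing M N K)) s
  have hf0 : f ≠ 0 := by
    rintro rfl
    rw [map_zero] at hf
    exact hb (hs.mul_left_eq_zero.mp hf)
  let := MvPolynomial.algebraMvPolynomial (R := ℤ) (S := cycRing M N K) (σ := Fin n × Fin n)
  have halg : IsAlgebraic (MvPolynomial (Fin n × Fin n) ℤ) f := Algebra.IsAlgebraic.isAlgebraic f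
  obtain ⟨d, hd, hfd⟩ := halg.exists_nonzero_dvd (mem_nonZeroDivisors_of_ne_zero hf0)
  refine ⟨d, hd, ?_⟩
  have h2 : algebraMap _ (CoordGL n (cycRing M N K)) f ∣ polyToCoord n M N K d := by
    refine map_dvd (algebraMap _ (CoordGL n (cycRing M N K))) ?_
    exact hfd
  exact (Dvd.intro _ hf).trans h2

theorem exists_pow_mul_not_dvd {p : ℕ} (hp : p.Prime) {d : MvPolynomial (Fin n × Fin n) ℤ}
    (hd : d ≠ 0) : ∃ (k : ℕ) (c : MvPolynomial (Fin n × Fin n) ℤ),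
      d = p ^ k * c ∧ ¬ (p : MvPolynomial (Fin n × Fin n) ℤ) ∣ c := by
  obtain ⟨c, hc⟩ := (FiniteMultiplicity.of_not_isUnit
    (prime_natCast_mvPolynomial (σ := Fin n × Fin n) hp).not_isUnit hd).exists_eq_pow_mul_and_not_dvd
  exact ⟨_, c, hc⟩

/-- A lift of Frobenius on the completion is injective on the coordinate ring, in the strong sense
that products of nonzero elements with images of nonzero elements are nonzero. -/
theorem mul_frob_ne_zero (hM0 : M ≠ 0) {p : ℕ} (hp : p.Prime) (hpM : ¬ (p : ℤ) ∣ M)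
    {Φ : PadicCompletion p (CoordGL n (cycRing M N K)) →+*
      PadicCompletion p (CoordGL n (cycRing M N K))}
    (hΦ : ∀ z, (p : PadicCompletion p (CoordGL n (cycRing M N K))) ∣ Φ z - z ^ p)
    {b b' : CoordGL n (cycRing M N K)} (hb : b ≠ 0) (hb' : b' ≠ 0) :
    toPadicCompletion p _ b * Φ (toPadicCompletion p _ b') ≠ 0 := by
  intro h0
  obtain ⟨d, hd, hbd⟩ := exists_dvd_polyToCoord hb
  obtain ⟨d', hd', hbd'⟩ := exists_dvd_polyToCoord hb'
  obtain ⟨k, c, hc, hpc⟩ := exists_pow_mul_not_dvd hp hd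
  obtain ⟨k', c', hc', hpc'⟩ := exists_pow_mul_not_dvd hp hd'
  set ι := toPadicCompletion p (CoordGL n (cycRing M N K))
  have h1 : ι (polyToCoord n M N K d) * Φ (ι (polyToCoord n M N K d')) = 0 := by
    have := mul_dvd_mul (map_dvd ι hbd) (map_dvd Φ (map_dvd ι hbd'))
    rw [h0] at this
    exact zero_dvd_iff.mp this
  have hcancel : ∀ (j : ℕ) (z : PadicCompletion p (CoordGL n (cycRing M N K))),
      (p : PadicCompletion p (CoordGL n (cycRing M N K))) ^ j * z = 0 → z = 0 := by
    intro j
    induction j with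
    | zero => intro z hz; simpa using hz
    | succ j ih =>
      intro z hz
      rw [pow_succ', mul_assoc] at hz
      refine ih z (PadicCompletion.mul_left_cancel (p := p) (fun b hb => ?_) hz)
      exact (mul_eq_zero.mp hb).resolve_left (Nat.cast_ne_zero.mpr hp.ne_zero)
  have h2 : ι (polyToCoord n M N K c) * Φ (ι (polyToCoord n M N K c')) = 0 := by
    refine hcancel (k + k') _ ?_
    rw [← h1, hc, hc']
    simp only [map_mul, map_pow, map_natCast]
    ring
  -- With all powers of `p` removed from the two integral polynomials, the product is `c c'^p`
  -- modulo `p`, and the prime `p` of `ℤ[x]` divides neither factor.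
  obtain ⟨w, hw⟩ := hΦ (ι (polyToCoord n M N K c'))
  have h3 : (p : PadicCompletion p (CoordGL n (cycRing M N K))) ^ 1 ∣
      ι (polyToCoord n M N K (c * c' ^ p)) := by
    refine ⟨-(ι (polyToCoord n M N K c) * w), ?_⟩
    rw [map_mul, map_pow, map_mul, map_pow]
    linear_combination h2 - ι (polyToCoord n M N K c) * hw
  have h4 := (PadicCompletion.pow_dvd_of_iff (p := p)).mp h3
  rw [pow_one] at h4
  have hpp := prime_natCast_mvPolynomial (σ := Fin n × Fin n) hp
  rcases hpp.dvd_or_dvd (dvd_of_dvd_polyToCoord hM0 hp hpM h4) with h | h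
  · exact hpc h
  · exact hpc' (hpp.dvd_of_dvd_pow h)

/-! ## Non-emptiness, finiteness -/

variable (q : Matrix.GeneralLinearGroup (Fin n) (cycRing M N K)) (p : ℕ)

/-- A point is built in a nonzero ring: in the completed coordinate ring invert all products `b
Φ(b')` with `b, b' ≠ 0`. These are nonzero by `mul_frob_ne_zero`, and both embeddings of `E` then
exist. -/
theorem chernRing_nontrivial (hM : Even M) (hM0 : M ≠ 0) {p : ℕ} (hp : p.Prime)
    (hpM : ¬ (p : ℤ) ∣ M) (hpN : p.Coprime N) : Nontrivial (ChernRing q p) := by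
  have h2 := isUnit_two_cycRing (N := N) (K := K) hM hM0
  have hs := frobA_congr (K := K) hM0 hp hpN
  obtain ⟨Y, ψ, hψ⟩ := exists_isSection (s := frobA M N K p) hp hs h2 q
  obtain ⟨Φ, -, hΦr, -, -, hΦf⟩ := hψ.exists_frob hp hs h2
  let S : Submonoid (PadicCompletion p (CoordGL n (cycRing M N K))) :=
    { carrier := {z | ∃ b b' : CoordGL n (cycRing M N K), b ≠ 0 ∧ b' ≠ 0 ∧
        z = toPadicCompletion p _ b * Φ (toPadicCompletion p _ b')}
      mul_mem' := by
        rintro _ _ ⟨a, a', ha, ha', rfl⟩ ⟨b, b', hb, hb', rfl⟩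
        refine ⟨a * b, a' * b', mul_ne_zero ha hb, mul_ne_zero ha' hb', ?_⟩
        simp only [map_mul]; ring
      one_mem' := ⟨1, 1, one_ne_zero, one_ne_zero, by simp⟩ }
  have hS : ∀ z ∈ S, z ≠ 0 := by
    rintro _ ⟨b, b', hb, hb', rfl⟩
    exact mul_frob_ne_zero hM0 hp hpM hΦf hb hb'
  have hT : Nontrivial (Localization S) := by
    refine ⟨⟨0, 1, fun h => ?_⟩⟩
    have h' : algebraMap (PadicCompletion p (CoordGL n (cycRing M N K))) (Localization S) 1 =
      algebraMap (PadicCompletion p (CoordGL n (cycRing M N K))) _ 0 := by rw [map_one, map_zero, h]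
    obtain ⟨c, hc⟩ := (IsLocalization.eq_iff_exists S (Localization S)).mp h'
    rw [mul_one, mul_zero] at hc
    exact hS c c.2 hc
  let j := algebraMap (PadicCompletion p (CoordGL n (cycRing M N K))) (Localization S)
  obtain ⟨l, hl⟩ := exists_lift_toE (n := n) (M := M) (N := N) (K := K)
    (j.comp (toPadicCompletion p _)) (fun b hb => by
      have hm : toPadicCompletion p _ b ∈ S := ⟨b, 1, hb, one_ne_zero, by simp⟩
      exact IsLocalization.map_units (M := S) (Localization S) ⟨_, hm⟩)
  obtain ⟨r, hr⟩ := exists_lift_toE (n := n) (M := M) (N := N) (K := K)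
    (j.comp (Φ.comp (toPadicCompletion p _))) (fun b hb => by
      have hm : Φ (toPadicCompletion p _ b) ∈ S := ⟨1, b, one_ne_zero, hb, by simp⟩
      exact IsLocalization.map_units (M := S) (Localization S) ⟨_, hm⟩)
  have e1 : l.comp (toE n M N K) = (j.comp ψ).comp (modelLeft (frobA M N K p) p q) := by
    rw [hl, RingHom.comp_assoc, hψ.left]
  have e2 : (j.comp ψ).comp (modelRight (frobA M N K p) p q) = r.comp (toE n M N K) := by
    rw [hr, hΦr, RingHom.comp_assoc]
  obtain ⟨g, -, -, -⟩ := chernRing_exists_lift' q p l r (j.comp ψ) e1 e2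
  exact g.domain_nontrivial

theorem essFiniteType_int_of_ringHom {S : Type*} [CommRing S] {f : ℤ →+* S} (h : f.EssFiniteType) :
    Algebra.EssFiniteType ℤ S := by
  rw [Subsingleton.elim f (algebraMap ℤ S)] at h
  exact RingHom.essFiniteType_algebraMap.mp h

/-- Taken over `ℤ`, the finiteness condition is independent of the two structures over `E` and
passes to either of them. -/
theorem chernRing_essFiniteType_int (hM : Even M) (hM0 : M ≠ 0) :
    Algebra.EssFiniteType ℤ (ChernRing q p) := by
  have h2 := isUnit_two_cycRing (N := N) (K := K) hM hM0
  have hA : Algebra.EssFiniteType ℤ (cycRing M N K) := by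
    have : Algebra.FiniteType ℤ (cycRing M N K) := by
      classical
      refine ((cycRing M N K).fg_iff_finiteType).mp ⟨{(M : K)⁻¹, zetaN N K}, ?_⟩
      simp [cycRing]
    infer_instance
  have hB : Algebra.EssFiniteType (cycRing M N K) (CoordGL n (cycRing M N K)) := inferInstance
  have hE := toE_essFiniteType (n := n) (M := M) (N := N) (K := K)
  have hmod : (modelLeft (frobA M N K p) p q).EssFiniteType := by
    have h := modelLeft_etale (frobA M N K p) p q h2
    let := (modelLeft (frobA M N K p) p q).toAlgebra
    have h' : Algebra.Etale (CoordGL n (cycRing M N K)) (ModelRing (frobA M N K p) p q.val) := h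
    have : Algebra.FiniteType (CoordGL n (cycRing M N K)) (ModelRing (frobA M N K p) p q.val) :=
      inferInstance
    exact RingHom.essFiniteType_algebraMap.mpr
      (inferInstance : Algebra.EssFiniteType (CoordGL n (cycRing M N K)) _)
  have h3 := Pushout.inl_essFiniteType (toE n M N K) (chernModelA M N q p).left hmod
  have h4 := Pushout.inl_essFiniteType ((Pushout.inr (toE n M N K)
    (chernModelA M N q p).left).comp (chernModelA M N q p).right) (toE n M N K) hE
  have h5 := RingHom.essFiniteType_algebraMap.mpr hA
  have h6 := RingHom.essFiniteType_algebraMap.mpr hB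
  have h7 := (h4.comp' h3).comp' (hE.comp' (h6.comp' h5))
  exact essFiniteType_int_of_ringHom h7

theorem essFiniteType_of_int {R S : Type*} [CommRing R] [CommRing S]
    [Algebra.EssFiniteType ℤ S] (f : R →+* S) : f.EssFiniteType := by
  let := f.toAlgebra
  have : IsScalarTower ℤ R S := .of_algebraMap_eq fun x => by simp
  exact Algebra.EssFiniteType.of_comp ℤ R S

end

end ArithChern

namespace ArithChern

variable {n : ℕ}

/-! ### Unramifiedness and finiteness over `E`, and the existence of the Chern connection -/

section

variable {M : ℤ} {N : ℕ} [NeZero N] {K : Type u} [Field K] [CharZero K]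
  [IsCyclotomicExtension {N} ℚ K]

variable (q : Matrix.GeneralLinearGroup (Fin n) (cycRing M N K)) (p : ℕ)

/-- Two matrices congruent modulo a square-zero ideal with the same square are equal, if the Jordan
multiplication by one of them is invertible. -/
theorem ModelRel.unique_of_sq_zero {A : Type u} [CommRing A] {s : A →+* A} {p : ℕ}
    {q : Matrix (Fin n) (Fin n) A} (h2 : IsUnit (2 : A)) (hq : IsUnit q.det)
    {T : Type v} [CommRing T] {I : Ideal T} (hI : I ^ 2 = ⊥)
    {a : A →+* T} {X Y Y' : Matrix (Fin n) (Fin n) T} (h : ModelRel s p q a X Y)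
    (h' : ModelRel s p q a X Y') (hYY : ∀ i j, Y' i j - Y i j ∈ I) : Y' = Y := by
  have hH : IsUnit (Hform (q.map (a.comp s)) (entryPow p X)).det := by
    rw [Hform, Matrix.det_mul, Matrix.det_mul, Matrix.det_transpose, det_map']
    exact (h.det_Xp.mul (hq.map _)).mul h.det_Xp
  have h3 : Y' * Y' = Y * Y := by
    have := h'.rel.trans h.rel.symm
    have := congrArg (fun Z => (Hform (q.map (a.comp s)) (entryPow p X))⁻¹ * Z) this
    simpa only [Matrix.nonsing_inv_mul_cancel_left _ _ hH] using this
  have hZ : (Y' - Y) * (Y' - Y) = 0 := by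
    ext i j
    rw [Matrix.mul_apply]
    refine Finset.sum_eq_zero fun k _ => ?_
    have : (Y' - Y) i k * (Y' - Y) k j ∈ I ^ 2 := by
      rw [pow_two]; exact Ideal.mul_mem_mul (hYY i k) (hYY k j)
    rwa [hI] at this
  have h4 : (Y' - Y) * Y + Y * (Y' - Y) = 0 * Y + Y * 0 := by
    have e : (Y' - Y) * Y + Y * (Y' - Y) = Y' * Y' - Y * Y - (Y' - Y) * (Y' - Y) := by
      noncomm_ring
    rw [e, hZ, h3]; simp
  exact sub_eq_zero.mp ((bijective_of_isUnit_jor (isUnit_two_of_map h2 a) h.jor_Y).1 h4)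

/-- Only uniqueness of infinitesimal lifts is needed here: with the essentially finite type
condition over a field it yields both finiteness and reducedness. -/
theorem chernL_formallyUnramified (hM : Even M) (hM0 : M ≠ 0) :
    (chernL q p).FormallyUnramified := by
  have h2 := isUnit_two_cycRing (N := N) (K := K) hM hM0
  let := (chernL q p).toAlgebra
  change Algebra.FormallyUnramified (FieldE n K) (ChernRing q p)
  rw [Algebra.FormallyUnramified.iff_comp_injective]
  intro T _ _ I hI f g hfg
  have hl : (f : ChernRing q p →+* T).comp (chernL q p) =
      (g : ChernRing q p →+* T).comp (chernL q p) :=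
    f.comp_algebraMap.trans g.comp_algebraMap.symm
  have hf := (chernRel q p hM hM0).map h2 (f : ChernRing q p →+* T)
  have hg := (chernRel q p hM hM0).map h2 (g : ChernRing q p →+* T)
  have hX : ((matE n K).map (chernL q p)).map (f : ChernRing q p →+* T) =
      ((matE n K).map (chernL q p)).map (g : ChernRing q p →+* T) := by
    rw [Matrix.map_map, Matrix.map_map, ← RingHom.coe_comp, ← RingHom.coe_comp, hl]
  rw [← RingHom.comp_assoc, ← RingHom.comp_assoc, hl, hX] at hf
  rw [← RingHom.comp_assoc, ← RingHom.comp_assoc] at hg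
  have hY := hg.unique_of_sq_zero h2 (isUnit_det_q q) hI hf (fun i j => by
    have := AlgHom.congr_fun hfg (chernY q p i j)
    exact Ideal.Quotient.eq.mp this)
  refine AlgHom.coe_ringHom_injective ?_
  exact chernRing_ext q p hl hY

theorem chernL_finite (hM : Even M) (hM0 : M ≠ 0) : (chernL q p).Finite := by
  have h1 := chernL_formallyUnramified q p hM hM0
  have h3 := chernRing_essFiniteType_int q p hM hM0
  have h4 := essFiniteType_of_int (chernL q p)
  let := (chernL q p).toAlgebra
  have h1' : Algebra.FormallyUnramified (FieldE n K) (ChernRing q p) := h1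
  have h4' : Algebra.EssFiniteType (FieldE n K) (ChernRing q p) := h4
  exact Algebra.FormallyUnramified.finite_of_free (FieldE n K) (ChernRing q p)

theorem chernRing_isReduced (hM : Even M) (hM0 : M ≠ 0) : IsReduced (ChernRing q p) := by
  have h1 := chernL_formallyUnramified q p hM hM0
  have h3 := chernRing_essFiniteType_int q p hM hM0
  have h4 := essFiniteType_of_int (chernL q p)
  let := (chernL q p).toAlgebra
  have h1' : Algebra.FormallyUnramified (FieldE n K) (ChernRing q p) := h1
  have h4' : Algebra.EssFiniteType (FieldE n K) (ChernRing q p) := h4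
  exact Algebra.FormallyUnramified.isReduced_of_field (FieldE n K) (ChernRing q p)

theorem frobK_surjective : Function.Surjective (frobK N K p) := by
  rw [frobK]
  split_ifs with h
  · exact AlgEquiv.surjective _
  · exact Function.surjective_id

theorem trdeg_of_finite {L : Type u} [Field L] (l : FieldE n K →+* L) (hl : l.Finite) :
    @Algebra.trdeg K L _ _ (l.comp (algebraMap K (FieldE n K))).toAlgebra =
      Cardinal.lift.{u} (Cardinal.mk (Fin n × Fin n)) := by
  let := (l.comp (algebraMap K (FieldE n K))).toAlgebra
  let := l.toAlgebra
  have : IsScalarTower K (FieldE n K) L := .of_algebraMap_eq fun _ => rfl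
  have : Module.Finite (FieldE n K) L := hl
  have : Algebra.IsAlgebraic (MvPolynomial (Fin n × Fin n) K) (FieldE n K) :=
    IsLocalization.isAlgebraic _ (nonZeroDivisors (MvPolynomial (Fin n × Fin n) K))
  rw [← trdeg_add_eq K (FieldE n K) (A := L), trdeg_eq_zero (R := FieldE n K),
    ← trdeg_add_eq K (MvPolynomial (Fin n × Fin n) K) (A := FieldE n K),
    trdeg_eq_zero (R := MvPolynomial (Fin n × Fin n) K), add_zero, add_zero,
    MvPolynomial.trdeg_of_isDomain]

/-- A homomorphism `r` from `E` to a finite extension `l : E → L` that is essentially of finite type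
and semilinear over an automorphism of the field of constants is also finite. -/
theorem finite_of_twisted {L : Type u} [Field L]
    (l r : FieldE n K →+* L) (hess : r.EssFiniteType) (hl : l.Finite)
    {σ : K →+* K} (hσ : Function.Surjective σ)
    (h : r.comp (algebraMap K (FieldE n K)) = (l.comp (algebraMap K (FieldE n K))).comp σ) :
    r.Finite := by
  have htr := trdeg_of_finite l hl
  let := (l.comp (algebraMap K (FieldE n K))).toAlgebra
  have hcoe : ∀ k, algebraMap K L k = l (algebraMap K (FieldE n K) k) := fun _ => rfl
  have hcomp : ∀ g : MvPolynomial (Fin n × Fin n) K,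
      MvPolynomial.aeval (fun ij : Fin n × Fin n => r (matE n K ij.1 ij.2))
        (MvPolynomial.map σ g) = r (algebraMap _ (FieldE n K) g) := by
    intro g
    have : (MvPolynomial.aeval (fun ij : Fin n × Fin n => r (matE n K ij.1 ij.2))).toRingHom.comp
        (MvPolynomial.map σ) = r.comp (algebraMap (MvPolynomial (Fin n × Fin n) K) (FieldE n K)) := by
      refine MvPolynomial.ringHom_ext (fun a => ?_) fun ij => ?_
      · have e := RingHom.congr_fun h a
        simp only [RingHom.comp_apply, IsScalarTower.algebraMap_apply K
          (MvPolynomial (Fin n × Fin n) K) (FieldE n K), MvPolynomial.algebraMap_eq] at e hcoe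
        simp [hcoe, ← e]
      · simp [matE]
    exact RingHom.congr_fun this g
  have hind : AlgebraicIndependent K (fun ij : Fin n × Fin n => r (matE n K ij.1 ij.2)) := by
    rw [algebraicIndependent_iff]
    intro f hf
    -- Surjectivity of the twist on constants turns any polynomial relation into the image under `r`
    -- of an element of `E`.
    obtain ⟨g, rfl⟩ := MvPolynomial.map_surjective σ hσ f
    rw [hcomp] at hf
    have : g = 0 := by
      refine IsFractionRing.injective (MvPolynomial (Fin n × Fin n) K) (FieldE n K) ?_
      rw [map_zero]
      exact (map_eq_zero r).mp hf
    rw [this, map_zero]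
  -- There are `n²` independent elements and `n²` is the transcendence degree, seen through `l`; so
  -- they form a transcendence basis.
  have hbasis := hind.isTranscendenceBasis_of_lift_trdeg_le_of_finite (by rw [htr]; simp)
  have halg := hbasis.isAlgebraic
  set x : Fin n × Fin n → L := fun ij => r (matE n K ij.1 ij.2)
  have hle : ∀ z ∈ Algebra.adjoin K (Set.range x), z ∈ r.fieldRange := by
    intro z hz
    induction hz using Algebra.adjoin_induction with
    | mem y hy => obtain ⟨ij, rfl⟩ := hy; exact ⟨_, rfl⟩
    | algebraMap k =>
      obtain ⟨k', rfl⟩ := hσ k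
      exact ⟨algebraMap K _ k', RingHom.congr_fun h k'⟩
    | add a b _ _ ha hb => exact add_mem ha hb
    | mul a b _ _ ha hb => exact mul_mem ha hb
  let incl : Algebra.adjoin K (Set.range x) →+* r.fieldRange :=
    (Algebra.adjoin K (Set.range x)).val.toRingHom.codRestrict r.fieldRange (fun z => hle z z.2)
  let := incl.toAlgebra
  have : IsScalarTower (Algebra.adjoin K (Set.range x)) r.fieldRange L := .of_algebraMap_eq fun _ => rfl
  have halg2 : Algebra.IsAlgebraic r.fieldRange L :=
    Algebra.IsAlgebraic.extendScalars (R := Algebra.adjoin K (Set.range x))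
      (fun a b hab => Subtype.ext (congrArg (fun z : r.fieldRange => (z : L)) hab))
  let := r.toAlgebra
  have halg3 : Algebra.IsAlgebraic (FieldE n K) L := by
    refine Algebra.IsAlgebraic.of_ringHom_of_comp_eq r.rangeRestrictField (RingHom.id L)
      (RingHom.rangeRestrictField_bijective r).2 Function.injective_id ?_
    rfl
  have hch : CharZero (FieldE n K) := inferInstance
  have hess : Algebra.EssFiniteType (FieldE n K) L := hess
  have := Algebra.FormallyEtale.of_isSeparable (FieldE n K) L
  exact Algebra.FormallyUnramified.finite_of_free (FieldE n K) L

/-- The ring is reduced and Artinian, hence a product of its residue fields, and `finite_of_twisted`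
applies to each factor. -/
theorem chernR_finite (hM : Even M) (hM0 : M ≠ 0) : (chernR q p).Finite := by
  have hl := chernL_finite q p hM hM0
  have hess := chernRing_essFiniteType_int q p hM hM0
  have := chernRing_isReduced q p hM hM0
  have hart : IsArtinianRing (ChernRing q p) := by
    let := (chernL q p).toAlgebra
    have : Module.Finite (FieldE n K) (ChernRing q p) := hl
    exact isArtinian_of_tower (FieldE n K) inferInstance
  have hm : ∀ m : MaximalSpectrum (ChernRing q p),
      ((Ideal.Quotient.mk m.asIdeal).comp (chernR q p)).Finite := by
    intro m
    let := Ideal.Quotient.field m.asIdeal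
    refine finite_of_twisted ((Ideal.Quotient.mk m.asIdeal).comp (chernL q p)) _
      ((RingHom.FiniteType.of_surjective (Ideal.Quotient.mk m.asIdeal)
        Ideal.Quotient.mk_surjective).essFiniteType.comp' (essFiniteType_of_int (chernR q p)))
      (RingHom.Finite.comp (RingHom.Finite.of_surjective _ Ideal.Quotient.mk_surjective) hl)
      (frobK_surjective (N := N) (K := K) p) ?_
    rw [RingHom.comp_assoc, chernR_const]
    rfl
  let := (chernR q p).toAlgebra
  have hfin : ∀ m : MaximalSpectrum (ChernRing q p),
      Module.Finite (FieldE n K) (ChernRing q p ⧸ m.asIdeal) := hm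
  have : Module.Finite (FieldE n K) (∀ m : MaximalSpectrum (ChernRing q p),
    ChernRing q p ⧸ m.asIdeal) := Module.Finite.pi
  exact Module.Finite.of_injective
    ((IsArtinianRing.equivPi (ChernRing q p)).toLinearEquiv.restrictScalars (FieldE n K)).toLinearMap
    (IsArtinianRing.equivPi (ChernRing q p)).injective

theorem chernCorrespondence_isFiniteReduced (hM : Even M) (hM0 : M ≠ 0) {p : ℕ} (hp : p.Prime)
    (hpM : ¬ (p : ℤ) ∣ M) (hpN : p.Coprime N) :
    (chernCorrespondence M N q p).IsFiniteReduced where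
  nonempty := chernRing_nontrivial q hM hM0 hp hpM hpN
  reduced := chernRing_isReduced q p hM hM0
  left_finite := chernL_finite q p hM hM0
  right_finite := chernR_finite q p hM hM0

theorem chern_connection_exists (hM : Even M) (hM0 : M ≠ 0)
    {V : Set ℕ} (hV : ∀ p ∈ V, p.Prime ∧ ¬ (p : ℤ) ∣ M * N)
    (hq : q.valᵀ = q.val ∨ q.valᵀ = -q.val) :
    ∃ δ : AdelicConnection n (cycRing M N K) V,
      IsChernConnection q.val δ ∧
      (∀ δ' : AdelicConnection n (cycRing M N K) V, IsChernConnection q.val δ' → δ' = δ) ∧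
      (∀ p : V, (chernModelA M N q p).Algebraizes (p : ℕ) (δ p).frob) ∧
      IsCorrespondenceStructure δ (fun p : V => chernCorrespondence M N q p) := by
  have hpM : ∀ p ∈ V, ¬ (p : ℤ) ∣ M := fun p hp h => (hV p hp).2 (h.mul_right _)
  have hpN : ∀ p ∈ V, p.Coprime N := fun p hp => by
    rw [(hV p hp).1.coprime_iff_not_dvd]
    exact fun h => (hV p hp).2 ((Int.natCast_dvd_natCast.mpr h).mul_left _)
  have hp2 : ∀ p ∈ V, Odd p := fun p hp => by
    refine (hV p hp).1.odd_of_ne_two ?_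
    rintro rfl
    exact hpM 2 hp (by exact_mod_cast hM.two_dvd)
  choose δ h1 h2 h3 h4 using fun p : V =>
    exists_unique_chern hM hM0 (hV p p.2).1 (hp2 p p.2) (hpN p p.2) q hq
  refine ⟨δ, ⟨h1, h2⟩, ?_, h3, fun p => ⟨?_, ?_⟩⟩
  · exact fun δ' h' => funext fun p => h4 p (δ' p) (h'.hform p) (h'.bform p)
  · exact chernCorrespondence_isFiniteReduced q hM hM0 (hV p p.2).1 (hpM p p.2) (hpN p p.2)
  · exact ⟨chernModelA M N q p, ⟨RingEquiv.refl _, rfl, rfl⟩, h3 p⟩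

end

end ArithChern

namespace ArithChern

variable {n : ℕ}

/-! ## Counting homomorphisms -/

section Counting

/-- A finite reduced algebra over a field of characteristic zero all of whose residue fields have
degree at least `d`, and which has at most `d` geometric points, is a field of degree `d`. -/
theorem isField_of_card_algHom_le {k F Ω : Type*} [Field k] [CharZero k] [CommRing F] [Algebra k F]
    [Module.Finite k F] [IsReduced F] [Nontrivial F] [Field Ω] [Algebra k Ω] [IsAlgClosed Ω]
    {d : ℕ} (hd : 0 < d) (h1 : ∀ m : MaximalSpectrum F, d ≤ Module.finrank k (F ⧸ m.asIdeal))
    (h2 : Nat.card (F →ₐ[k] Ω) ≤ d) : IsField F ∧ Module.finrank k F = d := by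
  have hcard : ∀ m : MaximalSpectrum F, d ≤ Nat.card ((F ⧸ m.asIdeal) →ₐ[k] Ω) := by
    intro m
    let := Ideal.Quotient.field m.asIdeal
    have := AlgHom.card k (F ⧸ m.asIdeal) Ω
    rw [Nat.card_eq_fintype_card, this]
    exact h1 m
  -- Two maximal ideals would account for `2d > d` geometric points, distinguished by their kernels.
  have huniq : ∀ m m' : MaximalSpectrum F, m = m' := by
    intro m m'
    by_contra hne
    let c : ((F ⧸ m.asIdeal) →ₐ[k] Ω) ⊕ ((F ⧸ m'.asIdeal) →ₐ[k] Ω) → (F →ₐ[k] Ω) :=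
      Sum.elim (fun g => g.comp (Ideal.Quotient.mkₐ k m.asIdeal))
        (fun g => g.comp (Ideal.Quotient.mkₐ k m'.asIdeal))
    have hker : ∀ (m : MaximalSpectrum F) (g : (F ⧸ m.asIdeal) →ₐ[k] Ω),
        RingHom.ker (g.comp (Ideal.Quotient.mkₐ k m.asIdeal)) = m.asIdeal := by
      intro m g
      let := Ideal.Quotient.field m.asIdeal
      ext z
      change (g : (F ⧸ m.asIdeal) →+* Ω) (Ideal.Quotient.mk m.asIdeal z) = 0 ↔ _
      rw [map_eq_zero_iff _ (RingHom.injective _), Ideal.Quotient.eq_zero_iff_mem]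
    have hinj : ∀ m : MaximalSpectrum F, Function.Injective
        (fun g : (F ⧸ m.asIdeal) →ₐ[k] Ω => g.comp (Ideal.Quotient.mkₐ k m.asIdeal)) := by
      intro m g g' h
      refine AlgHom.coe_ringHom_injective (Ideal.Quotient.ringHom_ext ?_)
      exact congrArg (fun f : F →ₐ[k] Ω => (f : F →+* Ω)) h
    have hc : Function.Injective c := by
      rintro (g | g) (g' | g') h
      · exact congrArg _ (hinj m h)
      · refine absurd (MaximalSpectrum.ext ?_) hne
        rw [← hker m g, ← hker m' g']
        exact congrArg (fun f : F →ₐ[k] Ω => RingHom.ker f) h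
      · refine absurd (MaximalSpectrum.ext ?_) hne
        rw [← hker m g', ← hker m' g]
        exact congrArg (fun f : F →ₐ[k] Ω => RingHom.ker f) h.symm
      · exact congrArg _ (hinj m' h)
    have h4 := Nat.card_le_card_of_injective c hc
    have h5 := hcard m
    have h6 := hcard m'
    have : Nat.card (((F ⧸ m.asIdeal) →ₐ[k] Ω) ⊕ ((F ⧸ m'.asIdeal) →ₐ[k] Ω)) = _ := Nat.card_sum
    omega
  have hloc : IsLocalRing F := by
    obtain ⟨m, hm⟩ := Ideal.exists_maximal F
    refine IsLocalRing.of_unique_max_ideal ⟨m, hm, fun m' hm' => ?_⟩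
    exact congrArg MaximalSpectrum.asIdeal (huniq ⟨m', hm'⟩ ⟨m, hm⟩)
  have : IsArtinianRing F := isArtinian_of_tower k inferInstance
  have hF := IsArtinianRing.isField_of_isReduced_of_isLocalRing F
  refine ⟨hF, le_antisymm ?_ ?_⟩
  · let := hF.toField
    have := AlgHom.card k F Ω
    rw [← this, ← Nat.card_eq_fintype_card]
    exact h2
  · obtain ⟨m, hm⟩ := Ideal.exists_maximal F
    exact (h1 ⟨m, hm⟩).trans (LinearMap.finrank_le_finrank_of_surjective
      (f := (Ideal.Quotient.mkₐ k m).toLinearMap) Ideal.Quotient.mk_surjective)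

/-- A homomorphism from a field to an algebraically closed field extends along finite ring
homomorphisms to nonzero rings. -/
theorem exists_extension {E F : Type*} {U : Type*} [Field E] [CommRing F] [Nontrivial F] [Field U]
    [IsAlgClosed U] {f : E →+* F} (hf : f.Finite) (σ : E →+* U) :
    ∃ ρ : F →+* U, ρ.comp f = σ := by
  obtain ⟨m, hm⟩ := Ideal.exists_maximal F
  let := Ideal.Quotient.field m
  let := f.toAlgebra
  have : Module.Finite E F := hf
  let := σ.toAlgebra
  have : Algebra.IsAlgebraic E (F ⧸ m) := Algebra.IsAlgebraic.of_finite E (F ⧸ m)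
  let g : (F ⧸ m) →ₐ[E] U := IsAlgClosed.lift
  exact ⟨(g : (F ⧸ m) →+* U).comp (Ideal.Quotient.mk m), RingHom.ext fun e => g.commutes e⟩

end Counting

/-! ## The actions of correspondences -/

section Actions

open Correspondence

variable {E : Type u} [Field E]

theorem finite_points {U : Type v} [Field U] {Γ : Correspondence E} (hl : Γ.left.Finite)
    (σ : E →+* U) : Finite {ρ : Γ.carrier →+* U // ρ.comp Γ.left = σ} := by
  let := Γ.left.toAlgebra
  let := σ.toAlgebra
  have : Module.Finite E Γ.carrier := hl
  refine Finite.of_injective (β := Γ.carrier →ₐ[E] U)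
    (fun ρ => { ρ.1 with commutes' := fun e => RingHom.congr_fun ρ.2 e }) ?_
  intro ρ ρ' h
  exact Subtype.ext (congrArg (fun g : Γ.carrier →ₐ[E] U => (g : Γ.carrier →+* U)) h)

theorem lowerStar_single {U : Type v} [Field U] (Γ : Correspondence E) (σ : E →+* U) :
    Γ.lowerStar U (Finsupp.single σ 1) = ∑ᶠ ρ : {ρ : Γ.carrier →+* U // ρ.comp Γ.left = σ},
      Finsupp.single (ρ.1.comp Γ.right) (1 : ℤ) := by
  rw [lowerStar, Finsupp.lift_apply, Finsupp.sum_single_index] <;> simp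

/-- The trace of an element of the base field is the degree times that element. Such pairs `(z, w)`
are the only place where `Γ^*` is ever computed. -/
theorem upperStar_eq_of_right_eq {Γ : Correspondence E} {z w : E} (h : Γ.right z = Γ.left w) :
    Γ.upperStar z = Γ.leftDegree • w := by
  let := Γ.left.toAlgebra
  change Algebra.trace E Γ.carrier (Γ.right z) = _
  rw [h]
  exact Algebra.trace_algebraMap w

/-- The correspondence given by an endomorphism. -/
theorem upperStar_graph (f : E →+* E) (z : E) :
    Correspondence.upperStar ⟨E, RingHom.id E, f⟩ z = f z := by
  rw [upperStar_eq_of_right_eq (w := f z) rfl]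
  have e : (RingHom.id E).toAlgebra = Algebra.id E := Algebra.algebra_ext _ _ fun _ => rfl
  have : Correspondence.leftDegree ⟨E, RingHom.id E, f⟩ = 1 := by
    change @Module.finrank E E _ _ (RingHom.id E).toAlgebra.toModule = 1
    rw [e]
    exact Module.finrank_self E
  rw [this, one_smul]

theorem lowerStar_graph {U : Type v} [Field U] (f : E →+* E) (σ : E →+* U) :
    Correspondence.lowerStar U ⟨E, RingHom.id E, f⟩ (Finsupp.single σ 1) =
      Finsupp.single (σ.comp f) 1 := by
  rw [lowerStar_single]
  let : Unique {ρ : E →+* U // ρ.comp (RingHom.id E) = σ} :=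
    ⟨⟨⟨σ, RingHom.comp_id σ⟩⟩, fun ρ => Subtype.ext ((RingHom.comp_id ρ.1).symm.trans ρ.2)⟩
  exact finsum_unique fun ρ : {ρ : E →+* U // ρ.comp (RingHom.id E) = σ} =>
    Finsupp.single (ρ.1.comp f) (1 : ℤ)

variable [CharZero E]

/-- On `z` the two orders of composition give `d f(w)` and `d w^{p'}`, with `d` the left degree. -/
theorem upperCurvature11_ne_zero {Γ : Correspondence E} {f : E →+* E} {p p' : ℕ} (hp : p ≠ 0)
    (hp' : p' ≠ 0) (hd : Γ.leftDegree ≠ 0) {z w : E} (h : Γ.right z = Γ.left w)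
    (hz : f z = z ^ p') (hw : f w ≠ w ^ p') :
    upperCurvature11 p p' Γ ⟨E, RingHom.id E, f⟩ ≠ 0 := by
  intro h0
  have h1 : ⁅Correspondence.upperStar ⟨E, RingHom.id E, f⟩, Γ.upperStar⁆ = 0 := by
    rw [upperCurvature11] at h0
    refine (smul_eq_zero.mp h0).resolve_left ?_
    split_ifs <;> positivity
  have h2 := DFunLike.congr_fun h1 z
  have h3 : Correspondence.upperStar ⟨E, RingHom.id E, f⟩ (Γ.upperStar z) -
      Γ.upperStar (Correspondence.upperStar ⟨E, RingHom.id E, f⟩ z) = 0 := h2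
  rw [upperStar_graph, upperStar_graph, upperStar_eq_of_right_eq h, hz,
    upperStar_eq_of_right_eq (w := w ^ p') (by rw [map_pow, map_pow, h]), map_nsmul, ← smul_sub] at h3
  exact hw (sub_eq_zero.mp ((smul_eq_zero.mp h3).resolve_left hd))

/-- Follow the coefficient of `τ = ρ ∘ φ ∘ f` in the image of `[σ]`. It is positive in one order of
composition. In the other it is zero, for every embedding occurring there sends `z` to `σ(f w)`,
while `τ(z) = σ(w^{p'})`. -/
theorem lowerCurvature11_ne_zero {Γ : Correspondence E} {f : E →+* E} {p p' : ℕ} (hp : p ≠ 0)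
    (hp' : p' ≠ 0) (hnt : Nontrivial Γ.carrier) (hl : Γ.left.Finite) {z w : E}
    (h : Γ.right z = Γ.left w) (hz : f z = z ^ p') (hw : f w ≠ w ^ p')
    {U : Type v} [Field U] [IsAlgClosed U] (hU : Nonempty (E →+* U)) :
    lowerCurvature11 U p p' Γ ⟨E, RingHom.id E, f⟩ ≠ 0 := by
  classical
  obtain ⟨σ⟩ := hU
  obtain ⟨ρ, hρ⟩ := exists_extension hl σ
  set Γ' : Correspondence E := ⟨E, RingHom.id E, f⟩
  let τ := (ρ.comp Γ.right).comp f
  -- An integral linear functional; tensored with `ℚ` it detects non-vanishing in the tensor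
  -- product, where the denominators live.
  let ev : Module.End ℤ (Correspondence.Cyc E U) →ₗ[ℤ] ℤ :=
    (Finsupp.lapply τ).comp (LinearMap.applyₗ (Finsupp.single σ 1))
  have hev : 0 < ev ⁅Γ'.lowerStar U, Γ.lowerStar U⁆ := by
    change 0 < (Γ'.lowerStar U (Γ.lowerStar U (Finsupp.single σ 1)) -
      Γ.lowerStar U (Γ'.lowerStar U (Finsupp.single σ 1))) τ
    have := finite_points hl σ
    have := finite_points hl (σ.comp f)
    let := Fintype.ofFinite {ρ : Γ.carrier →+* U // ρ.comp Γ.left = σ}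
    let := Fintype.ofFinite {ρ : Γ.carrier →+* U // ρ.comp Γ.left = σ.comp f}
    rw [lowerStar_graph, lowerStar_single, lowerStar_single, finsum_eq_sum_of_fintype,
      finsum_eq_sum_of_fintype, map_sum, Finsupp.sub_apply, Finsupp.finsetSum_apply,
      Finsupp.finsetSum_apply]
    have h1 : ∑ x : {ρ : Γ.carrier →+* U // ρ.comp Γ.left = σ.comp f},
        (Finsupp.single (x.1.comp Γ.right) (1 : ℤ)) τ = 0 := by
      refine Finset.sum_eq_zero fun x _ => ?_
      rw [Finsupp.single_apply, if_neg]
      intro hx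
      have e1 : x.1 (Γ.right z) = σ (f w) := by
        rw [h]; exact RingHom.congr_fun x.2 w
      have e2 : x.1 (Γ.right z) = σ (w ^ p') := by
        have := RingHom.congr_fun hx z
        refine this.trans ?_
        change ρ (Γ.right (f z)) = _
        rw [hz, map_pow, h, map_pow, map_pow]
        exact congrArg (· ^ p') (RingHom.congr_fun hρ w)
      exact hw (σ.injective (e1.symm.trans e2))
    rw [h1, sub_zero]
    refine Finset.sum_pos' (fun x _ => ?_) ⟨⟨ρ, hρ⟩, Finset.mem_univ _, ?_⟩
    · rw [lowerStar_graph, Finsupp.single_apply]; split_ifs <;> simp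
    · rw [lowerStar_graph]
      simp [τ]
  intro h0
  rw [lowerCurvature11] at h0
  have h2 := congrArg (fun t => TensorProduct.rid ℤ ℚ (LinearMap.lTensor ℚ ev t)) h0
  simp only [LinearMap.lTensor_tmul, TensorProduct.rid_tmul, map_zero] at h2
  refine (smul_ne_zero hev.ne' ?_) h2
  split_ifs <;> positivity

end Actions

/-! ## Partially induced correspondences -/

section Induced

variable {M : ℤ} {N : ℕ} [NeZero N] {K : Type u} [Field K] [CharZero K]
  [IsCyclotomicExtension {N} ℚ K]

theorem iota_const : (iota n K).comp (algebraMap K (FieldE n K)) = algebraMap K _ := by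
  ext k
  have h := IsScalarTower.algebraMap_apply K (MvPolynomial (Fin n × Fin n) K) (FieldE n K) k
  simp only [RingHom.comp_apply, h, iota, IsFractionRing.map, IsLocalization.map_eq]
  congr 1
  exact (iotaPoly n K).commutes k

theorem iota_matE : (matE n K).map (iota n K) = -matE n K := by
  ext i j
  simp only [matE, Matrix.map_apply, Matrix.mvPolynomialX_apply, Matrix.neg_apply, iota,
    IsFractionRing.map, IsLocalization.map_eq]
  simp [iotaPoly]

theorem iota_iota : (iota n K).comp (iota n K) = RingHom.id _ := by
  refine fieldE_ringHom_ext ?_ ?_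
  · rw [RingHom.comp_assoc, iota_const, iota_const]; rfl
  · rw [RingHom.coe_comp, ← Matrix.map_map, iota_matE, Matrix.map_neg _ (map_neg _), iota_matE,
      neg_neg]
    simp

theorem frobE_const {p : ℕ} (hp : p.Prime) : (frobE n N K p hp).comp (algebraMap K (FieldE n K)) =
    (algebraMap K _).comp (frobK N K p) := by
  ext k
  have h := fun k => IsScalarTower.algebraMap_apply K (MvPolynomial (Fin n × Fin n) K) (FieldE n K) k
  rw [RingHom.comp_apply, RingHom.comp_apply, h, h, frobE, IsFractionRing.map,
    IsLocalization.map_eq]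
  congr 1
  simp [frobPoly, MvPolynomial.algebraMap_eq]

theorem frobE_matE {p : ℕ} (hp : p.Prime) : (matE n K).map (frobE n N K p hp) =
    entryPow p (matE n K) := by
  ext i j
  simp only [matE, Matrix.map_apply, Matrix.mvPolynomialX_apply, frobE,
    IsFractionRing.map, IsLocalization.map_eq, entryPow]
  simp [frobPoly]

theorem jor_neg {R : Type*} [CommRing R] (Y : Matrix (Fin n) (Fin n) R) :
    jor (-Y) = (-1) ^ (n * n) * jor Y := by
  have : Ring.inverse (2 : R) • (LinearMap.mulRight R (-Y) + LinearMap.mulLeft R (-Y)) =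
      (-1 : R) • (Ring.inverse (2 : R) • (LinearMap.mulRight R Y + LinearMap.mulLeft R Y)) := by
    ext z : 1
    simp only [LinearMap.smul_apply, LinearMap.add_apply, LinearMap.mulRight_apply,
      LinearMap.mulLeft_apply, mul_neg, neg_mul, neg_smul, one_smul, smul_neg, LinearMap.neg_apply,
      ← neg_add]
  rcases subsingleton_or_nontrivial R with h | h
  · exact Subsingleton.elim _ _
  · rw [jor, this, LinearMap.det_smul, jor]
    simp [Module.finrank_matrix]

variable (q : Matrix.GeneralLinearGroup (Fin n) (cycRing M N K)) {p : ℕ}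

theorem ModelRel.neg_right {A : Type u} [CommRing A] {s : A →+* A} {p : ℕ}
    {q : Matrix (Fin n) (Fin n) A} {T : Type v} [CommRing T]
    {a : A →+* T} {X Y : Matrix (Fin n) (Fin n) T} (h : ModelRel s p q a X Y)
    (h1 : IsUnit (1 - Y).det) : ModelRel s p q a X (-Y) where
  det_X := h.det_X
  det_Xp := h.det_Xp
  det_F := h.det_F
  det_Y := by rwa [neg_add_eq_sub]
  jor_Y := by
    rw [jor_neg]
    exact ((isUnit_one.neg).pow _).mul h.jor_Y
  rel := by rw [neg_mul_neg]; exact h.rel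

theorem ModelRel.neg_left {A : Type u} [CommRing A] {s : A →+* A} {p : ℕ} (hp : Odd p)
    {q : Matrix (Fin n) (Fin n) A} {T : Type v} [CommRing T]
    {a : A →+* T} {X Y : Matrix (Fin n) (Fin n) T} (h : ModelRel s p q a X Y) :
    ModelRel s p q a (-X) Y where
  det_X := by rw [Matrix.det_neg]; exact ((isUnit_one.neg).pow _).mul h.det_X
  det_Xp := by rw [entryPow_neg hp, Matrix.det_neg]; exact ((isUnit_one.neg).pow _).mul h.det_Xp
  det_F := by
    have : Hform (q.map a) (-X) = Hform (q.map a) X := by simp [Hform]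
    rw [this]; exact h.det_F
  det_Y := h.det_Y
  jor_Y := h.jor_Y
  rel := by
    have e1 : Hform (q.map a) (-X) = Hform (q.map a) X := by simp [Hform]
    have e2 : Hform (q.map (a.comp s)) (-entryPow p X) =
      Hform (q.map (a.comp s)) (entryPow p X) := by simp [Hform]
    rw [entryPow_neg hp, e1, e2]; exact h.rel

/-- The involution of the ring of `Γ_p` with `y ↦ -y`. -/
theorem exists_sign_involution (hM : Even M) (hM0 : M ≠ 0)
    (h1 : IsUnit (1 - chernY q p).det) :
    ∃ ν : ChernRing q p ≃+* ChernRing q p, (ν : _ →+* _).comp (chernL q p) = chernL q p ∧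
      (ν : _ →+* _).comp (chernR q p) = (chernR q p).comp (iota n K) ∧
      (chernY q p).map ν = -chernY q p := by
  obtain ⟨ν, hl, hr, hY⟩ := chernRing_exists_lift q p hM hM0 (chernL q p)
    ((chernR q p).comp (iota n K)) (-chernY q p)
    ((chernRel q p hM hM0).neg_right h1)
    (by rw [RingHom.comp_assoc, iota_const, chernR_const])
    (by rw [RingHom.coe_comp, ← Matrix.map_map, iota_matE, Matrix.map_neg _ (map_neg _), chernR_matE,
          Matrix.mul_neg])
  have hinv : ν.comp ν = RingHom.id _ := by
    refine chernRing_ext q p ?_ ?_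
    · rw [RingHom.comp_assoc, hl, hl]; rfl
    · rw [RingHom.coe_comp, ← Matrix.map_map, hY, Matrix.map_neg _ (map_neg _), hY, neg_neg]
      simp
  exact ⟨RingEquiv.ofRingHom ν ν hinv hinv, hl, hr, hY⟩

/-- The involution of the ring of `Γ_p` induced by `ι`. -/
theorem exists_iota_involution (hM : Even M) (hM0 : M ≠ 0) (hp : Odd p) :
    ∃ θ : ChernRing q p ≃+* ChernRing q p,
      (θ : _ →+* _).comp (chernL q p) = (chernL q p).comp (iota n K) ∧
      (θ : _ →+* _).comp (chernR q p) = (chernR q p).comp (iota n K) ∧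
      (chernY q p).map θ = chernY q p := by
  have hX : (matE n K).map ((chernL q p).comp (iota n K)) = -(matE n K).map (chernL q p) := by
    rw [RingHom.coe_comp, ← Matrix.map_map, iota_matE, Matrix.map_neg _ (map_neg _)]
  have hc : ((chernL q p).comp (iota n K)).comp (algebraMap K (FieldE n K)) =
      (chernL q p).comp (algebraMap K (FieldE n K)) := by
    rw [RingHom.comp_assoc, iota_const]
  obtain ⟨θ, hl, hr, hY⟩ := chernRing_exists_lift q p hM hM0 ((chernL q p).comp (iota n K))
    ((chernR q p).comp (iota n K)) (chernY q p)
    (by rw [hc, hX]; exact (chernRel q p hM hM0).neg_left hp)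
    (by rw [RingHom.comp_assoc, iota_const, hc, chernR_const])
    (by rw [hX, RingHom.coe_comp, ← Matrix.map_map, iota_matE, Matrix.map_neg _ (map_neg _),
          chernR_matE, entryPow_neg hp, Matrix.neg_mul])
  have hinv : θ.comp θ = RingHom.id _ := by
    refine chernRing_ext q p ?_ ?_
    · rw [RingHom.comp_assoc, hl, ← RingHom.comp_assoc, hl, RingHom.comp_assoc, iota_iota]; rfl
    · rw [RingHom.coe_comp, ← Matrix.map_map, hY, hY]
      simp
  exact ⟨RingEquiv.ofRingHom θ θ hinv hinv, hl, hr, hY⟩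

/-- The involution `y ↦ -y` fixes `π` and replaces `φ` by `φ ∘ ι`, so invariance of the trace gives
`Γ^* ∘ ι = Γ^*` and kills `E⁻`. The involution covering `ι` on both sides fixes `φ(z)` for `z` in
`E⁺`, so its trace is `ι`-invariant. -/
theorem chern_isPartiallyInduced (hM : Even M) (hM0 : M ≠ 0) (hp : Odd p)
    (h1 : IsUnit (1 - chernY q p).det) :
    (chernCorrespondence M N q p).IsPartiallyInduced (iota n K) := by
  obtain ⟨ν, hνl, hνr, -⟩ := exists_sign_involution q hM hM0 h1
  obtain ⟨θ, hθl, hθr, -⟩ := exists_iota_involution q hM hM0 hp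
  let := (chernL q p).toAlgebra
  have hstar : ∀ z, (chernCorrespondence M N q p).upperStar z =
    Algebra.trace (FieldE n K) (ChernRing q p) (chernR q p z) := fun _ => rfl
  have e1 : ∀ z, (chernCorrespondence M N q p).upperStar (iota n K z) =
      (chernCorrespondence M N q p).upperStar z := by
    intro z
    rw [hstar, hstar]
    let ν' : ChernRing q p ≃ₐ[FieldE n K] ChernRing q p :=
      AlgEquiv.ofRingEquiv (f := ν) (fun e => RingHom.congr_fun hνl e)
    rw [← Algebra.trace_eq_of_algEquiv ν' (chernR q p z)]
    exact congrArg _ (RingHom.congr_fun hνr z).symm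
  constructor
  · intro z hz
    have := Algebra.trace_eq_of_equiv_equiv
      (RingEquiv.ofRingHom (iota n K) (iota n K) iota_iota iota_iota) θ
      (by exact hθl.symm) (chernR q p z)
    rw [hstar]
    have e2 : θ (chernR q p z) = chernR q p z := by
      have := RingHom.congr_fun hθr z
      rw [RingHom.comp_apply, RingHom.comp_apply, hz] at this
      exact this
    rw [e2] at this
    have h3 := congrArg (iota n K) this
    refine h3.trans ?_
    exact RingHom.congr_fun iota_iota _
  · intro z hz
    have := e1 z
    rw [hz, map_neg] at this
    exact self_eq_neg.mp this.symm

end Induced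

end ArithChern

namespace ArithChern

variable {n : ℕ}

/-! ## Square classes -/

section Squares

theorem isSquare_of_isSquare_mul_sq {k : Type*} [Field k] {a b : k} (hb : b ≠ 0)
    (h : IsSquare (a * b ^ 2)) : IsSquare a := by
  obtain ⟨w, hw⟩ := h
  refine ⟨w / b, ?_⟩
  field_simp
  rw [hw]; ring

/-- A polynomial with a simple root on some line is not a square in the field of fractions. -/
theorem not_isSquare_of_simple_root {R : Type*} [CommRing R] [IsDomain R] [IsIntegrallyClosed R]
    {Ω : Type*} [Field Ω] (ev : R →+* Polynomial Ω) {f : R} {ω : Ω}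
    (h0 : (ev f).eval ω = 0) (h1 : (Polynomial.derivative (ev f)).eval ω ≠ 0) :
    ¬ IsSquare (algebraMap R (FractionRing R) f) := by
  rintro ⟨w, hw⟩
  have hint : IsIntegral R w := by
    refine IsIntegral.of_pow (n := 2) two_pos ?_
    rw [pow_two, ← hw]
    exact isIntegral_algebraMap
  obtain ⟨g, rfl⟩ := IsIntegrallyClosed.isIntegral_iff.mp hint
  rw [← map_mul] at hw
  have hf : f = g * g := IsFractionRing.injective R (FractionRing R) hw
  rw [hf, map_mul, Polynomial.eval_mul, mul_self_eq_zero] at h0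
  refine h1 ?_
  rw [hf, map_mul, Polynomial.derivative_mul]
  simp [h0]

/-- Adjoining the square root of `a` makes only the square classes of `1` and `a` trivial. -/
theorem isSquare_or_of_add_mul_sq {Ω : Type*} [Field Ω] (h2 : (2 : Ω) ≠ 0) (k : Subfield Ω)
    {u a s α β : Ω} (ha : a ∈ k) (hs : s ^ 2 = a) (hα : α ∈ k) (hβ : β ∈ k)
    (hu : u ∈ k) (h : (α + β * s) ^ 2 = u) : (∃ t ∈ k, t ^ 2 = u) ∨ ∃ t ∈ k, t ^ 2 = u * a := by
  by_cases hβ0 : β = 0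
  · subst hβ0
    exact Or.inl ⟨α, hα, by rw [← h]; ring⟩
  by_cases hα0 : α = 0
  · subst hα0
    exact Or.inr ⟨β * a, mul_mem hβ ha, by rw [← h, mul_pow, zero_add, mul_pow, hs]; ring⟩
  · left
    -- With both coefficients nonzero the cross term `2αβs` puts `s` itself into `k`.
    have hsk : s ∈ k := by
      have : s = (u - α ^ 2 - β ^ 2 * a) / (2 * α * β) := by
        rw [eq_div_iff (mul_ne_zero (mul_ne_zero h2 hα0) hβ0), ← h, ← hs]; ring
      rw [this]
      have h2k : (2 : Ω) ∈ k := by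
        have : (2 : Ω) = 1 + 1 := by norm_num
        rw [this]; exact add_mem (one_mem k) (one_mem k)
      exact div_mem (sub_mem (sub_mem hu (pow_mem hα 2)) (mul_mem (pow_mem hβ 2) ha))
        (mul_mem (mul_mem h2k hα) hβ)
    exact ⟨α + β * s, add_mem hα (mul_mem hβ hsk), h⟩

theorem exists_add_mul_of_finrank_two {k F : Type*} [Field k] [Field F] [Algebra k F]
    (h2 : Module.finrank k F = 2) {v : F} (hv : ∀ a : k, algebraMap k F a ≠ v) (z : F) :
    ∃ a b : k, z = algebraMap k F a + algebraMap k F b * v := by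
  have hfin : Module.Finite k F := Module.finite_of_finrank_pos (by omega)
  have hli : LinearIndependent k ![(1 : F), v] := by
    rw [LinearIndependent.pair_iff]
    intro s t hst
    rw [Algebra.smul_def, Algebra.smul_def, mul_one] at hst
    by_cases ht : t = 0
    · subst ht
      simp only [map_zero, zero_mul, add_zero] at hst
      exact ⟨(map_eq_zero _).mp hst, rfl⟩
    · refine absurd ?_ (hv (-s / t))
      have : algebraMap k F t ≠ 0 := (map_ne_zero _).mpr ht
      rw [map_div₀, map_neg, div_eq_iff this]
      linear_combination -hst
  have hspan := hli.span_eq_top_of_card_eq_finrank' (by rw [Fintype.card_fin, h2])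
  have hz : z ∈ Submodule.span k (Set.range ![(1 : F), v]) := hspan ▸ Submodule.mem_top
  rw [Matrix.range_cons, Matrix.range_cons, Matrix.range_empty, Set.union_empty,
    Set.singleton_union, Submodule.mem_span_pair] at hz
  obtain ⟨a, b, rfl⟩ := hz
  exact ⟨a, b, by rw [Algebra.smul_def, Algebra.smul_def, mul_one]⟩

end Squares

/-! ## Two by two matrices -/

section TwoByTwo

variable {R : Type*} [CommRing R]

/-- In a residue field where the trace vanishes there is a nonzero matrix anticommuting with `Y`,
contradicting injectivity of Jordan multiplication. -/
theorem isUnit_trace_of_isUnit_jor (h2 : IsUnit (2 : R)) {Y : Matrix (Fin 2) (Fin 2) R}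
    (h : IsUnit (jor Y)) : IsUnit Y.trace := by
  by_contra hY
  obtain ⟨m, hm, hYm⟩ := exists_max_ideal_of_mem_nonunits hY
  let := Ideal.Quotient.field m
  set π := Ideal.Quotient.mk m
  have h2' := isUnit_two_of_map h2 π
  have hj : IsUnit (jor (Y.map π)) := by rw [← map_jor h2]; exact h.map π
  have htr : (Y.map π).trace = 0 := by
    have : π Y.trace = 0 := Ideal.Quotient.eq_zero_iff_mem.mpr hYm
    rw [← this]; simp [Matrix.trace]
  have hinj := (bijective_of_isUnit_jor h2' hj).1
  set y := Y.map π
  rw [Matrix.trace_fin_two] at htr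
  have hd : y 1 1 = - y 0 0 := by linear_combination htr
  -- Anticommuting matrices are written down explicitly; `diag(1, -1)` serves when the diagonal
  -- vanishes, and otherwise a triangular one has the nonzero entry `2 y₀₀`.
  by_cases ha : y 0 0 = 0
  · have : (!![1, 0; 0, -1] : Matrix (Fin 2) (Fin 2) (R ⧸ m)) = 0 := by
      refine hinj ?_
      ext i j
      fin_cases i <;> fin_cases j <;> 
        simp [Matrix.mul_apply, Fin.sum_univ_two, Matrix.vecMul, dotProduct, ha, hd]
    have := congrFun₂ this 0 0
    simp at this
  · have : (!![-y 1 0, 2 * y 0 0; 0, y 1 0] : Matrix (Fin 2) (Fin 2) (R ⧸ m)) = 0 := by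
      refine hinj ?_
      ext i j
      fin_cases i <;> fin_cases j <;> 
        simp [Matrix.mul_apply, Fin.sum_univ_two, Matrix.vecMul, dotProduct, hd] <;> ring
    have := congrFun₂ this 0 1
    simp only [Matrix.of_apply, Matrix.cons_val', Matrix.cons_val_zero, Matrix.cons_val_one,
      Matrix.zero_apply] at this
    exact mul_ne_zero h2'.ne_zero ha this

theorem mul_self_fin_two (Y : Matrix (Fin 2) (Fin 2) R) :
    Y * Y = Y.trace • Y - Y.det • (1 : Matrix (Fin 2) (Fin 2) R) := by
  rw [Matrix.trace_fin_two, Matrix.det_fin_two]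
  ext i j
  fin_cases i <;> fin_cases j <;> simp [Matrix.mul_apply, Fin.sum_univ_two] <;> ring

theorem Hform_alternating (q X : Matrix (Fin 2) (Fin 2) R) (hq : q = !![0, 1; -1, 0]) :
    Hform q X = X.det • q := by
  subst hq
  rw [Hform, Matrix.det_fin_two]
  ext i j
  fin_cases i <;> fin_cases j <;> simp [Matrix.mul_apply, Fin.sum_univ_two] <;> ring

end TwoByTwo

/-- The condition on the primes under consideration. -/
structure IsGoodPrime (M : ℤ) (N p : ℕ) : Prop where
  prime : p.Prime
  not_dvd : ¬ (p : ℤ) ∣ M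
  coprime : p.Coprime N
  odd : Odd p

theorem isGoodPrime_of_not_dvd_mul {M : ℤ} {N p : ℕ} (hM : Even M)
    (h : p.Prime ∧ ¬ (p : ℤ) ∣ M * N) : IsGoodPrime M N p := by
  have h1 : ¬ (p : ℤ) ∣ M := fun h' => h.2 (h'.mul_right _)
  refine ⟨h.1, h1, ?_, h.1.odd_of_ne_two ?_⟩
  · rw [h.1.coprime_iff_not_dvd]
    exact fun h' => h.2 ((Int.natCast_dvd_natCast.mpr h').mul_left _)
  · rintro rfl
    exact h1 (by exact_mod_cast hM.two_dvd)

/-! ## The antisymmetric form in dimension two -/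

section Alternating

variable {M : ℤ} {N : ℕ} [NeZero N] {K : Type u} [Field K] [CharZero K]
  [IsCyclotomicExtension {N} ℚ K]

/-! ### Square classes of the determinants `det(x^{(m)})` -/

section Determinants

variable (K)

/-- The determinant of the matrix `x^{(m)}` of powers of the indeterminates. -/
noncomputable def detPow (m : ℕ) : FieldE 2 K := (entryPow m (matE 2 K)).det

/-- The determinant of `x^{(m)}` as a polynomial. -/
noncomputable def detPowPoly (m : ℕ) : MvPolynomial (Fin 2 × Fin 2) K :=
  (entryPow m (Matrix.mvPolynomialX (Fin 2) (Fin 2) K)).det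

theorem algebraMap_detPowPoly (m : ℕ) :
    algebraMap _ (FieldE 2 K) (detPowPoly K m) = detPow K m := by
  rw [detPowPoly, ← det_map', entryPow_map', detPow, matE]

/-- The specialization `x₀₀ ↦ t`, all other `x_{ij} ↦ 1`, over the algebraic closure. -/
noncomputable def cornerEval : MvPolynomial (Fin 2 × Fin 2) K →+* Polynomial (AlgebraicClosure K) :=
  MvPolynomial.eval₂Hom ((Polynomial.C).comp (algebraMap K (AlgebraicClosure K)))
    (fun ij => if ij = (0, 0) then Polynomial.X else 1)

theorem cornerEval_detPowPoly (m : ℕ) : cornerEval K (detPowPoly K m) = Polynomial.X ^ m - 1 := by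
  rw [detPowPoly, ← det_map', entryPow_map', Matrix.det_fin_two]
  simp [entryPow, cornerEval]

variable {K}

/-- On the line `x₀₀ = t` with the other entries `1`, the determinant becomes `t^m - 1`, which has a
simple zero at `ω`; the other factor does not vanish there. -/
theorem not_isSquare_mul_detPow (g : MvPolynomial (Fin 2 × Fin 2) K) {m : ℕ} (hm : m ≠ 0)
    {ω : AlgebraicClosure K} (hω : ω ^ m = 1) (hg : (cornerEval K g).eval ω ≠ 0) :
    ¬ IsSquare (algebraMap _ (FieldE 2 K) g * detPow K m) := by
  rw [← algebraMap_detPowPoly, ← map_mul]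
  have hω0 : ω ≠ 0 := by rintro rfl; simp [hm] at hω
  refine not_isSquare_of_simple_root (cornerEval K) (ω := ω) ?_ ?_
  · rw [map_mul, cornerEval_detPowPoly]; simp [hω]
  · rw [map_mul, cornerEval_detPowPoly, Polynomial.derivative_mul]
    simp only [Polynomial.derivative_sub, Polynomial.derivative_X_pow, Polynomial.derivative_one,
      sub_zero, Polynomial.eval_add, Polynomial.eval_mul, Polynomial.eval_sub, Polynomial.eval_pow,
      Polynomial.eval_X, Polynomial.eval_one, hω, sub_self, mul_zero, zero_add, Polynomial.eval_C]
    have : (m : AlgebraicClosure K) ≠ 0 := Nat.cast_ne_zero.mpr hm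
    exact mul_ne_zero hg (mul_ne_zero this (pow_ne_zero _ hω0))

theorem detPow_ne_zero {m : ℕ} (hm : m ≠ 0) : detPow K m ≠ 0 := by
  intro h
  have := not_isSquare_mul_detPow (K := K) 1 hm (one_pow m) (by simp)
  rw [h, mul_zero] at this
  exact this ⟨0, by simp⟩

theorem detPow_one : detPow K 1 = (matE 2 K).det := by
  rw [detPow]; congr 1; ext i j; simp [entryPow]

end Determinants

variable (K) in
/-- The element `det(x)^p / det(x^{(p)})`. -/
noncomputable def ratioE (p : ℕ) : FieldE 2 K := detPow K 1 ^ p / detPow K p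

theorem exists_primitiveRoot (K : Type u) [Field K] [CharZero K] {m : ℕ} (hm : m ≠ 0) :
    ∃ ω : AlgebraicClosure K, IsPrimitiveRoot ω m := by
  have : NeZero (m : AlgebraicClosure K) := ⟨Nat.cast_ne_zero.mpr hm⟩
  exact HasEnoughRootsOfUnity.exists_primitiveRoot _ m

omit [CharZero K] in
-- For odd `p`, `a^p / b` and `ab` lie in the same square class.
theorem pow_div_eq_mul_sq {p : ℕ} (hp : Odd p) {a b : FieldE 2 K} (ha : a ≠ 0) (hb : b ≠ 0) :
    ∃ e ≠ 0, a ^ p / b = a * b * e ^ 2 := by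
  obtain ⟨k, rfl⟩ := hp
  refine ⟨a ^ k / b, div_ne_zero (pow_ne_zero _ ha) hb, ?_⟩
  field_simp
  ring

theorem not_isSquare_ratioE {p : ℕ} (hp : p.Prime) (hp2 : Odd p) : ¬ IsSquare (ratioE K p) := by
  intro h
  obtain ⟨e, he, hu⟩ := pow_div_eq_mul_sq hp2 (detPow_ne_zero (K := K) one_ne_zero)
    (detPow_ne_zero (K := K) hp.ne_zero)
  rw [ratioE, hu] at h
  have h1 := isSquare_of_isSquare_mul_sq he h
  obtain ⟨ω, hω⟩ := exists_primitiveRoot K hp.ne_zero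
  rw [← algebraMap_detPowPoly K 1] at h1
  refine not_isSquare_mul_detPow _ hp.ne_zero hω.pow_eq_one ?_ h1
  rw [cornerEval_detPowPoly]
  simpa [sub_eq_zero] using hω.ne_one hp.one_lt

variable {q : Matrix.GeneralLinearGroup (Fin 2) (cycRing M N K)} {p : ℕ}

/-- The form cancels and leaves `det(X^{(p)}) Y² = det(X)^p`. By Cayley–Hamilton `tr(Y) Y` is then
scalar, and the trace is a unit. -/
theorem ModelRel.exists_scalar {A : Type u} [CommRing A] {s : A →+* A} (h2 : IsUnit (2 : A))
    {p : ℕ} (hp : Odd p) {q : Matrix (Fin 2) (Fin 2) A} (hq : q = !![0, 1; -1, 0]) {T : Type v}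
    [CommRing T] {a : A →+* T} {X Y : Matrix (Fin 2) (Fin 2) T} (h : ModelRel s p q a X Y) :
    Y = Y 0 0 • (1 : Matrix (Fin 2) (Fin 2) T) ∧ (entryPow p X).det * (Y 0 0) ^ 2 = X.det ^ p := by
  have hq1 : ∀ b : A →+* T, q.map b = !![0, 1; -1, 0] := by
    intro b; subst hq; ext i j; fin_cases i <;> fin_cases j <;> simp
  have h1 := h.rel
  rw [Hform_alternating _ _ (hq1 _), Hform_alternating _ _ (hq1 _), hq1, hq1] at h1
  have hpow : entryPow p (X.det • (!![0, 1; -1, 0] : Matrix (Fin 2) (Fin 2) T)) =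
      X.det ^ p • !![0, 1; -1, 0] := by
    ext i j
    fin_cases i <;> fin_cases j <;> simp [entryPow, hp.neg_pow, hp.pos.ne']
  rw [hpow] at h1
  have h3 : (entryPow p X).det • (Y * Y) = X.det ^ p • (1 : Matrix (Fin 2) (Fin 2) T) := by
    have h4 := congrArg (fun Z => (!![0, -1; 1, 0] : Matrix (Fin 2) (Fin 2) T) * Z) h1
    have h5 : (!![0, -1; 1, 0] : Matrix (Fin 2) (Fin 2) T) * !![0, 1; -1, 0] = 1 := by
      ext i j; fin_cases i <;> fin_cases j <;> simp
    simp only [Matrix.smul_mul, Matrix.mul_smul, ← Matrix.mul_assoc, h5, Matrix.one_mul] at h4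
    exact h4
  have ht := isUnit_trace_of_isUnit_jor (isUnit_two_of_map h2 a) h.jor_Y
  have hd := h.det_Xp
  set D := (entryPow p X).det
  rw [mul_self_fin_two] at h3
  -- The off-diagonal entries of the relation, and the difference of its diagonal entries, say
  -- precisely this.
  have h6 : Y.trace • (D • (Y - Y 0 0 • (1 : Matrix (Fin 2) (Fin 2) T))) = 0 := by
    have e00 := congrFun₂ h3 0 0
    have e01 := congrFun₂ h3 0 1
    have e10 := congrFun₂ h3 1 0
    have e11 := congrFun₂ h3 1 1
    simp only [Matrix.smul_apply, Matrix.sub_apply, smul_eq_mul, Matrix.one_apply_eq, mul_one,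
      Matrix.one_apply, Fin.isValue, zero_ne_one, one_ne_zero, ↓reduceIte, mul_zero, sub_zero]
      at e00 e01 e10 e11
    ext i j
    fin_cases i <;> fin_cases j <;> simp
    · linear_combination e01
    · linear_combination e10
    · linear_combination e11 - e00
  have h7 : Y = Y 0 0 • (1 : Matrix (Fin 2) (Fin 2) T) := by
    refine sub_eq_zero.mp ?_
    ext i j
    have := congrFun₂ h6 i j
    rw [Matrix.smul_apply, Matrix.smul_apply, smul_eq_mul, smul_eq_mul] at this
    exact hd.mul_left_cancel ((ht.mul_left_cancel (this.trans (mul_zero _).symm)).trans (mul_zero _).symm)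
  refine ⟨h7, ?_⟩
  rw [← mul_self_fin_two, h7] at h3
  have := congrFun₂ h3 0 0
  simp at this
  linear_combination this

/-- The square root of `det(x)^p / det(x^{(p)})` in the ring of `Γ_p`. -/
noncomputable def chernV (q : Matrix.GeneralLinearGroup (Fin 2) (cycRing M N K)) (p : ℕ) :
    ChernRing q p := chernY q p 0 0

variable (hM : Even M) (hM0 : M ≠ 0) (hq : q.val = !![0, 1; -1, 0]) (hp : IsGoodPrime M N p)

include hM hM0 hq hp

theorem chernY_eq_smul : chernY q p = chernV q p • (1 : Matrix (Fin 2) (Fin 2) (ChernRing q p)) :=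
  ((chernRel q p hM hM0).exists_scalar (isUnit_two_cycRing hM hM0) hp.odd hq).1

theorem chernV_sq : chernV q p ^ 2 = chernL q p (ratioE K p) := by
  have h := ((chernRel q p hM hM0).exists_scalar (isUnit_two_cycRing hM hM0) hp.odd hq).2
  have h0 := detPow_ne_zero (K := K) hp.prime.ne_zero
  have e1 : (entryPow p ((matE 2 K).map (chernL q p))).det = chernL q p (detPow K p) := by
    rw [← entryPow_map', det_map', detPow]
  have e2 : ((matE 2 K).map (chernL q p)).det = chernL q p (detPow K 1) := by
    rw [det_map', detPow_one]
  rw [e1, e2] at h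
  refine ((isUnit_iff_ne_zero.mpr h0).map (chernL q p)).mul_left_cancel (h.trans ?_)
  rw [← map_pow, ← map_mul, ratioE, mul_div_cancel₀ _ h0]

theorem chernR_apply (i j : Fin 2) :
    chernR q p (matE 2 K i j) = chernL q p (matE 2 K i j) ^ p * chernV q p := by
  have := congrFun₂ (chernR_matE q p) i j
  rw [chernY_eq_smul hM hM0 hq hp] at this
  simpa [entryPow, mul_comm] using this

/-- Otherwise `det(x)^p / det(x^{(p)})` would be a square in `E`. Allowing any field as target
covers all residue fields at once. -/
theorem chernL_ne_of_map {L : Type*} [Field L] (f : ChernRing q p →+* L) (a : FieldE 2 K) :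
    f (chernL q p a) ≠ f (chernV q p) := by
  intro h
  refine not_isSquare_ratioE (K := K) hp.prime hp.odd ⟨a, ?_⟩
  refine (f.comp (chernL q p)).injective ?_
  rw [RingHom.comp_apply, RingHom.comp_apply, ← chernV_sq hM hM0 hq hp, map_mul, map_mul, h, map_pow,
    pow_two]

/-- Each residue field is strictly larger than `E` because it contains `v`, and a geometric point is
determined by the choice of sign of `v`. -/
theorem alternating_isField_and_degree :
    IsField (ChernRing q p) ∧ (chernCorrespondence M N q p).leftDegree = 2 := by
  have hfin := chernL_finite q p hM hM0
  have hred := chernRing_isReduced q p hM hM0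
  have hnt := chernRing_nontrivial q hM hM0 hp.prime hp.not_dvd hp.coprime
  let := (chernL q p).toAlgebra
  have hfin' : Module.Finite (FieldE 2 K) (ChernRing q p) := hfin
  refine isField_of_card_algHom_le (k := FieldE 2 K) (F := ChernRing q p) (Ω := AlgebraicClosure (FieldE 2 K)) two_pos ?_ ?_
  · intro m
    let := Ideal.Quotient.field m.asIdeal
    have h0 : 0 < Module.finrank (FieldE 2 K) (ChernRing q p ⧸ m.asIdeal) := Module.finrank_pos
    by_contra hlt
    have h1 : Module.finrank (FieldE 2 K) (ChernRing q p ⧸ m.asIdeal) = 1 := by omega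
    have h2 := Subalgebra.bot_eq_top_of_finrank_eq_one h1
    have h3 : Ideal.Quotient.mk m.asIdeal (chernV q p) ∈
      (⊥ : Subalgebra (FieldE 2 K) (ChernRing q p ⧸ m.asIdeal)) := h2 ▸ Algebra.mem_top
    obtain ⟨a, ha⟩ := Algebra.mem_bot.mp h3
    exact chernL_ne_of_map hM hM0 hq hp (Ideal.Quotient.mk m.asIdeal) a ha
  · classical
    obtain ⟨s, hs⟩ := IsAlgClosed.exists_pow_nat_eq
      (algebraMap (FieldE 2 K) (AlgebraicClosure (FieldE 2 K)) (ratioE K p)) two_pos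
    have hsq : ∀ ρ : ChernRing q p →ₐ[FieldE 2 K] AlgebraicClosure (FieldE 2 K),
        ρ (chernV q p) = s ∨ ρ (chernV q p) = -s := by
      intro ρ
      rw [← sq_eq_sq_iff_eq_or_eq_neg, hs, ← map_pow, chernV_sq hM hM0 hq hp]
      exact ρ.commutes _
    let c : (ChernRing q p →ₐ[FieldE 2 K] AlgebraicClosure (FieldE 2 K)) → Bool :=
      fun ρ => decide (ρ (chernV q p) = s)
    have hc : Function.Injective c := by
      intro ρ ρ' h
      have h1 : ρ (chernV q p) = ρ' (chernV q p) := by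
        have h2 : ρ (chernV q p) = s ↔ ρ' (chernV q p) = s := by simpa [c] using h
        rcases hsq ρ with h3 | h3 <;> rcases hsq ρ' with h4 | h4
        · rw [h3, h4]
        · rw [h3, h2.mp h3]
        · rw [h4, h2.mpr h4]
        · rw [h3, h4]
      refine AlgHom.coe_ringHom_injective (chernRing_ext q p ?_ ?_)
      · exact RingHom.ext fun e => (ρ.commutes e).trans (ρ'.commutes e).symm
      · rw [chernY_eq_smul hM hM0 hq hp]
        ext i j
        simp only [Matrix.map_apply, Matrix.smul_apply, smul_eq_mul, map_mul, Matrix.one_apply,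
          RingHom.coe_coe, h1]
        split_ifs <;> simp
    have := Nat.card_le_card_of_injective c hc
    simpa using this

theorem alternating_isField : IsField (ChernRing q p) :=
  (alternating_isField_and_degree hM hM0 hq hp).1

theorem alternating_exists_add_mul (z : ChernRing q p) :
    ∃ a b, z = chernL q p a + chernL q p b * chernV q p := by
  let := (alternating_isField hM hM0 hq hp).toField
  let := (chernL q p).toAlgebra
  exact exists_add_mul_of_finrank_two (k := FieldE 2 K) (F := ChernRing q p)
    (alternating_isField_and_degree hM hM0 hq hp).2
    (fun a => chernL_ne_of_map hM hM0 hq hp (RingHom.id (ChernRing q p)) a) z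

theorem alternating_isUnit_one_sub : IsUnit (1 - chernY q p).det := by
  let := (alternating_isField hM hM0 hq hp).toField
  have h1 := chernL_ne_of_map hM hM0 hq hp (RingHom.id (ChernRing q p)) 1
  rw [chernY_eq_smul hM hM0 hq hp, Matrix.det_fin_two]
  simp only [map_one, RingHom.id_apply] at h1
  have : (1 - chernV q p) * (1 - chernV q p) ≠ 0 :=
    mul_ne_zero (sub_ne_zero.mpr h1) (sub_ne_zero.mpr h1)
  rw [isUnit_iff_ne_zero]
  simpa using this

theorem alternating_isPartiallyInduced :
    (chernCorrespondence M N q p).IsPartiallyInduced (iota 2 K) :=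
  chern_isPartiallyInduced q hM hM0 hp.odd (alternating_isUnit_one_sub hM hM0 hq hp)

/-- For `z` in `E⁺`, `φ(z)` is fixed by `v ↦ -v`, so its `v`-component vanishes and it lies in
`π(E)`. The involution covering `ι` then shows that the preimage is even. -/
theorem alternating_isInduced : (chernCorrespondence M N q p).IsInduced (iota 2 K) := by
  refine ⟨alternating_isPartiallyInduced hM hM0 hq hp, fun z hz => ?_⟩
  let := (alternating_isField hM hM0 hq hp).toField
  obtain ⟨ν, hνl, hνr, hνY⟩ :=
    exists_sign_involution q hM hM0 (alternating_isUnit_one_sub hM hM0 hq hp)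
  obtain ⟨θ, hθl, hθr, -⟩ := exists_iota_involution q hM hM0 hp.odd
  obtain ⟨a, b, hab⟩ := alternating_exists_add_mul hM hM0 hq hp (chernR q p z)
  have hν1 : ν (chernR q p z) = chernR q p z := by
    have := RingHom.congr_fun hνr z
    rw [RingHom.comp_apply, RingHom.comp_apply, hz] at this
    exact this
  have hνv : ν (chernV q p) = -chernV q p := congrFun₂ hνY 0 0
  have hνl' : ∀ e, ν (chernL q p e) = chernL q p e := RingHom.congr_fun hνl
  rw [hab, map_add, map_mul, hνl', hνl', hνv] at hν1
  have hv0 : chernL q p b * chernV q p = 0 := by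
    have : (2 : ChernRing q p) * (chernL q p b * chernV q p) = 0 := by linear_combination -hν1
    have h2 : (2 : ChernRing q p) ≠ 0 := by
      rw [← map_ofNat (chernL q p) 2]
      exact (map_ne_zero _).mpr two_ne_zero
    exact (mul_eq_zero.mp this).resolve_left h2
  rw [hv0, add_zero] at hab
  refine ⟨a, ?_, hab⟩
  refine (chernL q p).injective ?_
  have h3 := RingHom.congr_fun hθr z
  have h4 := RingHom.congr_fun hθl a
  simp only [RingHom.comp_apply] at h3 h4
  rw [← h4, ← hab, h3, hz]

end Alternating

end ArithChern

namespace ArithChern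

/-! ### Curvature in the antisymmetric case -/

section Alternating

variable {M : ℤ} {N : ℕ} [NeZero N] {K : Type u} [Field K] [CharZero K]
  [IsCyclotomicExtension {N} ℚ K]

omit [CharZero K] [IsCyclotomicExtension {N} ℚ K] in
theorem map_detPow {T : Type v} [CommRing T] {f : FieldE 2 K →+* T} {m : ℕ} :
    f (detPow K m) = (entryPow m ((matE 2 K).map f)).det := by
  rw [detPow, ← det_map', entryPow_map']

theorem entryPow_entryPow {n : ℕ} {R : Type*} [CommRing R] (a b : ℕ) (X : Matrix (Fin n) (Fin n) R) :
    entryPow a (entryPow b X) = entryPow (b * a) X := by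
  ext i j; simp [entryPow, pow_mul]

theorem det_entryPow_smul {R : Type*} [CommRing R] (m : ℕ) (c : R) (X : Matrix (Fin 2) (Fin 2) R) :
    (entryPow m (c • X)).det = c ^ (2 * m) * (entryPow m X).det := by
  simp only [Matrix.det_fin_two, entryPow, Matrix.map_apply, Matrix.smul_apply, smul_eq_mul]
  ring

theorem frobE_detPow {p : ℕ} (hp : p.Prime) (m : ℕ) :
    frobE 2 N K p hp (detPow K m) = detPow K (p * m) := by
  rw [map_detPow, frobE_matE, entryPow_entryPow, detPow]

/-- Clear denominators and specialize at `t = -1`, where every `t^m - 1` with odd `m` is `-2`.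
Equality would force `p + p' = pp' + 1`, that is `(p - 1)(p' - 1) = 0`. The primes may coincide. -/
theorem frobE_ratioE_ne {p p' : ℕ} (hp : p.Prime) (hp' : p'.Prime) (h2 : Odd p) (h2' : Odd p') :
    frobE 2 N K p' hp' (ratioE K p) ≠ ratioE K p ^ p' := by
  intro h
  have h0 : ∀ {m : ℕ}, m ≠ 0 → detPow K m ≠ 0 := detPow_ne_zero
  rw [ratioE, map_div₀, map_pow, frobE_detPow, frobE_detPow, div_pow, mul_one,
    div_eq_div_iff (h0 (mul_ne_zero hp'.ne_zero hp.ne_zero)) (pow_ne_zero _ (h0 hp.ne_zero))] at h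
  simp only [← algebraMap_detPowPoly, ← map_pow, ← map_mul] at h
  have h1 := congrArg (cornerEval K) (IsFractionRing.injective _ _ h)
  simp only [map_mul, map_pow, cornerEval_detPowPoly] at h1
  have h3 := congrArg (Polynomial.eval (-1)) h1
  simp only [Polynomial.eval_mul, Polynomial.eval_pow, Polynomial.eval_sub, Polynomial.eval_X,
    Polynomial.eval_one, h2'.neg_one_pow, h2.neg_one_pow, (h2'.mul h2).neg_one_pow, pow_one] at h3
  have e : (-1 - 1 : AlgebraicClosure K) = ((-2 : ℤ) : AlgebraicClosure K) := by push_cast; ring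
  rw [e] at h3
  have h4 : (-2 : ℤ) ^ p * (-2) ^ p' = ((-2) ^ p) ^ p' * (-2) := by exact_mod_cast h3
  have h5 := congrArg Int.natAbs h4
  simp only [Int.natAbs_mul, Int.natAbs_pow, Int.natAbs_neg, show Int.natAbs 2 = 2 from rfl] at h5
  rw [← pow_mul, ← pow_add, ← pow_succ] at h5
  have h6 := Nat.pow_right_injective (le_refl 2) h5
  have := hp.one_lt
  have := hp'.one_lt
  obtain ⟨a, rfl⟩ := Nat.exists_eq_add_of_lt (hp.one_lt)
  obtain ⟨b, rfl⟩ := Nat.exists_eq_add_of_lt (hp'.one_lt)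
  ring_nf at h6
  nlinarith [Nat.zero_le (a * b)]

theorem frobK_comm {p p' : ℕ} (hM0 : M ≠ 0) (hp : p.Coprime N) (hp' : p'.Coprime N) :
    (frobK N K p).comp (frobK N K p') = (frobK N K p').comp (frobK N K p) := by
  refine ringHom_ext_cycRing (M := M) (N := N) (cycRing_hom_ext hM0 ?_)
  change frobK N K p (frobK N K p' (zetaN N K)) = frobK N K p' (frobK N K p (zetaN N K))
  rw [frobK_zetaN N K p hp, frobK_zetaN N K p' hp', map_pow, map_pow, frobK_zetaN N K p hp,
    frobK_zetaN N K p' hp', pow_right_comm]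

variable {q : Matrix.GeneralLinearGroup (Fin 2) (cycRing M N K)} {p p' : ℕ}

variable (hM : Even M) (hM0 : M ≠ 0) (hq : q.val = !![0, 1; -1, 0]) (hp : IsGoodPrime M N p)
  (hp' : IsGoodPrime M N p')

include hM hM0 hq hp

/-- The square of a coordinate is the test element for the `(1,1)`-curvature: squaring removes `v`.
-/
theorem chernR_matE_sq :
    chernR q p (matE 2 K 0 0 ^ 2) = chernL q p (matE 2 K 0 0 ^ (2 * p) * ratioE K p) := by
  rw [map_pow, chernR_apply hM hM0 hq hp, map_mul, ← chernV_sq hM hM0 hq hp, map_pow, mul_pow,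
    ← pow_mul, mul_comm p]

omit hM hM0 hq in
include hp' in
theorem frobE_ne_pow : frobE 2 N K p' hp'.prime (matE 2 K 0 0 ^ (2 * p) * ratioE K p) ≠
    (matE 2 K 0 0 ^ (2 * p) * ratioE K p) ^ p' := by
  have h : frobE 2 N K p' hp'.prime (matE 2 K 0 0) = matE 2 K 0 0 ^ p' :=
    congrFun₂ (frobE_matE hp'.prime) 0 0
  have h0 : matE 2 K 0 0 ≠ 0 := by
    simp [matE]
  rw [map_mul, map_pow, h, mul_pow, ← pow_mul, ← pow_mul, mul_comm p' (2 * p)]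
  intro h1
  exact frobE_ratioE_ne hp.prime hp'.prime hp.odd hp'.odd
    (mul_left_cancel₀ (pow_ne_zero _ h0) h1)

include hp' in
theorem alternating_upperCurvature11_ne_zero :
    upperCurvature11 p p' (chernCorrespondence M N q p) (canonicalCorrespondence 2 N K p' hp'.prime)
      ≠ 0 := by
  refine upperCurvature11_ne_zero hp.prime.ne_zero hp'.prime.ne_zero ?_
    (chernR_matE_sq hM hM0 hq hp) ?_ (frobE_ne_pow hp hp')
  · rw [(alternating_isField_and_degree hM hM0 hq hp).2]; norm_num
  · rw [map_pow, show frobE 2 N K p' hp'.prime (matE 2 K 0 0) = matE 2 K 0 0 ^ p' from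
      congrFun₂ (frobE_matE hp'.prime) 0 0, ← pow_mul, ← pow_mul, mul_comm]

include hp' in
theorem alternating_lowerCurvature11_ne_zero (U : Type v) [Field U] [IsAlgClosed U]
    (hU : Nonempty (FieldE 2 K →+* U)) :
    lowerCurvature11 U p p' (chernCorrespondence M N q p)
      (canonicalCorrespondence 2 N K p' hp'.prime) ≠ 0 := by
  refine lowerCurvature11_ne_zero hp.prime.ne_zero hp'.prime.ne_zero
    (chernRing_nontrivial q hM hM0 hp.prime hp.not_dvd hp.coprime) (chernL_finite q p hM hM0)
    (chernR_matE_sq hM hM0 hq hp) ?_ (frobE_ne_pow hp hp') hU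
  rw [map_pow, show frobE 2 N K p' hp'.prime (matE 2 K 0 0) = matE 2 K 0 0 ^ p' from
      congrFun₂ (frobE_matE hp'.prime) 0 0, ← pow_mul, ← pow_mul, mul_comm]

/-! ### Composing two of the correspondences -/

theorem chernR_map_eq_smul : (matE 2 K).map (chernR q p) =
    chernV q p • entryPow p ((matE 2 K).map (chernL q p)) := by
  ext i j
  simp [chernR_apply hM hM0 hq hp, entryPow, mul_comm]

theorem chernR_detPow (m : ℕ) :
    chernR q p (detPow K m) = chernV q p ^ (2 * m) * chernL q p (detPow K (p * m)) := by
  rw [map_detPow, chernR_map_eq_smul hM hM0 hq hp, det_entryPow_smul, entryPow_entryPow,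
    ← map_detPow]

include hp' in
-- The ratio is homogeneous of degree zero in the coordinates, so the powers of `v` produced by `φ`
-- cancel.
theorem chernR_ratioE : chernR q p (ratioE K p') =
    chernL q p (detPow K p ^ p' / detPow K (p * p')) := by
  have h0 : ∀ {m : ℕ}, m ≠ 0 → detPow K m ≠ 0 := detPow_ne_zero
  have h3 : chernR q p (ratioE K p') * chernR q p (detPow K p') =
      chernR q p (detPow K 1) ^ p' := by
    rw [← map_mul, ratioE, div_mul_cancel₀ _ (h0 hp'.prime.ne_zero), map_pow]
  rw [chernR_detPow hM hM0 hq hp, chernR_detPow hM hM0 hq hp] at h3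
  have hv : IsUnit (chernV q p) := by
    refine (isUnit_pow_iff two_ne_zero).mp ?_
    rw [chernV_sq hM hM0 hq hp]
    exact (isUnit_iff_ne_zero.mpr (div_ne_zero (pow_ne_zero _ (h0 one_ne_zero))
      (h0 hp.prime.ne_zero))).map _
  have hd := (isUnit_iff_ne_zero.mpr (h0 (mul_ne_zero hp.prime.ne_zero hp'.prime.ne_zero))).map
    (chernL q p)
  refine (((hv.pow (2 * p')).mul hd).mul_left_injective) ?_
  change _ * _ = _ * _
  rw [h3, ← mul_assoc, mul_right_comm, ← map_mul, div_mul_cancel₀ _ (h0 (mul_ne_zero hp.prime.ne_zero hp'.prime.ne_zero)),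
    mul_one, mul_one, map_pow]
  ring

include hp'

variable {T : Type v} [CommRing T] {f : ChernRing q p →+* T} {g : ChernRing q p' →+* T}
  (h : g.comp (chernL q p') = f.comp (chernR q p))

include h

omit hM hM0 hq hp hp' in
theorem comp_const : (g.comp (chernR q p')).comp (algebraMap K _) =
    ((f.comp (chernL q p)).comp (algebraMap K _)).comp ((frobK N K p).comp (frobK N K p')) := by
  rw [RingHom.comp_assoc, chernR_const, ← RingHom.comp_assoc, ← RingHom.comp_assoc, h,
    RingHom.comp_assoc (algebraMap K _) (chernR q p) f, chernR_const]
  rfl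

/-- On a point of the composition, `x` is sent to `x^{(pp')}` times a scalar; the exponent `p'` on
the first factor comes from the second Frobenius. -/
theorem comp_matE : (matE 2 K).map (g.comp (chernR q p')) =
    (f (chernV q p) ^ p' * g (chernV q p')) •
      entryPow (p * p') ((matE 2 K).map (f.comp (chernL q p))) := by
  ext i j
  have h1 := RingHom.congr_fun h (matE 2 K i j)
  simp only [RingHom.comp_apply] at h1
  simp only [Matrix.map_apply, RingHom.comp_apply, chernR_apply hM hM0 hq hp', map_mul, map_pow, h1,
    chernR_apply hM hM0 hq hp, entryPow, Matrix.smul_apply, smul_eq_mul]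
  ring

/-- The square of the scalar is symmetric in `p` and `p'`, so the two orders of composition can
differ only by a sign. This drives both the vanishing of the curvature and partial commutation. -/
theorem comp_scalar_sq : (f (chernV q p) ^ p' * g (chernV q p')) ^ 2 =
    f (chernL q p (detPow K 1 ^ (p * p') / detPow K (p * p'))) := by
  have h0 : ∀ {m : ℕ}, m ≠ 0 → detPow K m ≠ 0 := detPow_ne_zero
  have h1 := RingHom.congr_fun h (ratioE K p')
  rw [RingHom.comp_apply, ← chernV_sq hM hM0 hq hp', RingHom.comp_apply] at h1
  rw [mul_pow, ← map_pow g, h1, chernR_ratioE hM hM0 hq hp hp', ← map_pow, ← map_pow, ← map_mul, pow_right_comm,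
    chernV_sq hM hM0 hq hp, ← map_pow, ← map_mul]
  congr 2
  have := h0 hp.prime.ne_zero
  rw [ratioE, div_pow]
  field_simp
  rw [pow_mul]

theorem comp_scalar_eq_or [IsDomain T] {f' : ChernRing q p' →+* T} {g' : ChernRing q p →+* T}
    (h' : g'.comp (chernL q p) = f'.comp (chernR q p'))
    (h0 : f.comp (chernL q p) = f'.comp (chernL q p')) :
    f (chernV q p) ^ p' * g (chernV q p') = f' (chernV q p') ^ p * g' (chernV q p) ∨
    f (chernV q p) ^ p' * g (chernV q p') = -(f' (chernV q p') ^ p * g' (chernV q p)) := by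
  rw [← sq_eq_sq_iff_eq_or_eq_neg, comp_scalar_sq hM hM0 hq hp hp' h,
    comp_scalar_sq hM hM0 hq hp' hp h', mul_comm p]
  exact RingHom.congr_fun h0 _

theorem comp_eq_of_scalar_eq {f' : ChernRing q p' →+* T} {g' : ChernRing q p →+* T}
    (h' : g'.comp (chernL q p) = f'.comp (chernR q p'))
    (h0 : f.comp (chernL q p) = f'.comp (chernL q p'))
    (h1 : f (chernV q p) ^ p' * g (chernV q p') = f' (chernV q p') ^ p * g' (chernV q p)) :
    g.comp (chernR q p') = g'.comp (chernR q p) := by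
  refine fieldE_ringHom_ext ?_ ?_
  · rw [comp_const h, comp_const h', h0, frobK_comm hM0 hp.coprime hp'.coprime]
  · rw [comp_matE hM hM0 hq hp hp' h, comp_matE hM hM0 hq hp' hp h', h0, h1, mul_comm p]

theorem comp_eq_or_eq_comp_iota [IsDomain T] {f' : ChernRing q p' →+* T} {g' : ChernRing q p →+* T}
    (h' : g'.comp (chernL q p) = f'.comp (chernR q p'))
    (h0 : f.comp (chernL q p) = f'.comp (chernL q p')) :
    g.comp (chernR q p') = g'.comp (chernR q p) ∨
      g.comp (chernR q p') = (g'.comp (chernR q p)).comp (iota 2 K) := by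
  rcases comp_scalar_eq_or hM hM0 hq hp hp' h h' h0 with h1 | h1
  · exact Or.inl (comp_eq_of_scalar_eq hM hM0 hq hp hp' h h' h0 h1)
  · right
    refine fieldE_ringHom_ext ?_ ?_
    · rw [RingHom.comp_assoc _ (iota 2 K), iota_const, comp_const h, comp_const h', h0,
        frobK_comm hM0 hp.coprime hp'.coprime]
    · rw [RingHom.coe_comp (g'.comp (chernR q p)), ← Matrix.map_map, iota_matE,
        Matrix.map_neg _ (map_neg _), comp_matE hM hM0 hq hp hp' h,
        comp_matE hM hM0 hq hp' hp h', h0, h1, mul_comm p, neg_smul]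

omit h in
-- Decompose under `ι`. Both actions vanish on `E⁻`. On `E⁺` each is twice a field element, and the
-- resulting elements are compared at geometric points, where the two composites agree up to `ι` and
-- hence agree on `E⁺`.
theorem alternating_upperCurvature_eq_zero :
    upperCurvature p p' (chernCorrespondence M N q p) (chernCorrespondence M N q p') = 0 := by
  have hstar : ∀ {p : ℕ}, IsGoodPrime M N p → ∀ {z w : FieldE 2 K}, chernR q p z = chernL q p w →
      (chernCorrespondence M N q p).upperStar z = (2 : ℕ) • w := by
    intro p hp z w hzw
    exact (upperStar_eq_of_right_eq hzw).trans
      (congrArg (· • w) (alternating_isField_and_degree hM hM0 hq hp).2)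
  have hodd : ∀ {p : ℕ}, IsGoodPrime M N p → ∀ z, iota 2 K z = -z →
      (chernCorrespondence M N q p).upperStar z = 0 :=
    fun hp z hz => (alternating_isPartiallyInduced hM hM0 hq hp).2 z hz
  let Ω := AlgebraicClosure (FieldE 2 K)
  let σ : FieldE 2 K →+* Ω := algebraMap _ _
  have hex : ∀ {p : ℕ}, IsGoodPrime M N p → ∀ τ : FieldE 2 K →+* Ω, ∃ ρ : ChernRing q p →+* Ω,
      ρ.comp (chernL q p) = τ := by
    intro p hp τ
    have := chernRing_nontrivial q hM hM0 hp.prime hp.not_dvd hp.coprime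
    exact exists_extension (chernL_finite q p hM hM0) τ
  have hcomp : (chernCorrespondence M N q p').upperStar * (chernCorrespondence M N q p).upperStar =
      (chernCorrespondence M N q p).upperStar * (chernCorrespondence M N q p').upperStar := by
    have heven : ∀ z, iota 2 K z = z →
        (chernCorrespondence M N q p').upperStar ((chernCorrespondence M N q p).upperStar z) =
        (chernCorrespondence M N q p).upperStar ((chernCorrespondence M N q p').upperStar z) := by
      intro z hz
      obtain ⟨w, hw, (hzw : chernR q p z = chernL q p w)⟩ := (alternating_isInduced hM hM0 hq hp).2 z hz
      obtain ⟨w', hw', (hzw' : chernR q p' z = chernL q p' w')⟩ :=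
         (alternating_isInduced hM hM0 hq hp').2 z hz
      obtain ⟨y, -, (hy : chernR q p' w = chernL q p' y)⟩ :=
         (alternating_isInduced hM hM0 hq hp').2 w hw
      obtain ⟨y', -, (hy' : chernR q p w' = chernL q p y')⟩ :=
         (alternating_isInduced hM hM0 hq hp).2 w' hw'
      rw [hstar hp hzw, hstar hp' hzw', map_nsmul, map_nsmul, hstar hp' hy, hstar hp hy']
      congr 2
      obtain ⟨f, hf⟩ := hex hp σ
      obtain ⟨g, hg⟩ := hex hp' (f.comp (chernR q p))
      obtain ⟨f', hf'⟩ := hex hp' σ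
      obtain ⟨g', hg'⟩ := hex hp (f'.comp (chernR q p'))
      have e1 : g (chernR q p' z) = σ y' := by
        have h1 : g (chernL q p' w') = f (chernR q p w') := RingHom.congr_fun hg w'
        rw [hzw', h1, hy']
        exact RingHom.congr_fun hf y'
      have e2 : g' (chernR q p z) = σ y := by
        have h1 : g' (chernL q p w) = f' (chernR q p' w) := RingHom.congr_fun hg' w
        rw [hzw, h1, hy]
        exact RingHom.congr_fun hf' y
      refine σ.injective ?_
      rw [← e1, ← e2]
      rcases comp_eq_or_eq_comp_iota hM hM0 hq hp hp' hg hg' (hf.trans hf'.symm) with h | h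
      · exact (RingHom.congr_fun h z).symm
      · have := RingHom.congr_fun h z
        rw [RingHom.comp_apply _ (iota 2 K), hz] at this
        exact this.symm
    ext z
    have h2 : (2 : FieldE 2 K) ≠ 0 := two_ne_zero
    have h1 := iota_iota (n := 2) (K := K)
    have e1 : iota 2 K (iota 2 K z) = z := RingHom.congr_fun h1 z
    have hz : z = (z + iota 2 K z) / 2 + (z - iota 2 K z) / 2 := by field_simp; ring
    have hp1 : iota 2 K ((z + iota 2 K z) / 2) = (z + iota 2 K z) / 2 := by
      rw [map_div₀, map_add, e1, map_ofNat, add_comm]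
    have hp2 : iota 2 K ((z - iota 2 K z) / 2) = -((z - iota 2 K z) / 2) := by
      rw [map_div₀, map_sub, e1, map_ofNat, ← neg_div, neg_sub]
    rw [hz, map_add, map_add]
    change _ + (chernCorrespondence M N q p').upperStar ((chernCorrespondence M N q p).upperStar _) =
      _ + (chernCorrespondence M N q p).upperStar ((chernCorrespondence M N q p').upperStar _)
    rw [hodd hp _ hp2, hodd hp' _ hp2, map_zero, map_zero]
    exact congrArg (· + 0) (heven _ hp1)
  rw [upperCurvature, Ring.lie_def, hcomp, sub_self, smul_zero]

end Alternating

end ArithChern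

/-! ### Idempotents and partial commutation -/

namespace ArithChern

theorem totallyDominant_of_nontrivial {E : Type u} [Field E] {S : Type u} [CommRing S] [Nontrivial S]
    (f : E →+* S) : Correspondence.TotallyDominant f := by
  constructor
  · intro x
    obtain ⟨y⟩ := (inferInstance : Nonempty (PrimeSpectrum S))
    rw [Subsingleton.elim x (PrimeSpectrum.comap f y)]
    exact subset_closure ⟨y, rfl⟩
  · intro y x _
    rw [Subsingleton.elim x (PrimeSpectrum.comap f y)]
    exact subset_closure ⟨y, mem_connectedComponent, rfl⟩

/-- A nontrivial idempotent cutting out a strictly symmetric part of `Γ' ∘ Γᵗ`. -/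
theorem compatibleWith_of_idempotent {E : Type u} [Field E] {Γ Γ' : Correspondence E}
    {e : (Γ'.comp Γ.transpose).carrier} (he : IsIdempotentElem e) (hu : ¬ IsUnit e)
    (hsym : (Ideal.Quotient.mk (Ideal.span {e})).comp (Γ'.comp Γ.transpose).left =
      (Ideal.Quotient.mk (Ideal.span {e})).comp (Γ'.comp Γ.transpose).right) :
    Γ.CompatibleWith Γ' := by
  let G := Γ'.comp Γ.transpose
  let π₁ := Ideal.Quotient.mk (Ideal.span {e})
  let π₂ := Ideal.Quotient.mk (Ideal.span {1 - e})
  refine ⟨⟨_, π₁.comp G.left, π₁.comp G.right⟩, ⟨_, π₂.comp G.left, π₂.comp G.right⟩,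
    ⟨RingEquiv.ofBijective (π₁.prod π₂) ?_, ?_, ?_⟩, hsym, ?_⟩
  · exact RingHom.prod_bijective_of_isIdempotentElem he he.one_sub (by simp)
      (by rw [mul_sub, he.eq, mul_one, sub_self])
  · rfl
  · rfl
  · have : Nontrivial ((Γ'.comp Γ.transpose).carrier ⧸ Ideal.span {e}) :=
      Ideal.Quotient.nontrivial_iff.mpr (by rwa [Ne, Ideal.span_singleton_eq_top])
    exact totallyDominant_of_nontrivial (π₁.comp G.left)

theorem Pushout.mem_of_forall {R S T : Type u} [CommRing R] [CommRing S] [CommRing T]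
    {f : R →+* S} {g : R →+* T} (A : Subring (Pushout f g)) (h1 : ∀ s, inl f g s ∈ A)
    (h2 : ∀ t, inr f g t ∈ A) (z : Pushout f g) : z ∈ A := by
  let := f.toAlgebra
  let := g.toAlgebra
  induction z using TensorProduct.induction_on with
  | zero => exact zero_mem A
  | tmul s t =>
    have e : s ⊗ₜ[R] t = inl f g s * inr f g t := by
      change s ⊗ₜ[R] t = (s ⊗ₜ[R] (1 : T)) * ((1 : S) ⊗ₜ[R] t)
      rw [Algebra.TensorProduct.tmul_mul_tmul, mul_one, one_mul]
    exact (congrArg (· ∈ A) e).mpr (mul_mem (h1 s) (h2 t))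
  | add a b ha hb => exact add_mem ha hb

/-- The idempotent of the locus on which two units with the same square coincide. -/
theorem exists_isIdempotentElem_of_sq_eq {G : Type u} [CommRing G] (h2 : IsUnit (2 : G)) {c c' : G}
    (hc : IsUnit c) (h : c ^ 2 = c' ^ 2) :
    ∃ e : G, IsIdempotentElem e ∧ Ideal.Quotient.mk (Ideal.span {e}) c =
      Ideal.Quotient.mk (Ideal.span {e}) c' ∧
      ∀ (T : Type u) [CommRing T] (γ : G →+* T), γ c = γ c' → γ e = 0 := by
  obtain ⟨i, hi⟩ := hc.exists_right_inv
  obtain ⟨w, hw⟩ := h2.exists_right_inv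
  have hc : (c' * i) ^ 2 = 1 := by
    rw [mul_pow, ← h, ← mul_pow, hi, one_pow]
  -- This is `(1 - c'/c)/2`, an idempotent because `c'/c` has square `1`.
  refine ⟨w * (1 - c' * i), ?_, ?_, ?_⟩
  · change w * (1 - c' * i) * (w * (1 - c' * i)) = w * (1 - c' * i)
    linear_combination w ^ 2 * hc + (w * (1 - c' * i)) * hw
  · rw [Ideal.Quotient.eq, Ideal.mem_span_singleton]
    exact ⟨2 * c, by linear_combination (c' - c) * hw + 2 * w * c' * hi⟩
  · intro T _ γ hγ
    rw [map_mul, map_sub, map_mul γ c', ← hγ, ← map_mul γ c, hi, sub_self, mul_zero]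

namespace Correspondence

variable {E : Type u} [CommRing E] (Γ' Γ : Correspondence E)

/-- The comorphism of the first projection from a composition of correspondences. -/
noncomputable def compInl : Γ.carrier →+* (Γ'.comp Γ).carrier := Pushout.inl Γ.right Γ'.left

/-- The comorphism of the second projection from a composition of correspondences. -/
noncomputable def compInr : Γ'.carrier →+* (Γ'.comp Γ).carrier := Pushout.inr Γ.right Γ'.left

theorem compInl_comp_right : (compInr Γ' Γ).comp Γ'.left = (compInl Γ' Γ).comp Γ.right :=
  (Pushout.inl_comp Γ.right Γ'.left).symm

theorem comp_exists_lift {T : Type v} [CommRing T] (f : Γ.carrier →+* T) (g : Γ'.carrier →+* T)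
    (h : g.comp Γ'.left = f.comp Γ.right) :
    ∃ γ : (Γ'.comp Γ).carrier →+* T, γ.comp (compInl Γ' Γ) = f ∧ γ.comp (compInr Γ' Γ) = g :=
  Pushout.exists_lift _ _ f g h.symm

theorem comp_mem_of_forall (A : Subring (Γ'.comp Γ).carrier) (h1 : ∀ s, compInl Γ' Γ s ∈ A)
    (h2 : ∀ t, compInr Γ' Γ t ∈ A) (z : (Γ'.comp Γ).carrier) : z ∈ A :=
  Pushout.mem_of_forall A h1 h2 z

end Correspondence

/-- A criterion for partial commutation in terms of the ring `G` of the fibre product over `Spec E`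
of the two compositions. -/
theorem partiallyCommute_of_exists_idempotent {E : Type u} [Field E] (Γ Γ' : Correspondence E)
    (H : ∀ (G : Type u) [CommRing G] (f : Γ.carrier →+* G) (g : Γ'.carrier →+* G)
      (f' : Γ'.carrier →+* G) (g' : Γ.carrier →+* G), g.comp Γ'.left = f.comp Γ.right →
      g'.comp Γ.left = f'.comp Γ'.right → f.comp Γ.left = f'.comp Γ'.left →
      (∀ (T : Type u) [CommRing T] (ρ₁ : Γ.carrier →+* T) (ρ₂ : Γ'.carrier →+* T)
        (ρ₃ : Γ'.carrier →+* T) (ρ₄ : Γ.carrier →+* T),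
        ρ₂.comp Γ'.left = ρ₁.comp Γ.right → ρ₄.comp Γ.left = ρ₃.comp Γ'.right →
        ρ₁.comp Γ.left = ρ₃.comp Γ'.left → ∃ γ : G →+* T, γ.comp f = ρ₁ ∧
          γ.comp g = ρ₂ ∧ γ.comp f' = ρ₃ ∧ γ.comp g' = ρ₄) →
      ∃ e : G, IsIdempotentElem e ∧ ¬ IsUnit e ∧
        (Ideal.Quotient.mk (Ideal.span {e})).comp (g'.comp Γ.right) =
          (Ideal.Quotient.mk (Ideal.span {e})).comp (g.comp Γ'.right)) :
    Γ.PartiallyCommute Γ' := by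
  obtain ⟨e, he, hu, hs⟩ := H ((Γ'.comp Γ).comp (Γ.comp Γ').transpose).carrier
    ((Correspondence.compInr (Γ'.comp Γ) (Γ.comp Γ').transpose).comp (Correspondence.compInl Γ' Γ))
    ((Correspondence.compInr (Γ'.comp Γ) (Γ.comp Γ').transpose).comp (Correspondence.compInr Γ' Γ))
    ((Correspondence.compInl (Γ'.comp Γ) (Γ.comp Γ').transpose).comp (Correspondence.compInl Γ Γ'))
    ((Correspondence.compInl (Γ'.comp Γ) (Γ.comp Γ').transpose).comp (Correspondence.compInr Γ Γ'))
    (congrArg (RingHom.comp (Correspondence.compInr (Γ'.comp Γ) (Γ.comp Γ').transpose))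
      (Correspondence.compInl_comp_right Γ' Γ))
    (congrArg (RingHom.comp (Correspondence.compInl (Γ'.comp Γ) (Γ.comp Γ').transpose))
      (Correspondence.compInl_comp_right Γ Γ'))
    (Correspondence.compInl_comp_right (Γ'.comp Γ) (Γ.comp Γ').transpose)
    (by
      intro T _ ρ₁ ρ₂ ρ₃ ρ₄ h₁ h₂ h₃
      obtain ⟨α, rfl, rfl⟩ := Correspondence.comp_exists_lift Γ Γ' ρ₃ ρ₄ h₂
      obtain ⟨β, rfl, rfl⟩ := Correspondence.comp_exists_lift Γ' Γ ρ₁ ρ₂ h₁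
      obtain ⟨γ, h₄, h₅⟩ := Correspondence.comp_exists_lift (Γ'.comp Γ) (Γ.comp Γ').transpose α β h₃
      exact ⟨γ, congrArg (RingHom.comp · (Correspondence.compInl Γ' Γ)) h₅,
        congrArg (RingHom.comp · (Correspondence.compInr Γ' Γ)) h₅,
        congrArg (RingHom.comp · (Correspondence.compInl Γ Γ')) h₄,
        congrArg (RingHom.comp · (Correspondence.compInr Γ Γ')) h₄⟩)
  exact compatibleWith_of_idempotent he hu hs

/-- Only the left maps are retained from the isomorphism. They place the carrier of `Γ'`, over its
own left map, inside the ring of `Γ' ∘ Γ`; this alone will contradict commutation. -/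
theorem exists_of_commutes {E : Type u} [Field E] {Γ Γ' : Correspondence E} (H : Γ.Commutes Γ') :
    ∃ (T : Type u) (_ : CommRing T) (f : Γ.carrier →+* T) (g : Γ'.carrier →+* T)
      (f' : Γ'.carrier →+* T), g.comp Γ'.left = f.comp Γ.right ∧
      f.comp Γ.left = f'.comp Γ'.left ∧
      (∀ (U : Type u) [CommRing U] (ρ₁ : Γ.carrier →+* U) (ρ₂ : Γ'.carrier →+* U),
        ρ₂.comp Γ'.left = ρ₁.comp Γ.right → ∃ γ : T →+* U, γ.comp f = ρ₁ ∧ γ.comp g = ρ₂) ∧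
      ∀ A : Subring T, (∀ s, f s ∈ A) → (∀ t, g t ∈ A) → ∀ z, z ∈ A := by
  obtain ⟨e, he, -⟩ := H
  exact ⟨(Γ'.comp Γ).carrier, inferInstance, Correspondence.compInl Γ' Γ,
    Correspondence.compInr Γ' Γ,
    (e : (Γ.comp Γ').carrier →+* (Γ'.comp Γ).carrier).comp (Correspondence.compInl Γ Γ'),
    Correspondence.compInl_comp_right Γ' Γ, he.symm,
    fun U _ ρ₁ ρ₂ h => Correspondence.comp_exists_lift Γ' Γ ρ₁ ρ₂ h,
    fun A h1 h2 z => Correspondence.comp_mem_of_forall Γ' Γ A h1 h2 z⟩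

/-! ### Partial commutation and failure of commutation in the antisymmetric case -/

section Alternating

variable {M : ℤ} {N : ℕ} [NeZero N] {K : Type u} [Field K] [CharZero K]
  [IsCyclotomicExtension {N} ℚ K]

variable {q : Matrix.GeneralLinearGroup (Fin 2) (cycRing M N K)} {p p' : ℕ}

variable (hM : Even M) (hM0 : M ≠ 0) (hq : q.val = !![0, 1; -1, 0]) (hp : IsGoodPrime M N p)
  (hp' : IsGoodPrime M N p')

include hM hM0 hp

theorem chernRing_exists_extension (U : Type*) [Field U] [IsAlgClosed U] (τ : FieldE 2 K →+* U) :
    ∃ ρ : ChernRing q p →+* U, ρ.comp (chernL q p) = τ := by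
  have := chernRing_nontrivial q hM hM0 hp.prime hp.not_dvd hp.coprime
  exact exists_extension (chernL_finite q p hM hM0) τ

include hq hp'

/-- The two composite scalars are units of `G` with equal squares; on the part where they coincide
the two composite right maps coincide. That part is non-empty because some geometric point has equal
scalars. -/
theorem exists_idempotent_of_scalars {G : Type u} [CommRing G] {f : ChernRing q p →+* G}
    {g : ChernRing q p' →+* G} (h : g.comp (chernL q p') = f.comp (chernR q p))
    {f' : ChernRing q p' →+* G} {g' : ChernRing q p →+* G}
    (h' : g'.comp (chernL q p) = f'.comp (chernR q p'))
    (h0 : f.comp (chernL q p) = f'.comp (chernL q p'))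
    (hγ : ∀ (T : Type u) [CommRing T] (ρ₁ : ChernRing q p →+* T) (ρ₂ : ChernRing q p' →+* T)
      (ρ₃ : ChernRing q p' →+* T) (ρ₄ : ChernRing q p →+* T),
      ρ₂.comp (chernL q p') = ρ₁.comp (chernR q p) → ρ₄.comp (chernL q p) = ρ₃.comp (chernR q p') →
      ρ₁.comp (chernL q p) = ρ₃.comp (chernL q p') → ∃ γ : G →+* T, γ.comp f = ρ₁ ∧
        γ.comp g = ρ₂ ∧ γ.comp f' = ρ₃ ∧ γ.comp g' = ρ₄) :
    ∃ e : G, IsIdempotentElem e ∧ ¬ IsUnit e ∧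
      (Ideal.Quotient.mk (Ideal.span {e})).comp (g'.comp (chernR q p)) =
        (Ideal.Quotient.mk (Ideal.span {e})).comp (g.comp (chernR q p')) := by
  have hsq := comp_scalar_sq hM hM0 hq hp hp' h
  have hsq' : (f (chernV q p) ^ p' * g (chernV q p')) ^ 2 =
      (f' (chernV q p') ^ p * g' (chernV q p)) ^ 2 := by
    rw [hsq, comp_scalar_sq hM hM0 hq hp' hp h', mul_comm p]
    exact RingHom.congr_fun h0 _
  have hunit : IsUnit (f (chernV q p) ^ p' * g (chernV q p')) := by
    refine (isUnit_pow_iff two_ne_zero).mp ?_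
    have hd : ∀ {m : ℕ}, m ≠ 0 → detPow K m ≠ 0 := detPow_ne_zero
    rw [hsq]
    exact (isUnit_iff_ne_zero.mpr (div_ne_zero (pow_ne_zero _ (hd one_ne_zero))
      (hd (mul_ne_zero hp.prime.ne_zero hp'.prime.ne_zero)))).map (f.comp (chernL q p))
  have h2u : IsUnit (2 : G) := by
    have := (isUnit_iff_ne_zero.mpr (two_ne_zero : (2 : FieldE 2 K) ≠ 0)).map
      (f.comp (chernL q p))
    rwa [map_ofNat] at this
  obtain ⟨e, he, hmk, hlift⟩ := exists_isIdempotentElem_of_sq_eq h2u hunit hsq'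
  refine ⟨e, he, ?_, ?_⟩
  · let Ω := AlgebraicClosure (FieldE 2 K)
    obtain ⟨ρ₁, h₁⟩ := chernRing_exists_extension (q := q) hM hM0 hp Ω (algebraMap _ _)
    obtain ⟨ρ₂, h₂⟩ := chernRing_exists_extension (q := q) hM hM0 hp' Ω (ρ₁.comp (chernR q p))
    obtain ⟨ρ₃, h₃⟩ := chernRing_exists_extension (q := q) hM hM0 hp' Ω (algebraMap _ _)
    obtain ⟨ρ₄, h₄, h₅⟩ : ∃ ρ₄ : ChernRing q p →+* Ω, ρ₄.comp (chernL q p) = ρ₃.comp (chernR q p') ∧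
        ρ₁ (chernV q p) ^ p' * ρ₂ (chernV q p') = ρ₃ (chernV q p') ^ p * ρ₄ (chernV q p) := by
      obtain ⟨ρ₄, h₄⟩ := chernRing_exists_extension (q := q) hM hM0 hp Ω (ρ₃.comp (chernR q p'))
      rcases comp_scalar_eq_or hM hM0 hq hp hp' h₂ h₄ (h₁.trans h₃.symm) with h₅ | h₅
      · exact ⟨ρ₄, h₄, h₅⟩
      -- If the signs disagree, precompose the last map with `y ↦ -y`. This changes the sign of one
      -- scalar and leaves the left maps untouched.
      · obtain ⟨ν, hνl, -, hνY⟩ :=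
          exists_sign_involution q hM hM0 (alternating_isUnit_one_sub hM hM0 hq hp)
        refine ⟨ρ₄.comp ν, by rw [RingHom.comp_assoc, hνl, h₄], ?_⟩
        have : ν (chernV q p) = -chernV q p := congrFun₂ hνY 0 0
        rw [h₅, RingHom.comp_apply, RingHom.coe_coe, this, map_neg, mul_neg]
    obtain ⟨γ, rfl, rfl, rfl, rfl⟩ := hγ Ω ρ₁ ρ₂ ρ₃ ρ₄ h₂ h₄ (h₁.trans h₃.symm)
    intro hun
    refine (hun.map γ).ne_zero (hlift Ω γ ?_)
    simpa using h₅
  · exact (comp_eq_of_scalar_eq hM hM0 hq hp hp' (f := (Ideal.Quotient.mk (Ideal.span {e})).comp f)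
      (g := (Ideal.Quotient.mk (Ideal.span {e})).comp g) (by rw [RingHom.comp_assoc, h]; rfl)
      (f' := (Ideal.Quotient.mk (Ideal.span {e})).comp f')
      (g' := (Ideal.Quotient.mk (Ideal.span {e})).comp g')
      (by rw [RingHom.comp_assoc, h']; rfl) (by rw [RingHom.comp_assoc, h0]; rfl)
      (by simpa using hmk)).symm

theorem alternating_partiallyCommute :
    (chernCorrespondence M N q p).PartiallyCommute (chernCorrespondence M N q p') :=
  partiallyCommute_of_exists_idempotent _ _ fun _ _ _ _ _ _ h h' h0 hγ =>
    exists_idempotent_of_scalars hM hM0 hq hp hp' h h' h0 hγ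

/-- Commutation would put a square root of the ratio for `p'` into the field generated over `E` by
`v` and by a square root of `a = det(x^{(p)})^{p'} / det(x^{(pp')})`. Descending through these two
quadratic extensions, the ratio for `p'` would be a square in `E` up to factors `a` and the ratio
for `p`, which the square classes forbid. -/
theorem alternating_not_commutes (hne : p ≠ p') :
    ¬ (chernCorrespondence M N q p).Commutes (chernCorrespondence M N q p') := by
  intro H
  obtain ⟨T, _, ft, gt, ft', ht, ht0, hlift, hmem⟩ := exists_of_commutes H
  let := (alternating_isField hM hM0 hq hp).toField
  let σ := algebraMap (FieldE 2 K) (AlgebraicClosure (FieldE 2 K))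
  obtain ⟨f, hf⟩ := chernRing_exists_extension (q := q) hM hM0 hp (AlgebraicClosure (FieldE 2 K)) σ
  obtain ⟨g, hg⟩ := chernRing_exists_extension (q := q) hM hM0 hp' _ (f.comp (chernR q p))
  obtain ⟨ρ, hρ₁, hρ₂⟩ := hlift _ f g hg
  have hs2 : ρ (ft' (chernV q p')) ^ 2 = σ (ratioE K p') := by
    rw [← map_pow, ← map_pow, chernV_sq hM hM0 hq hp', ← hf, ← hρ₁]
    exact congrArg ρ (RingHom.congr_fun ht0 _).symm
  have hd : ∀ {m : ℕ}, m ≠ 0 → detPow K m ≠ 0 := detPow_ne_zero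
  have hp0 := hp.prime.ne_zero
  have hp0' := hp'.prime.ne_zero
  set a := detPow K p ^ p' / detPow K (p * p') with ha
  have hpp := mul_ne_zero hp0 hp0'
  have hg2 : g (chernV q p') ^ 2 = σ a := by
    rw [← map_pow, chernV_sq hM hM0 hq hp', ← hf]
    exact (RingHom.congr_fun hg _).trans (congrArg f (chernR_ratioE hM hM0 hq hp hp'))
  have hσ : ∀ x, σ x ∈ f.fieldRange := fun x => ⟨chernL q p x, RingHom.congr_fun hf x⟩
  obtain ⟨α, hα, β, hβ, hαβ⟩ : ∃ α ∈ f.fieldRange, ∃ β ∈ f.fieldRange,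
      ρ (ft' (chernV q p')) = α + β * g (chernV q p') := by
    -- Elements whose image lies in `f(F_p) + f(F_p) g(v')` form a subring containing both tensor
    -- factors, hence everything.
    let A : Subring T :=
      { carrier := {z | ∃ α ∈ f.fieldRange, ∃ β ∈ f.fieldRange, ρ z = α + β * g (chernV q p')}
        mul_mem' := by
          rintro x y ⟨α, hα, β, hβ, hx⟩ ⟨α', hα', β', hβ', hy⟩
          refine ⟨α * α' + β * β' * σ a, add_mem (mul_mem hα hα') (mul_mem (mul_mem hβ hβ') (hσ a)),
            α * β' + β * α', add_mem (mul_mem hα hβ') (mul_mem hβ hα'), ?_⟩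
          rw [map_mul, hx, hy, ← hg2]; ring
        one_mem' := ⟨1, one_mem _, 0, zero_mem _, by simp⟩
        add_mem' := by
          rintro x y ⟨α, hα, β, hβ, hx⟩ ⟨α', hα', β', hβ', hy⟩
          exact ⟨α + α', add_mem hα hα', β + β', add_mem hβ hβ', by rw [map_add, hx, hy]; ring⟩
        zero_mem' := ⟨0, zero_mem _, 0, zero_mem _, by simp⟩
        neg_mem' := by
          rintro x ⟨α, hα, β, hβ, hx⟩
          exact ⟨-α, neg_mem hα, -β, neg_mem hβ, by rw [map_neg, hx]; ring⟩ }
    refine hmem A (fun z => ⟨f z, ⟨z, rfl⟩, 0, zero_mem _, ?_⟩) (fun z => ?_) _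
    · rw [zero_mul, add_zero]; exact RingHom.congr_fun hρ₁ z
    · obtain ⟨b, c, hbc⟩ := alternating_exists_add_mul hM hM0 hq hp' z
      refine ⟨f (chernR q p b), ⟨_, rfl⟩, f (chernR q p c), ⟨_, rfl⟩, ?_⟩
      have e1 : ρ (gt z) = g z := RingHom.congr_fun hρ₂ z
      have e2 : ∀ b, g (chernL q p' b) = f (chernR q p b) := RingHom.congr_fun hg
      rw [e1, hbc, map_add, map_mul, e2, e2]
  have h2 : (2 : AlgebraicClosure (FieldE 2 K)) ≠ 0 := two_ne_zero
  -- Second descent, from `E(v)` to `E`.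
  have hdesc : ∀ w, (∃ t ∈ f.fieldRange, t ^ 2 = σ w) → IsSquare w ∨ IsSquare (w * ratioE K p) := by
    rintro w ⟨t, ⟨y, rfl⟩, ht⟩
    obtain ⟨b, c, rfl⟩ := alternating_exists_add_mul hM hM0 hq hp y
    have e2 : ∀ b, f (chernL q p b) = σ b := RingHom.congr_fun hf
    have hv : f (chernV q p) ^ 2 = σ (ratioE K p) := by
      rw [← map_pow, chernV_sq hM hM0 hq hp, e2]
    rw [map_add, map_mul, e2, e2] at ht
    rcases isSquare_or_of_add_mul_sq h2 σ.fieldRange ⟨_, rfl⟩ hv ⟨_, rfl⟩ ⟨_, rfl⟩ ⟨_, rfl⟩ ht with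
      ⟨_, ⟨t, rfl⟩, h⟩ | ⟨_, ⟨t, rfl⟩, h⟩
    · exact Or.inl ⟨t, σ.injective (by rw [← h, map_mul, pow_two])⟩
    · exact Or.inr ⟨t, σ.injective (by rw [map_mul σ, ← h, map_mul, pow_two])⟩
  have hsq := isSquare_or_of_add_mul_sq h2 f.fieldRange (hσ a) hg2 hα hβ (hσ _)
    (by rw [← hαβ, hs2])
  rw [← map_mul] at hsq
  obtain ⟨e₁, he₁, hr₁⟩ := pow_div_eq_mul_sq hp'.odd (hd one_ne_zero) (hd hp0')
  obtain ⟨e₂, he₂, hr₂⟩ := pow_div_eq_mul_sq hp'.odd (hd hp0) (hd hpp)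
  obtain ⟨e₃, he₃, hr₃⟩ := pow_div_eq_mul_sq hp.odd (hd one_ne_zero) (hd hp0)
  have hnd : ¬ p' ∣ p := fun h' => hne ((Nat.prime_dvd_prime_iff_eq hp'.prime hp.prime).mp h').symm
  have hev : ∀ {m k : ℕ} {ω : AlgebraicClosure K}, IsPrimitiveRoot ω k → ¬ k ∣ m →
      (cornerEval K (detPowPoly K m)).eval ω ≠ 0 := by
    intro m k ω hω hk h
    rw [cornerEval_detPowPoly] at h
    simp only [Polynomial.eval_sub, Polynomial.eval_pow, Polynomial.eval_X, Polynomial.eval_one,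
      sub_eq_zero] at h
    exact hk (hω.dvd_of_pow_eq_one m h)
  obtain ⟨ω, hω⟩ := exists_primitiveRoot K hp0'
  obtain ⟨η, hη⟩ := exists_primitiveRoot K hpp
  have hη1 : ¬ p * p' ∣ 1 := fun h => hp.prime.one_lt.ne' (Nat.dvd_one.mp ((dvd_mul_right _ _).trans h))
  have hηp : ¬ p * p' ∣ p := fun h => hnd ((dvd_mul_left _ _).trans h)
  have hηp' : ¬ p * p' ∣ p' := fun h => hne
    ((Nat.prime_dvd_prime_iff_eq hp.prime hp'.prime).mp ((dvd_mul_right _ _).trans h))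
  -- With `u_m = det(x^{(m)})`, the four candidates for a square are the classes of `u_1 u_{p'}`,
  -- `u_p u_{p'}`, `u_1 u_p u_{p'} u_{pp'}` and `u_{p'} u_{pp'}`. Each is tested at a primitive root
  -- of unity of order `p'` or `pp'`, a zero of exactly one of its factors.
  rcases hsq with h | h <;> rcases hdesc _ h with h | h
  · exact not_isSquare_ratioE hp'.prime hp'.odd h
  · refine not_isSquare_mul_detPow (detPowPoly K p) hp0' hω.pow_eq_one (hev hω hnd) ?_
    rw [algebraMap_detPowPoly]
    refine isSquare_of_isSquare_mul_sq (b := detPow K 1 * e₁ * e₃)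
      (mul_ne_zero (mul_ne_zero (hd one_ne_zero) he₁) he₃) ?_
    rw [ratioE, ratioE, hr₁, hr₃] at h
    refine Eq.mp (congrArg IsSquare ?_) h; ring
  · refine not_isSquare_mul_detPow (detPowPoly K 1 * detPowPoly K p' * detPowPoly K p) hpp
      hη.pow_eq_one ?_ ?_
    · rw [map_mul, map_mul, Polynomial.eval_mul, Polynomial.eval_mul]
      exact mul_ne_zero (mul_ne_zero (hev hη hη1) (hev hη hηp')) (hev hη hηp)
    rw [map_mul, map_mul, algebraMap_detPowPoly, algebraMap_detPowPoly, algebraMap_detPowPoly]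
    refine isSquare_of_isSquare_mul_sq (b := e₁ * e₂) (mul_ne_zero he₁ he₂) ?_
    rw [ratioE, ha, hr₁, hr₂] at h
    refine Eq.mp (congrArg IsSquare ?_) h; ring
  · refine not_isSquare_mul_detPow (detPowPoly K p') hpp hη.pow_eq_one (hev hη hηp') ?_
    rw [algebraMap_detPowPoly]
    refine isSquare_of_isSquare_mul_sq (b := detPow K 1 * detPow K p * e₁ * e₂ * e₃)
      (mul_ne_zero (mul_ne_zero (mul_ne_zero (mul_ne_zero (hd one_ne_zero) (hd hp0)) he₁) he₂) he₃) ?_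
    rw [ratioE, ratioE, ha, hr₁, hr₂, hr₃] at h
    refine Eq.mp (congrArg IsSquare ?_) h; ring

end Alternating

end ArithChern

namespace ArithChern

variable {n : ℕ}

/-! ## Degrees of homomorphisms of fields -/

section Degree

/-- The degree of a homomorphism. -/
noncomputable def homDegree {E F : Type*} [CommRing E] [CommRing F] (f : E →+* F) : ℕ :=
  @Module.finrank E F _ _ f.toAlgebra.toModule

theorem homDegree_comp {E F L : Type*} [Field E] [Field F] [Field L] (g : F →+* L) (f : E →+* F) :
    homDegree (g.comp f) = homDegree f * homDegree g := by
  let := f.toAlgebra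
  let := g.toAlgebra
  let := (g.comp f).toAlgebra
  have : IsScalarTower E F L := .of_algebraMap_eq fun _ => rfl
  exact (Module.finrank_mul_finrank E F L).symm

theorem homDegree_of_family {E F ι : Type*} [Field E] [Field F] [Fintype ι] (f : E →+* F)
    (b : ι → F) (hli : ∀ c : ι → E, ∑ i, f (c i) * b i = 0 → ∀ i, c i = 0)
    (hspan : ∀ z, ∃ c : ι → E, ∑ i, f (c i) * b i = z) : homDegree f = Fintype.card ι := by
  let := f.toAlgebra
  have h1 : LinearIndependent E b := Fintype.linearIndependent_iff.mpr hli
  have h2 : ⊤ ≤ Submodule.span E (Set.range b) := by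
    intro z _
    obtain ⟨c, rfl⟩ := hspan z
    exact Submodule.sum_mem _ fun i _ => Submodule.smul_mem _ (c i) (Submodule.subset_span ⟨i, rfl⟩)
  exact Module.finrank_eq_card_basis (Module.Basis.mk h1 h2)

theorem homDegree_of_surjective {E F : Type*} [Field E] [Field F] (f : E →+* F)
    (hf : Function.Surjective f) : homDegree f = 1 := by
  rw [homDegree_of_family (ι := Unit) f (fun _ => 1)]
  · simp
  · intro c hc i
    simpa using hc
  · intro z
    obtain ⟨c, rfl⟩ := hf z
    exact ⟨fun _ => c, by simp⟩

/-- An integral element divides a nonzero element of the base, as with norms; used to make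
denominators lie in the image of Frobenius. -/
theorem exists_dvd_of_isIntegral {R S : Type*} [CommRing R] [CommRing S] [IsDomain S] {f : R →+* S}
    (hf : f.IsIntegral) (hinj : Function.Injective f) {s : S} (hs : s ≠ 0) :
    ∃ r, f r ≠ 0 ∧ s ∣ f r := by
  have := f.domain_nontrivial
  let := f.toAlgebra
  have hint : IsIntegral R s := hf s
  obtain ⟨r, hr, h⟩ := hint.isAlgebraic.exists_nonzero_dvd (mem_nonZeroDivisors_of_ne_zero hs)
  exact ⟨r, (map_ne_zero_iff f hinj).mpr hr, h⟩

end Degree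

/-! ## The degree of the Frobenius endomorphism -/

section Frobenius

variable {N : ℕ} [NeZero N] {K : Type u} [Field K] [CharZero K]
  [IsCyclotomicExtension {N} ℚ K] {p : ℕ}

theorem frobPoly_C (c : K) : frobPoly n N K p (MvPolynomial.C c) = MvPolynomial.C (frobK N K p c) := by
  simp [frobPoly]

theorem frobPoly_X (ij : Fin n × Fin n) :
    frobPoly n N K p (MvPolynomial.X ij) = MvPolynomial.X ij ^ p := by
  simp [frobPoly]

theorem frobPoly_isIntegral (hp : p ≠ 0) : (frobPoly n N K p).IsIntegral := by
  intro g
  induction g using MvPolynomial.induction_on with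
  | C c =>
    obtain ⟨c, rfl⟩ := frobK_surjective (N := N) (K := K) p c
    rw [← frobPoly_C]
    exact RingHom.isIntegralElem_map _
  | add f g hf hg => exact hf.add _ hg
  | mul_X f ij hf =>
    refine hf.mul _ ⟨Polynomial.X ^ p - Polynomial.C (MvPolynomial.X ij),
      Polynomial.monic_X_pow_sub_C _ hp, ?_⟩
    simp [frobPoly_X]

/-- A vector of exponents smaller than `p`. -/
noncomputable def reducedExponent (a : Fin n × Fin n → Fin p) : Fin n × Fin n →₀ ℕ :=
  Finsupp.equivFunOnFinite.symm fun i => (a i : ℕ)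

theorem reducedExponent_apply (a : Fin n × Fin n → Fin p) (i) : reducedExponent a i = a i := rfl

variable (n K p) in
/-- The monomials with all exponents smaller than `p`. -/
noncomputable def reducedMonomial (a : Fin n × Fin n → Fin p) : MvPolynomial (Fin n × Fin n) K :=
  MvPolynomial.monomial (reducedExponent a) 1

/-- Divide each exponent by `p` with remainder; coefficients are no obstacle since Frobenius is onto
on `K`. -/
theorem frobPoly_span (hp : 0 < p) (g : MvPolynomial (Fin n × Fin n) K) :
    ∃ c : (Fin n × Fin n → Fin p) → MvPolynomial (Fin n × Fin n) K,
      ∑ a, frobPoly n N K p (c a) * reducedMonomial n K p a = g := by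
  classical
  induction g using MvPolynomial.induction_on' with
  | monomial u c =>
    obtain ⟨c, rfl⟩ := frobK_surjective (N := N) (K := K) p c
    refine ⟨Pi.single (fun i => ⟨u i % p, Nat.mod_lt _ hp⟩)
      (MvPolynomial.monomial (Finsupp.equivFunOnFinite.symm fun i => u i / p) c), ?_⟩
    rw [Finset.sum_eq_single (fun i => (⟨u i % p, Nat.mod_lt _ hp⟩ : Fin p))]
    · rw [Pi.single_eq_same, frobPoly, RingHom.comp_apply, MvPolynomial.map_monomial]
      change MvPolynomial.expand p _ * _ = _
      rw [MvPolynomial.expand_monomial, reducedMonomial, MvPolynomial.monomial_mul, mul_one]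
      have e : p • (Finsupp.equivFunOnFinite.symm fun i => u i / p) +
          reducedExponent (fun i => (⟨u i % p, Nat.mod_lt _ hp⟩ : Fin p)) = u := by
        ext i
        simp [reducedExponent_apply, Nat.div_add_mod]
      rw [e]
    · intro a _ ha
      rw [Pi.single_eq_of_ne ha, map_zero, zero_mul]
    · simp
  | add f g hf hg =>
    obtain ⟨c, rfl⟩ := hf
    obtain ⟨d, rfl⟩ := hg
    exact ⟨c + d, by simp [add_mul, Finset.sum_add_distrib]⟩

theorem frobPoly_linearIndependent (hp : 0 < p)
    (c : (Fin n × Fin n → Fin p) → MvPolynomial (Fin n × Fin n) K)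
    (h : ∑ a, frobPoly n N K p (c a) * reducedMonomial n K p a = 0) (a) : c a = 0 := by
  classical
  ext m
  have h1 := congrArg (MvPolynomial.coeff (p • m + reducedExponent a)) h
  rw [MvPolynomial.coeff_sum, Finset.sum_eq_single a, reducedMonomial,
    MvPolynomial.coeff_mul_monomial, mul_one] at h1
  · have h2 : frobK N K p (MvPolynomial.coeff m (c a)) = 0 := by
      rw [← MvPolynomial.coeff_map, ← MvPolynomial.coeff_expand_smul p hp.ne']
      exact h1
    rw [MvPolynomial.coeff_zero]
    exact (map_eq_zero _).mp h2
  · intro b _ hb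
    rw [reducedMonomial, MvPolynomial.coeff_mul_monomial', mul_one]
    by_cases hle : reducedExponent b ≤ p • m + reducedExponent a
    · rw [if_pos hle]
      obtain ⟨i, hi⟩ := Function.ne_iff.mp hb
      change MvPolynomial.coeff _ (MvPolynomial.expand p (MvPolynomial.map (frobK N K p) (c b))) = 0
      refine MvPolynomial.coeff_expand_of_not_dvd (MvPolynomial.map (frobK N K p) (c b)) (i := i) ?_
      have hlei : (b i : ℕ) ≤ p * m i + a i := hle i
      change ¬ p ∣ p * m i + a i - b i
      rw [← Nat.modEq_iff_dvd' hlei]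
      intro hmod
      refine hi (Fin.ext ?_)
      rw [Nat.ModEq, Nat.mul_add_mod, Nat.mod_eq_of_lt (a i).2, Nat.mod_eq_of_lt (b i).2] at hmod
      exact hmod
    · rw [if_neg hle]
  · simp

theorem frobE_algebraMap (hp : p.Prime) (g : MvPolynomial (Fin n × Fin n) K) :
    frobE n N K p hp (algebraMap _ _ g) = algebraMap _ _ (frobPoly n N K p g) := by
  rw [frobE, IsFractionRing.map, IsLocalization.map_eq]

/-- The `p^(n²)` monomials with all exponents below `p` form a basis already at the level of
polynomials, and this persists after clearing denominators. -/
theorem homDegree_frobE (hp : p.Prime) : homDegree (frobE n N K p hp) = p ^ (n * n) := by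
  classical
  have hinj := IsFractionRing.injective (MvPolynomial (Fin n × Fin n) K) (FieldE n K)
  rw [homDegree_of_family (frobE n N K p hp) fun a => algebraMap _ _ (reducedMonomial n K p a)]
  · simp
  · intro c hc a
    obtain ⟨d, hd⟩ := IsLocalization.exist_integer_multiples_of_finite
      (nonZeroDivisors (MvPolynomial (Fin n × Fin n) K)) c
    choose e he using hd
    have he' : ∀ a, algebraMap _ (FieldE n K) (e a) = algebraMap _ _ d.1 * c a := fun a => by
      rw [he a, Algebra.smul_def]
    have h0 : algebraMap (MvPolynomial (Fin n × Fin n) K) (FieldE n K) d.1 ≠ 0 :=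
      (map_ne_zero_iff _ hinj).mpr (nonZeroDivisors.ne_zero d.2)
    have h1 : e a = 0 := by
      refine frobPoly_linearIndependent (N := N) hp.pos e (hinj ?_) a
      rw [map_sum, map_zero, ← mul_zero (frobE n N K p hp (algebraMap _ _ d.1)), ← hc, Finset.mul_sum]
      refine Finset.sum_congr rfl fun a _ => ?_
      rw [map_mul, ← frobE_algebraMap hp, he' a, map_mul, mul_assoc]
    have h2 := he' a
    rw [h1, map_zero] at h2
    exact (mul_eq_zero.mp h2.symm).resolve_left h0
  · intro z
    obtain ⟨f, g, hg, rfl⟩ := IsFractionRing.div_surjective (A := MvPolynomial (Fin n × Fin n) K) z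
    have hg0 := nonZeroDivisors.ne_zero hg
    -- Multiplying numerator and denominator by `k` turns the denominator into the image of `r`.
    obtain ⟨r, hr0, k, hk⟩ := exists_dvd_of_isIntegral
      (frobPoly_isIntegral (n := n) (N := N) (K := K) hp.ne_zero) (frobPoly_injective n N K p hp) hg0
    obtain ⟨c, hc⟩ := frobPoly_span (N := N) hp.pos (f * k)
    refine ⟨fun a => algebraMap _ _ (c a) / algebraMap _ _ r, ?_⟩
    have e1 : ∀ a, frobE n N K p hp (algebraMap _ _ (c a) / algebraMap _ _ r) *
        algebraMap _ (FieldE n K) (reducedMonomial n K p a) =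
        algebraMap _ _ (frobPoly n N K p (c a) * reducedMonomial n K p a) /
          algebraMap _ _ (frobPoly n N K p r) := by
      intro a
      rw [map_div₀, frobE_algebraMap, frobE_algebraMap, map_mul]
      ring
    simp only [e1]
    rw [← Finset.sum_div, ← map_sum, hc, hk, map_mul, map_mul]
    rw [hk] at hr0
    have hk0 : algebraMap _ (FieldE n K) k ≠ 0 :=
      (map_ne_zero_iff _ hinj).mpr (right_ne_zero_of_mul hr0)
    rw [mul_div_mul_right _ _ hk0]

end Frobenius

end ArithChern

namespace ArithChern

variable {n : ℕ}

/-! ### Embeddings obtained by rescaling the coordinates -/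

section Scaling

variable {K : Type u} [Field K]

theorem fieldE_mem_subfield (F : Subfield (FieldE n K)) (h1 : ∀ a, algebraMap K _ a ∈ F)
    (h2 : ∀ i j, matE n K i j ∈ F) (z : FieldE n K) : z ∈ F := by
  have h : ∀ g : MvPolynomial (Fin n × Fin n) K, algebraMap _ (FieldE n K) g ∈ F := by
    intro g
    induction g using MvPolynomial.induction_on with
    | C c => exact h1 c
    | add f g hf hg => rw [map_add]; exact add_mem hf hg
    | mul_X f ij hf =>
      rw [map_mul]
      refine mul_mem hf ?_
      have := h2 ij.1 ij.2
      simpa [matE] using this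
  obtain ⟨f, g, -, rfl⟩ := IsFractionRing.div_surjective (A := MvPolynomial (Fin n × Fin n) K) z
  exact div_mem (h f) (h g)

variable [CharZero K]

/-- Rescaling the indeterminates by a factor that is algebraic over the field generated by the
rescaled indeterminates. -/
theorem exists_scaling {L : Type u} [Field L] (l : FieldE n K →+* L) (hl : l.Finite) {c : L}
    (hc : c ≠ 0) {k : ℕ} (hk : 0 < k)
    (hck : ∀ F : Subfield L, (∀ a, l (algebraMap K _ a) ∈ F) →
      (∀ i j, c * l (matE n K i j) ∈ F) → c ^ k ∈ F) :
    ∃ l' : FieldE n K →+* L, l'.comp (algebraMap K _) = l.comp (algebraMap K _) ∧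
      ∀ i j, l' (matE n K i j) = c * l (matE n K i j) := by
  have htr := trdeg_of_finite l hl
  let := (l.comp (algebraMap K (FieldE n K))).toAlgebra
  let x : Fin n × Fin n → L := fun ij => c * l (matE n K ij.1 ij.2)
  let A := Algebra.adjoin K (Set.range x)
  -- The elements algebraic over the rescaled coordinates. They include `c`, because `c^k` is one of
  -- them, hence the original coordinates, hence all of `L`.
  let Q : Subfield L :=
    { carrier := {z | IsAlgebraic A z}
      mul_mem' := fun h1 h2 => IsAlgebraic.mul h1 h2
      one_mem' := isAlgebraic_one
      add_mem' := fun h1 h2 => IsAlgebraic.add h1 h2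
      zero_mem' := isAlgebraic_zero
      neg_mem' := fun h => IsAlgebraic.neg h
      inv_mem' := fun _ h => IsAlgebraic.inv h }
  have hK : ∀ a, l (algebraMap K _ a) ∈ Q := fun a =>
    isAlgebraic_algebraMap (R := A) (A := L) (algebraMap K A a)
  have hx : ∀ i j, c * l (matE n K i j) ∈ Q := fun i j =>
    isAlgebraic_algebraMap (R := A) (A := L) ⟨_, Algebra.subset_adjoin ⟨(i, j), rfl⟩⟩
  have hcQ : c ∈ Q := IsAlgebraic.of_pow hk (hck Q hK hx)
  have hlQ : ∀ z, l z ∈ Q := fun z =>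
    fieldE_mem_subfield (Q.comap l) hK (fun i j => by
      have := mul_mem (inv_mem hcQ) (hx i j)
      rwa [inv_mul_cancel_left₀ hc] at this) z
  have halg : Algebra.IsAlgebraic A L := by
    let f : A →+* Q := A.val.toRingHom.codRestrict Q fun z =>
      isAlgebraic_algebraMap (R := A) (A := L) z
    let := f.toAlgebra
    have : IsScalarTower A Q L := .of_algebraMap_eq fun _ => rfl
    have h1 : Algebra.IsAlgebraic A Q :=
      ⟨fun z => (isAlgebraic_algebraMap_iff (R := A) (A := L) (S := Q) Subtype.val_injective).mp z.2⟩
    have h2 : Algebra.IsAlgebraic Q L := by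
      refine ⟨fun z => ?_⟩
      obtain ⟨P, hP, h0⟩ := hl.to_isIntegral z
      let g : FieldE n K →+* Q := l.codRestrict Q hlQ
      refine IsIntegral.isAlgebraic ⟨P.map g, hP.map g, ?_⟩
      rw [Polynomial.eval₂_map]
      exact h0
    exact Algebra.IsAlgebraic.trans A Q L
  -- `L` is algebraic over `n²` elements and has transcendence degree `n²`, so these elements are
  -- independent and the rescaling extends to `E`.
  have hbasis : IsTranscendenceBasis K x :=
    Algebra.IsAlgebraic.isTranscendenceBasis_of_lift_le_trdeg_of_finite K x (by rw [htr]; simp)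
  have hind : Function.Injective ((MvPolynomial.aeval x : MvPolynomial (Fin n × Fin n) K →ₐ[K] L) :
      MvPolynomial (Fin n × Fin n) K →+* L) := hbasis.1
  refine ⟨IsFractionRing.lift hind, ?_, fun i j => ?_⟩
  · ext a
    rw [RingHom.comp_apply, IsScalarTower.algebraMap_apply K (MvPolynomial (Fin n × Fin n) K),
      IsFractionRing.lift_algebraMap]
    exact (MvPolynomial.aeval x).commutes a
  · have : matE n K i j = algebraMap (MvPolynomial (Fin n × Fin n) K) _ (MvPolynomial.X (i, j)) := by
      simp [matE]
    rw [this, IsFractionRing.lift_algebraMap, ← this]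
    exact MvPolynomial.aeval_X x (i, j)

end Scaling

/-! ### The right degree in the antisymmetric case -/

section Alternating

variable {M : ℤ} {N : ℕ} [NeZero N] {K : Type u} [Field K] [CharZero K]
  [IsCyclotomicExtension {N} ℚ K]

variable (K) in
/-- The element `det(x) / x₀₀²`. -/
noncomputable def homogE : FieldE 2 K := detPow K 1 / matE 2 K 0 0 ^ 2

section

variable {L : Type u} [Field L] {l l' : FieldE 2 K →+* L} {c : L}
  (h : ∀ i j, l' (matE 2 K i j) = c * l (matE 2 K i j))

include h

omit [CharZero K] in
theorem scaling_detPow (m : ℕ) : l' (detPow K m) = c ^ (2 * m) * l (detPow K m) := by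
  have : (matE 2 K).map l' = c • (matE 2 K).map l := by ext i j; simp [h]
  rw [map_detPow, this, det_entryPow_smul, ← map_detPow]

omit [CharZero K] in
theorem scaling_homogE (hc : c ≠ 0) : l' (homogE K) = l (homogE K) := by
  rw [homogE, map_div₀, map_div₀, scaling_detPow h, map_pow, map_pow, h, mul_pow, mul_one,
    mul_div_mul_left _ _ (pow_ne_zero 2 hc)]

omit [CharZero K] in
theorem scaling_ratioE (hc : c ≠ 0) (p : ℕ) : l' (ratioE K p) = l (ratioE K p) := by
  rw [ratioE, map_div₀, map_div₀, scaling_detPow h, map_pow, map_pow, scaling_detPow h, mul_pow,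
    ← pow_mul, mul_one, mul_div_mul_left _ _ (pow_ne_zero _ hc)]

end

/-- Functions homogeneous of degree zero do not see the scalar `c`. This supplies the algebraicity
required by `exists_scaling`. -/
theorem homogE_mem_of_scaled {L : Type u} [Field L] {l : FieldE 2 K →+* L} {c : L} (hc : c ≠ 0)
    {F : Subfield L} (hF : ∀ i j, c * l (matE 2 K i j) ∈ F) : l (homogE K) ∈ F ∧
      ∀ p, l (ratioE K p) ∈ F := by
  have hdet : ∀ m, c ^ (2 * m) * l (detPow K m) ∈ F := by
    intro m
    rw [map_detPow, ← det_entryPow_smul, Matrix.det_fin_two]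
    exact sub_mem (mul_mem (pow_mem (hF 0 0) m) (pow_mem (hF 1 1) m))
      (mul_mem (pow_mem (hF 0 1) m) (pow_mem (hF 1 0) m))
  constructor
  · have := div_mem (hdet 1) (pow_mem (hF 0 0) 2)
    rwa [mul_pow, mul_one, mul_div_mul_left _ _ (pow_ne_zero 2 hc), ← map_pow, ← map_div₀] at this
  · intro p
    have := div_mem (pow_mem (hdet 1) p) (hdet p)
    rwa [mul_pow, mul_one, ← pow_mul, mul_div_mul_left _ _ (pow_ne_zero _ hc), ← map_pow,
      ← map_div₀] at this

theorem scaling_identity {F : Type*} [Field F] {v d : F} (hd : d ≠ 0) (x : F) {k p : ℕ}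
    (hk : p = 2 * k + 1) : (v / d ^ k * x) ^ p = ((d ^ p / v ^ 2) ^ k)⁻¹ * (x ^ p * v) := by
  subst hk
  rw [mul_pow, div_pow, div_pow]
  field_simp
  ring

theorem homogE_ne_zero : homogE K ≠ 0 :=
  div_ne_zero (detPow_ne_zero one_ne_zero) (pow_ne_zero _ (by simp [matE]))

variable (K) in
-- The scaling factor is itself invariant under scaling, so multiplication of the coordinates by the
-- inverse factor gives the inverse homomorphism.
theorem exists_scaling_homogE (k : ℕ) : ∃ η : FieldE 2 K →+* FieldE 2 K,
    η.comp (algebraMap K _) = algebraMap K _ ∧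
    (∀ i j, η (matE 2 K i j) = (homogE K ^ k)⁻¹ * matE 2 K i j) ∧ Function.Surjective η := by
  have hd := pow_ne_zero k (homogE_ne_zero (K := K))
  obtain ⟨η, h1, h2⟩ := exists_scaling (RingHom.id (FieldE 2 K)) (RingHom.Finite.id _)
    (c := (homogE K ^ k)⁻¹) (inv_ne_zero hd) one_pos (fun F hK hx => by
      rw [pow_one]
      exact inv_mem (pow_mem (homogE_mem_of_scaled (inv_ne_zero hd) hx).1 k))
  obtain ⟨θ, h3, h4⟩ := exists_scaling (RingHom.id (FieldE 2 K)) (RingHom.Finite.id _)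
    (c := homogE K ^ k) hd one_pos (fun F hK hx => by
      rw [pow_one]
      exact pow_mem (homogE_mem_of_scaled hd hx).1 k)
  refine ⟨η, h1, h2, fun z => ⟨θ z, ?_⟩⟩
  have : η.comp θ = RingHom.id _ := by
    refine fieldE_ringHom_ext ?_ ?_
    · rw [RingHom.comp_assoc, h3]; exact h1
    · ext i j
      rw [Matrix.map_apply, RingHom.comp_apply, h4, map_mul, map_pow,
        scaling_homogE h2 (inv_ne_zero hd), RingHom.id_apply, RingHom.id_apply, h2,
        RingHom.id_apply, mul_inv_cancel_left₀ hd]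
      rfl
  exact RingHom.congr_fun this z

variable {q : Matrix.GeneralLinearGroup (Fin 2) (cycRing M N K)} {p : ℕ}

variable (hM : Even M) (hM0 : M ≠ 0) (hq : q.val = !![0, 1; -1, 0]) (hp : IsGoodPrime M N p)

include hM hM0 hq hp

theorem chernR_homogE : chernR q p (homogE K) * chernV q p ^ 2 = chernL q p (homogE K) ^ p := by
  let := (alternating_isField hM hM0 hq hp).toField
  have hx : matE 2 K 0 0 ≠ 0 := by simp [matE]
  have hd : ∀ {m : ℕ}, m ≠ 0 → detPow K m ≠ 0 := detPow_ne_zero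
  have hv : chernV q p ≠ 0 := by
    intro h
    have := chernV_sq hM hM0 hq hp
    rw [h, zero_pow two_ne_zero] at this
    exact div_ne_zero (pow_ne_zero _ (hd one_ne_zero)) (hd hp.prime.ne_zero)
      ((map_eq_zero (chernL q p)).mp this.symm)
  rw [homogE, map_div₀, chernR_detPow hM hM0 hq hp, map_pow, chernR_apply hM hM0 hq hp,
    mul_one, mul_one, mul_pow, mul_comm (chernV q p ^ 2),
    mul_div_mul_right _ _ (pow_ne_zero 2 hv), chernV_sq hM hM0 hq hp, ← map_pow, ← map_pow, ← map_div₀,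
    ← map_mul, ← map_pow]
  congr 1
  have := hd hp.prime.ne_zero
  rw [ratioE, div_pow]
  field_simp
  ring

/-- Put `p = 2k + 1` and `d = det(x)/x₀₀²`. Let `l'` be the left embedding rescaled by `c = v /
π(d)^k`, and `η` the automorphism `x ↦ d^(-k) x`. Since `φ(d) v² = π(d)^p`, one finds `l' ∘ Frob = φ
∘ η`. Frobenius has degree `p^4`, `η` degree `1`, and `l'` degree `2` because `l'(E)` and `v`
generate the field while `v²` is the image of a non-square. -/
theorem alternating_rightDegree : (chernCorrespondence M N q p).rightDegree = 2 * p ^ 4 := by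
  change homDegree (chernR q p) = 2 * p ^ 4
  let := (alternating_isField hM hM0 hq hp).toField
  obtain ⟨k, hk⟩ := hp.odd
  have hd := homogE_ne_zero (K := K)
  have hld : chernL q p (homogE K) ≠ 0 := (map_ne_zero _).mpr hd
  have hv : chernV q p ≠ 0 := fun h => by
    have := chernL_ne_of_map hM hM0 hq hp (RingHom.id (ChernRing q p)) 0
    rw [map_zero, map_zero, h, map_zero] at this
    exact this rfl
  have hv2 := chernV_sq hM hM0 hq hp
  set v := chernV q p
  set c : ChernRing q p := v / chernL q p (homogE K) ^ k
  have hc : c ≠ 0 := div_ne_zero hv (pow_ne_zero _ hld)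
  obtain ⟨l', h1, h2⟩ := exists_scaling (chernL q p) (chernL_finite q p hM hM0) hc two_pos
    (fun F hK hx => by
      obtain ⟨h3, h4⟩ := homogE_mem_of_scaled hc hx
      rw [div_pow, hv2]
      exact div_mem (h4 p) (pow_mem (pow_mem h3 k) 2))
  have hl' : l' (ratioE K p) = v ^ 2 := by rw [scaling_ratioE h2 hc, hv2]
  have hlh : l' (homogE K) = chernL q p (homogE K) := scaling_homogE h2 hc
  obtain ⟨η, h3, h4, hη⟩ := exists_scaling_homogE K k
  have hcomp : l'.comp (frobE 2 N K p hp.prime) = (chernR q p).comp η := by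
    refine fieldE_ringHom_ext ?_ ?_
    · rw [RingHom.comp_assoc, frobE_const, ← RingHom.comp_assoc, h1, RingHom.comp_assoc _ η, h3, chernR_const]
    · ext i j
      have e : frobE 2 N K p hp.prime (matE 2 K i j) = matE 2 K i j ^ p :=
        congrFun₂ (frobE_matE hp.prime) i j
      have e1 := chernR_homogE hM hM0 hq hp
      have e2 : chernR q p (homogE K) = chernL q p (homogE K) ^ p / v ^ 2 := by
        rw [eq_div_iff (pow_ne_zero 2 hv), e1]
      simp only [Matrix.map_apply, RingHom.comp_apply, e, map_pow, h2, h4, map_mul, map_inv₀, e2,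
        chernR_apply hM hM0 hq hp]
      change (v / chernL q p (homogE K) ^ k * _) ^ p = _ * (_ * v)
      exact scaling_identity hld _ hk
  have hdeg : homDegree l' = 2 := by
    have hind : ∀ a b : FieldE 2 K, l' a + l' b * v = 0 → a = 0 ∧ b = 0 := by
      intro a b hab
      by_cases hb : b = 0
      · subst hb
        rw [map_zero, zero_mul, add_zero] at hab
        exact ⟨(map_eq_zero l').mp hab, rfl⟩
      · exfalso
        have hb' : l' b ≠ 0 := (map_ne_zero l').mpr hb
        refine not_isSquare_ratioE (K := K) hp.prime hp.odd ⟨a / b, l'.injective ?_⟩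
        have : v = -(l' a / l' b) := by
          field_simp
          linear_combination hab
        rw [hl', this, map_mul, map_div₀]
        ring
    let S : Subfield (ChernRing q p) :=
      { carrier := {z | ∃ a b, z = l' a + l' b * v}
        mul_mem' := by
          rintro _ _ ⟨a, b, rfl⟩ ⟨a', b', rfl⟩
          refine ⟨a * a' + b * b' * ratioE K p, a * b' + b * a', ?_⟩
          rw [map_add, map_mul, map_mul, map_mul, hl', map_add, map_mul, map_mul]
          ring
        one_mem' := ⟨1, 0, by simp⟩
        add_mem' := by
          rintro _ _ ⟨a, b, rfl⟩ ⟨a', b', rfl⟩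
          exact ⟨a + a', b + b', by rw [map_add, map_add]; ring⟩
        zero_mem' := ⟨0, 0, by simp⟩
        neg_mem' := by
          rintro _ ⟨a, b, rfl⟩
          exact ⟨-a, -b, by rw [map_neg, map_neg]; ring⟩
        inv_mem' := by
          rintro _ ⟨a, b, rfl⟩
          by_cases hab : l' a + l' b * v = 0
          · exact ⟨0, 0, by rw [hab]; simp⟩
          · have h6 : l' a + l' (-b) * v ≠ 0 := by
              intro h0
              obtain ⟨rfl, h8⟩ := hind _ _ h0
              rw [neg_eq_zero] at h8
              subst h8
              simp at hab
            have h7 : l' (a ^ 2 - b ^ 2 * ratioE K p) = (l' a + l' b * v) * (l' a + l' (-b) * v) := by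
              rw [map_sub, map_mul, hl', map_neg, map_pow, map_pow]
              ring
            refine ⟨a / (a ^ 2 - b ^ 2 * ratioE K p), -b / (a ^ 2 - b ^ 2 * ratioE K p), ?_⟩
            rw [map_div₀, map_div₀, h7, div_mul_eq_mul_div, ← add_div, inv_eq_one_div,
              div_eq_div_iff hab (mul_ne_zero hab h6)]
            ring }
    -- The subfield generated by `l'(E)` and `v` contains `π(d)`, hence `c`, hence the unscaled
    -- coordinates; so it is everything.
    have hvS : v ∈ S := ⟨0, 1, by simp⟩
    have hlS : ∀ a, chernL q p a ∈ S := fun a =>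
      fieldE_mem_subfield (S.comap (chernL q p))
        (fun a => ⟨algebraMap K _ a, 0, by
          rw [map_zero, zero_mul, add_zero]; exact (RingHom.congr_fun h1 a).symm⟩)
        (fun i j => by
          have e1 : c * chernL q p (matE 2 K i j) ∈ S := ⟨matE 2 K i j, 0, by rw [h2]; simp⟩
          have e2 : chernL q p (homogE K) ∈ S := ⟨homogE K, 0, by rw [hlh]; simp⟩
          have e3 := mul_mem (inv_mem (div_mem hvS (pow_mem e2 k))) e1
          rwa [inv_mul_cancel_left₀ hc] at e3) a
    rw [homDegree_of_family l' ![1, v]]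
    · simp
    · intro c' hc'
      rw [Fin.sum_univ_two] at hc'
      have := hind (c' 0) (c' 1) (by simpa using hc')
      intro i
      fin_cases i
      · exact this.1
      · exact this.2
    · intro z
      obtain ⟨a, b, hz⟩ := alternating_exists_add_mul hM hM0 hq hp z
      obtain ⟨a', b', hz'⟩ : z ∈ S := by
        rw [hz]
        exact add_mem (hlS a) (mul_mem (hlS b) hvS)
      exact ⟨![a', b'], by rw [Fin.sum_univ_two, hz']; simp⟩
  have h5 := congrArg homDegree hcomp
  rw [homDegree_comp, homDegree_comp, homDegree_frobE, homDegree_of_surjective η hη, hdeg, one_mul] at h5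
  rw [← h5, mul_comm]

end Alternating

end ArithChern

namespace ArithChern

/-! ## Independent square roots -/

section SquareRoots

variable {k Ω J : Type*} [Field k] [CharZero k] [Field Ω] [Algebra k Ω] [IsAlgClosed Ω]
  [Algebra.IsAlgebraic k Ω] [Fintype J]

/-- If no nonempty subproduct of the `a j` is a square, then all sign changes of the square roots
`s j` come from automorphisms. -/
theorem exists_algEquiv_signs {a : J → k} {s : J → Ω} (hs : ∀ j, s j ^ 2 = algebraMap k Ω (a j))
    (ha : ∀ T : Finset J, T.Nonempty → ¬ IsSquare (∏ j ∈ T, a j)) (v : J → ZMod 2) :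
    ∃ σ : Ω ≃ₐ[k] Ω, ∀ j, σ (s j) = (-1) ^ (v j).val * s j := by
  classical
  have : IsAlgClosure k Ω := ⟨inferInstance, inferInstance⟩
  have : IsGalois k Ω := ⟨⟩
  have hadd : ∀ x y : ZMod 2, ((-1 : Ω)) ^ (x + y).val = (-1) ^ y.val * (-1) ^ x.val := by
    have h11 : (1 + 1 : ZMod 2) = 0 := by decide
    have h01 : ∀ x : ZMod 2, x = 0 ∨ x = 1 := by decide
    intro x y
    rcases h01 x with rfl | rfl <;> rcases h01 y with rfl | rfl <;> simp [ZMod.val_one, h11]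
  -- The sign patterns realized by automorphisms form a subspace over the field with two elements.
  let W : AddSubgroup (J → ZMod 2) :=
    { carrier := {v | ∃ σ : Ω ≃ₐ[k] Ω, ∀ j, σ (s j) = (-1) ^ (v j).val * s j}
      zero_mem' := ⟨AlgEquiv.refl, fun j => by simp⟩
      add_mem' := by
        rintro v w ⟨σ, hσ⟩ ⟨τ, hτ⟩
        refine ⟨σ.trans τ, fun j => ?_⟩
        rw [AlgEquiv.trans_apply, hσ, map_mul, map_pow, map_neg, map_one, hτ, Pi.add_apply, hadd]
        ring
      neg_mem' := by
        intro v hv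
        have : -v = v := by ext j; simp [ZMod.neg_eq_self_mod_two]
        rwa [this] }
  let W' : Submodule (ZMod 2) (J → ZMod 2) := AddSubgroup.toZModSubmodule 2 W
  suffices h : W' = ⊤ from (h ▸ Submodule.mem_top : v ∈ W')
  by_contra hW
  obtain ⟨f, hf, hWf⟩ := Submodule.exists_le_ker_of_lt_top W' (lt_top_iff_ne_top.mpr hW)
  -- A nonzero linear form killing all realized patterns is a sum over a nonempty `T`. Then the
  -- product of the `s j` over `T` is Galois-invariant, so the product of the `a j` is a square.
  let T : Finset J := Finset.univ.filter fun j => f (Pi.single j 1) ≠ 0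
  have hfv : ∀ v, f v = ∑ j ∈ T, v j := by
    intro v
    have h1 : v = ∑ j, v j • Pi.single (M := fun _ => ZMod 2) j 1 := by
      ext i; simp [Finset.sum_apply, Pi.single_apply]
    conv_lhs => rw [h1]
    rw [map_sum, Finset.sum_filter]
    refine Finset.sum_congr rfl fun j _ => ?_
    rw [map_smul]
    have : ∀ x : ZMod 2, x ≠ 0 → x = 1 := by decide
    split_ifs with h
    · rw [this _ h, smul_eq_mul, mul_one]
    · rw [not_not.mp h, smul_zero]
  have hT : T.Nonempty := by
    by_contra hT
    rw [Finset.not_nonempty_iff_eq_empty] at hT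
    exact hf (LinearMap.ext fun v => by rw [hfv, hT]; simp)
  have hfix : ∏ j ∈ T, s j ∈ Set.range (algebraMap k Ω) := by
    rw [InfiniteGalois.mem_range_algebraMap_iff_fixed]
    intro σ
    have hsgn : ∀ j, ∃ x : ZMod 2, σ (s j) = (-1) ^ x.val * s j := by
      intro j
      have : σ (s j) ^ 2 = s j ^ 2 := by rw [← map_pow, hs, σ.commutes]
      rcases sq_eq_sq_iff_eq_or_eq_neg.mp this with h | h
      · exact ⟨0, by simpa using h⟩
      · exact ⟨1, by simpa [ZMod.val_one] using h⟩
    choose v hv using hsgn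
    have h0 : f v = 0 := hWf (show v ∈ W from ⟨σ, hv⟩)
    rw [hfv] at h0
    rw [map_prod, Finset.prod_congr rfl fun j _ => hv j, Finset.prod_mul_distrib,
      Finset.prod_pow_eq_pow_sum, Even.neg_one_pow, one_mul]
    rw [← ZMod.natCast_eq_zero_iff_even]
    simpa using h0
  obtain ⟨b, hb⟩ := hfix
  refine ha T hT ⟨b, (algebraMap k Ω).injective ?_⟩
  rw [map_prod, map_mul, hb, ← Finset.prod_mul_distrib]
  exact Finset.prod_congr rfl fun j _ => by rw [← hs, pow_two]

/-- All sign changes of the sum are conjugates. They are distinct: the automorphism flipping only `s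
j` detects the sign at `j`. -/
theorem two_pow_le_natDegree_minpoly_sum {a : J → k} {s : J → Ω}
    (hs : ∀ j, s j ^ 2 = algebraMap k Ω (a j))
    (ha : ∀ T : Finset J, T.Nonempty → ¬ IsSquare (∏ j ∈ T, a j)) :
    2 ^ Fintype.card J ≤ (minpoly k (∑ j, s j)).natDegree := by
  classical
  have hCZ : CharZero Ω := charZero_of_injective_algebraMap (algebraMap k Ω).injective
  let g : (J → ZMod 2) → Ω := fun v => ∑ j, (-1) ^ (v j).val * s j
  have hs0 : ∀ j, s j ≠ 0 := by
    intro j h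
    refine ha {j} ⟨j, by simp⟩ ⟨0, ?_⟩
    have := hs j
    rw [h] at this
    simpa using this.symm
  have hg : Function.Injective g := by
    intro v w h
    ext1 j
    obtain ⟨σ, hσ⟩ := exists_algEquiv_signs hs ha (Pi.single j 1)
    have key : ∀ v, g v - σ (g v) = 2 * ((-1) ^ (v j).val * s j) := by
      intro v
      simp only [g, map_sum, ← Finset.sum_sub_distrib]
      rw [Finset.sum_eq_single j]
      · rw [map_mul, hσ]; simp [ZMod.val_one]; ring
      · intro i _ hi
        rw [map_mul, hσ]
        simp [Pi.single_eq_of_ne hi]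
      · simp
    have h1 := key v
    rw [h, key w] at h1
    have h2 := mul_right_cancel₀ (hs0 j) (mul_left_cancel₀ two_ne_zero h1)
    have : ∀ x y : ZMod 2, ((-1 : Ω)) ^ x.val = (-1) ^ y.val → x = y := by
      intro x y
      have e1 : (-1 : Ω) ≠ 1 := by norm_num
      have e2 : (1 : Ω) ≠ -1 := by norm_num
      have h01 : ∀ x : ZMod 2, x = 0 ∨ x = 1 := by decide
      rcases h01 x with rfl | rfl <;> rcases h01 y with rfl | rfl <;> simp [ZMod.val_one, e1, e2]
    exact (this _ _ h2).symm
  have hint : IsIntegral k (∑ j, s j) := (Algebra.IsAlgebraic.isAlgebraic _).isIntegral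
  have hroots : Finset.univ.image g ⊆ ((minpoly k (∑ j, s j)).map (algebraMap k Ω)).roots.toFinset := by
    intro x hx
    obtain ⟨v, -, rfl⟩ := Finset.mem_image.mp hx
    obtain ⟨σ, hσ⟩ := exists_algEquiv_signs hs ha v
    rw [Multiset.mem_toFinset, Polynomial.mem_roots', Polynomial.IsRoot, Polynomial.eval_map_algebraMap]
    refine ⟨((minpoly.monic hint).map _).ne_zero, ?_⟩
    have : g v = σ (∑ j, s j) := by rw [map_sum]; exact Finset.sum_congr rfl fun j _ => (hσ j).symm
    rw [this, ← AlgEquiv.coe_toAlgHom, Polynomial.aeval_algHom_apply, minpoly.aeval, map_zero]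
  calc 2 ^ Fintype.card J = (Finset.univ.image g).card := by
        rw [Finset.card_image_of_injective _ hg]; simp [ZMod.card]
    _ ≤ _ := Finset.card_le_card hroots
    _ ≤ _ := Multiset.toFinset_card_le _
    _ ≤ _ := Polynomial.card_roots' _
    _ ≤ _ := Polynomial.natDegree_map_le

end SquareRoots

/-! ## Specialization -/

/-- Choose a prime over the kernel, then embed the integral quotient into the algebraically closed
field. In this way eigenvalues and their square roots are specialized together. -/
theorem exists_ringHom_of_isIntegral {R O Ω₀ : Type*} [CommRing R] [CommRing O] [IsDomain O]
    [Algebra R O] [FaithfulSMul R O] [Algebra.IsIntegral R O] [Field Ω₀] [IsAlgClosed Ω₀]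
    (f : R →+* Ω₀) : ∃ θ : O →+* Ω₀, θ.comp (algebraMap R O) = f := by
  have : (RingHom.ker f).IsPrime := RingHom.ker_isPrime f
  obtain ⟨Q, -, hQ, hQf⟩ := Ideal.exists_ideal_over_prime_of_isIntegral
    (S := O) (RingHom.ker f) ⊥ (by
      intro x hx
      have h1 : algebraMap R O x = 0 := by simpa using hx
      rw [(FaithfulSMul.algebraMap_injective R O) (h1.trans (map_zero _).symm)]
      exact zero_mem _)
  have hover : Q.LiesOver (RingHom.ker f) := ⟨hQf.symm⟩
  let : Algebra (R ⧸ RingHom.ker f) Ω₀ := (RingHom.kerLift f).toAlgebra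
  have hinj : Function.Injective (algebraMap (R ⧸ RingHom.ker f) Ω₀) := RingHom.kerLift_injective f
  have : FaithfulSMul (R ⧸ RingHom.ker f) Ω₀ := (faithfulSMul_iff_algebraMap_injective _ _).mpr hinj
  have : Module.IsTorsionFree (R ⧸ RingHom.ker f) Ω₀ := inferInstance
  have hf2 : FaithfulSMul (R ⧸ RingHom.ker f) (O ⧸ Q) := inferInstance
  have : Algebra.IsIntegral (R ⧸ RingHom.ker f) (O ⧸ Q) := inferInstance
  have : IsDomain (R ⧸ RingHom.ker f) := Ideal.Quotient.isDomain _
  have : IsDomain (O ⧸ Q) := Ideal.Quotient.isDomain _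
  have : Module.IsTorsionFree (R ⧸ RingHom.ker f) (O ⧸ Q) :=
    Module.isTorsionFree_iff_faithfulSMul.mpr hf2
  let g : (O ⧸ Q) →ₐ[R ⧸ RingHom.ker f] Ω₀ := IsAlgClosed.lift
  refine ⟨(g : _ →+* Ω₀).comp (Ideal.Quotient.mk Q), ?_⟩
  ext x
  exact (g.commutes (Ideal.Quotient.mk _ x)).trans (RingHom.kerLift_mk f x)

/-! ### Square roots of matrices with distinct eigenvalues -/

section MatrixRoots

variable {ι : Type*} [Fintype ι] [DecidableEq ι]

theorem exists_eigenbasis {k : Type*} [Field k] {P : Matrix ι ι k} {ν : ι → k}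
    (hν : Function.Injective ν) (hP : P.charpoly = ∏ i, (Polynomial.X - Polynomial.C (ν i))) :
    ∃ U : Matrix ι ι k, IsUnit U.det ∧ P * U = U * Matrix.diagonal ν := by
  have h1 : ∀ i, ∃ v : ι → k, Module.End.HasEigenvector (Matrix.toLin' P) (ν i) v := by
    intro i
    refine Module.End.HasEigenvalue.exists_hasEigenvector ?_
    rw [Module.End.hasEigenvalue_iff_isRoot_charpoly, Matrix.charpoly_toLin', hP, Polynomial.IsRoot,
      Polynomial.eval_prod]
    exact Finset.prod_eq_zero (Finset.mem_univ i) (by simp)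
  choose v hv using h1
  have hli := Module.End.eigenvectors_linearIndependent' (Matrix.toLin' P) ν hν v hv
  have hunit : IsUnit (Matrix.of v) := Matrix.linearIndependent_rows_iff_isUnit.mp hli
  refine ⟨(Matrix.of v)ᵀ, by rw [Matrix.det_transpose]; exact (Matrix.isUnit_iff_isUnit_det _).mp hunit, ?_⟩
  ext i j
  have := congrFun (hv j).apply_eq_smul i
  rw [Matrix.mul_diagonal, Matrix.mul_apply]
  simpa [Matrix.mulVec, dotProduct, mul_comm] using this

/-- A square root commutes with its square, and what commutes with a diagonal matrix with distinct
entries is diagonal. -/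
theorem eq_mul_diagonal_of_mul_self {k : Type*} [Field k] {P U B : Matrix ι ι k} {ν : ι → k}
    (hν : Function.Injective ν) (hU : IsUnit U.det) (hPU : P * U = U * Matrix.diagonal ν)
    (hB : B * B = P) :
    ∃ c : ι → k, (∀ i, c i ^ 2 = ν i) ∧ B = U * Matrix.diagonal c * U⁻¹ := by
  have hUU := Matrix.nonsing_inv_mul U hU
  have hUU' := Matrix.mul_nonsing_inv U hU
  set C := U⁻¹ * B * U with hC
  have hCC : C * C = Matrix.diagonal ν := by
    calc C * C = U⁻¹ * B * (U * U⁻¹) * B * U := by simp only [hC, Matrix.mul_assoc]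
      _ = U⁻¹ * (B * B * U) := by rw [hUU', Matrix.mul_one]; simp only [Matrix.mul_assoc]
      _ = Matrix.diagonal ν := by rw [hB, hPU, ← Matrix.mul_assoc, hUU, Matrix.one_mul]
  have hcomm : C * Matrix.diagonal ν = Matrix.diagonal ν * C := by
    rw [← hCC]
    exact (Matrix.mul_assoc C C C).symm
  have hdiag : C = Matrix.diagonal fun i => C i i := by
    ext i j
    by_cases hij : i = j
    · subst hij; simp
    · rw [Matrix.diagonal_apply_ne _ hij]
      have := congrFun₂ hcomm i j
      rw [Matrix.mul_diagonal, Matrix.diagonal_mul] at this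
      have h2 : (ν j - ν i) * C i j = 0 := by linear_combination this
      exact (mul_eq_zero.mp h2).resolve_left (sub_ne_zero.mpr fun h => hij (hν h).symm)
  refine ⟨fun i => C i i, fun i => ?_, ?_⟩
  · rw [hdiag, Matrix.diagonal_mul_diagonal] at hCC
    have := congrFun₂ hCC i i
    simp only [Matrix.diagonal_apply_eq] at this
    rw [pow_two, this]
  · rw [← hdiag, hC]
    calc B = (U * U⁻¹) * B * (U * U⁻¹) := by rw [hUU', Matrix.one_mul, Matrix.mul_one]
      _ = _ := by simp only [Matrix.mul_assoc]

/-- In an eigenbasis a root amounts to one sign per eigenvalue, measured relative to a fixed root.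
-/
theorem card_matrix_roots_le {k : Type*} [Field k] {P U : Matrix ι ι k} {ν : ι → k}
    (hν : Function.Injective ν) (hU : IsUnit U.det) (hPU : P * U = U * Matrix.diagonal ν)
    {α : Type*} (B : α → Matrix ι ι k) (hB : Function.Injective B)
    (hBB : ∀ x, B x * B x = P) : Nat.card α ≤ 2 ^ Fintype.card ι := by
  classical
  choose c hc hBc using fun x => eq_mul_diagonal_of_mul_self hν hU hPU (hBB x)
  have hcinj : Function.Injective c := fun x y h => hB (by rw [hBc x, hBc y, h])
  rcases isEmpty_or_nonempty α with h | ⟨⟨x₀⟩⟩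
  · simp
  let g : α → ι → Bool := fun x i => decide (c x i = c x₀ i)
  have hg : Function.Injective g := by
    intro x y h
    refine hcinj (funext fun i => ?_)
    have h2 : c x i = c x₀ i ↔ c y i = c x₀ i := by simpa [g] using congrFun h i
    have h3 : ∀ z, c z i = c x₀ i ∨ c z i = -c x₀ i := fun z => by
      rw [← sq_eq_sq_iff_eq_or_eq_neg, hc, hc]
    rcases h3 x with h4 | h4 <;> rcases h3 y with h5 | h5
    · rw [h4, h5]
    · rw [h4, h2.mp h4]
    · rw [h5, h2.mpr h5]
    · rw [h4, h5]
  have := Nat.card_le_card_of_injective g hg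
  simpa using this

end MatrixRoots

section Specialization

variable {ι J R E k₀ : Type*} {Ω : Type v} [Fintype ι] [DecidableEq ι] [Fintype J] [CommRing R] [IsDomain R]
  [IsIntegrallyClosed R] [Field E] [Algebra R E] [IsFractionRing R E] [Field Ω] [IsAlgClosed Ω]
  [Algebra E Ω] [Field k₀] [CharZero k₀]

theorem roots_prod_X_sub_C_fun {κ k : Type*} [Field k] [Fintype κ] (w : κ → k) :
    (∏ i, (Polynomial.X - Polynomial.C (w i))).roots = Finset.univ.val.map w := by
  rw [← Polynomial.roots_multiset_prod_X_sub_C (Finset.univ.val.map w), Multiset.map_map]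
  rfl

theorem exists_fun_prod_eq {k : Type*} [Field k] [IsAlgClosed k] (P : Matrix ι ι k) :
    ∃ ν : ι → k, P.charpoly = ∏ i, (Polynomial.X - Polynomial.C (ν i)) := by
  have h1 : P.charpoly.roots.card = Fintype.card ι := by
    rw [← (IsAlgClosed.splits P.charpoly).natDegree_eq_card_roots, Matrix.charpoly_natDegree_eq_dim]
  let l := P.charpoly.roots.toList
  have hl : Fintype.card ι = l.length := by rw [← h1]; simp [l]
  let e : ι ≃ Fin l.length := (Fintype.equivFin ι).trans (finCongr hl)
  refine ⟨fun i => l.get (e i), ?_⟩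
  rw [e.prod_comp (fun i => Polynomial.X - Polynomial.C (l.get i))]
  have h2 := (IsAlgClosed.splits P.charpoly).eq_prod_roots_of_monic P.charpoly_monic
  have h3 : P.charpoly.roots = (l : Multiset k) := by simp [l]
  rw [h3, Multiset.map_coe, Multiset.prod_coe] at h2
  rw [h2, ← List.prod_ofFn]
  congr 1
  conv_lhs => rw [← List.ofFn_get l]
  rw [List.map_ofFn]
  rfl

variable [Algebra R Ω] [IsScalarTower R E Ω]

/-- Square roots of a matrix that specializes to one with independent square roots of
eigenvalues. -/
theorem matrix_root_specialization (P : Matrix ι ι R) (sp : R →+* k₀) {lam : J → k₀}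
    (hP : P.charpoly.map sp = ∏ j, (Polynomial.X - Polynomial.C (lam j)))
    (hlam : ∀ T : Finset J, T.Nonempty → ¬ IsSquare (∏ j ∈ T, lam j)) :
    (∀ B : Matrix ι ι Ω, B * B = P.map (algebraMap R Ω) →
      2 ^ Fintype.card J ≤ (minpoly E B.trace).natDegree) ∧
    ∀ (α : Type v) (B : α → Matrix ι ι Ω), Function.Injective B →
      (∀ x, B x * B x = P.map (algebraMap R Ω)) → Nat.card α ≤ 2 ^ Fintype.card J := by
  classical
  have hfs : FaithfulSMul R Ω := (faithfulSMul_iff_algebraMap_injective _ _).mpr (by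
    rw [IsScalarTower.algebraMap_eq R E Ω]
    exact (algebraMap E Ω).injective.comp (IsFractionRing.injective R E))
  have hlaminj : Function.Injective lam := by
    intro i j h
    by_contra hij
    refine hlam {i, j} ⟨i, by simp⟩ ⟨lam i, ?_⟩
    rw [Finset.prod_pair hij, h]
  have hcard : Fintype.card ι = Fintype.card J := by
    have h1 := congrArg Polynomial.natDegree hP
    rw [P.charpoly_monic.natDegree_map, Matrix.charpoly_natDegree_eq_dim,
      Polynomial.natDegree_prod_of_monic _ _ (fun i _ => Polynomial.monic_X_sub_C _)] at h1
    simpa using h1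
  let Ω₀ := AlgebraicClosure k₀
  let O := integralClosure R Ω
  have : FaithfulSMul R O := (faithfulSMul_iff_algebraMap_injective _ _).mpr (fun x y h =>
    FaithfulSMul.algebraMap_injective R Ω (congrArg Subtype.val h))
  obtain ⟨θ, hθ⟩ := exists_ringHom_of_isIntegral (O := O) ((algebraMap k₀ Ω₀).comp sp)
  obtain ⟨ν, hν⟩ := exists_fun_prod_eq (P.map (algebraMap R Ω))
  have hνO : ∀ i, ν i ∈ integralClosure R Ω := by
    intro i
    refine ⟨P.charpoly, P.charpoly_monic, ?_⟩
    rw [← Polynomial.eval_map, ← Matrix.charpoly_map, hν, Polynomial.eval_prod]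
    exact Finset.prod_eq_zero (Finset.mem_univ i) (by simp)
  let νO : ι → O := fun i => ⟨ν i, hνO i⟩
  have hOΩ : Function.Injective (algebraMap O Ω) := Subtype.val_injective
  have hνO' : P.charpoly.map (algebraMap R O) = ∏ i, (Polynomial.X - Polynomial.C (νO i)) := by
    refine Polynomial.map_injective _ hOΩ ?_
    rw [Polynomial.map_map, ← IsScalarTower.algebraMap_eq, ← Matrix.charpoly_map, hν,
      Polynomial.map_prod]
    simp [νO, O]
  have hθν : ∏ i, (Polynomial.X - Polynomial.C (θ (νO i))) =
      ∏ j, (Polynomial.X - Polynomial.C (algebraMap k₀ Ω₀ (lam j))) := by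
    have h1 := congrArg (Polynomial.map θ) hνO'
    rw [Polynomial.map_map, hθ, ← Polynomial.map_map, hP, Polynomial.map_prod,
      Polynomial.map_prod] at h1
    simpa using h1.symm
  have hroots : (Finset.univ.val.map fun i => θ (νO i)) =
      Finset.univ.val.map fun j => algebraMap k₀ Ω₀ (lam j) := by
    have h1 := congrArg Polynomial.roots hθν
    rwa [roots_prod_X_sub_C_fun, roots_prod_X_sub_C_fun] at h1
  have hmem : ∀ i, ∃ j, algebraMap k₀ Ω₀ (lam j) = θ (νO i) := by
    intro i
    have : θ (νO i) ∈ Finset.univ.val.map fun i => θ (νO i) :=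
      Multiset.mem_map_of_mem _ (Finset.mem_univ i)
    rw [hroots] at this
    obtain ⟨j, -, hj⟩ := Multiset.mem_map.mp this
    exact ⟨j, hj⟩
  -- The specialized eigenvalues are distinct, so the generic ones are as well, and square roots can
  -- be diagonalized.
  have hθinj : Function.Injective fun i => θ (νO i) := by
    have hnd : (Finset.univ.val.map fun i => θ (νO i)).Nodup := by
      rw [hroots]
      exact Multiset.Nodup.map ((algebraMap k₀ Ω₀).injective.comp hlaminj) Finset.univ.nodup
    intro i i' h
    exact Multiset.inj_on_of_nodup_map hnd i (Finset.mem_univ i) i' (Finset.mem_univ i') h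
  have hνinj : Function.Injective ν := fun i i' h =>
    hθinj (congrArg θ (Subtype.ext h : νO i = νO i'))
  choose e he using hmem
  have heinj : Function.Injective e := fun i i' h => hθinj (by simp only [← he, h])
  have hebij : Function.Bijective e := (Fintype.bijective_iff_injective_and_card e).mpr ⟨heinj, hcard⟩
  obtain ⟨U, hU, hPU⟩ := exists_eigenbasis hνinj hν
  refine ⟨fun B hB => ?_, fun α B hB hBB => hcard ▸ card_matrix_roots_le hνinj hU hPU B hB hBB⟩
  obtain ⟨c, hc, hBc⟩ := eq_mul_diagonal_of_mul_self hνinj hU hPU hB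
  have htr : B.trace = ∑ i, c i := by
    rw [hBc, Matrix.trace_mul_cycle, Matrix.nonsing_inv_mul U hU, Matrix.one_mul,
      Matrix.trace_diagonal]
  have hcO : ∀ i, c i ∈ integralClosure R Ω := fun i =>
    IsIntegral.of_pow two_pos (by rw [hc]; exact hνO i)
  let cO : ι → O := fun i => ⟨c i, hcO i⟩
  have htO : B.trace = algebraMap O Ω (∑ i, cO i) := by
    rw [htr, map_sum]; rfl
  have hint : IsIntegral R B.trace := by rw [htO]; exact (∑ i, cO i).2
  -- Over an integrally closed ring the minimal polynomial is monic with coefficients in `R`, so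
  -- specialization keeps its degree. The specialized trace is a root of it, and that trace already
  -- has `2^n` conjugates.
  have hdeg : (minpoly E B.trace).natDegree = ((minpoly R B.trace).map sp).natDegree := by
    rw [minpoly.isIntegrallyClosed_eq_field_fractions' E hint, (minpoly.monic hint).natDegree_map,
      (minpoly.monic hint).natDegree_map]
  have hsq : ∀ i, θ (cO i) ^ 2 = algebraMap k₀ Ω₀ (lam (e i)) := by
    intro i
    rw [he, ← map_pow]
    exact congrArg θ (Subtype.ext (hc i))
  have hroot : Polynomial.aeval (∑ i, θ (cO i)) ((minpoly R B.trace).map sp) = 0 := by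
    have h1 : Polynomial.aeval (∑ i, cO i) (minpoly R B.trace) = 0 := by
      refine hOΩ ?_
      rw [map_zero, ← Polynomial.aeval_algebraMap_apply, ← htO, minpoly.aeval]
    rw [Polynomial.aeval_def] at h1
    rw [← map_sum, Polynomial.aeval_def, Polynomial.eval₂_map, ← hθ, ← Polynomial.hom_eval₂, h1,
      map_zero]
  have hle := two_pow_le_natDegree_minpoly_sum (Ω := Ω₀) hsq (by
    intro T hT
    have := hlam (T.image e) (hT.image e)
    rwa [Finset.prod_image fun x _ y _ h => heinj h] at this)
  rw [hcard] at hle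
  rw [hdeg]
  exact hle.trans (Polynomial.natDegree_le_of_dvd (minpoly.dvd _ _ hroot)
    ((minpoly.monic hint).map _).ne_zero)

end Specialization

end ArithChern

namespace ArithChern

/-! ## The matrix whose square roots parametrize the correspondence -/

section FormPower

variable {ι T : Type*} [Fintype ι] [DecidableEq ι] [CommRing T]

/-- The matrix `h adj(H) (Xᵗ Q X)^{(p)}`, where `H = X^{(p)t} Q X^{(p)}` and `h = det H`. -/
def formPower (Q : Matrix ι ι T) (p : ℕ) (X : Matrix ι ι T) : Matrix ι ι T :=
  ((X.map (· ^ p))ᵀ * Q * X.map (· ^ p)).det •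
    (((X.map (· ^ p))ᵀ * Q * X.map (· ^ p)).adjugate * (Xᵀ * Q * X).map (· ^ p))

theorem formPower_map {T' : Type*} [CommRing T'] (f : T →+* T') (Q : Matrix ι ι T) (p : ℕ)
    (X : Matrix ι ι T) : (formPower Q p X).map f = formPower (Q.map f) p (X.map f) := by
  have h1 : (X.map f).map (· ^ p) = (X.map (· ^ p)).map f := by ext; simp
  have hT : ∀ A : Matrix ι ι T, (A.map f)ᵀ = Aᵀ.map f := fun _ => rfl
  have h2 : ((X.map f)ᵀ * Q.map f * X.map f).map (· ^ p) = ((Xᵀ * Q * X).map (· ^ p)).map f := by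
    rw [hT, ← Matrix.map_mul, ← Matrix.map_mul]
    ext
    simp only [Matrix.map_apply, map_pow]
  rw [formPower, formPower, h2, h1, hT, ← Matrix.map_mul, ← Matrix.map_mul]
  set H := (X.map (· ^ p))ᵀ * Q * X.map (· ^ p)
  have h3 : (H.map f).adjugate = H.adjugate.map f := (RingHom.map_adjugate f H).symm
  have h4 : (H.map f).det = f H.det := (RingHom.map_det f H).symm
  rw [h3, h4, ← Matrix.map_mul]
  ext i j
  simp only [Matrix.map_apply, Matrix.smul_apply, smul_eq_mul, map_mul]

theorem formPower_reindex {ι' : Type*} [Fintype ι'] [DecidableEq ι'] (e : ι ≃ ι')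
    (Q : Matrix ι ι T) (p : ℕ) (X : Matrix ι ι T) :
    formPower (Matrix.reindex e e Q) p (Matrix.reindex e e X) =
      Matrix.reindex e e (formPower Q p X) := by
  simp only [formPower, Matrix.reindex_apply, Matrix.transpose_submatrix,
    ← Matrix.submatrix_map, Matrix.submatrix_mul_equiv, Matrix.det_submatrix_equiv_self,
    Matrix.adjugate_submatrix_equiv_self, Matrix.submatrix_smul]
  rfl

/-- Scaling `Y` by `h = det H` clears denominators: `h² H⁻¹F` has polynomial entries and can be
specialized. -/
theorem smul_mul_self_eq_formPower {Q X Y : Matrix ι ι T} {p : ℕ}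
    (h : (X.map (· ^ p))ᵀ * Q * X.map (· ^ p) * (Y * Y) = (Xᵀ * Q * X).map (· ^ p)) :
    (((X.map (· ^ p))ᵀ * Q * X.map (· ^ p)).det • Y) *
      (((X.map (· ^ p))ᵀ * Q * X.map (· ^ p)).det • Y) = formPower Q p X := by
  rw [formPower, ← h]
  set H := (X.map (· ^ p))ᵀ * Q * X.map (· ^ p)
  rw [← Matrix.mul_assoc, Matrix.adjugate_mul, Matrix.smul_mul, Matrix.mul_smul, Matrix.smul_mul,
    Matrix.one_mul]

end FormPower

/-! ### Block matrices and the specialized characteristic polynomial -/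

section Blocks

variable {ι k : Type*} [Fintype ι] [DecidableEq ι] [Field k]

/-- The matrix with diagonal blocks `a, b, b, a`. -/
def symBlock (a b : ι → k) : Matrix (ι ⊕ ι) (ι ⊕ ι) k :=
  Matrix.fromBlocks (Matrix.diagonal a) (Matrix.diagonal b) (Matrix.diagonal b) (Matrix.diagonal a)

theorem symBlock_mul (a b c d : ι → k) :
    symBlock a b * symBlock c d = symBlock (a * c + b * d) (a * d + b * c) := by
  rw [symBlock, symBlock, Matrix.fromBlocks_multiply, symBlock]
  simp only [Matrix.diagonal_mul_diagonal, Matrix.diagonal_add]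
  congr 1 <;> congr 1 <;> ext i <;> simp [add_comm]

theorem symBlock_transpose (a b : ι → k) : (symBlock a b)ᵀ = symBlock a b := by
  simp [symBlock, Matrix.fromBlocks_transpose]

theorem symBlock_map_pow (a b : ι → k) {p : ℕ} (hp : p ≠ 0) :
    (symBlock a b).map (· ^ p) = symBlock (a ^ p) (b ^ p) := by
  simp only [symBlock, Matrix.fromBlocks_map]
  congr 1 <;> (rw [Matrix.diagonal_map (by simp [hp])]; rfl)

theorem symBlock_one_zero : symBlock (1 : ι → k) 0 = 1 := by
  simp [symBlock]

theorem smul_symBlock (t : k) (a b : ι → k) : t • symBlock a b = symBlock (t • a) (t • b) := by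
  simp [symBlock, Matrix.fromBlocks_smul, ← Matrix.diagonal_smul]

/-- The matrix with blocks `1, 1, 1, -1` diagonalizes; up to the factor `2` it is its own inverse.
-/
theorem symBlock_charpoly (h2 : (2 : k) ≠ 0) (a b : ι → k) :
    (symBlock a b).charpoly =
      ∏ j : ι ⊕ ι, (Polynomial.X - Polynomial.C (Sum.elim (a + b) (a - b) j)) := by
  let U : Matrix (ι ⊕ ι) (ι ⊕ ι) k := Matrix.fromBlocks 1 1 1 (-1)
  have hUU : U * U = (2 : k) • (1 : Matrix (ι ⊕ ι) (ι ⊕ ι) k) := by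
    rw [← Matrix.fromBlocks_one, Matrix.fromBlocks_smul]
    simp only [U, Matrix.fromBlocks_multiply]
    simp [two_smul]
  have hU : symBlock a b * U = U * Matrix.diagonal (Sum.elim (a + b) (a - b)) := by
    rw [← Matrix.fromBlocks_diagonal]
    simp only [U, symBlock, Matrix.fromBlocks_multiply]
    simp [Matrix.diagonal_add, Matrix.diagonal_sub, sub_eq_add_neg, add_comm]
  have h3 : symBlock a b = (2⁻¹ : k) • (U * (Matrix.diagonal (Sum.elim (a + b) (a - b)) * U)) := by
    rw [← Matrix.mul_assoc, ← hU, Matrix.mul_assoc, hUU, Matrix.mul_smul, Matrix.mul_one, smul_smul,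
      inv_mul_cancel₀ h2, one_smul]
  rw [h3, ← Matrix.smul_mul, Matrix.charpoly_mul_comm, Matrix.mul_assoc, Matrix.mul_smul, hUU,
    smul_smul, inv_mul_cancel₀ h2, one_smul, Matrix.mul_one, Matrix.charpoly_diagonal]

theorem det_symBlock_smul_adjugate {a b : ι → k} (h1 : ∀ i, a i + b i ≠ 0)
    (h2 : ∀ i, a i - b i ≠ 0) : (symBlock a b).det ≠ 0 ∧ (symBlock a b).adjugate =
      (symBlock a b).det • symBlock (a / ((a + b) * (a - b))) (-b / ((a + b) * (a - b))) := by
  have h3 : symBlock a b * symBlock (a / ((a + b) * (a - b))) (-b / ((a + b) * (a - b))) = 1 := by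
    rw [symBlock_mul, ← symBlock_one_zero]
    congr 1
    · ext i
      have := h1 i
      have := h2 i
      simp only [Pi.add_apply, Pi.mul_apply, Pi.div_apply, Pi.sub_apply, Pi.neg_apply, Pi.one_apply]
      field_simp
      ring
    · ext i
      have := h1 i
      have := h2 i
      simp only [Pi.add_apply, Pi.mul_apply, Pi.div_apply, Pi.sub_apply, Pi.neg_apply, Pi.zero_apply]
      ring
  refine ⟨(Matrix.isUnit_det_of_right_inverse h3).ne_zero, ?_⟩
  rw [← Matrix.mul_one (symBlock a b).adjugate, ← h3, ← Matrix.mul_assoc, Matrix.adjugate_mul,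
    Matrix.smul_mul, Matrix.one_mul]

/-- The specialization of the characteristic polynomial at `[[m, 1], [1, m]]`. -/
theorem formPower_symBlock_charpoly (h2 : (2 : k) ≠ 0) {p : ℕ} (hp : p ≠ 0) (m : ι → k)
    (h1 : ∀ i, m i ^ p + 1 ≠ 0) (h3 : ∀ i, m i ^ p - 1 ≠ 0) :
    ∃ h ≠ 0, (formPower (symBlock 0 1) p (symBlock m 1)).charpoly =
      ∏ j : ι ⊕ ι, (Polynomial.X - Polynomial.C (Sum.elim
        (fun i => ((m i ^ 2 + 1) ^ p + (2 * m i) ^ p) * (h / (m i ^ p + 1)) ^ 2)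
        (fun i => ((m i ^ 2 + 1) ^ p - (2 * m i) ^ p) * (h / (m i ^ p - 1)) ^ 2) j)) := by
  have e1 : ∀ a : ι → k, symBlock a 1 * symBlock 0 1 * symBlock a 1 =
      symBlock (2 * a) (a ^ 2 + 1) := by
    intro a
    rw [symBlock_mul, symBlock_mul]
    congr 1 <;> ring
  rw [formPower, symBlock_transpose, symBlock_map_pow _ _ hp, symBlock_transpose, one_pow, e1, e1,
    symBlock_map_pow _ _ hp]
  obtain ⟨hd, hadj⟩ := det_symBlock_smul_adjugate (a := 2 * m ^ p) (b := (m ^ p) ^ 2 + 1)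
    (fun i => by
      have : (2 * m ^ p : ι → k) i + ((m ^ p) ^ 2 + 1 : ι → k) i = (m i ^ p + 1) ^ 2 := by
        simp; ring
      rw [this]
      exact pow_ne_zero _ (h1 i))
    (fun i => by
      have : (2 * m ^ p : ι → k) i - ((m ^ p) ^ 2 + 1 : ι → k) i = -(m i ^ p - 1) ^ 2 := by
        simp; ring
      rw [this]
      exact neg_ne_zero.mpr (pow_ne_zero _ (h3 i)))
  refine ⟨_, hd, ?_⟩
  rw [hadj, Matrix.smul_mul, smul_smul, symBlock_mul, smul_symBlock, symBlock_charpoly h2]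
  refine Finset.prod_congr rfl fun j _ => ?_
  congr 2
  generalize (symBlock (2 * m ^ p) ((m ^ p) ^ 2 + 1)).det = h
  have key : ∀ i, ((2 * m ^ p : ι → k) i + ((m ^ p) ^ 2 + 1 : ι → k) i) *
    ((2 * m ^ p : ι → k) i - ((m ^ p) ^ 2 + 1 : ι → k) i) =
      -((m i ^ p + 1) ^ 2 * (m i ^ p - 1) ^ 2) := by intro i; simp; ring
  rcases j with i | i
  · have a1 := h1 i
    have a2 := h3 i
    simp only [Sum.elim_inl, Pi.add_apply, Pi.smul_apply, Pi.mul_apply, Pi.div_apply, Pi.sub_apply,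
      Pi.neg_apply, Pi.pow_apply, Pi.one_apply, Pi.ofNat_apply, smul_eq_mul] at key ⊢
    rw [key]
    field_simp
    ring
  · have a1 := h1 i
    have a2 := h3 i
    simp only [Sum.elim_inr, Pi.add_apply, Pi.smul_apply, Pi.mul_apply, Pi.div_apply, Pi.sub_apply,
      Pi.neg_apply, Pi.pow_apply, Pi.one_apply, Pi.ofNat_apply, smul_eq_mul] at key ⊢
    rw [key]
    field_simp
    ring

end Blocks

/-! ## Square classes of the eigenvalues -/

section Eigenvalues

/-- The numerators of the eigenvalues after specialization. -/
noncomputable def eigenNum {ι T : Type*} [CommRing T] (p : ℕ) (m : ι → T) : ι ⊕ ι → T :=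
  Sum.elim (fun i => (m i ^ 2 + 1) ^ p + (2 * m i) ^ p) (fun i => (m i ^ 2 + 1) ^ p - (2 * m i) ^ p)

theorem map_eigenNum {ι T T' : Type*} [CommRing T] [CommRing T'] (f : T →+* T') (p : ℕ) (m : ι → T)
    (j : ι ⊕ ι) : f (eigenNum p m j) = eigenNum p (fun i => f (m i)) j := by
  rcases j with i | i <;> simp [eigenNum, map_ofNat f 2]

/-- A simple zero of `(t² + 1)^p + (2 ε t)^p` with `ε = ±1` that is not a zero of
`(t² + 1)^p - (2 ε t)^p`. -/
theorem exists_simple_zero {Ω : Type*} [Field Ω] [IsAlgClosed Ω] [CharZero Ω] {p : ℕ} (hp : p.Prime)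
    (hodd : Odd p) {ζ : Ω} (hζ : IsPrimitiveRoot ζ p) {ε : Ω} (hε : ε ^ 2 = 1) :
    ∃ t : Ω, (t ^ 2 + 1) ^ p + (2 * ε * t) ^ p = 0 ∧ (t ^ 2 + 1) ^ p - (2 * ε * t) ^ p ≠ 0 ∧
      p * (t ^ 2 + 1) ^ (p - 1) * (2 * t) + p * (2 * ε * t) ^ (p - 1) * (2 * ε) ≠ 0 := by
  -- The zero is sought on `t² + 1 = -2εζt`, that is `(t + εζ)² = ζ² - 1`.
  obtain ⟨s, hs⟩ := IsAlgClosed.exists_pow_nat_eq (ζ ^ 2 - 1) two_pos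
  have hε0 : ε ≠ 0 := by rintro rfl; simp at hε
  have ht : ∀ t, t = -(ε * ζ) + s → t ^ 2 + 1 = -(ζ * (2 * ε * t)) := by
    rintro t rfl
    linear_combination hs - ζ ^ 2 * hε
  set t := -(ε * ζ) + s
  have htt := ht t rfl
  have hζp := hζ.pow_eq_one
  have ht0 : t ≠ 0 := by
    intro h
    rw [h] at htt
    simp at htt
  have hw : 2 * ε * t ≠ 0 := mul_ne_zero (mul_ne_zero two_ne_zero hε0) ht0
  set w := 2 * ε * t with hwdef
  have hup : (t ^ 2 + 1) ^ p = -w ^ p := by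
    rw [htt, hodd.neg_pow, mul_pow, hζp, one_mul]
  refine ⟨t, by rw [hup]; ring, ?_, ?_⟩
  · rw [hup]
    have : -w ^ p - w ^ p = -(2 * w ^ p) := by ring
    rw [this]
    exact neg_ne_zero.mpr (mul_ne_zero two_ne_zero (pow_ne_zero _ hw))
  · have heven : Even (p - 1) := by
      obtain ⟨k, hk⟩ := hodd
      exact ⟨k, by omega⟩
    have hζ1 : ζ ^ (p - 1) * ζ = 1 := by
      rw [← pow_succ, Nat.sub_add_cancel hp.one_le, hζp]
    rw [htt, heven.neg_pow, mul_pow]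
    intro h
    have h1 : (p * w ^ (p - 1) * 2) * (ζ ^ (p - 1) * t + ε) = 0 := by linear_combination h
    have h2 := (mul_eq_zero.mp h1).resolve_left
      (mul_ne_zero (mul_ne_zero (Nat.cast_ne_zero.mpr hp.ne_zero) (pow_ne_zero _ hw)) two_ne_zero)
    have h3 : t = -(ε * ζ) := by linear_combination ζ * h2 - t * hζ1
    -- A vanishing derivative forces `t = -εζ`, hence `ζ² = 1`, impossible for a primitive root of
    -- odd prime order.
    have h4 : ζ ^ 2 = 1 := by
      rw [hwdef, h3] at htt
      linear_combination -htt - ζ ^ 2 * hε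
    have h5 := (hζ.dvd_of_pow_eq_one 2 h4)
    have := hodd
    rw [(Nat.prime_dvd_prime_iff_eq hp Nat.prime_two).mp h5] at this
    exact absurd this (by decide)

theorem splitMatrix_map {S T : Type*} [CommRing S] [CommRing T] (f : S →+* T) (r : ℕ) :
    (splitMatrix r (1 : S)).map f = splitMatrix r (1 : T) := by
  simp only [splitMatrix, Matrix.reindex_apply, ← Matrix.submatrix_map, Matrix.fromBlocks_map]
  congr 1
  congr 1
  · ext; simp
  · ext i j; by_cases h : i = j <;> simp [h, Matrix.one_apply]
  · ext i j; by_cases h : i = j <;> simp [h, Matrix.one_apply]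
  · ext; simp

variable {ι : Type*} [Fintype ι] [DecidableEq ι] {K : Type u} [Field K] [CharZero K]

/-- Pick a factor in the product and set every variable but its own to `0`. All other factors become
`1` except its partner, and the chosen factor has a simple zero that the partner avoids. -/
theorem not_isSquare_prod_eigenNum {p : ℕ} (hp : p.Prime) (hodd : Odd p) {T : Finset (ι ⊕ ι)}
    (hT : T.Nonempty) :
    ¬ IsSquare (∏ j ∈ T, algebraMap (MvPolynomial ι K) (FractionRing (MvPolynomial ι K))
      (eigenNum p MvPolynomial.X j)) := by
  classical
  obtain ⟨j₀, hj₀⟩ := hT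
  let Ω := AlgebraicClosure K
  have : CharZero Ω := charZero_of_injective_algebraMap (algebraMap K Ω).injective
  obtain ⟨ζ, hζ⟩ := exists_primitiveRoot K hp.ne_zero
  let ev (i₀ : ι) : MvPolynomial ι K →+* Polynomial Ω :=
    MvPolynomial.eval₂Hom (Polynomial.C.comp (algebraMap K Ω))
      (fun i => if i = i₀ then Polynomial.X else 0)
  have hev : ∀ i₀ j, ev i₀ (eigenNum p MvPolynomial.X j) =
      eigenNum p (fun i => if i = i₀ then Polynomial.X else 0) j := by
    intro i₀ j
    rw [map_eigenNum]
    simp [ev]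
  have key : ∀ (i₀ : ι) (j₀ j₁ : ι ⊕ ι) (ε : Ω), ε ^ 2 = 1 → j₀ ∈ T →
      (∀ j, j ≠ j₀ → j ≠ j₁ →
        eigenNum p (fun i => if i = i₀ then Polynomial.X else 0) j = (1 : Polynomial Ω)) →
      (eigenNum p (fun i => if i = i₀ then Polynomial.X else 0) j₀ =
        ((Polynomial.X ^ 2 + 1) ^ p + (Polynomial.C (2 * ε) * Polynomial.X) ^ p : Polynomial Ω)) →
      (eigenNum p (fun i => if i = i₀ then Polynomial.X else 0) j₁ =
        ((Polynomial.X ^ 2 + 1) ^ p - (Polynomial.C (2 * ε) * Polynomial.X) ^ p : Polynomial Ω)) →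
      ¬ IsSquare (∏ j ∈ T, algebraMap (MvPolynomial ι K) (FractionRing (MvPolynomial ι K))
        (eigenNum p MvPolynomial.X j)) := by
    intro i₀ j₀ j₁ ε hε hj₀ h1 h2 h3
    obtain ⟨t, ht1, ht2, ht3⟩ := exists_simple_zero hp hodd hζ hε
    have hz : (ev i₀ (eigenNum p MvPolynomial.X j₀)).eval t = 0 := by
      rw [hev, h2]; simpa using ht1
    rw [← map_prod, ← Finset.mul_prod_erase T _ hj₀]
    refine not_isSquare_of_simple_root (ev i₀) (ω := t) ?_ ?_
    · rw [map_mul, Polynomial.eval_mul, hz, zero_mul]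
    · rw [map_mul, Polynomial.derivative_mul, Polynomial.eval_add, Polynomial.eval_mul,
        Polynomial.eval_mul, hz, zero_mul, add_zero]
      refine mul_ne_zero ?_ ?_
      · rw [hev, h2]
        simp only [Polynomial.derivative_add, Polynomial.derivative_pow, Polynomial.derivative_X,
          Polynomial.derivative_one, Polynomial.derivative_mul, Polynomial.derivative_C]
        simpa using ht3
      · rw [map_prod, Polynomial.eval_prod, Finset.prod_ne_zero_iff]
        intro j hj
        rw [hev]
        by_cases hj1 : j = j₁
        · subst hj1; rw [h3]; simpa using ht2
        · rw [h1 j (Finset.ne_of_mem_erase hj) hj1]; simp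
  have hC2 : (Polynomial.C (2 : Ω)) = 2 := map_ofNat _ 2
  rcases j₀ with i₀ | i₀
  · refine key i₀ (Sum.inl i₀) (Sum.inr i₀) 1 (by norm_num) hj₀ ?_ ?_ ?_
    · rintro (i | i) h1 h2
      · have : i ≠ i₀ := fun h => h1 (h ▸ rfl)
        simp [eigenNum, this, hp.ne_zero]
      · have : i ≠ i₀ := fun h => h2 (h ▸ rfl)
        simp [eigenNum, this, hp.ne_zero]
    · simp [eigenNum, hC2]
    · simp [eigenNum, hC2]
  · refine key i₀ (Sum.inr i₀) (Sum.inl i₀) (-1) (by norm_num) hj₀ ?_ ?_ ?_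
    · rintro (i | i) h1 h2
      · have : i ≠ i₀ := fun h => h2 (h ▸ rfl)
        simp [eigenNum, this, hp.ne_zero]
      · have : i ≠ i₀ := fun h => h1 (h ▸ rfl)
        simp [eigenNum, this, hp.ne_zero]
    · simp [eigenNum, hodd.neg_pow, sub_eq_add_neg, hC2]
    · simp [eigenNum, hodd.neg_pow, sub_eq_add_neg, hC2]

variable (K) in
-- The matrix `x` is specialized to blocks `m, 1, 1, m` with `m` diagonal and generic. The
-- eigenvalues are then the elements `eigenNum` up to nonzero squares.
theorem exists_specialization {r p : ℕ} (hp : p.Prime) (hodd : Odd p) :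
    ∃ (sp : MvPolynomial (Fin (2 * r) × Fin (2 * r)) K →+*
        FractionRing (MvPolynomial (Fin r) K))
      (lam : Fin r ⊕ Fin r → FractionRing (MvPolynomial (Fin r) K)),
      (formPower (splitMatrix r 1) p (Matrix.mvPolynomialX (Fin (2 * r)) (Fin (2 * r)) K)).charpoly.map
        sp = ∏ j, (Polynomial.X - Polynomial.C (lam j)) ∧
      ∀ T : Finset (Fin r ⊕ Fin r), T.Nonempty → ¬ IsSquare (∏ j ∈ T, lam j) := by
  let k := FractionRing (MvPolynomial (Fin r) K)
  let e : Fin r ⊕ Fin r ≃ Fin (2 * r) := finSumFinEquiv.trans (finCongr (two_mul r).symm)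
  let m : Fin r → k := fun i => algebraMap (MvPolynomial (Fin r) K) k (MvPolynomial.X i)
  have hinj := IsFractionRing.injective (MvPolynomial (Fin r) K) k
  have : CharZero k := charZero_of_injective_algebraMap hinj
  have hm1 : ∀ i, m i ^ p + 1 ≠ 0 := by
    intro i h
    have h1 : algebraMap (MvPolynomial (Fin r) K) k (MvPolynomial.X i ^ p + 1) = 0 := by simpa using h
    have h2 := congrArg (MvPolynomial.eval (0 : Fin r → K)) (hinj (h1.trans (map_zero _).symm))
    simp [hp.ne_zero] at h2
  have hm2 : ∀ i, m i ^ p - 1 ≠ 0 := by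
    intro i h
    have h1 : algebraMap (MvPolynomial (Fin r) K) k (MvPolynomial.X i ^ p - 1) = 0 := by simpa using h
    have h2 := congrArg (MvPolynomial.eval (0 : Fin r → K)) (hinj (h1.trans (map_zero _).symm))
    simp [hp.ne_zero] at h2
  obtain ⟨h, hh, hchar⟩ := formPower_symBlock_charpoly (two_ne_zero (α := k)) hp.ne_zero m hm1 hm2
  let x₀ : Matrix (Fin (2 * r)) (Fin (2 * r)) k := Matrix.reindex e e (symBlock m 1)
  let sp : MvPolynomial (Fin (2 * r) × Fin (2 * r)) K →+* k :=
    MvPolynomial.eval₂Hom (algebraMap K k) fun ij => x₀ ij.1 ij.2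
  let d : Fin r ⊕ Fin r → k := Sum.elim (fun i => h / (m i ^ p + 1)) (fun i => h / (m i ^ p - 1))
  have hd : ∀ j, d j ≠ 0 := by
    rintro (i | i)
    · exact div_ne_zero hh (hm1 i)
    · exact div_ne_zero hh (hm2 i)
  refine ⟨sp, fun j => algebraMap (MvPolynomial (Fin r) K) k (eigenNum p MvPolynomial.X j) * d j ^ 2, ?_, ?_⟩
  · rw [← Matrix.charpoly_map, formPower_map]
    have h1 : (Matrix.mvPolynomialX (Fin (2 * r)) (Fin (2 * r)) K).map sp = x₀ := by
      ext i j
      simp [sp]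
    have h2 : (splitMatrix r (1 : MvPolynomial (Fin (2 * r) × Fin (2 * r)) K)).map sp =
        Matrix.reindex e e (symBlock (0 : Fin r → k) 1) := by
      rw [splitMatrix_map, splitMatrix, symBlock, one_smul]
      simp only [Matrix.diagonal_zero', Matrix.diagonal_one']
      rfl
    rw [h1, h2, formPower_reindex, Matrix.charpoly_reindex, hchar]
    refine Finset.prod_congr rfl fun j _ => ?_
    simp only [map_eigenNum]
    rcases j with i | i <;> rfl
  · intro T hT hsq
    rw [Finset.prod_mul_distrib, Finset.prod_pow] at hsq
    exact not_isSquare_prod_eigenNum hp hodd hT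
      (isSquare_of_isSquare_mul_sq (Finset.prod_ne_zero_iff.mpr fun j _ => hd j) hsq)

end Eigenvalues

end ArithChern

namespace ArithChern

/-! ## The split symmetric form -/

section SplitSymmetric

variable {M : ℤ} {N : ℕ} [NeZero N] {K : Type u} [Field K] [CharZero K]
  [IsCyclotomicExtension {N} ℚ K] {r : ℕ}
  {q : Matrix.GeneralLinearGroup (Fin (2 * r)) (cycRing M N K)} {p : ℕ}

variable (K r) in
/-- The determinant of `x^{(p)t} q x^{(p)}`. -/
noncomputable def splitDet (p : ℕ) : FieldE (2 * r) K :=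
  (Hform (splitMatrix r 1) (entryPow p (matE (2 * r) K))).det

variable (hM : Even M) (hM0 : M ≠ 0) (hq : q.val = splitMatrix r 1) (hp : IsGoodPrime M N p)

include hM hM0 hq

theorem split_rel : Hform (splitMatrix r 1) (entryPow p ((matE (2 * r) K).map (chernL q p))) *
    (chernY q p * chernY q p) =
      entryPow p (Hform (splitMatrix r 1) ((matE (2 * r) K).map (chernL q p))) := by
  have := (chernRel q p hM hM0).rel
  rwa [hq, splitMatrix_map, splitMatrix_map] at this

theorem split_smul_mul_self {T : Type*} [CommRing T] (f : ChernRing q p →+* T) :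
    (f (chernL q p (splitDet K r p)) • (chernY q p).map f) *
      (f (chernL q p (splitDet K r p)) • (chernY q p).map f) =
    (formPower (splitMatrix r 1) p (Matrix.mvPolynomialX (Fin (2 * r)) (Fin (2 * r)) K)).map
      ((f.comp (chernL q p)).comp (algebraMap _ (FieldE (2 * r) K))) := by
  have h1 := congrArg (fun Z => Matrix.map Z f) (split_rel hM hM0 hq (p := p))
  rw [formPower_map, splitMatrix_map]
  have h2 : (Matrix.mvPolynomialX (Fin (2 * r)) (Fin (2 * r)) K).map
      ((f.comp (chernL q p)).comp (algebraMap _ (FieldE (2 * r) K))) =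
      ((matE (2 * r) K).map (chernL q p)).map f := by
    rw [matE, Matrix.map_map, Matrix.map_map]; rfl
  rw [h2]
  have h3 : f (chernL q p (splitDet K r p)) = (Hform (splitMatrix r 1)
      (entryPow p (((matE (2 * r) K).map (chernL q p)).map f))).det := by
    rw [splitDet, ← det_map', ← det_map', Hform_map', Hform_map', splitMatrix_map,
      splitMatrix_map, entryPow_map', entryPow_map']
  rw [h3]
  refine smul_mul_self_eq_formPower ?_
  rw [← Matrix.map_mul]
  rw [Matrix.map_mul, Hform_map', entryPow_map', entryPow_map', Hform_map', splitMatrix_map] at h1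
  exact h1

theorem split_two_pow_le {Ω : Type*} [Field Ω] [IsAlgClosed Ω] [Algebra (FieldE (2 * r) K) Ω]
    (hp : IsGoodPrime M N p)
    (f : ChernRing q p →+* Ω) (hf : f.comp (chernL q p) = algebraMap (FieldE (2 * r) K) Ω) :
    2 ^ (2 * r) ≤ (minpoly (FieldE (2 * r) K)
      (f (chernL q p (splitDet K r p) * (chernY q p).trace))).natDegree := by
  obtain ⟨sp, lam, h1, h2⟩ := exists_specialization K (r := r) hp.prime hp.odd
  let : Algebra (MvPolynomial (Fin (2 * r) × Fin (2 * r)) K) Ω :=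
    ((algebraMap (FieldE (2 * r) K) Ω).comp (algebraMap _ (FieldE (2 * r) K))).toAlgebra
  have : IsScalarTower (MvPolynomial (Fin (2 * r) × Fin (2 * r)) K) (FieldE (2 * r) K) Ω :=
    IsScalarTower.of_algebraMap_eq' rfl
  have : CharZero (FractionRing (MvPolynomial (Fin r) K)) :=
    charZero_of_injective_algebraMap (IsFractionRing.injective (MvPolynomial (Fin r) K) _)
  have h3 := (matrix_root_specialization (E := FieldE (2 * r) K) (Ω := Ω) _ sp h1 h2).1 _
    ((split_smul_mul_self hM hM0 hq f).trans (by rw [hf]; rfl))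
  rw [Matrix.trace_smul, smul_eq_mul] at h3
  have h4 : ((chernY q p).map f).trace = f (chernY q p).trace := by
    rw [Matrix.trace, Matrix.trace, map_sum]; rfl
  rw [h4, ← map_mul] at h3
  simpa [two_mul] using h3

include hp

theorem splitDet_ne_zero : splitDet K r p ≠ 0 := by
  have hnt := chernRing_nontrivial q hM hM0 hp.prime hp.not_dvd hp.coprime
  have h1 : IsUnit (splitMatrix r (1 : FieldE (2 * r) K)).det := by
    rw [← splitMatrix_map ((algebraMap K (FieldE (2 * r) K)).comp (cycRing M N K).val.toRingHom), ← hq,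
      det_map']
    exact ((Matrix.isUnit_iff_isUnit_det _).mp q.isUnit).map _
  have h2 : (entryPow p (matE (2 * r) K)).det ≠ 0 := by
    intro h
    have h3 := (chernRel q p hM hM0).det_Xp
    rw [← entryPow_map', det_map', h, map_zero] at h3
    exact not_isUnit_zero h3
  rw [splitDet, Hform, Matrix.det_mul, Matrix.det_mul, Matrix.det_transpose]
  exact mul_ne_zero (mul_ne_zero h2 h1.ne_zero) h2

theorem split_card_le {α Ω : Type v} [Field Ω] [IsAlgClosed Ω]
    [Algebra (FieldE (2 * r) K) Ω] (f : α → ChernRing q p →+* Ω) (hinj : Function.Injective f)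
    (hf : ∀ x, (f x).comp (chernL q p) = algebraMap (FieldE (2 * r) K) Ω) :
    Nat.card α ≤ 2 ^ (2 * r) := by
  obtain ⟨sp, lam, h1, h2⟩ := exists_specialization K (r := r) hp.prime hp.odd
  let : Algebra (MvPolynomial (Fin (2 * r) × Fin (2 * r)) K) Ω :=
    ((algebraMap (FieldE (2 * r) K) Ω).comp (algebraMap _ (FieldE (2 * r) K))).toAlgebra
  have : IsScalarTower (MvPolynomial (Fin (2 * r) × Fin (2 * r)) K) (FieldE (2 * r) K) Ω :=
    IsScalarTower.of_algebraMap_eq' rfl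
  have : CharZero (FractionRing (MvPolynomial (Fin r) K)) :=
    charZero_of_injective_algebraMap (IsFractionRing.injective (MvPolynomial (Fin r) K) _)
  have h3 := (matrix_root_specialization (E := FieldE (2 * r) K) (Ω := Ω) _ sp h1 h2).2 α
    (fun x => f x (chernL q p (splitDet K r p)) • (chernY q p).map (f x)) ?_
    (fun x => (split_smul_mul_self hM hM0 hq (f x)).trans (by rw [hf]; rfl))
  · simpa [two_mul] using h3
  · intro x y h
    have hx : ∀ x, f x (chernL q p (splitDet K r p)) = algebraMap _ Ω (splitDet K r p) :=
      fun x => RingHom.congr_fun (hf x) _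
    simp only [hx] at h
    exact hinj (chernRing_ext q p ((hf x).trans (hf y).symm)
      (smul_right_injective _ ((map_ne_zero _).mpr (splitDet_ne_zero hM hM0 hq hp)) h))

/-- The trace of the square root forces every residue field to have degree at least `2^(2r)`, and a
geometric point is determined by its square root. -/
theorem split_isField_and_degree :
    IsField (ChernRing q p) ∧ (chernCorrespondence M N q p).leftDegree = 2 ^ (2 * r) := by
  have hfin := chernL_finite q p hM hM0
  have hred := chernRing_isReduced q p hM hM0
  have hnt := chernRing_nontrivial q hM hM0 hp.prime hp.not_dvd hp.coprime
  let := (chernL q p).toAlgebra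
  have hfin' : Module.Finite (FieldE (2 * r) K) (ChernRing q p) := hfin
  refine isField_of_card_algHom_le (k := FieldE (2 * r) K) (F := ChernRing q p)
    (Ω := AlgebraicClosure (FieldE (2 * r) K)) (by positivity) ?_ ?_
  · intro m
    let := Ideal.Quotient.field m.asIdeal
    let ρ : (ChernRing q p ⧸ m.asIdeal) →ₐ[FieldE (2 * r) K] AlgebraicClosure (FieldE (2 * r) K) :=
      IsAlgClosed.lift
    have h1 := split_two_pow_le (Ω := AlgebraicClosure (FieldE (2 * r) K)) hM hM0 hq hp
      (ρ.toRingHom.comp (Ideal.Quotient.mk m.asIdeal)) (RingHom.ext fun x => ρ.commutes x)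
    refine h1.trans ?_
    rw [RingHom.comp_apply, AlgHom.toRingHom_eq_coe, RingHom.coe_coe,
      minpoly.algHom_eq ρ ρ.injective]
    exact minpoly.natDegree_le _
  · exact split_card_le hM hM0 hq hp (Ω := AlgebraicClosure (FieldE (2 * r) K))
      (fun ρ : ChernRing q p →ₐ[FieldE (2 * r) K] AlgebraicClosure (FieldE (2 * r) K) =>
        (ρ : ChernRing q p →+* AlgebraicClosure (FieldE (2 * r) K))) AlgHom.coe_ringHom_injective
      fun ρ => RingHom.ext ρ.commutes

end SplitSymmetric

end ArithChern

namespace ArithChern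

variable {n : ℕ}

/-! ## The split symmetric form in dimension two -/

theorem splitMatrix_one_one {A : Type u} [CommRing A] :
    (splitMatrix 1 (1 : A) : Matrix (Fin 2) (Fin 2) A) = !![0, 1; 1, 0] := by
  rw [splitMatrix, one_smul]
  ext i j
  fin_cases i <;> fin_cases j <;> rfl

/-- By Cayley–Hamilton, `tr(Y) H Y = S + det(Y) H` is symmetric; the trace being a unit, `H Y = Yᵗ
H`. This gives the first Chern equation on `Γ_p` itself, where no `p`-adic uniqueness is available.
-/
theorem transpose_mul_mul_eq {R : Type*} [CommRing R] {H S Y : Matrix (Fin 2) (Fin 2) R} (hH : Hᵀ = H)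
    (hS : Sᵀ = S) (ht : IsUnit Y.trace) (h : H * (Y * Y) = S) : Yᵀ * H * Y = S := by
  have h1 : Y.trace • (H * Y) = S + Y.det • H := by
    rw [← h, mul_self_fin_two, Matrix.mul_sub, Matrix.mul_smul, Matrix.mul_smul, Matrix.mul_one]
    abel
  have h2 : Y.trace • (Yᵀ * H) = Y.trace • (H * Y) := by
    have h2 := congrArg Matrix.transpose h1
    rwa [Matrix.transpose_smul, Matrix.transpose_mul, Matrix.transpose_add, Matrix.transpose_smul, hS,
      hH, ← h1] at h2
  have h3 : Yᵀ * H = H * Y := by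
    ext i j
    exact ht.mul_left_cancel (congrFun₂ h2 i j)
  rw [h3, Matrix.mul_assoc, h]

theorem Hform_transpose {R : Type*} [CommRing R] {Q : Matrix (Fin n) (Fin n) R} (hQ : Qᵀ = Q)
    (X : Matrix (Fin n) (Fin n) R) : (Hform Q X)ᵀ = Hform Q X := by
  rw [Hform, Matrix.transpose_mul, Matrix.transpose_mul, Matrix.transpose_transpose, hQ,
    Matrix.mul_assoc]

section SymmetricTwo

variable {M : ℤ} {N : ℕ} [NeZero N] {K : Type u} [Field K] [CharZero K]
  [IsCyclotomicExtension {N} ℚ K]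
  {q : Matrix.GeneralLinearGroup (Fin 2) (cycRing M N K)} {p : ℕ}
  (hM : Even M) (hM0 : M ≠ 0) (hq : q.val = splitMatrix 1 1) (hp : IsGoodPrime M N p)

include hM hM0 hq hp

theorem symmetric_isField : IsField (ChernRing q p) :=
  (split_isField_and_degree (r := 1) hM hM0 hq hp).1

/-- A multiple of the trace by an element of `E` has degree at least four over `E`. -/
theorem symmetric_trace_sq_ne (c d : FieldE 2 K) :
    (chernY q p).trace ^ 2 ≠ chernL q p c * (chernY q p).trace + chernL q p d := by
  intro h
  let Ω := AlgebraicClosure (FieldE 2 K)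
  have hnt := chernRing_nontrivial q hM hM0 hp.prime hp.not_dvd hp.coprime
  obtain ⟨f, hf⟩ := exists_extension (chernL_finite q p hM hM0) (algebraMap (FieldE 2 K) Ω)
  have h1 : 2 ^ 2 ≤ (minpoly (FieldE 2 K)
      (f (chernL q p (splitDet K 1 p) * (chernY q p).trace))).natDegree :=
    split_two_pow_le (r := 1) hM hM0 hq hp f hf
  set e : FieldE 2 K := splitDet K 1 p
  set t := (chernY q p).trace
  have hfl : ∀ a, f (chernL q p a) = algebraMap _ Ω a := RingHom.congr_fun hf
  have h2 : Polynomial.aeval (f (chernL q p e * t)) (Polynomial.C 1 * Polynomial.X ^ 2 +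
      Polynomial.C (-(e * c)) * Polynomial.X + Polynomial.C (-(e ^ 2 * d))) = 0 := by
    have h3 := congrArg f h
    simp only [map_add, map_mul, map_pow, hfl] at h3
    simp only [map_add, map_mul, map_pow, Polynomial.aeval_C, Polynomial.aeval_X, hfl, map_one, map_neg]
    linear_combination (algebraMap _ Ω e) ^ 2 * h3
  have h4 := Polynomial.natDegree_quadratic (a := (1 : FieldE 2 K)) (b := -(e * c))
    (c := -(e ^ 2 * d)) one_ne_zero
  have h5 : (Polynomial.C 1 * Polynomial.X ^ 2 +
      Polynomial.C (-(e * c)) * Polynomial.X + Polynomial.C (-(e ^ 2 * d))) ≠ 0 := by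
    intro h0
    rw [h0] at h4
    simp at h4
  have h6 := Polynomial.natDegree_le_of_dvd (minpoly.dvd _ _ h2) h5
  omega

theorem symmetric_trace_ne_zero : (chernY q p).trace ≠ 0 := by
  intro h
  refine symmetric_trace_sq_ne hM hM0 hq hp 0 0 ?_
  simp [h]

/-- If `det (1 - Y) = 0` then `tr Y - 1 = det Y`, and `(det Y)²` lies in `π(E)`; this is a quadratic
relation for the trace. -/
theorem symmetric_isUnit_one_sub : IsUnit (1 - chernY q p).det := by
  let := (symmetric_isField hM hM0 hq hp).toField
  rw [isUnit_iff_ne_zero]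
  intro h
  have h1 : 1 - (chernY q p).trace + (chernY q p).det = 0 := by
    rw [← h, Matrix.trace_fin_two, Matrix.det_fin_two, Matrix.det_fin_two]
    simp
    ring
  have h2 := congrArg Matrix.det (split_rel (r := 1) hM hM0 hq (p := p))
  rw [Matrix.det_mul, Matrix.det_mul, ← entryPow_map', ← splitMatrix_map (chernL q p), ← Hform_map',
    ← Hform_map', ← entryPow_map', det_map', det_map'] at h2
  have h3 := splitDet_ne_zero (r := 1) hM hM0 hq hp
  rw [splitDet] at h3
  set a := (Hform (splitMatrix 1 1) (entryPow p (matE (2 * 1) K))).det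
  set b := (entryPow p (Hform (splitMatrix 1 1) (matE (2 * 1) K))).det
  have h4 : (chernY q p).det ^ 2 = chernL q p (b / a) := by
    have h5 : chernL q p a ≠ 0 := (map_ne_zero _).mpr h3
    rw [map_div₀, eq_div_iff h5, ← h2]
    ring
  refine symmetric_trace_sq_ne hM hM0 hq hp 2 (b / a - 1) ?_
  rw [map_sub, ← h4, map_one, map_ofNat]
  linear_combination (-(chernY q p).trace + 1 - (chernY q p).det) * h1

theorem symmetric_isPartiallyInduced :
    (chernCorrespondence M N q p).IsPartiallyInduced (iota 2 K) :=
  chern_isPartiallyInduced q hM hM0 hp.odd (symmetric_isUnit_one_sub hM hM0 hq hp)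

/-- Products of two coordinates are even. Were their images in `π(E)`, then `(tr Y)²` would be too,
as the entries of `Y` are linear in the `φ(x_{ij})` over `π(E)`. -/
theorem symmetric_not_isInduced : ¬ (chernCorrespondence M N q p).IsInduced (iota 2 K) := by
  rintro ⟨-, h⟩
  have hdet : IsUnit (entryPow p (matE 2 K)).det := by
    have hnt := chernRing_nontrivial q hM hM0 hp.prime hp.not_dvd hp.coprime
    rw [isUnit_iff_ne_zero]
    intro h0
    have h3 := (chernRel q p hM hM0).det_Xp
    rw [← entryPow_map', det_map', h0, map_zero] at h3
    exact not_isUnit_zero h3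
  have hι : ∀ i j, iota 2 K (matE 2 K i j) = -matE 2 K i j := congrFun₂ iota_matE
  have hZ : ∀ i j k l, chernR q p (matE 2 K i j) * chernR q p (matE 2 K k l) ∈ (chernL q p).range := by
    intro i j k l
    obtain ⟨w, -, hw⟩ := h (matE 2 K i j * matE 2 K k l) (by
      rw [map_mul, hι, hι]; ring)
    exact ⟨w, by rw [← map_mul]; exact hw.symm⟩
  have hY : chernY q p = ((entryPow p (matE 2 K))⁻¹).map (chernL q p) * (matE 2 K).map (chernR q p) := by
    rw [chernR_matE, ← entryPow_map', ← Matrix.mul_assoc, ← Matrix.map_mul,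
      Matrix.nonsing_inv_mul _ hdet, Matrix.map_one _ (map_zero _) (map_one _), Matrix.one_mul]
  have hmem : (chernY q p).trace ^ 2 ∈ (chernL q p).range := by
    rw [hY, Matrix.trace_fin_two, Matrix.mul_apply, Matrix.mul_apply, Fin.sum_univ_two,
      Fin.sum_univ_two]
    simp only [Matrix.map_apply]
    set V := (entryPow p (matE 2 K))⁻¹
    have hm : ∀ i j k l i' j' k' l', chernL q p (V i j) * chernR q p (matE 2 K k l) *
        (chernL q p (V i' j') * chernR q p (matE 2 K k' l')) ∈ (chernL q p).range := by
      intro i j k l i' j' k' l'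
      rw [mul_mul_mul_comm]
      exact mul_mem (mul_mem ⟨_, rfl⟩ ⟨_, rfl⟩) (hZ _ _ _ _)
    rw [pow_two]
    simp only [add_mul, mul_add]
    repeat' first | exact hm _ _ _ _ _ _ _ _ | refine add_mem ?_ ?_
  obtain ⟨d, hd⟩ := hmem
  refine symmetric_trace_sq_ne hM hM0 hq hp 0 d ?_
  rw [← hd]; simp

/-- The corner entry of `xᵗ q x` is `2 x₀₀ x₁₀`, and the first Chern equation sends it to its `p`-th
power. -/
theorem symmetric_chernR_mul : chernR q p (matE 2 K 0 0 * matE 2 K 1 0) =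
    chernL q p (2 ^ (p - 1) * (matE 2 K 0 0 * matE 2 K 1 0) ^ p) := by
  let := (symmetric_isField hM hM0 hq hp).toField
  have ht := isUnit_iff_ne_zero.mpr (symmetric_trace_ne_zero hM hM0 hq hp)
  have hrel : Hform !![0, 1; 1, 0] (entryPow p ((matE 2 K).map (chernL q p))) *
      (chernY q p * chernY q p) = entryPow p (Hform !![0, 1; 1, 0] ((matE 2 K).map (chernL q p))) := by
    rw [← splitMatrix_one_one]
    exact split_rel (r := 1) hM hM0 hq
  have hQ : (!![0, 1; 1, 0] : Matrix (Fin 2) (Fin 2) (ChernRing q p))ᵀ = !![0, 1; 1, 0] := by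
    ext i j
    fin_cases i <;> fin_cases j <;> rfl
  have hS : (entryPow p (Hform !![0, 1; 1, 0] ((matE 2 K).map (chernL q p))))ᵀ =
      entryPow p (Hform !![0, 1; 1, 0] ((matE 2 K).map (chernL q p))) := by
    conv_rhs => rw [← Hform_transpose hQ]
    rfl
  have h1 := transpose_mul_mul_eq (Hform_transpose hQ _) hS ht hrel
  have h2 : Hform !![0, 1; 1, 0] ((matE 2 K).map (chernR q p)) =
      entryPow p (Hform !![0, 1; 1, 0] ((matE 2 K).map (chernL q p))) := by
    rw [← h1, chernR_matE, Hform, Hform, Matrix.transpose_mul]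
    simp only [Matrix.mul_assoc]
  have h3 : ∀ Z : Matrix (Fin 2) (Fin 2) (ChernRing q p),
      Hform !![0, 1; 1, 0] Z 0 0 = 2 * (Z 0 0 * Z 1 0) := by
    intro Z
    simp [Hform, Matrix.mul_apply, Fin.sum_univ_two]
    ring
  have h4 := congrFun₂ h2 0 0
  rw [entryPow, Matrix.map_apply, h3, h3] at h4
  simp only [Matrix.map_apply, ← map_mul] at h4
  have h5 : (2 : ChernRing q p) ≠ 0 := by
    rw [← map_ofNat (chernL q p) 2]
    exact (map_ne_zero _).mpr two_ne_zero
  refine mul_left_cancel₀ h5 (h4.trans ?_)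
  generalize matE 2 K 0 0 * matE 2 K 1 0 = z
  rw [mul_pow, map_mul, map_pow, map_pow, map_ofNat, ← mul_assoc, ← pow_succ',
    Nat.sub_add_cancel hp.prime.one_le]

variable {p' : ℕ} (hp' : IsGoodPrime M N p')

omit hM hM0 hq hp in
include hp' in
theorem frobE_matE_mul : frobE 2 N K p' hp'.prime (matE 2 K 0 0 * matE 2 K 1 0) =
    (matE 2 K 0 0 * matE 2 K 1 0) ^ p' := by
  rw [map_mul, mul_pow]
  exact congrArg₂ (· * ·) (congrFun₂ (frobE_matE hp'.prime) 0 0) (congrFun₂ (frobE_matE hp'.prime) 1 0)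

omit hM hM0 hq in
include hp' in
-- The constant decides: Frobenius fixes `2^(p-1)`, while raising to the power `p'` does not.
theorem frobE_two_pow_mul_ne : frobE 2 N K p' hp'.prime
    (2 ^ (p - 1) * (matE 2 K 0 0 * matE 2 K 1 0) ^ p) ≠
      (2 ^ (p - 1) * (matE 2 K 0 0 * matE 2 K 1 0) ^ p) ^ p' := by
  have h0 : ∀ i j, matE 2 K i j ≠ 0 := by
    intro i j
    rw [matE, Matrix.map_apply, Matrix.mvPolynomialX_apply]
    exact (map_ne_zero_iff _ (IsFractionRing.injective _ _)).mpr (MvPolynomial.X_ne_zero _)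
  have hz := mul_ne_zero (h0 0 0) (h0 1 0)
  have hf := frobE_matE_mul (K := K) hp'
  generalize matE 2 K 0 0 * matE 2 K 1 0 = z at hz hf ⊢
  rw [map_mul, map_pow, map_pow, map_ofNat, hf, mul_pow, ← pow_mul, ← pow_mul,
    ← pow_mul, mul_comm p p']
  intro h
  have h1 := mul_right_cancel₀ (pow_ne_zero _ hz) h
  have h2 : 2 ^ (p - 1) = 2 ^ ((p - 1) * p') := by exact_mod_cast h1
  have h3 := Nat.pow_right_injective le_rfl h2
  have h4 := hp.prime.two_le
  have h5 := hp'.prime.two_le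
  have h6 : (p - 1) * 2 ≤ (p - 1) * p' := Nat.mul_le_mul_left _ h5
  omega

include hp' in
theorem symmetric_upperCurvature11_ne_zero :
    upperCurvature11 p p' (chernCorrespondence M N q p) (canonicalCorrespondence 2 N K p' hp'.prime)
      ≠ 0 := by
  refine upperCurvature11_ne_zero hp.prime.ne_zero hp'.prime.ne_zero ?_
    (symmetric_chernR_mul hM hM0 hq hp) (frobE_matE_mul hp') (frobE_two_pow_mul_ne hp hp')
  rw [(split_isField_and_degree (r := 1) hM hM0 hq hp).2]
  positivity

include hp' in
theorem symmetric_lowerCurvature11_ne_zero (U : Type v) [Field U] [IsAlgClosed U]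
    (hU : Nonempty (FieldE 2 K →+* U)) :
    lowerCurvature11 U p p' (chernCorrespondence M N q p)
      (canonicalCorrespondence 2 N K p' hp'.prime) ≠ 0 :=
  lowerCurvature11_ne_zero hp.prime.ne_zero hp'.prime.ne_zero
    (chernRing_nontrivial q hM hM0 hp.prime hp.not_dvd hp.coprime) (chernL_finite q p hM hM0)
    (symmetric_chernR_mul hM hM0 hq hp) (frobE_matE_mul hp') (frobE_two_pow_mul_ne hp hp') hU

end SymmetricTwo

end ArithChern

theorem theorem5p2 {K : Type u} [Field K] [CharZero K] (M : ℤ) (hM : Even M) (hM0 : M ≠ 0)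
    (N : ℕ) [NeZero N] [IsCyclotomicExtension {N} ℚ K]
    (V : Set ℕ) (hV : ∀ p ∈ V, p.Prime ∧ ¬ (p : ℤ) ∣ M * N) :
    -- Part 1
    (∀ (n : ℕ) (q : Matrix.GeneralLinearGroup (Fin n) (cycRing M N K)),
      (q.valᵀ = q.val ∨ q.valᵀ = -q.val) →
      ∃ δ : AdelicConnection n (cycRing M N K) V,
        IsChernConnection q.val δ ∧
        (∀ δ' : AdelicConnection n (cycRing M N K) V, IsChernConnection q.val δ' → δ' = δ) ∧
        (∀ p : V, (chernModelA M N q p).Algebraizes (p : ℕ) (δ p).frob) ∧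
        IsCorrespondenceStructure δ (fun p : V => chernCorrespondence M N q p)) ∧
    -- Part 2
    (∀ q : Matrix.GeneralLinearGroup (Fin 2) (cycRing M N K), q.val = !![0, 1; -1, 0] →
      (∀ p : V,
        (chernCorrespondence M N q p).IsIrreducible ∧
        (chernCorrespondence M N q p).IsInduced (iota 2 K) ∧
        (chernCorrespondence M N q p).leftDegree = 2 ∧
        (chernCorrespondence M N q p).rightDegree = 2 * (p : ℕ) ^ 4) ∧
      (∀ p p' : V,
        upperCurvature p p' (chernCorrespondence M N q p) (chernCorrespondence M N q p') = 0 ∧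
        upperCurvature11 p p' (chernCorrespondence M N q p)
          (canonicalCorrespondence 2 N K p' (hV p' p'.2).1) ≠ 0 ∧
        (∀ (U : Type v) [Field U] [IsAlgClosed U], Nonempty (FieldE 2 K →+* U) →
          lowerCurvature11 U p p' (chernCorrespondence M N q p)
            (canonicalCorrespondence 2 N K p' (hV p' p'.2).1) ≠ 0) ∧
        (chernCorrespondence M N q p).PartiallyCommute (chernCorrespondence M N q p') ∧
        (p ≠ p' → ¬ (chernCorrespondence M N q p).Commutes (chernCorrespondence M N q p')))) ∧
    -- Part 3
    (∀ (r : ℕ) (q : Matrix.GeneralLinearGroup (Fin (2 * r)) (cycRing M N K)),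
      q.val = splitMatrix r 1 →
      (∀ p : V, (chernCorrespondence M N q p).leftDegree = 2 ^ (2 * r)) ∧
      (r = 1 →
        (∀ p : V,
          (chernCorrespondence M N q p).IsIrreducible ∧
          (chernCorrespondence M N q p).IsPartiallyInduced (iota (2 * r) K) ∧
          ¬ (chernCorrespondence M N q p).IsInduced (iota (2 * r) K)) ∧
        (∀ p p' : V,
          upperCurvature11 p p' (chernCorrespondence M N q p)
            (canonicalCorrespondence (2 * r) N K p' (hV p' p'.2).1) ≠ 0 ∧
          (∀ (U : Type v) [Field U] [IsAlgClosed U], Nonempty (FieldE (2 * r) K →+* U) →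
            lowerCurvature11 U p p' (chernCorrespondence M N q p)
              (canonicalCorrespondence (2 * r) N K p' (hV p' p'.2).1) ≠ 0)))) := by
  refine ⟨fun n q hq => chern_connection_exists q hM hM0 hV hq, ?_, ?_⟩
  · intro q hq
    have good : ∀ p : V, IsGoodPrime M N p := fun p => isGoodPrime_of_not_dvd_mul hM (hV p p.2)
    refine ⟨fun p => ⟨alternating_isField hM hM0 hq (good p), alternating_isInduced hM hM0 hq (good p),
      (alternating_isField_and_degree hM hM0 hq (good p)).2,
      alternating_rightDegree hM hM0 hq (good p)⟩, fun p p' => ⟨?_, ?_, ?_, ?_, ?_⟩⟩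
    · exact alternating_upperCurvature_eq_zero hM hM0 hq (good p) (good p')
    · exact alternating_upperCurvature11_ne_zero hM hM0 hq (good p) (good p')
    · exact fun U _ _ hU => alternating_lowerCurvature11_ne_zero hM hM0 hq (good p) (good p') U hU
    · exact alternating_partiallyCommute hM hM0 hq (good p) (good p')
    · exact fun hne => alternating_not_commutes hM hM0 hq (good p) (good p')
        fun h => hne (Subtype.ext h)
  · intro r q hq
    have good : ∀ p : V, IsGoodPrime M N p := fun p => isGoodPrime_of_not_dvd_mul hM (hV p p.2)
    refine ⟨fun p => (split_isField_and_degree hM hM0 hq (good p)).2, ?_⟩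
    rintro rfl
    exact ⟨fun p => ⟨symmetric_isField hM hM0 hq (good p),
        symmetric_isPartiallyInduced hM hM0 hq (good p), symmetric_not_isInduced hM hM0 hq (good p)⟩,
      fun p p' => ⟨symmetric_upperCurvature11_ne_zero hM hM0 hq (good p) (good p'),
        fun U _ _ hU => symmetric_lowerCurvature11_ne_zero hM hM0 hq (good p) (good p') U hU⟩⟩
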